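/- **Singular grids.** A singular grid $G$ is a rectangular grid, some squares of which carry one decoration $O$ or $X$, such that each row or column (RoC) contains either exactly one $O$ and one $X$ (regular RoC), or exactly two $O$'s and two $X$'s (singular RoC), in which case each of the two middle decorations lies between decorations of different kinds. Let $\mathbb O,\mathbb X$ be the sets of $O$'s and $X$'s, $n=\#\mathbb O$, and $k$ the number of singular RoCs. A singular column is split into two regular columns (its decorations being sent alternately to the left and to the right) in two ways: in the $0$-resolution the line through its two topmost decorations has negative slope if they are of the same kind and positive slope otherwise; the $1$-resolution is the opposite one. Singular rows are split in the same way, with the two rightmost decorations. For $I\in\{0,1\}^k$ let $G_I$ be the resulting regular $n\times n$ grid, and $\#I$ the number of $1$'s in $I$. **Winding arcs and peaks.** Let $\mathcal T$ be the torus obtained by gluing opposite sides of $G$. Winding arcs for a singular RoC are two closed curves $\alpha,\beta$ in $\mathcal T$ running along the RoC inside it, realizing its $0$- and $1$-resolution respectively, each meeting every grid line or winding arc across the RoC exactly once, such that $\alpha$ and $\beta$ meet in exactly four points, off the other lines and arcs; they bound four bigons containing one decoration each. (Up to isotopy, arcs of columns are graphs over the vertical direction and arcs of rows are graphs over the horizontal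 one.) A set of peaks $P$ is the choice, for each singular RoC, of a point of $\alpha\cap\beta$ whose two adjacent bigons contain decorations of different kinds. A compass convention is a map $C:P\to\{\mathrm{North},\mathrm{South},\mathrm{East},\mathrm{West}\}$ with values in $\{\mathrm{North},\mathrm{South}\}$ on singular rows and in $\{\mathrm{East},\mathrm{West}\}$ on singular columns. **The module.** $C^-(G_I)$ is the free $\mathbb Z[U_O]_{O\in\mathbb O}$-module on the one-to-one correspondences $x$ between columns and rows of $G_I$, drawn as $n$ dots at the bottom left corners of the corresponding squares. For finite $A,B\subset\mathbb R^2$ let $\mathcal J(A,B)$ be half the number of pairs $(a,b)\in A\times B$ with $(b_1-a_1)(b_2-a_2)>0$ and $M_B(A)=\mathcal J(A,A)-2\mathcal J(A,B)+\mathcal J(B,B)+1$. The Maslov and Alexander gradings on $C^-(G_I)$ are $M(u x)=M_{\mathbb O}(x)-2\deg u$ and $A(u x)=\tfrac12(M_{\mathbb O}(x)-M_{\mathbb X}(x))-\tfrac{n-\ell}{2}-\deg u$, for a monomial $u$, where $\mathbb O,\mathbb X$ are taken in $G_I$ and $\ell$ is the number of components of the link described by $G_I$. Put $$CV^-(G)=\bigoplus_{I\in\{0,1\}^k}C^-(G_I)[-\#I],$$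 where $[-\#I]$ lowers the Maslov grading by $\#I$ and leaves the Alexander grading unchanged. Its generators are the generators of all $C^-(G_I)$; the dots of a generator of $C^-(G_I)$ are placed on the grid lines and the winding arcs selected by $I$. **Grid polygons.** Let $x,y$ be generators of $CV^-(G)$. A grid polygon $\pi$ connecting $x$ to $y$ is an embedded polygon in $\mathcal T$ with boundary in the grid lines and winding arcs, whose corners are two points of $x$, two points of $y$ and possibly some points of $P$, such that: starting at a corner in $x$ and running positively along $\partial\pi$ one first follows a horizontal arc and then meets alternately points of $y$ and of $x$, with at most one peak between two consecutive ones; $x$ and $y$ coincide off $\partial\pi$; near each corner the interior of $\pi$ meets no grid line or winding arc. Thus $\pi$ is a rectangle with peaks inserted on some of its four sides (north, south, east, west); the side of a peak is its compass type. It is empty if its interior contains no point of $x$. Let $\mathrm{Pol}(x,y,P)$ be the set of empty grid polygons connecting $x$ to $y$. Forgetting the peaks and moving all dots from $\beta$- to $\alpha$-arcs turns $\pi$ into an empty rectangle $\phi(\pi)$ on $G_{0\cdots0}$. **Signs.** Let $\varepsilon$ be a sign assignment on the empty rectangles of $G_{0\cdots 0}$ in the sense of Manolescu, Ozsváth, Szabó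 and Thurston: a $\{\pm1\}$-valued function such that $\varepsilon(r_1)\varepsilon(r_2)=-\varepsilon(r_1')\varepsilon(r_2')$ for any four distinct empty rectangles whose juxtapositions $r_1*r_2=r_1'*r_2'$ coincide (same initial and final generators, same domain), $\varepsilon(r_1)\varepsilon(r_2)=-1$ if $r_1*r_2$ is a vertical annulus, and $\varepsilon(r_1)\varepsilon(r_2)=1$ if $r_1*r_2$ is a horizontal annulus. Put $\varepsilon(\pi)=(-1)^{\mu(\pi,C)}\varepsilon(\phi(\pi))$, where $\mu(\pi,C)$ is the number of peaks $p$ of $\pi$ whose compass type is $C(p)$, and let $\partial^-_G$ be the $\mathbb Z[U_O]$-linear map on $CV^-(G)$ with $$\partial^-_G(x)=\sum_{y}\ \sum_{\pi\in\mathrm{Pol}(x,y,P)}\varepsilon(\pi)\Big(\prod_{O\in\mathbb O\cap\pi}U_O\Big)\,y .$$ **Proposition.** For every singular grid $G$ with winding arcs, every set of peaks $P$, every compass convention $C$ and every sign assignment $\varepsilon$: 1. $CV^-(G)$ is the direct sum of its parts of Maslov degree $m$ and Alexander degree $a$, $(m,a)\in\mathbb Z^2$, and each $U_O$ sends the part of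 bidegree $(m,a)$ to the part of bidegree $(m-2,a-1)$; that is, $CV^-(G)$ is a bigraded $\mathbb Z[U_O]$-module; 2. $\partial^-_G\circ\partial^-_G=0$; 3. $\partial^-_G$ lowers the Maslov grading by one; 4. $\partial^-_G$ respects the Alexander filtration: for every $a\in\mathbb Z$ it maps the span of the parts of Alexander degree at most $a$ into itself. So $(CV^-(G),\partial^-_G)$ is a filtered chain complex. -/

import Mathlib

open scoped BigOperators DirectSum

noncomputable section

/-- The two kinds of decorations of a grid. -/
inductive Mark
  | O
  | X
  deriving DecidableEq

/-- Directions, used for the sides of grid polygons and the compass types of peaks. -/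
inductive Compass
  | north
  | south
  | east
  | west
  deriving DecidableEq

instance : Fintype Compass :=
  ⟨{.north, .south, .east, .west}, by intro d; cases d <;> simp⟩

/-! ### A single row or column

A row or column (RoC) is read as a sequence `f : Fin m → Option Mark`, from bottom to top for a
column and from left to right for a row. "First" means left for a column and below for a row:
rows are treated as mirror images of columns in the diagonal. -/

namespace RoC

/-- The number of decorations of kind `k`. -/
def count {m : ℕ} (f : Fin m → Option Mark) (k : Mark) : ℕ :=
  (Finset.univ.filter (fun p => f p = some k)).card

/-- Singular RoCs contain four decorations. -/
def IsSingular {m : ℕ} (f : Fin m → Option Mark) : Prop :=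
  (Finset.univ.filter (fun p => f p ≠ none)).card = 4

/-- A RoC contains exactly one or exactly two decorations of each kind; in the second case each of
the two middle decorations lies between decorations of different kinds. -/
def IsAdmissible {m : ℕ} (f : Fin m → Option Mark) : Prop :=
  (count f .O = 1 ∧ count f .X = 1) ∨
  (count f .O = 2 ∧ count f .X = 2 ∧
    ∀ a b c d : Fin m, a < b → b < c → c < d →
      f a ≠ none → f b ≠ none → f c ≠ none → f d ≠ none → f a ≠ f c ∧ f b ≠ f d)

/-- The number of decorations above (or to the right of) position `p`. -/
def rankFromTop {m : ℕ} (f : Fin m → Option Mark) (p : Fin m) : ℕ :=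
  (Finset.univ.filter (fun q => p < q ∧ f q ≠ none)).card

/-- The two topmost (rightmost) decorations are of the same kind. -/
def TopTwoAlike {m : ℕ} (f : Fin m → Option Mark) : Prop :=
  ∃ p q : Fin m, f p ≠ none ∧ f q ≠ none ∧ rankFromTop f p = 0 ∧ rankFromTop f q = 1 ∧ f p = f q

/-- Splitting a singular RoC in two so that the connections of the link survive separates the
decorations of even rank from those of odd rank. `OnFirstSide f b p` says that the decoration at
`p` goes to the left (lower) half in the `b`-resolution: in the `0`-resolution the line through the
two topmost (rightmost) decorations has negative slope if they are of the same kind, and positive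
slope otherwise; in the `1`-resolution it is the other way round. -/
def OnFirstSide {m : ℕ} (f : Fin m → Option Mark) (b : Fin 2) (p : Fin m) : Prop :=
  Even (rankFromTop f p) ↔ (TopTwoAlike f ↔ b = 0)

/-- Winding arcs for a singular column whose squares occupy the strip `base < s < base + 1`
(for a row: exchange the coordinates). `arc 0` is the arc `α` of the `0`-resolution, `arc 1` the arc
`β` of the `1`-resolution; `arc b t` is the abscissa at height `t`, so that the arc meets each grid
line across the strip once. Decorations sit at the centres of their squares. As each arc has to
leave each decoration on the prescribed side, and `α` and `β` meet only four times, each of the four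
bigons between `α` and `β` contains exactly one decoration. -/
structure IsWindingPair {m : ℕ} (f : Fin m → Option Mark) (base : ℝ)
    (arc : Fin 2 → ℝ → ℝ) : Prop where
  continuous : ∀ b, Continuous (arc b)
  periodic : ∀ b, Function.Periodic (arc b) (m : ℝ)
  mem_strip : ∀ b t, base < arc b t ∧ arc b t < base + 1
  first_side : ∀ b p, f p ≠ none → OnFirstSide f b p →
    base + 1 / 2 < arc b ((p : ℝ) + 1 / 2)
  second_side : ∀ b p, f p ≠ none → ¬ OnFirstSide f b p →
    arc b ((p : ℝ) + 1 / 2) < base + 1 / 2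
  four_crossings : {t : ℝ | 0 ≤ t ∧ t < m ∧ arc 0 t = arc 1 t}.ncard = 4
  crossings_off_lines : ∀ k : ℤ, arc 0 k ≠ arc 1 k

/-- `t` is the height (abscissa, for a row) of a crossing of `α` and `β` which separates two bigons
containing decorations of different kinds: an `O` over an `X` or an `X` over an `O`. -/
def IsPeak {m : ℕ} (f : Fin m → Option Mark) (arc : Fin 2 → ℝ → ℝ) (t : ℝ) : Prop :=
  0 ≤ t ∧ t < m ∧ arc 0 t = arc 1 t ∧
  ∃ (p q : Fin m) (k l : ℤ), f p ≠ none ∧ f q ≠ none ∧ f p ≠ f q ∧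
    (p : ℝ) + 1 / 2 + k * m < t ∧ t < (q : ℝ) + 1 / 2 + l * m ∧
    ∀ u : ℝ, (p : ℝ) + 1 / 2 + k * m ≤ u → u ≤ (q : ℝ) + 1 / 2 + l * m →
      arc 0 u = arc 1 u → u = t

end RoC

/-- Singular grid diagrams. Column `c` is the strip `c < s < c + 1` and row `r` the strip
`r < t < r + 1`; the torus is obtained from the plane by dividing by the translations by `cols` and
`rows`. -/
structure SingularGrid where
  cols : ℕ
  rows : ℕ
  deco : Fin cols → Fin rows → Option Mark
  col_admissible : ∀ c, RoC.IsAdmissible (deco c)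
  row_admissible : ∀ r, RoC.IsAdmissible (fun c => deco c r)

namespace SingularGrid

abbrev SingCol (G : SingularGrid) : Type := {c : Fin G.cols // RoC.IsSingular (G.deco c)}

abbrev SingRow (G : SingularGrid) : Type :=
  {r : Fin G.rows // RoC.IsSingular (fun c => G.deco c r)}

/-- The singular RoCs. -/
abbrev SingRoC (G : SingularGrid) : Type := G.SingCol ⊕ G.SingRow

instance (G : SingularGrid) : Fintype G.SingCol := Fintype.ofFinite _

instance (G : SingularGrid) : Fintype G.SingRow := Fintype.ofFinite _

/-- The squares carrying a decoration of kind `k`. -/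
abbrev Decor (G : SingularGrid) (k : Mark) : Type :=
  {q : Fin G.cols × Fin G.rows // G.deco q.1 q.2 = some k}

/-- The size of the grid, the number of its `O`s. -/
def size (G : SingularGrid) : ℕ := Fintype.card (G.Decor .O)

/-- A choice of a `0`- or `1`-resolution for each singular RoC. -/
abbrev Resolution (G : SingularGrid) : Type := G.SingRoC → Fin 2

/-- The number of `1`s in a resolution. -/
def numOnes (G : SingularGrid) (I : G.Resolution) : ℕ :=
  (Finset.univ.filter (fun e => I e = 1)).card

/-- The vertical lines of any resolution of `G`: the line `s = c` at the left of column `c`, and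
the winding arc of each singular column. Each line is identified with the column of the
resolved grid which has it as its left border. -/
abbrev VLine (G : SingularGrid) : Type := Fin G.cols ⊕ G.SingCol

/-- The horizontal lines of any resolution of `G`, identified with the rows of the resolved grid
above them. -/
abbrev HLine (G : SingularGrid) : Type := Fin G.rows ⊕ G.SingRow

/-- Number of the column of `G` to which a vertical line belongs. -/
def VLine.idx {G : SingularGrid} : G.VLine → ℕ
  | .inl c => c
  | .inr j => j.1

def HLine.idx {G : SingularGrid} : G.HLine → ℕ
  | .inl r => r
  | .inr i => i.1

/-- Position in the left-to-right order of the vertical lines. -/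
def VLine.key {G : SingularGrid} : G.VLine → ℕ
  | .inl c => 2 * c
  | .inr j => 2 * j.1 + 1

/-- Position in the bottom-to-top order of the horizontal lines. -/
def HLine.key {G : SingularGrid} : G.HLine → ℕ
  | .inl r => 2 * r
  | .inr i => 2 * i.1 + 1

/-- The singular RoC whose winding arcs a line belongs to, if any. -/
def VLine.roc {G : SingularGrid} : G.VLine → Option G.SingRoC
  | .inl _ => none
  | .inr j => some (.inl j)

def HLine.roc {G : SingularGrid} : G.HLine → Option G.SingRoC
  | .inl _ => none
  | .inr i => some (.inr i)

/-- The one-to-one correspondences between the columns and the rows of a resolved grid. -/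
abbrev Perm (G : SingularGrid) : Type := G.VLine ≃ G.HLine

/-! ### Gradings of the regular grids `G_I` -/

open Classical in
/-- The column of the resolved grid `G_I` containing the decoration of the square `q`. -/
def resolvedCol (G : SingularGrid) (I : G.Resolution) (q : Fin G.cols × Fin G.rows) : G.VLine :=
  if h : RoC.IsSingular (G.deco q.1) then
    if RoC.OnFirstSide (G.deco q.1) (I (.inl ⟨q.1, h⟩)) q.2 then .inl q.1 else .inr ⟨q.1, h⟩
  else .inl q.1

open Classical in
/-- The row of the resolved grid `G_I` containing the decoration of the square `q`. -/
def resolvedRow (G : SingularGrid) (I : G.Resolution) (q : Fin G.cols × Fin G.rows) : G.HLine :=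
  if h : RoC.IsSingular (fun c => G.deco c q.2) then
    if RoC.OnFirstSide (fun c => G.deco c q.2) (I (.inr ⟨q.2, h⟩)) q.1 then .inl q.2
    else .inr ⟨q.2, h⟩
  else .inl q.2

/-- The decorations of kind `k` of the grid `G_I`, drawn at the centres of their squares
(only relative positions matter). -/
def decorPoints (G : SingularGrid) (I : G.Resolution) (k : Mark) : Finset (ℚ × ℚ) :=
  Finset.univ.image (fun q : G.Decor k =>
    (((G.resolvedCol I q.1).key : ℚ) + 1 / 2, ((G.resolvedRow I q.1).key : ℚ) + 1 / 2))

/-- The dots of a generator, at the bottom left corners of the squares common to associated columns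
and rows. -/
def dotPoints (G : SingularGrid) (x : G.Perm) : Finset (ℚ × ℚ) :=
  Finset.univ.image (fun v : G.VLine => ((v.key : ℚ), ((x v).key : ℚ)))

/-- Half the number of pairs in `A × B` in south-west/north-east position. -/
def pairing (A B : Finset (ℚ × ℚ)) : ℚ :=
  (((A ×ˢ B).filter (fun p => 0 < (p.2.1 - p.1.1) * (p.2.2 - p.1.2))).card : ℚ) / 2

/-- `M_B(A) = J(A,A) - 2 J(A,B) + J(B,B) + 1`. -/
def relMaslov (A B : Finset (ℚ × ℚ)) : ℚ :=
  pairing A A - 2 * pairing A B + pairing B B + 1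

/-- The Maslov grading of a generator in `C⁻(G_I)`. -/
def gridMaslov (G : SingularGrid) (I : G.Resolution) (x : G.Perm) : ℚ :=
  relMaslov (G.dotPoints x) (G.decorPoints I .O)

/-- The number of components of the link described by `G_I`: decorations of `G_I` in the same
column or the same row are joined by a strand. -/
def numComponents (G : SingularGrid) (I : G.Resolution) : ℕ :=
  Nat.card (Quot (fun q q' : {q : Fin G.cols × Fin G.rows // G.deco q.1 q.2 ≠ none} =>
    G.resolvedCol I q.1 = G.resolvedCol I q'.1 ∨ G.resolvedRow I q.1 = G.resolvedRow I q'.1))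

/-- The Alexander grading of a generator in `C⁻(G_I)`. -/
def gridAlexander (G : SingularGrid) (I : G.Resolution) (x : G.Perm) : ℚ :=
  (relMaslov (G.dotPoints x) (G.decorPoints I .O) - relMaslov (G.dotPoints x) (G.decorPoints I .X))
    / 2 - ((G.size : ℚ) - G.numComponents I) / 2

/-! ### The module `CV⁻(G)` -/

/-- The ring `ℤ[U_O]`, with one variable for each `O`. -/
abbrev Coeff (G : SingularGrid) : Type := MvPolynomial (G.Decor .O) ℤ

/-- `C⁻(G_I)`, the free module on the generators of `G_I`. -/
abbrev CMinus (G : SingularGrid) (_I : G.Resolution) : Type := G.Perm →₀ G.Coeff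

/-- `CV⁻(G)`, the direct sum of the modules `C⁻(G_I)` over all resolutions. -/
abbrev CV (G : SingularGrid) : Type := ⨁ I : G.Resolution, G.CMinus I

/-- The generators of `CV⁻(G)`. -/
abbrev Gen (G : SingularGrid) : Type := G.Resolution × G.Perm

/-- A generator as an element of `CV⁻(G)`. -/
def gen (G : SingularGrid) (x : G.Gen) : G.CV :=
  DirectSum.lof G.Coeff G.Resolution G.CMinus x.1 (Finsupp.single x.2 1)

/-- Maslov grading in `CV⁻(G)`: the summand of `I` is `C⁻(G_I)[-#I]`. -/
def maslov (G : SingularGrid) (x : G.Gen) : ℚ := G.gridMaslov x.1 x.2 - G.numOnes x.1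

def alexander (G : SingularGrid) (x : G.Gen) : ℚ := G.gridAlexander x.1 x.2

/-- The part of `CV⁻(G)` of Maslov degree `d.1` and Alexander degree `d.2`, spanned by products of
monomials and generators; a monomial of total degree `N` has bidegree `(-2N, -N)`. -/
def bigradedPart (G : SingularGrid) (d : ℤ × ℤ) : Submodule ℤ G.CV :=
  Submodule.span ℤ {z | ∃ (x : G.Gen) (e : G.Decor .O →₀ ℕ),
    z = (MvPolynomial.monomial e (1 : ℤ) : G.Coeff) • G.gen x ∧
    G.maslov x - 2 * (e.degree : ℚ) = d.1 ∧ G.alexander x - (e.degree : ℚ) = d.2}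

/-- The part of Maslov degree `m`. -/
def maslovPart (G : SingularGrid) (m : ℤ) : Submodule ℤ G.CV :=
  ⨆ a : ℤ, G.bigradedPart (m, a)

/-- The Alexander filtration: the span of the parts of Alexander degree at most `a`. -/
def alexanderFiltration (G : SingularGrid) (a : ℤ) : Submodule ℤ G.CV :=
  ⨆ (m : ℤ) (a' : ℤ) (_ : a' ≤ a), G.bigradedPart (m, a')

/-! ### Rectangles on the regular grid `G_{0⋯0}` and sign assignments -/

/-- `b` lies strictly between `a` and `c` in the cyclic order. -/
def CycBetween (a b c : ℕ) : Prop := (a < b ∧ b < c) ∨ (b < c ∧ c < a) ∨ (c < a ∧ a < b)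

/-- A rectangle of the torus, on the straightened regular grid `G_{0⋯0}`, connecting `start` to
`finish`: it lies between the vertical lines `west` and `east`, its south-west and north-east
corners are dots of `start`, and its other two corners are dots of `finish`. -/
@[ext] structure Rect (G : SingularGrid) where
  start : G.Perm
  west : G.VLine
  east : G.VLine

def Rect.finish {G : SingularGrid} (ρ : G.Rect) : G.Perm :=
  (Equiv.swap ρ.west ρ.east).trans ρ.start

/-- The rectangle is nondegenerate and has no dot of `start` in its interior. -/
def Rect.IsEmpty {G : SingularGrid} (ρ : G.Rect) : Prop :=
  ρ.west ≠ ρ.east ∧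
  ∀ v : G.VLine, CycBetween ρ.west.key v.key ρ.east.key →
    ¬ CycBetween (ρ.start ρ.west).key (ρ.start v).key (ρ.start ρ.east).key

open Classical in
/-- The multiplicity of a rectangle at the square of `G_{0⋯0}` in the column to the right of the
line `v` and the row above the line `h`. -/
def Rect.mult {G : SingularGrid} (ρ : G.Rect) (v : G.VLine) (h : G.HLine) : ℕ :=
  if (v = ρ.west ∨ CycBetween ρ.west.key v.key ρ.east.key) ∧
     (h = ρ.start ρ.west ∨ CycBetween (ρ.start ρ.west).key h.key (ρ.start ρ.east).key)
  then 1 else 0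

/-- Sign assignments for the empty rectangles of `G_{0⋯0}` in the sense of Manolescu, Ozsváth,
Szabó and Thurston. Only the values on empty rectangles matter. -/
structure SignAssignment (G : SingularGrid) where
  sign : G.Rect → ℤˣ
  /-- Two different decompositions of the same domain have opposite signs. -/
  square : ∀ ρ₁ ρ₂ ρ₁' ρ₂' : G.Rect, ρ₁.IsEmpty → ρ₂.IsEmpty → ρ₁'.IsEmpty → ρ₂'.IsEmpty →
    ρ₁.finish = ρ₂.start → ρ₁'.finish = ρ₂'.start →
    ρ₁.start = ρ₁'.start → ρ₂.finish = ρ₂'.finish →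
    (∀ v h, ρ₁.mult v h + ρ₂.mult v h = ρ₁'.mult v h + ρ₂'.mult v h) →
    [ρ₁, ρ₂, ρ₁', ρ₂'].Nodup →
    sign ρ₁ * sign ρ₂ = - (sign ρ₁' * sign ρ₂')
  /-- Juxtapositions forming a vertical annulus. -/
  vertical : ∀ ρ₁ ρ₂ : G.Rect, ρ₁.IsEmpty → ρ₂.IsEmpty → ρ₁.finish = ρ₂.start →
    ρ₂.west = ρ₁.west → ρ₂.east = ρ₁.east → sign ρ₁ * sign ρ₂ = -1
  /-- Juxtapositions forming a horizontal annulus. -/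
  horizontal : ∀ ρ₁ ρ₂ : G.Rect, ρ₁.IsEmpty → ρ₂.IsEmpty → ρ₁.finish = ρ₂.start →
    ρ₂.west = ρ₁.east → ρ₂.east = ρ₁.west → sign ρ₁ * sign ρ₂ = 1

/-! ### Winding arcs, peaks, compass conventions -/

/-- A set of winding arcs for each singular RoC of `G`, such that an arc of a singular column and an
arc of a singular row meet once and no crossing of two arcs of the same RoC lies on a
third arc. The points of `colArc j b` are `(colArc j b t, t)`, those of `rowArc i b` are
`(s, rowArc i b s)`. -/
structure WindingArcs (G : SingularGrid) where
  colArc : G.SingCol → Fin 2 → ℝ → ℝ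
  rowArc : G.SingRow → Fin 2 → ℝ → ℝ
  col_winding : ∀ j, RoC.IsWindingPair (G.deco j.1) ((j.1 : ℕ) : ℝ) (colArc j)
  row_winding : ∀ i, RoC.IsWindingPair (fun c => G.deco c i.1) ((i.1 : ℕ) : ℝ) (rowArc i)
  meet_once : ∀ j i b b', ∃! z : ℝ × ℝ, z.1 = colArc j b z.2 ∧ z.2 = rowArc i b' z.1
  col_crossing_off : ∀ j i b t, colArc j 0 t = colArc j 1 t → rowArc i b (colArc j 0 t) ≠ t
  row_crossing_off : ∀ i j b s, rowArc i 0 s = rowArc i 1 s → colArc j b (rowArc i 0 s) ≠ s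

/-- A set of peaks: for each singular column (row) the height (abscissa) of the chosen point of
`α ∩ β`. -/
structure Peaks {G : SingularGrid} (A : G.WindingArcs) where
  colPeak : G.SingCol → ℝ
  rowPeak : G.SingRow → ℝ
  col_isPeak : ∀ j, RoC.IsPeak (G.deco j.1) (A.colArc j) (colPeak j)
  row_isPeak : ∀ i, RoC.IsPeak (fun c => G.deco c i.1) (A.rowArc i) (rowPeak i)

/-- A compass convention; peaks are indexed by the singular RoCs. -/
structure CompassConvention (G : SingularGrid) where
  dir : G.SingRoC → Compass
  col_dir : ∀ j : G.SingCol, dir (.inl j) = .east ∨ dir (.inl j) = .west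
  row_dir : ∀ i : G.SingRow, dir (.inr i) = .north ∨ dir (.inr i) = .south

/-- The vertical line `v` of the resolution `I`, as abscissa in terms of the height. -/
def WindingArcs.vcurve {G : SingularGrid} (A : G.WindingArcs) (I : G.Resolution) :
    G.VLine → ℝ → ℝ
  | .inl c => fun _ => ((c : ℕ) : ℝ)
  | .inr j => A.colArc j (I (.inl j))

/-- The horizontal line `h` of the resolution `I`, as height in terms of the abscissa. -/
def WindingArcs.hcurve {G : SingularGrid} (A : G.WindingArcs) (I : G.Resolution) :
    G.HLine → ℝ → ℝ
  | .inl r => fun _ => ((r : ℕ) : ℝ)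
  | .inr i => A.rowArc i (I (.inr i))

/-- The dots of a generator, drawn on `G` with its winding arcs and lifted to the plane. -/
def WindingArcs.dots {G : SingularGrid} (A : G.WindingArcs) (x : G.Gen) : Set (ℝ × ℝ) :=
  {z | ∃ (v : G.VLine) (k l : ℤ),
    z.1 = A.vcurve x.1 v z.2 + k * G.cols ∧ z.2 = A.hcurve x.1 (x.2 v) z.1 + l * G.rows}

/-- Height of the peak on an arc (irrelevant for a straight line). -/
def Peaks.onV {G : SingularGrid} {A : G.WindingArcs} (P : Peaks A) : G.VLine → ℝ
  | .inl _ => 0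
  | .inr j => P.colPeak j

/-- Abscissa of the peak on an arc (irrelevant for a straight line). -/
def Peaks.onH {G : SingularGrid} {A : G.WindingArcs} (P : Peaks A) : G.HLine → ℝ
  | .inl _ => 0
  | .inr i => P.rowPeak i

/-! ### Grid polygons -/

/-- The combinatorial data of a grid polygon connecting `start` to `finish`. Going around the
polygon positively, one follows its south side from a dot of `start` (south-west corner) to a dot of
`finish` (south-east corner), then its east side to a dot of `start` (north-east corner), its
north side to a dot of `finish` (north-west corner) and its west side back. A side is a
piece of a grid line, or it runs along the two arcs of a singular RoC and turns from one to
the other at the peak of this RoC. -/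
structure Quad (G : SingularGrid) where
  start : G.Gen
  finish : G.Gen
  west : G.VLine
  east : G.VLine

namespace Quad

variable {G : SingularGrid} {A : G.WindingArcs}

/-- The horizontal line through the south-west corner. -/
def south (π : G.Quad) : G.HLine := π.start.2 π.west

/-- The horizontal line through the north-east corner. -/
def north (π : G.Quad) : G.HLine := π.start.2 π.east

/-- The representative of `p` modulo `period` in `[base, base + period)`,
for `0 ≤ p < period` and `0 ≤ base < period`. -/
def lift (base period p : ℝ) : ℝ := if p < base then p + period else p

/-- We lift the polygon to the plane so that its west and south sides start on the lines `west` and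
`south` of the fundamental domain. These are the heights of the possible peaks on its west and
east sides, and the abscissas of the possible peaks on its south and north sides. -/
def bend (P : Peaks A) (π : G.Quad) : Compass → ℝ
  | .west => lift π.south.idx G.rows (P.onV π.west)
  | .east => lift π.south.idx G.rows (P.onV π.east)
  | .south => lift π.west.idx G.cols (P.onH π.south)
  | .north => lift π.west.idx G.cols (P.onH π.north)

/-- The curve carrying the west side: coming from the corner in `finish` it goes down to the peak
along a line of the resolution of `finish`, and then along a line of the resolution of `start`
(the two lines agree if there is no peak). -/
def westSide (P : Peaks A) (π : G.Quad) (t : ℝ) : ℝ :=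
  if t ≤ π.bend P .west then A.vcurve π.start.1 π.west t else A.vcurve π.finish.1 π.west t

def eastSide (P : Peaks A) (π : G.Quad) (t : ℝ) : ℝ :=
  (if π.west.key < π.east.key then 0 else (G.cols : ℝ)) +
  if t ≤ π.bend P .east then A.vcurve π.finish.1 π.east t else A.vcurve π.start.1 π.east t

def southSide (P : Peaks A) (π : G.Quad) (s : ℝ) : ℝ :=
  if s ≤ π.bend P .south then A.hcurve π.start.1 π.south s else A.hcurve π.finish.1 π.south s

def northSide (P : Peaks A) (π : G.Quad) (s : ℝ) : ℝ :=
  (if π.south.key < π.north.key then 0 else (G.rows : ℝ)) +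
  if s ≤ π.bend P .north then A.hcurve π.finish.1 π.north s else A.hcurve π.start.1 π.north s

/-- The interior of the polygon, lifted to the plane. -/
def interior (P : Peaks A) (π : G.Quad) : Set (ℝ × ℝ) :=
  {z | π.westSide P z.2 < z.1 ∧ z.1 < π.eastSide P z.2 ∧
    π.southSide P z.1 < z.2 ∧ z.2 < π.northSide P z.1}

/-- The singular RoC along whose arcs a side runs, if any. -/
def sideRoC (π : G.Quad) : Compass → Option G.SingRoC
  | .west => π.west.roc
  | .east => π.east.roc
  | .south => π.south.roc
  | .north => π.north.roc

open Classical in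
/-- The sides of the polygon with a peak, that is, the compass types of its peaks. -/
def peakSides (π : G.Quad) : Finset Compass :=
  Finset.univ.filter (fun d => ∃ e, π.sideRoC d = some e ∧ π.start.1 e ≠ π.finish.1 e)

/-- The peak on a vertical side lies strictly between the south and north sides, the peak on a
horizontal side strictly between the west and east sides. -/
def PeakOnSide (P : Peaks A) (π : G.Quad) : Compass → Prop
  | .west => π.southSide P (π.westSide P (π.bend P .west)) < π.bend P .west ∧
      π.bend P .west < π.northSide P (π.westSide P (π.bend P .west))
  | .east => π.southSide P (π.eastSide P (π.bend P .east)) < π.bend P .east ∧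
      π.bend P .east < π.northSide P (π.eastSide P (π.bend P .east))
  | .south => π.westSide P (π.southSide P (π.bend P .south)) < π.bend P .south ∧
      π.bend P .south < π.eastSide P (π.southSide P (π.bend P .south))
  | .north => π.westSide P (π.northSide P (π.bend P .north)) < π.bend P .north ∧
      π.bend P .north < π.eastSide P (π.northSide P (π.bend P .north))

/-- `π` is a grid polygon connecting `start` to `finish`. A peak at a point of `P` is a convex corner
precisely if the polygon passes there between `α`, carrying the dot of `start`, and `β`,
carrying the dot of `finish`; away from the sides of `π` the sets of dots coincide. -/
structure IsPolygon (P : Peaks A) (π : G.Quad) : Prop where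
  west_ne_east : π.west ≠ π.east
  finish_eq : π.finish.2 = (Equiv.swap π.west π.east).trans π.start.2
  resolutions : ∀ e : G.SingRoC, π.start.1 e ≠ π.finish.1 e →
    π.start.1 e = 0 ∧ π.finish.1 e = 1 ∧ ∃ d, π.sideRoC d = some e
  peaks : ∀ d ∈ π.peakSides, π.PeakOnSide P d

/-- No dot of `start` lies in the interior. -/
def IsEmpty (P : Peaks A) (π : G.Quad) : Prop :=
  ∀ z ∈ π.interior P, z ∉ A.dots π.start

/-- The polygon contains the decoration at the centre of the square `q`. -/
def Contains (P : Peaks A) (π : G.Quad) (q : Fin G.cols × Fin G.rows) : Prop :=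
  ∃ k l : ℤ, (((q.1 : ℕ) : ℝ) + 1 / 2 + k * G.cols, ((q.2 : ℕ) : ℝ) + 1 / 2 + l * G.rows)
    ∈ π.interior P

open Classical in
/-- The product of the variables of the `O`s contained in the polygon. -/
def weight (P : Peaks A) (π : G.Quad) : G.Coeff :=
  ∏ o : G.Decor .O, if π.Contains P o.1 then MvPolynomial.X o else 1

/-- The empty rectangle of `G_{0⋯0}` obtained by embanking the peaks and moving dots from `β`- to
`α`-arcs. -/
def toRect (π : G.Quad) : G.Rect := ⟨π.start.2, π.west, π.east⟩

open Classical in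
/-- The number of peaks whose compass type is the one prescribed by the convention. -/
def numConventional (C : G.CompassConvention) (π : G.Quad) : ℕ :=
  (π.peakSides.filter (fun d => ∃ e, π.sideRoC d = some e ∧ C.dir e = d)).card

def sign (C : G.CompassConvention) (ε : G.SignAssignment) (π : G.Quad) : ℤˣ :=
  (-1) ^ π.numConventional C * ε.sign π.toRect

end Quad

/-! ### The differential -/

open Classical in
/-- The empty grid polygons connecting `x` to `y`. -/
def polygons {G : SingularGrid} {A : G.WindingArcs} (P : Peaks A) (x y : G.Gen) :
    Finset (G.VLine × G.VLine) :=
  Finset.univ.filter (fun p =>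
    Quad.IsPolygon P ⟨x, y, p.1, p.2⟩ ∧ Quad.IsEmpty P ⟨x, y, p.1, p.2⟩)

/-- The differential of a generator. -/
def differentialGen {G : SingularGrid} {A : G.WindingArcs} (P : Peaks A)
    (C : G.CompassConvention) (ε : G.SignAssignment) (x : G.Gen) : G.CV :=
  ∑ y : G.Gen, ∑ p ∈ polygons P x y,
    ((((Quad.sign C ε ⟨x, y, p.1, p.2⟩ : ℤˣ) : ℤ) : G.Coeff) *
      Quad.weight P ⟨x, y, p.1, p.2⟩) • G.gen y

/-- The differential of `CV⁻(G)`. -/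
def differential {G : SingularGrid} {A : G.WindingArcs} (P : Peaks A)
    (C : G.CompassConvention) (ε : G.SignAssignment) : G.CV →ₗ[G.Coeff] G.CV :=
  DirectSum.toModule G.Coeff G.Resolution G.CV (fun I =>
    Finsupp.linearCombination G.Coeff (fun x : G.Perm => differentialGen P C ε (I, x)))

end SingularGrid

end

/-!
The complex `CV⁻(G)` is, up to a change of basis, the tensor product of the complex of the regular
grid `G_{0⋯0}` with a family of triangular `2 × 2` matrices, and this explains why its differential
squares to zero.

*Polygons.* The topology of winding arcs enters through finitely many bits: on which side of a peak
or of a decoration a line passes. A polygon from `x` to `y` is encoded by its straightened rectangle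
and by the signed number `Quad.turn` of times its sides on each singular RoC pass the peak of that
RoC: the polygon exists and is empty if and only if the rectangle is empty and every RoC whose
resolution changes does so from `0` to `1` with non-zero turn (`Quad.isPolygon_and_isEmpty_iff`).
That no further condition links the RoCs is due to the fact that two arcs crossing once cannot each
separate the other one from its peak.

*Weights.* The multiplicity of a polygon at a decoration is a difference of values of a potential at
`x` and `y`, plus a term depending on the rectangle alone, plus, for each singular RoC, a function of
its resolutions at `x` and `y` and of its turn (`Quad.IsPolygon.ind_contains_eq`). Hence, over the
field of fractions of `ℤ[U_O]`, the coefficient of a polygon is the one of its rectangle, conjugated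
by the potential, times a product of matrix entries `transfer c H n`, one for each singular RoC, where
`n` is the turn, `c` the sign given by the compass convention and `H` the quotient of the variables of
the two `O`s of the RoC (`Quad.algebraMap_coefficient`).

*Square of the differential.* The matrices form a one-parameter group,
`transfer c H m * transfer c H n = transfer c H (m + n)`. The sum over the resolutions of an
intermediate generator is therefore a product whose exponents depend on the domain of the
composite only (`sum_coefficient_mul_coefficient`; the turns may depend on the intermediate
resolution, but only in a triangular fashion). So pairs of rectangles with the same domain cancel as
on a regular grid, and what remains are the thin annuli (`sum_juxtaposition`). The vertical
ones contribute `∑ U_O` when the resolutions at both ends agree, and cancel in pairs at the two sides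
of a singular column otherwise; the horizontal ones contribute the same with the opposite sign
(`sum_coefficient_eq_zero`).

*Gradings.* With `O` or `X` as the kind of decorations, the Maslov grading of a generator is the
difference of numbers of ascents and values of the potential. Changing a resolution from `0` to `1`
exchanges two columns or rows of the decorations, which changes the number of ascents by an odd number
fixed by the peak, and the formula for the multiplicities gives the change of the grading along a
polygon (`Quad.IsPolygon.markMaslov_eq`). The Alexander grading is an integer because `n - ℓ` has the
parity of the permutation of the columns along the link, whose cycles are the components
(`sign_decoPerm`).
-/


noncomputable section

/-! ### Singular rows and columns -/

namespace RoC

variable {m : ℕ} {f : Fin m → Option Mark}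

theorem onFirstSide_one_iff (p : Fin m) : OnFirstSide f 1 p ↔ ¬ OnFirstSide f 0 p := by
  unfold OnFirstSide
  simp only [Fin.isValue, one_ne_zero, iff_false, iff_true]
  tauto

/-- The four positions of the decorations of a singular RoC, in increasing order. -/
structure Positions (f : Fin m → Option Mark) (a : Fin 4 → Fin m) : Prop where
  strictMono : StrictMono a
  ne_none_iff : ∀ p, f p ≠ none ↔ ∃ i, p = a i
  rank : ∀ i, rankFromTop f (a i) = 3 - i
  ne_zero_two : f (a 0) ≠ f (a 2)
  ne_one_three : f (a 1) ≠ f (a 3)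

theorem exists_positions (hs : IsSingular f) (ha : IsAdmissible f) : ∃ a, Positions f a := by
  classical
  have hs' : (Finset.univ.filter (fun p => f p ≠ none)).card = 4 := hs
  set s := Finset.univ.filter (fun p => f p ≠ none) with hsdef
  let a := s.orderEmbOfFin hs'
  have hmono : StrictMono a := a.strictMono
  have hmem : ∀ p, f p ≠ none ↔ ∃ i, p = a i := by
    intro p
    have h1 : p ∈ Set.range a ↔ p ∈ s := by
      rw [Finset.range_orderEmbOfFin]; simp
    have h2 : p ∈ s ↔ f p ≠ none := by simp [hsdef]
    rw [← h2, ← h1]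
    constructor
    · rintro ⟨i, rfl⟩; exact ⟨i, rfl⟩
    · rintro ⟨i, rfl⟩; exact ⟨i, rfl⟩
  have hdec : ∀ i, f (a i) ≠ none := fun i => (hmem _).2 ⟨i, rfl⟩
  have hcond : f (a 0) ≠ f (a 2) ∧ f (a 1) ≠ f (a 3) := by
    rcases ha with ⟨h1, h2⟩ | ⟨-, -, h⟩
    · exfalso
      have : s = (Finset.univ.filter (fun p => f p = some .O)) ∪
          (Finset.univ.filter (fun p => f p = some .X)) := by
        ext p
        simp only [hsdef, Finset.mem_filter, Finset.mem_univ, true_and, Finset.mem_union]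
        rcases f p with _ | (_ | _) <;> simp
      have hc := Finset.card_union_le (Finset.univ.filter (fun p => f p = some Mark.O))
        (Finset.univ.filter (fun p => f p = some Mark.X))
      rw [← this, hs'] at hc
      unfold count at h1 h2
      omega
    · exact h (a 0) (a 1) (a 2) (a 3) (hmono (by decide)) (hmono (by decide))
        (hmono (by decide)) (hdec 0) (hdec 1) (hdec 2) (hdec 3)
  refine ⟨a, hmono, hmem, ?_, hcond.1, hcond.2⟩
  intro i
  have : Finset.univ.filter (fun q => a i < q ∧ f q ≠ none) =
      (Finset.Ioi i).map a.toEmbedding := by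
    ext q
    simp only [Finset.mem_filter, Finset.mem_univ, true_and, Finset.mem_map, Finset.mem_Ioi, hmem]
    constructor
    · rintro ⟨h, j, rfl⟩
      exact ⟨j, hmono.lt_iff_lt.1 h, rfl⟩
    · rintro ⟨j, h, rfl⟩
      exact ⟨hmono h, j, rfl⟩
  unfold rankFromTop
  rw [this, Finset.card_map, Fin.card_Ioi]

namespace Positions

variable {a : Fin 4 → Fin m}

theorem ne_none (h : Positions f a) (i : Fin 4) : f (a i) ≠ none := (h.ne_none_iff _).2 ⟨i, rfl⟩

theorem topTwoAlike_iff (h : Positions f a) : TopTwoAlike f ↔ f (a 2) = f (a 3) := by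
  constructor
  · rintro ⟨p, q, hp, hq, rp, rq, e⟩
    obtain ⟨i, rfl⟩ := (h.ne_none_iff p).1 hp
    obtain ⟨j, rfl⟩ := (h.ne_none_iff q).1 hq
    rw [h.rank] at rp rq
    have hi : i = 3 := by fin_cases i <;> simp_all
    have hj : j = 2 := by fin_cases j <;> simp_all
    subst hi hj
    exact e.symm
  · intro e
    exact ⟨a 3, a 2, h.ne_none 3, h.ne_none 2, by rw [h.rank]; rfl, by rw [h.rank]; rfl, e.symm⟩

/-- In the sequence of the four decorations the two sides alternate. -/
theorem onFirstSide_iff (h : Positions f a) (b : Fin 2) (i : Fin 4) :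
    OnFirstSide f b (a i) ↔ (¬ Even (i : ℕ) ↔ (f (a 2) = f (a 3) ↔ b = 0)) := by
  unfold OnFirstSide
  rw [h.rank, h.topTwoAlike_iff]
  have : Even (3 - (i : ℕ)) ↔ ¬ Even (i : ℕ) := by
    fin_cases i <;> decide
  rw [this]

theorem kinds (h : Positions f a) :
    (f (a 0) = some .O ∧ f (a 2) = some .X ∨ f (a 0) = some .X ∧ f (a 2) = some .O) ∧
    (f (a 1) = some .O ∧ f (a 3) = some .X ∨ f (a 1) = some .X ∧ f (a 3) = some .O) := by
  have h0 := h.ne_none 0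
  have h1 := h.ne_none 1
  have h2 := h.ne_none 2
  have h3 := h.ne_none 3
  have h4 := h.ne_zero_two
  have h5 := h.ne_one_three
  generalize f (a 0) = x0 at *
  generalize f (a 1) = x1 at *
  generalize f (a 2) = x2 at *
  generalize f (a 3) = x3 at *
  rcases x0 with _ | (_ | _) <;> rcases x1 with _ | (_ | _) <;> rcases x2 with _ | (_ | _) <;>
    rcases x3 with _ | (_ | _) <;> simp_all

end Positions

theorem existsUnique_of_not_isSingular (hs : ¬ IsSingular f) (ha : IsAdmissible f) (k : Mark) :
    ∃! p, f p = some k := by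
  rcases ha with ⟨h1, h2⟩ | ⟨h1, h2, -⟩
  · have : count f k = 1 := by cases k <;> assumption
    obtain ⟨p, hp⟩ := Finset.card_eq_one.1 this
    refine ⟨p, ?_, fun q hq => ?_⟩
    · have : p ∈ Finset.univ.filter (fun p => f p = some k) := by rw [hp]; simp
      simpa using this
    · have : q ∈ Finset.univ.filter (fun p => f p = some k) := by simpa using hq
      rw [hp] at this
      simpa using this
  · exfalso
    apply hs
    unfold IsSingular
    have : (Finset.univ.filter (fun p => f p ≠ none)) =
        (Finset.univ.filter (fun p => f p = some .O)) ∪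
          (Finset.univ.filter (fun p => f p = some .X)) := by
      ext p
      simp only [Finset.mem_filter, Finset.mem_univ, true_and, Finset.mem_union]
      rcases f p with _ | (_ | _) <;> simp
    rw [this, Finset.card_union_of_disjoint]
    · unfold count at h1 h2; omega
    · rw [Finset.disjoint_filter]
      intro p _ h; simp [h]

/-- Each half of a split singular RoC contains one decoration of each kind. -/
theorem existsUnique_side (hs : IsSingular f) (ha : IsAdmissible f) (k : Mark) (b : Fin 2)
    (P : Prop) : ∃! p, f p = some k ∧ (OnFirstSide f b p ↔ P) := by
  obtain ⟨a, h⟩ := exists_positions hs ha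
  have key : ∃! i : Fin 4, f (a i) = some k ∧ (OnFirstSide f b (a i) ↔ P) := by
    have hk := h.kinds
    have e0 := h.onFirstSide_iff b 0
    have e1 := h.onFirstSide_iff b 1
    have e2 := h.onFirstSide_iff b 2
    have e3 := h.onFirstSide_iff b 3
    have n0 : Even ((0 : Fin 4) : ℕ) := by decide
    have n1 : ¬ Even ((1 : Fin 4) : ℕ) := by decide
    have n2 : Even ((2 : Fin 4) : ℕ) := by decide
    have n3 : ¬ Even ((3 : Fin 4) : ℕ) := by decide
    simp only [n0, n1, n2, n3, not_true, not_false_iff, false_iff, true_iff] at e0 e1 e2 e3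
    simp only [ExistsUnique, Fin.exists_fin_succ, Fin.forall_fin_succ]
    simp only [Fin.isValue, Fin.succ_zero_eq_one, Fin.succ_one_eq_two, IsEmpty.forall_iff,
      and_true, IsEmpty.exists_iff, or_false]
    have : (Fin.succ (2 : Fin 3)) = (3 : Fin 4) := rfl
    simp only [this, e0, e1, e2, e3]
    rcases hk with ⟨⟨k0, k2⟩ | ⟨k0, k2⟩, ⟨k1, k3⟩ | ⟨k1, k3⟩⟩ <;>
      simp only [k0, k1, k2, k3] <;> cases k <;> by_cases hb : b = 0 <;> by_cases hP : P <;>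
      simp [hb, hP]
  obtain ⟨i, hi, hu⟩ := key
  refine ⟨a i, hi, ?_⟩
  rintro q ⟨hq, hq'⟩
  obtain ⟨j, rfl⟩ := (h.ne_none_iff q).1 (by rw [hq]; simp)
  rw [hu j ⟨hq, hq'⟩]

/-! ### Winding arcs and peaks of a singular row or column -/

section arcs

variable {base : ℝ} {arc : Fin 2 → ℝ → ℝ} {t : ℝ}

theorem IsWindingPair.center_first (hw : IsWindingPair f base arc) {p : Fin m}
    (hp : f p ≠ none) (h : OnFirstSide f 0 p) :
    arc 1 ((p : ℝ) + 1 / 2) < base + 1 / 2 ∧ base + 1 / 2 < arc 0 ((p : ℝ) + 1 / 2) :=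
  ⟨hw.second_side 1 p hp (by rw [onFirstSide_one_iff]; tauto), hw.first_side 0 p hp h⟩

theorem IsWindingPair.center_second (hw : IsWindingPair f base arc) {p : Fin m}
    (hp : f p ≠ none) (h : ¬ OnFirstSide f 0 p) :
    arc 0 ((p : ℝ) + 1 / 2) < base + 1 / 2 ∧ base + 1 / 2 < arc 1 ((p : ℝ) + 1 / 2) :=
  ⟨hw.second_side 0 p hp h, hw.first_side 1 p hp (by rw [onFirstSide_one_iff]; tauto)⟩

theorem IsWindingPair.center_ne (hw : IsWindingPair f base arc) {p : Fin m} (hp : f p ≠ none) :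
    arc 0 ((p : ℝ) + 1 / 2) ≠ arc 1 ((p : ℝ) + 1 / 2) := by
  by_cases h : OnFirstSide f 0 p
  · have := hw.center_first hp h; intro e; linarith
  · have := hw.center_second hp h; intro e; linarith

theorem IsPeak.ne_center (hw : IsWindingPair f base arc) (ht : IsPeak f arc t) {p : Fin m}
    (hp : f p ≠ none) : t ≠ (p : ℝ) + 1 / 2 := by
  rintro rfl
  exact hw.center_ne hp ht.2.2.1

theorem IsWindingPair.shift (hw : IsWindingPair f base arc) (b : Fin 2) (u : ℝ) (k : ℤ) :
    arc b (u + k * m) = arc b u := (hw.periodic b).int_mul k u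

/-- Between decorations on different sides the arcs cross. -/
theorem IsWindingPair.exists_crossing (hw : IsWindingPair f base arc) {p q : Fin m} {k l : ℤ}
    (hp : f p ≠ none) (hq : f q ≠ none) (hpq : OnFirstSide f 0 p ↔ ¬ OnFirstSide f 0 q)
    (hlt : (p : ℝ) + 1 / 2 + k * m < (q : ℝ) + 1 / 2 + l * m) :
    ∃ u, (p : ℝ) + 1 / 2 + k * m < u ∧ u < (q : ℝ) + 1 / 2 + l * m ∧ arc 0 u = arc 1 u := by
  have hc : ContinuousOn (fun u => arc 0 u - arc 1 u)
      (Set.Icc ((p : ℝ) + 1 / 2 + k * m) ((q : ℝ) + 1 / 2 + l * m)) :=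
    ((hw.continuous 0).sub (hw.continuous 1)).continuousOn
  have e1 := fun b => hw.shift b ((p : ℝ) + 1 / 2) k
  have e2 := fun b => hw.shift b ((q : ℝ) + 1 / 2) l
  by_cases h : OnFirstSide f 0 p
  · have h1 := hw.center_first hp h
    have h2 := hw.center_second hq (hpq.1 h)
    have := intermediate_value_Ioo' hlt.le hc
    obtain ⟨u, hu, hu0⟩ := this (show (0 : ℝ) ∈ _ by
      simp only [e1, e2, Set.mem_Ioo]; constructor <;> linarith)
    exact ⟨u, hu.1, hu.2, sub_eq_zero.1 hu0⟩
  · have h1 := hw.center_second hp h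
    have h2 := hw.center_first hq (by tauto)
    have := intermediate_value_Ioo hlt.le hc
    obtain ⟨u, hu, hu0⟩ := this (show (0 : ℝ) ∈ _ by
      simp only [e1, e2, Set.mem_Ioo]; constructor <;> linarith)
    exact ⟨u, hu.1, hu.2, sub_eq_zero.1 hu0⟩

theorem int_mul_le_cases {m t c : ℝ} {k : ℤ} (hm : 0 ≤ m) (hc : 0 ≤ c) (htm : t < m)
    (h : c + k * m < t) :
    (k : ℝ) * m = 0 ∨ (k : ℝ) * m = - m ∨ (k : ℝ) * m ≤ - 2 * m := by
  rcases lt_trichotomy k (-1) with hk | rfl | hk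
  · have : (k : ℝ) ≤ -2 := by exact_mod_cast (by omega : k ≤ -2)
    right; right; nlinarith
  · right; left; push_cast; ring
  · rcases eq_or_lt_of_le (by omega : 0 ≤ k) with rfl | hk
    · left; simp
    · exfalso
      have : (1 : ℝ) ≤ k := by exact_mod_cast hk
      nlinarith

theorem int_mul_ge_cases {m t c : ℝ} {k : ℤ} (hm : 0 ≤ m) (hc : c ≤ m) (ht : 0 ≤ t)
    (h : t < c + k * m) :
    (k : ℝ) * m = 0 ∨ (k : ℝ) * m = m ∨ 2 * m ≤ (k : ℝ) * m := by
  rcases lt_trichotomy k 1 with hk | rfl | hk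
  · rcases eq_or_lt_of_le (by omega : k ≤ 0) with rfl | hk
    · left; simp
    · exfalso
      have : (k : ℝ) ≤ -1 := by exact_mod_cast (by omega : k ≤ -1)
      nlinarith
  · right; left; push_cast; ring
  · right; right
    have : (2 : ℝ) ≤ k := by exact_mod_cast (by omega : 2 ≤ k)
    nlinarith

set_option maxHeartbeats 1600000 in
/-- Arithmetic behind `IsPeak.gap`: if the interval from `X + K` to `Y + L` contains `t` and none of
the seven crossings other than `t`, it does not extend beyond the two neighbours of `t`. -/
theorem gap_aux {x0 x1 x2 x3 m t z01 z12 z23 z30 X Y K L : ℝ}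
    {I0 I1 I2 I3 J0 J1 J2 J3 : Prop}
    (c0 : t ≠ x0 + 1 / 2) (c1 : t ≠ x1 + 1 / 2) (c2 : t ≠ x2 + 1 / 2) (c3 : t ≠ x3 + 1 / 2)
    (t0 : 0 ≤ t) (tm : t < m) (l01 : x0 + 1 ≤ x1) (l12 : x1 + 1 ≤ x2) (l23 : x2 + 1 ≤ x3)
    (l3 : x3 + 1 ≤ m) (l0 : 0 ≤ x0)
    (z01a : x0 + 1 / 2 < z01) (z01b : z01 < x1 + 1 / 2)
    (z12a : x1 + 1 / 2 < z12) (z12b : z12 < x2 + 1 / 2)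
    (z23a : x2 + 1 / 2 < z23) (z23b : z23 < x3 + 1 / 2)
    (z30a : x3 + 1 / 2 < z30) (z30b : z30 < x0 + 1 / 2 + m)
    (hpt : X + 1 / 2 + K < t) (htq : t < Y + 1 / 2 + L)
    (ai : x0 ≤ X ∧ X ≤ x3) (aj : x0 ≤ Y ∧ Y ≤ x3)
    (hkm : K = 0 ∨ K = - m ∨ K ≤ - 2 * m) (hlm : L = 0 ∨ L = m ∨ 2 * m ≤ L)
    (u : ∀ z ∈ ({z01, z12, z23, z30, z01 + m, z23 - m, z30 - m} : Set ℝ),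
      X + 1 / 2 + K ≤ z → z ≤ Y + 1 / 2 + L → z = t)
    (zeroI : I0 ∨ x1 ≤ X) (oneI : I1 ∨ X ≤ x0 ∨ x2 ≤ X) (twoI : I2 ∨ X ≤ x1 ∨ x3 ≤ X)
    (threeI : I3 ∨ X ≤ x2)
    (zeroJ : J0 ∨ x1 ≤ Y) (oneJ : J1 ∨ Y ≤ x0 ∨ x2 ≤ Y) (twoJ : J2 ∨ Y ≤ x1 ∨ x3 ≤ Y)
    (threeJ : J3 ∨ Y ≤ x2) :
    (x0 + 1 / 2 < t ∧ t < x1 + 1 / 2 ∧ I0 ∧ J1) ∨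
    (x1 + 1 / 2 < t ∧ t < x2 + 1 / 2 ∧ I1 ∧ J2) ∨
    (x2 + 1 / 2 < t ∧ t < x3 + 1 / 2 ∧ I2 ∧ J3) ∨
    ((t < x0 + 1 / 2 ∨ x3 + 1 / 2 < t) ∧ I3 ∧ J0) := by
  have u1 := u z01 (by simp)
  have u2 := u z12 (by simp)
  have u3 := u z23 (by simp)
  have u4 := u z30 (by simp)
  have u5 := u (z01 + m) (by simp)
  have u6 := u (z23 - m) (by simp)
  have u7 := u (z30 - m) (by simp)
  rcases lt_or_gt_of_ne c0 with d0 | d0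
  · refine Or.inr (Or.inr (Or.inr ⟨Or.inl d0, ?_⟩))
    have hj : J0 := by
      rcases zeroJ with hj | hj
      · exact hj
      · exfalso
        have := u1 (by rcases hkm with e | e | e <;> linarith)
          (by rcases hlm with e | e | e <;> linarith)
        linarith
    have hi : I3 := by
      rcases threeI with hi | hi
      · exact hi
      · exfalso
        have := u6 (by rcases hkm with e | e | e <;> linarith)
          (by rcases hlm with e | e | e <;> linarith)
        linarith
    exact ⟨hi, hj⟩
  rcases lt_or_gt_of_ne c1 with d1 | d1
  · refine Or.inl ⟨d0, d1, ?_⟩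
    have hkm0 : K = 0 := by
      by_contra hne
      have := u7 (by rcases hkm with e | e | e <;> first | exact absurd e hne | linarith)
          (by rcases hlm with e | e | e <;> linarith)
      linarith
    have hlm0 : L = 0 := by
      by_contra hne
      have := u2 (by linarith)
          (by rcases hlm with e | e | e <;> first | exact absurd e hne | linarith)
      linarith
    have hi : I0 := by
      rcases zeroI with hi | hi
      · exact hi
      · exfalso; linarith
    have hj : J1 := by
      rcases oneJ with hj | hj | hj
      · exact hj
      · exfalso; linarith
      · exfalso
        have := u2 (by linarith) (by linarith)
        linarith
    exact ⟨hi, hj⟩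
  rcases lt_or_gt_of_ne c2 with d2 | d2
  · refine Or.inr (Or.inl ⟨d1, d2, ?_⟩)
    have hkm0 : K = 0 := by
      by_contra hne
      have := u1 (by rcases hkm with e | e | e <;> first | exact absurd e hne | linarith)
          (by rcases hlm with e | e | e <;> linarith)
      linarith
    have hlm0 : L = 0 := by
      by_contra hne
      have := u3 (by linarith)
          (by rcases hlm with e | e | e <;> first | exact absurd e hne | linarith)
      linarith
    have hi : I1 := by
      rcases oneI with hi | hi | hi
      · exact hi
      · exfalso
        have := u1 (by linarith) (by linarith)
        linarith
      · exfalso; linarith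
    have hj : J2 := by
      rcases twoJ with hj | hj | hj
      · exact hj
      · exfalso; linarith
      · exfalso
        have := u3 (by linarith) (by linarith)
        linarith
    exact ⟨hi, hj⟩
  rcases lt_or_gt_of_ne c3 with d3 | d3
  · refine Or.inr (Or.inr (Or.inl ⟨d2, d3, ?_⟩))
    have hkm0 : K = 0 := by
      by_contra hne
      have := u2 (by rcases hkm with e | e | e <;> first | exact absurd e hne | linarith)
          (by rcases hlm with e | e | e <;> linarith)
      linarith
    have hlm0 : L = 0 := by
      by_contra hne
      have := u4 (by linarith)
          (by rcases hlm with e | e | e <;> first | exact absurd e hne | linarith)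
      linarith
    have hi : I2 := by
      rcases twoI with hi | hi | hi
      · exact hi
      · exfalso
        have := u2 (by linarith) (by linarith)
        linarith
      · exfalso; linarith
    have hj : J3 := by
      rcases threeJ with hj | hj
      · exact hj
      · exfalso; linarith
    exact ⟨hi, hj⟩
  · refine Or.inr (Or.inr (Or.inr ⟨Or.inr d3, ?_⟩))
    have hkm0 : K = 0 := by
      by_contra hne
      have := u3 (by rcases hkm with e | e | e <;> first | exact absurd e hne | linarith)
          (by rcases hlm with e | e | e <;> linarith)
      linarith
    have hi : I3 := by
      rcases threeI with hi | hi
      · exact hi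
      · exfalso
        have := u3 (by linarith) (by rcases hlm with e | e | e <;> linarith)
        linarith
    have hj : J0 := by
      rcases zeroJ with hj | hj
      · exact hj
      · exfalso
        have := u5 (by linarith) (by rcases hlm with e | e | e <;> linarith)
        linarith
    exact ⟨hi, hj⟩

/-- A peak lies between consecutive decorations of different kinds. -/
theorem IsPeak.gap {a : Fin 4 → Fin m} (hw : IsWindingPair f base arc) (ht : IsPeak f arc t)
    (h : Positions f a) :
    ((a 0 : ℝ) + 1 / 2 < t ∧ t < (a 1 : ℝ) + 1 / 2 ∧ f (a 0) ≠ f (a 1)) ∨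
    ((a 1 : ℝ) + 1 / 2 < t ∧ t < (a 2 : ℝ) + 1 / 2 ∧ f (a 1) ≠ f (a 2)) ∨
    ((a 2 : ℝ) + 1 / 2 < t ∧ t < (a 3 : ℝ) + 1 / 2 ∧ f (a 2) ≠ f (a 3)) ∨
    ((t < (a 0 : ℝ) + 1 / 2 ∨ (a 3 : ℝ) + 1 / 2 < t) ∧ f (a 3) ≠ f (a 0)) := by
  have c0 := ht.ne_center hw (h.ne_none 0)
  have c1 := ht.ne_center hw (h.ne_none 1)
  have c2 := ht.ne_center hw (h.ne_none 2)
  have c3 := ht.ne_center hw (h.ne_none 3)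
  obtain ⟨t0, tm, -, p, q, k, l, hp, hq, hpq, hpt, htq, huniq⟩ := ht
  have alt : ∀ i j : Fin 4, ¬ (Even (i : ℕ) ↔ Even (j : ℕ)) →
      (OnFirstSide f 0 (a i) ↔ ¬ OnFirstSide f 0 (a j)) := by
    intro i j hij
    rw [h.onFirstSide_iff, h.onFirstSide_iff]; tauto
  have l01 : (a 0 : ℝ) + 1 ≤ a 1 := by
    have : (a 0 : ℕ) < a 1 := h.strictMono (by decide)
    exact_mod_cast this
  have l12 : (a 1 : ℝ) + 1 ≤ a 2 := by
    have : (a 1 : ℕ) < a 2 := h.strictMono (by decide)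
    exact_mod_cast this
  have l23 : (a 2 : ℝ) + 1 ≤ a 3 := by
    have : (a 2 : ℕ) < a 3 := h.strictMono (by decide)
    exact_mod_cast this
  have l3 : (a 3 : ℝ) + 1 ≤ m := by
    have := (a 3).2
    exact_mod_cast this
  have l0 : (0 : ℝ) ≤ a 0 := by positivity
  -- Consecutive decorations are on different sides, so that there is a crossing between them.
  obtain ⟨z01, z01a, z01b, z01c⟩ := hw.exists_crossing (k := 0) (l := 0) (h.ne_none 0)
    (h.ne_none 1) (alt 0 1 (by decide)) (by push_cast; linarith)
  obtain ⟨z12, z12a, z12b, z12c⟩ := hw.exists_crossing (k := 0) (l := 0) (h.ne_none 1)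
    (h.ne_none 2) (alt 1 2 (by decide)) (by push_cast; linarith)
  obtain ⟨z23, z23a, z23b, z23c⟩ := hw.exists_crossing (k := 0) (l := 0) (h.ne_none 2)
    (h.ne_none 3) (alt 2 3 (by decide)) (by push_cast; linarith)
  obtain ⟨z30, z30a, z30b, z30c⟩ := hw.exists_crossing (k := 0) (l := 1) (h.ne_none 3)
    (h.ne_none 0) (alt 3 0 (by decide)) (by push_cast; linarith)
  have z01c' : arc 0 (z01 + m) = arc 1 (z01 + m) := by
    have := fun b => hw.periodic b z01
    rw [this, this, z01c]
  have z23c' : arc 0 (z23 - m) = arc 1 (z23 - m) := by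
    have := fun b => (hw.periodic b).sub_eq z23
    rw [this, this, z23c]
  have z30c' : arc 0 (z30 - m) = arc 1 (z30 - m) := by
    have := fun b => (hw.periodic b).sub_eq z30
    rw [this, this, z30c]
  simp only [Int.cast_zero, Int.cast_one, zero_mul, one_mul, add_zero] at z01a z01b z12a z12b z23a z23b z30a z30b
  obtain ⟨i, rfl⟩ := (h.ne_none_iff p).1 hp
  obtain ⟨j, rfl⟩ := (h.ne_none_iff q).1 hq
  have ai : (a 0 : ℝ) ≤ a i ∧ (a i : ℝ) ≤ a 3 := by
    have h1 : (a 0 : ℕ) ≤ a i := h.strictMono.monotone (Fin.zero_le i)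
    have h2 : (a i : ℕ) ≤ a 3 := h.strictMono.monotone (Fin.le_last i)
    exact ⟨by exact_mod_cast h1, by exact_mod_cast h2⟩
  have aj : (a 0 : ℝ) ≤ a j ∧ (a j : ℝ) ≤ a 3 := by
    have h1 : (a 0 : ℕ) ≤ a j := h.strictMono.monotone (Fin.zero_le j)
    have h2 : (a j : ℕ) ≤ a 3 := h.strictMono.monotone (Fin.le_last j)
    exact ⟨by exact_mod_cast h1, by exact_mod_cast h2⟩
  have hkm := int_mul_le_cases (k := k) (c := (a i : ℝ) + 1 / 2) (Nat.cast_nonneg m)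
    (by linarith only [l0, ai.1]) tm hpt
  have hlm := int_mul_ge_cases (k := l) (c := (a j : ℝ) + 1 / 2) (Nat.cast_nonneg m)
    (by linarith only [l3, aj.2]) t0 htq
  have hmono : ∀ i j : Fin 4, i ≤ j → (a i : ℝ) ≤ a j := fun i j hij => by
    have : (a i : ℕ) ≤ a j := h.strictMono.monotone hij
    exact_mod_cast this
  have three : ∀ i : Fin 4, i = 3 ∨ (a i : ℝ) ≤ a 2 := fun i =>
    (show i = 3 ∨ i ≤ 2 by omega).imp id (hmono _ _)
  have zero : ∀ i : Fin 4, i = 0 ∨ (a 1 : ℝ) ≤ a i := fun i =>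
    (show i = 0 ∨ 1 ≤ i by omega).imp id (hmono _ _)
  have one : ∀ i : Fin 4, i = 1 ∨ (a i : ℝ) ≤ a 0 ∨ (a 2 : ℝ) ≤ a i := fun i =>
    (show i = 1 ∨ i ≤ 0 ∨ 2 ≤ i by omega).imp id (Or.imp (hmono _ _) (hmono _ _))
  have two : ∀ i : Fin 4, i = 2 ∨ (a i : ℝ) ≤ a 1 ∨ (a 3 : ℝ) ≤ a i := fun i =>
    (show i = 2 ∨ i ≤ 1 ∨ 3 ≤ i by omega).imp id (Or.imp (hmono _ _) (hmono _ _))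
  have key := gap_aux c0 c1 c2 c3 t0 tm l01 l12 l23 l3 l0 z01a z01b z12a z12b z23a z23b z30a z30b
    hpt htq
    ai aj hkm hlm
    (by
      intro z hz x y
      simp only [Set.mem_insert_iff, Set.mem_singleton_iff] at hz
      rcases hz with rfl | rfl | rfl | rfl | rfl | rfl | rfl <;> exact huniq _ x y (by assumption))
    (zero i) (one i) (two i) (three i) (zero j) (one j) (two j) (three j)
  rcases key with ⟨k1, k2, rfl, rfl⟩ | ⟨k1, k2, rfl, rfl⟩ | ⟨k1, k2, rfl, rfl⟩ | ⟨k1, rfl, rfl⟩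
  · exact Or.inl ⟨k1, k2, hpq⟩
  · exact Or.inr (Or.inl ⟨k1, k2, hpq⟩)
  · exact Or.inr (Or.inr (Or.inl ⟨k1, k2, hpq⟩))
  · exact Or.inr (Or.inr (Or.inr ⟨k1, hpq⟩))

/-- Going up from a decoration on the first side one meets the peak before the decoration of
the same kind on the second side. -/
theorem IsPeak.between_of_onFirstSide (hw : IsWindingPair f base arc) (ht : IsPeak f arc t)
    (hs : IsSingular f) (ha : IsAdmissible f) {p q : Fin m} (hp : f p ≠ none) (hpq : f p = f q)
    (h1 : OnFirstSide f 0 p) (h2 : ¬ OnFirstSide f 0 q) :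
    (p < q ∧ (p : ℝ) + 1 / 2 < t ∧ t < (q : ℝ) + 1 / 2) ∨
    (q < p ∧ ((p : ℝ) + 1 / 2 < t ∧ (q : ℝ) + 1 / 2 < t ∨
      t < (p : ℝ) + 1 / 2 ∧ t < (q : ℝ) + 1 / 2)) := by
  obtain ⟨a, h⟩ := exists_positions hs ha
  have l01' : a 0 < a 1 := h.strictMono (by decide)
  have l12' : a 1 < a 2 := h.strictMono (by decide)
  have l23' : a 2 < a 3 := h.strictMono (by decide)
  have l03' : a 0 < a 3 := h.strictMono (by decide)
  have l01 : (a 0 : ℝ) + 1 ≤ a 1 := by exact_mod_cast l01'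
  have l12 : (a 1 : ℝ) + 1 ≤ a 2 := by exact_mod_cast l12'
  have l23 : (a 2 : ℝ) + 1 ≤ a 3 := by exact_mod_cast l23'
  obtain ⟨i, rfl⟩ := (h.ne_none_iff p).1 hp
  obtain ⟨j, rfl⟩ := (h.ne_none_iff q).1 (hpq ▸ hp)
  rw [h.onFirstSide_iff] at h1 h2
  have hk := h.kinds
  have n0 : Even ((0 : Fin 4) : ℕ) := by decide
  have n1 : ¬ Even ((1 : Fin 4) : ℕ) := by decide
  have n2 : Even ((2 : Fin 4) : ℕ) := by decide
  have n3 : ¬ Even ((3 : Fin 4) : ℕ) := by decide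
  have hi : i = 0 ∨ i = 1 ∨ i = 2 ∨ i = 3 := by fin_cases i <;> simp
  have hj : j = 0 ∨ j = 1 ∨ j = 2 ∨ j = 3 := by fin_cases j <;> simp
  have g := ht.gap hw h
  rcases hk with ⟨⟨k0, k2⟩ | ⟨k0, k2⟩, ⟨k1, k3⟩ | ⟨k1, k3⟩⟩ <;>
  rcases hi with rfl | rfl | rfl | rfl <;> rcases hj with rfl | rfl | rfl | rfl <;>
  simp only [k0, k1, k2, k3, n0, n1, n2, n3, ne_eq, not_true, not_false_iff, Option.some.injEq,
    reduceCtorEq, iff_true, iff_false, and_false, or_false, false_or,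
    and_true] at hpq h1 h2 g <;>
  first
  | (left; refine ⟨by assumption, ?_, ?_⟩ <;>
      rcases g with ⟨g1, g2⟩ | ⟨g1, g2⟩ <;> linarith)
  | (right; refine ⟨by assumption, ?_⟩
     rcases g with ⟨g1, g2⟩ | ⟨g1, g2⟩ <;>
      first
      | (left; constructor <;> linarith)
      | (right; constructor <;> linarith))
  | (right; refine ⟨by assumption, ?_⟩
     rcases g with ⟨g1, g2⟩ | g1 | g1 <;>
      first
      | (left; constructor <;> linarith)
      | (right; constructor <;> linarith))

end arcs

end RoC

/-! ### Arcs crossing in the plane -/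

/-- The graphs `s = u t` and `t = g s` of two bounded continuous functions meet exactly once, at the
point `(a, b)`. -/
structure Crossing (u g : ℝ → ℝ) (a b : ℝ) : Prop where
  continuous_left : Continuous u
  continuous_right : Continuous g
  bounded_left : ∃ c C, ∀ t, c < u t ∧ u t < C
  bounded_right : ∃ c C, ∀ s, c < g s ∧ g s < C
  left_eq : a = u b
  right_eq : b = g a
  unique : ∀ s t, s = u t → t = g s → s = a ∧ t = b

namespace Crossing

variable {u g : ℝ → ℝ} {a b : ℝ}

theorem symm (h : Crossing u g a b) : Crossing g u b a :=
  ⟨h.2, h.1, h.4, h.3, h.6, h.5, fun s t hs ht => (h.7 t s ht hs).symm⟩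

theorem eq_of_eq (h : Crossing u g a b) {t : ℝ} (ht : t = g (u t)) : t = b :=
  (h.unique _ t rfl ht).2

/-- The curve `s = u t` runs below the other one before the crossing and above it afterwards. -/
theorem lt_iff (h : Crossing u g a b) (t : ℝ) : t < g (u t) ↔ t < b := by
  have hc : Continuous fun t => t - g (u t) :=
    continuous_id.sub (h.continuous_right.comp h.continuous_left)
  have hb : b = g (u b) := by rw [← h.left_eq]; exact h.right_eq
  obtain ⟨c, C, hcC⟩ := h.bounded_right
  constructor
  · intro ht
    by_contra hlt
    push Not at hlt
    rcases eq_or_lt_of_le hlt with rfl | hlt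
    · exact absurd ht (not_lt.2 hb.ge)
    · have hM : t < max t C + 1 := by linarith [le_max_left t C]
      obtain ⟨z, hz, hz0⟩ := intermediate_value_Ioo hM.le hc.continuousOn
        (show (0 : ℝ) ∈ _ from ⟨by linarith, by
          linarith [(hcC (u (max t C + 1))).2, le_max_right t C]⟩)
      have := h.eq_of_eq (sub_eq_zero.1 hz0)
      linarith [hz.1]
  · intro ht
    by_contra hlt
    push Not at hlt
    rcases eq_or_lt_of_le hlt with hlt | hlt
    · exact ht.ne (h.eq_of_eq hlt.symm)
    · have hM : min t c - 1 < t := by linarith [min_le_left t c]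
      obtain ⟨z, hz, hz0⟩ := intermediate_value_Ioo hM.le hc.continuousOn
        (show (0 : ℝ) ∈ _ from ⟨by
          linarith [(hcC (u (min t c - 1))).1, min_le_right t c], by
          linarith⟩)
      have := h.eq_of_eq (sub_eq_zero.1 hz0)
      linarith [hz.2]

theorem gt_iff (h : Crossing u g a b) (t : ℝ) : g (u t) < t ↔ b < t := by
  have hb : b = g (u b) := by rw [← h.left_eq]; exact h.right_eq
  rcases lt_trichotomy t b with ht | rfl | ht
  · have := (h.lt_iff t).2 ht
    constructor <;> intro <;> linarith
  · constructor <;> intro <;> linarith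
  · refine ⟨fun _ => ht, fun _ => lt_of_le_of_ne ?_ fun e => ht.ne' (h.eq_of_eq e.symm)⟩
    by_contra hlt
    push Not at hlt
    linarith [(h.lt_iff t).1 hlt]

/-- Let `u` pass between `g₀` and `g₁` at height `p`, and let `g₀` and `g₁` cross at abscissa
`q`. Between its crossings with `g₀` and `g₁` the curve `u` avoids the abscissa `q`; hence the
position of the crossing of `g₀` and `g₁` relative to `u` is read off at height `p`. -/
theorem lt_iff_of_between {g₀ g₁ : ℝ → ℝ} {a₀ b₀ a₁ b₁ p q : ℝ} (h₀ : Crossing u g₀ a₀ b₀)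
    (h₁ : Crossing u g₁ a₁ b₁) (hq : g₀ q = g₁ q) (hp₀ : g₀ (u p) < p) (hp₁ : p < g₁ (u p)) :
    u (g₀ q) < q ↔ u p < q := by
  have hb₀ := (h₀.gt_iff p).1 hp₀
  have hb₁ := (h₁.lt_iff p).1 hp₁
  have avoid : ∀ t, b₀ ≤ t → t ≤ p → u t ≠ q := by
    intro t ht htp e
    have h1 : g₀ (u t) ≤ t := by
      by_contra hlt; push Not at hlt
      linarith [(h₀.lt_iff t).1 hlt]
    have h2 : t ≤ g₁ (u t) := by
      by_contra hlt; push Not at hlt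
      linarith [(h₁.gt_iff t).1 hlt]
    rw [e] at h1 h2
    have h3 : t = g₁ (u t) := by rw [e]; linarith
    linarith [h₁.eq_of_eq h3]
  have h3 : u b₀ < q ↔ u p < q := by
    have hc := h₀.continuous_left.continuousOn (s := Set.Icc b₀ p)
    constructor
    · intro h
      by_contra hlt; push Not at hlt
      obtain ⟨z, hz, hz0⟩ := intermediate_value_Icc hb₀.le hc (show q ∈ _ from ⟨h.le, hlt⟩)
      exact avoid z hz.1 hz.2 hz0
    · intro h
      by_contra hlt; push Not at hlt
      obtain ⟨z, hz, hz0⟩ := intermediate_value_Icc' hb₀.le hc (show q ∈ _ from ⟨h.le, hlt⟩)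
      exact avoid z hz.1 hz.2 hz0
  rw [← h3, ← h₀.left_eq]
  exact h₀.symm.gt_iff q

/-- Let two curves `s = u t` and `s = v t` cross at height `p` and let the point `(x, m)`, `m < p`, lie
between them. A curve `t = g s` which passes below the point also passes below the crossing: to
avoid the crossing it would have to meet one of the two curves twice. -/
theorem lt_of_enclosed {v : ℝ → ℝ} {a' b' p m x : ℝ} (hu : Crossing u g a b)
    (hv : Crossing v g a' b') (hp : u p = v p) (h1 : u m < x) (h2 : x < v m) (hmp : m < p)
    (hg : g x < m) : g (u p) ≤ p := by
  by_contra hlt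
  push Not at hlt
  have hpb := (hu.lt_iff p).1 hlt
  have hpb' := (hv.lt_iff p).1 (hp ▸ hlt)
  have e1 := (hu.lt_iff m).2 (hmp.trans hpb)
  have e2 := (hv.lt_iff m).2 (hmp.trans hpb')
  have hc := fun s => hu.continuous_right.continuousOn (s := s)
  obtain ⟨s, hs, hsm⟩ := intermediate_value_Ioo' h1.le (hc _) (show m ∈ _ from ⟨hg, e1⟩)
  obtain ⟨s', hs', hsm'⟩ := intermediate_value_Ioo h2.le (hc _) (show m ∈ _ from ⟨hg, e2⟩)
  have h3 : a < s := (hu.symm.gt_iff s).1 (by rw [hsm]; exact hs.1)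
  have h4 : s' < a' := (hv.symm.lt_iff s').1 (by rw [hsm']; exact hs'.2)
  obtain ⟨w, hw, hwp⟩ := intermediate_value_Ioo h4.le (hc _)
    (show p ∈ _ from ⟨by rw [hsm']; exact hmp, by rw [← hv.right_eq]; exact hpb'⟩)
  have h5 := (hu.symm.gt_iff w).2 (by linarith [hw.1, hs.2, hs'.1])
  have h6 := (hv.symm.lt_iff w).2 hw.2
  rw [hwp] at h5 h6
  linarith

theorem gt_of_enclosed {v : ℝ → ℝ} {a' b' p m x : ℝ} (hu : Crossing u g a b)
    (hv : Crossing v g a' b') (hp : u p = v p) (h1 : u m < x) (h2 : x < v m) (hmp : p < m)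
    (hg : m < g x) : p ≤ g (u p) := by
  by_contra hlt
  push Not at hlt
  have hpb := (hu.gt_iff p).1 hlt
  have hpb' := (hv.gt_iff p).1 (hp ▸ hlt)
  have e1 := (hu.gt_iff m).2 (hpb.trans hmp)
  have e2 := (hv.gt_iff m).2 (hpb'.trans hmp)
  have hc := fun s => hu.continuous_right.continuousOn (s := s)
  obtain ⟨s, hs, hsm⟩ := intermediate_value_Ioo h1.le (hc _) (show m ∈ _ from ⟨e1, hg⟩)
  obtain ⟨s', hs', hsm'⟩ := intermediate_value_Ioo' h2.le (hc _) (show m ∈ _ from ⟨e2, hg⟩)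
  have h3 : a < s := (hu.symm.gt_iff s).1 (by rw [hsm]; exact hs.1)
  have h4 : s' < a' := (hv.symm.lt_iff s').1 (by rw [hsm']; exact hs'.2)
  obtain ⟨w, hw, hwp⟩ := intermediate_value_Ioo' h4.le (hc _)
    (show p ∈ _ from ⟨by rw [← hv.right_eq]; exact hpb', by rw [hsm']; exact hmp⟩)
  have h5 := (hu.symm.gt_iff w).2 (by linarith [hw.1, hs.2, hs'.1])
  have h6 := (hv.symm.lt_iff w).2 hw.2
  rw [hwp] at h5 h6
  linarith

end Crossing

/-! ### Lines of a resolution and the strips containing them -/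

/-- The height `h` of a point of the line with number `k`: even numbers belong to the grid lines,
odd ones to the winding arcs, which run in the open strip above their grid line. -/
structure InStrip (k : ℕ) (h : ℝ) : Prop where
  le : ((k / 2 : ℕ) : ℝ) ≤ h
  lt : h < ((k / 2 : ℕ) : ℝ) + 1
  even : k % 2 = 0 → h = ((k / 2 : ℕ) : ℝ)
  odd : k % 2 = 1 → ((k / 2 : ℕ) : ℝ) < h

theorem InStrip.lt_of_lt {k l : ℕ} {h h' : ℝ} (hk : InStrip k h) (hl : InStrip l h')
    (hkl : k < l) : h < h' := by
  rcases Nat.lt_or_ge (k / 2) (l / 2) with hlt | hge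
  · have : ((k / 2 : ℕ) : ℝ) + 1 ≤ ((l / 2 : ℕ) : ℝ) := by exact_mod_cast hlt
    linarith [hk.lt, hl.le]
  · have h1 : k % 2 = 0 := by omega
    have h2 : l % 2 = 1 := by omega
    have h3 : k / 2 = l / 2 := by omega
    rw [hk.even h1, h3]
    exact hl.odd h2

theorem inStrip_even (c : ℕ) : InStrip (2 * c) (c : ℝ) := by
  have h1 : 2 * c / 2 = c := by omega
  exact ⟨by rw [h1], by rw [h1]; linarith, fun _ => by rw [h1], fun h => by omega⟩

theorem inStrip_odd {c : ℕ} {h : ℝ} (h1 : (c : ℝ) < h) (h2 : h < (c : ℝ) + 1) :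
    InStrip (2 * c + 1) h := by
  have h3 : (2 * c + 1) / 2 = c := by omega
  exact ⟨by rw [h3]; exact h1.le, by rw [h3]; exact h2, fun h => by omega, fun _ => by rw [h3]; exact h1⟩

open Classical in
/-- Integer-valued truth value of a proposition. -/
def ind (p : Prop) : ℤ := if p then 1 else 0

@[simp] theorem ind_true {p : Prop} (h : p) : ind p = 1 := if_pos h
@[simp] theorem ind_false {p : Prop} (h : ¬ p) : ind p = 0 := if_neg h

theorem ind_eq_zero_or_one (p : Prop) : ind p = 0 ∨ ind p = 1 := by
  by_cases h : p <;> simp [h]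

theorem ind_congr {p q : Prop} (h : p ↔ q) : ind p = ind q := by rw [propext h]

/-- A point at height `p` of the circle of length `N` lies on the side of a polygon which goes up
from the line `ks` to the line `kn` precisely if its signed crossing number with this side is one:
the side crosses the cut `0` of the circle if `kn < ks`, and the position of the point relative to
the two ends of the side corrects for the difference between the cut and the point. -/
theorem lift_between_iff {ks kn : ℕ} {hs hn p N : ℝ} (is : InStrip ks hs) (iN : InStrip kn hn)
    (hne : ks ≠ kn) (h1 : hs ≠ p) (h2 : hn ≠ p) (p0 : 0 ≤ p) (pN : p < N)
    (hs1 : ((ks / 2 : ℕ) : ℝ) + 1 ≤ N) (hn1 : ((kn / 2 : ℕ) : ℝ) + 1 ≤ N) :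
    (hs < SingularGrid.Quad.lift ((ks / 2 : ℕ) : ℝ) N p ∧
      SingularGrid.Quad.lift ((ks / 2 : ℕ) : ℝ) N p < (if ks < kn then 0 else N) + hn) ↔
    ind (kn < ks) + ind (hs < p) - ind (hn < p) = 1 := by
  unfold SingularGrid.Quad.lift
  have hs0 : (0 : ℝ) ≤ ((ks / 2 : ℕ) : ℝ) := Nat.cast_nonneg _
  have hn0 : (0 : ℝ) ≤ ((kn / 2 : ℕ) : ℝ) := Nat.cast_nonneg _
  have := is.le
  have := is.lt
  have := iN.le
  have := iN.lt
  rcases Nat.lt_or_ge ks kn with hlt | hge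
  · have hlt' := is.lt_of_lt iN hlt
    rw [ind_false (p := kn < ks) (by omega), if_pos hlt]
    split_ifs with hZ
    · constructor
      · rintro ⟨-, h⟩; exfalso; linarith
      · rw [ind_false (p := hs < p) (by linarith)]
        intro h
        rcases ind_eq_zero_or_one (hn < p) with e | e <;> rw [e] at h <;> norm_num at h
    · rcases lt_or_gt_of_ne h1 with h1 | h1 <;> rcases lt_or_gt_of_ne h2 with h2 | h2
      · simp [h1, h2, h2.le]
      · simp [h1, h2, not_lt.2 h2.le]
      · exfalso; linarith
      · simp [h2, not_lt.2 h2.le, not_lt.2 h1.le]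
  · have hgt : kn < ks := by omega
    have hlt' := iN.lt_of_lt is hgt
    rw [ind_true (p := kn < ks) hgt, if_neg (show ¬ ks < kn by omega)]
    split_ifs with hZ
    · rw [ind_false (p := hs < p) (by linarith)]
      rcases lt_or_gt_of_ne h2 with h2 | h2
      · rw [ind_true (p := hn < p) h2]
        constructor
        · rintro ⟨-, h⟩; exfalso; linarith
        · norm_num
      · rw [ind_false (p := hn < p) (by linarith)]
        constructor
        · norm_num
        · intro; constructor <;> linarith
    · have hnp : hn < p := by
        refine lt_of_le_of_ne ?_ h2
        rcases Nat.lt_or_ge (kn / 2) (ks / 2) with hlt | hge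
        · have : ((kn / 2 : ℕ) : ℝ) + 1 ≤ ((ks / 2 : ℕ) : ℝ) := by exact_mod_cast hlt
          linarith
        · have h3 : kn % 2 = 0 := by omega
          have h4 : kn / 2 = ks / 2 := by omega
          rw [iN.even h3, h4]; linarith
      rw [ind_true (p := hn < p) hnp]
      rcases lt_or_gt_of_ne h1 with h1 | h1
      · rw [ind_true (p := hs < p) h1]
        constructor
        · norm_num
        · intro; constructor <;> linarith
      · rw [ind_false (p := hs < p) (by linarith)]
        constructor
        · rintro ⟨h, -⟩; exfalso; linarith
        · norm_num

namespace SingularGrid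

variable {G : SingularGrid} {A : G.WindingArcs}

@[simp] theorem VLine.key_inl (c : Fin G.cols) : VLine.key (.inl c : G.VLine) = 2 * c := rfl
@[simp] theorem VLine.key_inr (j : G.SingCol) : VLine.key (.inr j : G.VLine) = 2 * j.1 + 1 := rfl
@[simp] theorem HLine.key_inl (r : Fin G.rows) : HLine.key (.inl r : G.HLine) = 2 * r := rfl
@[simp] theorem HLine.key_inr (i : G.SingRow) : HLine.key (.inr i : G.HLine) = 2 * i.1 + 1 := rfl

theorem VLine.key_injective : Function.Injective (VLine.key (G := G)) := by
  rintro (a | a) (b | b) h <;> simp only [VLine.key] at h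
  · rw [Fin.ext (by omega : (a : ℕ) = b)]
  · omega
  · omega
  · rw [Subtype.ext (Fin.ext (by omega : (a.1 : ℕ) = b.1))]

theorem HLine.key_injective : Function.Injective (HLine.key (G := G)) := by
  rintro (a | a) (b | b) h <;> simp only [HLine.key] at h
  · rw [Fin.ext (by omega : (a : ℕ) = b)]
  · omega
  · omega
  · rw [Subtype.ext (Fin.ext (by omega : (a.1 : ℕ) = b.1))]

theorem VLine.idx_eq (v : G.VLine) : v.idx = v.key / 2 := by
  rcases v with c | j <;> simp only [VLine.idx, VLine.key] <;> omega

theorem HLine.idx_eq (h : G.HLine) : h.idx = h.key / 2 := by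
  rcases h with c | j <;> simp only [HLine.idx, HLine.key] <;> omega

theorem VLine.idx_lt (v : G.VLine) : v.idx < G.cols := by
  rcases v with c | j
  · exact c.2
  · exact j.1.2

theorem HLine.idx_lt (h : G.HLine) : h.idx < G.rows := by
  rcases h with c | j
  · exact c.2
  · exact j.1.2

theorem VLine.idx_add_one_le (v : G.VLine) : ((v.key / 2 : ℕ) : ℝ) + 1 ≤ G.cols := by
  have := v.idx_lt
  rw [v.idx_eq] at this
  exact_mod_cast this

theorem HLine.idx_add_one_le (h : G.HLine) : ((h.key / 2 : ℕ) : ℝ) + 1 ≤ G.rows := by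
  have := h.idx_lt
  rw [h.idx_eq] at this
  exact_mod_cast this

theorem WindingArcs.vcurve_inStrip (I : G.Resolution) (v : G.VLine) (t : ℝ) :
    InStrip v.key (A.vcurve I v t) := by
  rcases v with c | j
  · exact inStrip_even _
  · exact inStrip_odd ((A.col_winding j).mem_strip _ t).1 ((A.col_winding j).mem_strip _ t).2

theorem WindingArcs.hcurve_inStrip (I : G.Resolution) (h : G.HLine) (s : ℝ) :
    InStrip h.key (A.hcurve I h s) := by
  rcases h with c | j
  · exact inStrip_even _
  · exact inStrip_odd ((A.row_winding j).mem_strip _ s).1 ((A.row_winding j).mem_strip _ s).2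

theorem WindingArcs.vcurve_shift (I : G.Resolution) (v : G.VLine) (t : ℝ) (k : ℤ) :
    A.vcurve I v (t + k * G.rows) = A.vcurve I v t := by
  rcases v with c | j
  · rfl
  · exact (A.col_winding j).shift _ t k

theorem WindingArcs.hcurve_shift (I : G.Resolution) (h : G.HLine) (s : ℝ) (k : ℤ) :
    A.hcurve I h (s + k * G.cols) = A.hcurve I h s := by
  rcases h with c | j
  · rfl
  · exact (A.row_winding j).shift _ s k

theorem WindingArcs.vcurve_congr {I J : G.Resolution} {v : G.VLine}
    (h : ∀ e, v.roc = some e → I e = J e) : A.vcurve I v = A.vcurve J v := by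
  rcases v with c | j
  · rfl
  · simp only [WindingArcs.vcurve, h _ rfl]

theorem WindingArcs.hcurve_congr {I J : G.Resolution} {h : G.HLine}
    (hh : ∀ e, h.roc = some e → I e = J e) : A.hcurve I h = A.hcurve J h := by
  rcases h with c | j
  · rfl
  · simp only [WindingArcs.hcurve, hh _ rfl]

/-- The arcs of a singular column and of a singular row cross once. -/
theorem WindingArcs.crossing (A : G.WindingArcs) (j : G.SingCol) (i : G.SingRow) (b b' : Fin 2) :
    ∃ x y, Crossing (A.colArc j b) (A.rowArc i b') x y := by
  obtain ⟨⟨x, y⟩, ⟨h1, h2⟩, hu⟩ := A.meet_once j i b b'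
  refine ⟨x, y, (A.col_winding j).continuous b, (A.row_winding i).continuous b',
    ⟨_, _, (A.col_winding j).mem_strip b⟩, ⟨_, _, (A.row_winding i).mem_strip b'⟩, h1, h2, ?_⟩
  intro s t hs ht
  have := hu (s, t) ⟨hs, ht⟩
  exact ⟨congrArg Prod.fst this, congrArg Prod.snd this⟩

/-! ### Position of the decorations relative to the lines -/

/-- The decoration at `q` lies to the left of the line `v` in the resolution `I`. -/
def IsLeft (I : G.Resolution) (q : Fin G.cols × Fin G.rows) (v : G.VLine) : Prop :=
  (G.resolvedCol I q).key < v.key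

/-- The decoration at `q` lies below the line `h` in the resolution `I`. -/
def IsBelow (I : G.Resolution) (q : Fin G.cols × Fin G.rows) (h : G.HLine) : Prop :=
  (G.resolvedRow I q).key < h.key

theorem resolvedCol_of_singular {I : G.Resolution} {q : Fin G.cols × Fin G.rows}
    (h : RoC.IsSingular (G.deco q.1)) [Decidable (RoC.OnFirstSide (G.deco q.1) (I (.inl ⟨q.1, h⟩)) q.2)] :
    G.resolvedCol I q = if RoC.OnFirstSide (G.deco q.1) (I (.inl ⟨q.1, h⟩)) q.2
      then .inl q.1 else .inr ⟨q.1, h⟩ := by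
  unfold resolvedCol
  rw [dif_pos h]
  congr

theorem resolvedRow_of_singular {I : G.Resolution} {q : Fin G.cols × Fin G.rows}
    (h : RoC.IsSingular (fun c => G.deco c q.2))
    [Decidable (RoC.OnFirstSide (fun c => G.deco c q.2) (I (.inr ⟨q.2, h⟩)) q.1)] :
    G.resolvedRow I q = if RoC.OnFirstSide (fun c => G.deco c q.2) (I (.inr ⟨q.2, h⟩)) q.1
      then .inl q.2 else .inr ⟨q.2, h⟩ := by
  unfold resolvedRow
  rw [dif_pos h]
  congr

theorem resolvedCol_of_not_singular {I : G.Resolution} {q : Fin G.cols × Fin G.rows}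
    (h : ¬ RoC.IsSingular (G.deco q.1)) : G.resolvedCol I q = .inl q.1 := dif_neg h

theorem resolvedRow_of_not_singular {I : G.Resolution} {q : Fin G.cols × Fin G.rows}
    (h : ¬ RoC.IsSingular (fun c => G.deco c q.2)) : G.resolvedRow I q = .inl q.2 := dif_neg h

theorem idx_resolvedCol (I : G.Resolution) (q : Fin G.cols × Fin G.rows) :
    (G.resolvedCol I q).key / 2 = q.1 := by
  classical
  by_cases h : RoC.IsSingular (G.deco q.1)
  · rw [resolvedCol_of_singular h]
    split_ifs <;> simp only [VLine.key] <;> omega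
  · rw [resolvedCol_of_not_singular h]; simp only [VLine.key]; omega

theorem idx_resolvedRow (I : G.Resolution) (q : Fin G.cols × Fin G.rows) :
    (G.resolvedRow I q).key / 2 = q.2 := by
  classical
  by_cases h : RoC.IsSingular (fun c => G.deco c q.2)
  · rw [resolvedRow_of_singular h]
    split_ifs <;> simp only [HLine.key] <;> omega
  · rw [resolvedRow_of_not_singular h]; simp only [HLine.key]; omega

/-- Lines of other columns are on the same side of a decoration in all resolutions. -/
theorem isLeft_iff_of_ne {I : G.Resolution} {q : Fin G.cols × Fin G.rows} {v : G.VLine}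
    (h : ∀ j, v = .inr j → j.1 ≠ q.1) : IsLeft I q v ↔ 2 * (q.1 : ℕ) + 1 < v.key := by
  have h1 := idx_resolvedCol I q
  unfold IsLeft
  rcases v with c | j
  · simp only [VLine.key_inl]; omega
  · have : (j.1 : ℕ) ≠ q.1 := fun e => h j rfl (Fin.ext e)
    simp only [VLine.key_inr]; omega

theorem isBelow_iff_of_ne {I : G.Resolution} {q : Fin G.cols × Fin G.rows} {v : G.HLine}
    (h : ∀ j, v = .inr j → j.1 ≠ q.2) : IsBelow I q v ↔ 2 * (q.2 : ℕ) + 1 < v.key := by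
  have h1 := idx_resolvedRow I q
  unfold IsBelow
  rcases v with c | j
  · simp only [HLine.key_inl]; omega
  · have : (j.1 : ℕ) ≠ q.2 := fun e => h j rfl (Fin.ext e)
    simp only [HLine.key_inr]; omega

theorem isLeft_inr_iff {I : G.Resolution} {q : Fin G.cols × Fin G.rows} {j : G.SingCol}
    (h : j.1 = q.1) : IsLeft I q (.inr j) ↔ RoC.OnFirstSide (G.deco j.1) (I (.inl j)) q.2 := by
  classical
  obtain ⟨c, hc⟩ := j
  obtain ⟨q1, q2⟩ := q
  dsimp only at h
  subst h
  unfold IsLeft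
  rw [resolvedCol_of_singular hc]
  split_ifs with h1
  · simp only [VLine.key]
    exact ⟨fun _ => h1, fun _ => by omega⟩
  · simp only [VLine.key, lt_irrefl, false_iff]
    exact h1

theorem isBelow_inr_iff {I : G.Resolution} {q : Fin G.cols × Fin G.rows} {i : G.SingRow}
    (h : i.1 = q.2) :
    IsBelow I q (.inr i) ↔ RoC.OnFirstSide (fun c => G.deco c i.1) (I (.inr i)) q.1 := by
  classical
  obtain ⟨c, hc⟩ := i
  obtain ⟨q1, q2⟩ := q
  dsimp only at h
  subst h
  unfold IsBelow
  rw [resolvedRow_of_singular (q := (q1, c)) hc]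
  split_ifs with h1
  · simp only [HLine.key]
    exact ⟨fun _ => h1, fun _ => by omega⟩
  · simp only [HLine.key, lt_irrefl, false_iff]
    exact h1

theorem InStrip.center_lt_iff {k c : ℕ} {h : ℝ} (hk : InStrip k h) (hne : k ≠ 2 * c + 1) :
    ((c : ℝ) + 1 / 2 < h ↔ 2 * c + 1 < k) ∧ ((c : ℝ) + 1 / 2 ≠ h) := by
  have h1 := hk.le
  have h2 := hk.lt
  rcases Nat.lt_or_ge (2 * c + 1) k with hlt | hge
  · have : (c : ℝ) + 1 ≤ ((k / 2 : ℕ) : ℝ) := by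
      exact_mod_cast (by omega : c + 1 ≤ k / 2)
    exact ⟨⟨fun _ => hlt, fun _ => by linarith⟩, by linarith⟩
  · have h3 : h ≤ c := by
      rcases Nat.lt_or_ge (k / 2) c with hlt | hge'
      · have : ((k / 2 : ℕ) : ℝ) + 1 ≤ c := by exact_mod_cast hlt
        linarith
      · rw [hk.even (by omega)]
        exact_mod_cast (by omega : k / 2 ≤ c)
    exact ⟨⟨fun _ => by linarith, fun _ => by omega⟩, by linarith⟩

/-- The lines of the resolution pass on the prescribed sides of the decorations. -/
theorem WindingArcs.center_lt_vcurve_iff (I : G.Resolution) {q : Fin G.cols × Fin G.rows}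
    (hq : G.deco q.1 q.2 ≠ none) (v : G.VLine) :
    ((q.1 : ℝ) + 1 / 2 < A.vcurve I v ((q.2 : ℝ) + 1 / 2) ↔ IsLeft I q v) ∧
      (q.1 : ℝ) + 1 / 2 ≠ A.vcurve I v ((q.2 : ℝ) + 1 / 2) := by
  by_cases h : ∃ j, v = .inr j ∧ j.1 = q.1
  · obtain ⟨j, rfl, hj⟩ := h
    rw [isLeft_inr_iff hj]
    have hw := A.col_winding j
    have hq' : G.deco j.1 q.2 ≠ none := by rw [hj]; exact hq
    simp only [WindingArcs.vcurve, ← hj]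
    by_cases h1 : RoC.OnFirstSide (G.deco j.1) (I (.inl j)) q.2
    · have := hw.first_side (I (.inl j)) q.2 hq' h1
      exact ⟨⟨fun _ => h1, fun _ => this⟩, this.ne⟩
    · have := hw.second_side (I (.inl j)) q.2 hq' h1
      exact ⟨⟨fun h => by linarith, fun h => absurd h h1⟩, this.ne'⟩
  · push Not at h
    rw [isLeft_iff_of_ne h]
    refine InStrip.center_lt_iff (A.vcurve_inStrip I v _) ?_
    rcases v with c | j
    · simp only [VLine.key_inl]; omega
    · intro e
      simp only [VLine.key] at e
      exact h j rfl (Fin.ext (by omega))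

theorem WindingArcs.center_lt_hcurve_iff (I : G.Resolution) {q : Fin G.cols × Fin G.rows}
    (hq : G.deco q.1 q.2 ≠ none) (v : G.HLine) :
    ((q.2 : ℝ) + 1 / 2 < A.hcurve I v ((q.1 : ℝ) + 1 / 2) ↔ IsBelow I q v) ∧
      (q.2 : ℝ) + 1 / 2 ≠ A.hcurve I v ((q.1 : ℝ) + 1 / 2) := by
  by_cases h : ∃ j, v = .inr j ∧ j.1 = q.2
  · obtain ⟨j, rfl, hj⟩ := h
    rw [isBelow_inr_iff hj]
    have hw := A.row_winding j
    have hq' : G.deco q.1 j.1 ≠ none := by rw [hj]; exact hq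
    simp only [WindingArcs.hcurve, ← hj]
    by_cases h1 : RoC.OnFirstSide (fun c => G.deco c j.1) (I (.inr j)) q.1
    · have := hw.first_side (I (.inr j)) q.1 hq' h1
      exact ⟨⟨fun _ => h1, fun _ => this⟩, this.ne⟩
    · have := hw.second_side (I (.inr j)) q.1 hq' h1
      exact ⟨⟨fun h => by linarith, fun h => absurd h h1⟩, this.ne'⟩
  · push Not at h
    rw [isBelow_iff_of_ne h]
    refine InStrip.center_lt_iff (A.hcurve_inStrip I v _) ?_
    rcases v with c | j
    · simp only [HLine.key_inl]; omega
    · intro e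
      simp only [HLine.key] at e
      exact h j rfl (Fin.ext (by omega))

end SingularGrid

namespace SingularGrid

variable {G : SingularGrid} {A : G.WindingArcs}

/-! ### Position of the peaks relative to the lines -/

/-- The abscissa of the peak of a singular column. -/
def Peaks.colAbs (P : Peaks A) (j : G.SingCol) : ℝ := A.colArc j 0 (P.colPeak j)

/-- The height of the peak of a singular row. -/
def Peaks.rowHgt (P : Peaks A) (i : G.SingRow) : ℝ := A.rowArc i 0 (P.rowPeak i)

theorem Peaks.colArc_colPeak (P : Peaks A) (j : G.SingCol) (b : Fin 2) :
    A.colArc j b (P.colPeak j) = P.colAbs j := by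
  have := (P.col_isPeak j).2.2.1
  obtain rfl | rfl : b = 0 ∨ b = 1 := by omega
  · rfl
  · exact this.symm

theorem Peaks.rowArc_rowPeak (P : Peaks A) (i : G.SingRow) (b : Fin 2) :
    A.rowArc i b (P.rowPeak i) = P.rowHgt i := by
  have := (P.row_isPeak i).2.2.1
  obtain rfl | rfl : b = 0 ∨ b = 1 := by omega
  · rfl
  · exact this.symm

/-- The line `h` of the resolution `K` passes below the peak of the column `j`. -/
def Peaks.HBelow (P : Peaks A) (K : G.Resolution) (h : G.HLine) (j : G.SingCol) : Prop :=
  A.hcurve K h (P.colAbs j) < P.colPeak j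

/-- The line `v` of the resolution `K` passes to the left of the peak of the row `i`. -/
def Peaks.VLeft (P : Peaks A) (K : G.Resolution) (v : G.VLine) (i : G.SingRow) : Prop :=
  A.vcurve K v (P.rowHgt i) < P.rowPeak i

theorem Peaks.hcurve_ne (P : Peaks A) (K : G.Resolution) (h : G.HLine) (j : G.SingCol) :
    A.hcurve K h (P.colAbs j) ≠ P.colPeak j := by
  rcases h with r | i
  · intro e
    have := (P.col_isPeak j).2.2.1
    refine (A.col_winding j).crossings_off_lines (r : ℕ) ?_
    simp only [WindingArcs.hcurve] at e
    rw [Int.cast_natCast, e, this]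
  · exact A.col_crossing_off j i _ _ (P.col_isPeak j).2.2.1

theorem Peaks.vcurve_ne (P : Peaks A) (K : G.Resolution) (v : G.VLine) (i : G.SingRow) :
    A.vcurve K v (P.rowHgt i) ≠ P.rowPeak i := by
  rcases v with r | j
  · intro e
    have := (P.row_isPeak i).2.2.1
    refine (A.row_winding i).crossings_off_lines (r : ℕ) ?_
    simp only [WindingArcs.vcurve] at e
    rw [Int.cast_natCast, e, this]
  · exact A.row_crossing_off i j _ _ (P.row_isPeak i).2.2.1

theorem Peaks.hBelow_congr (P : Peaks A) {I J : G.Resolution} {h : G.HLine} (j : G.SingCol)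
    (hh : ∀ e, h.roc = some e → I e = J e) : P.HBelow I h j ↔ P.HBelow J h j := by
  unfold Peaks.HBelow
  rw [WindingArcs.hcurve_congr hh]

theorem Peaks.vLeft_congr (P : Peaks A) {I J : G.Resolution} {v : G.VLine} (i : G.SingRow)
    (hh : ∀ e, v.roc = some e → I e = J e) : P.VLeft I v i ↔ P.VLeft J v i := by
  unfold Peaks.VLeft
  rw [WindingArcs.vcurve_congr hh]

/-- If the two arcs of a row pass on different sides of the peak of a column, then the arcs of the
column pass on the same side of the peak of the row, the side of the peak of the column. -/
theorem Peaks.vLeft_iff_of_hBelow_ne (P : Peaks A) {j : G.SingCol} {i : G.SingRow}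
    {K K' : G.Resolution} (h : ¬ (P.HBelow K (.inr i) j ↔ P.HBelow K' (.inr i) j))
    (L : G.Resolution) : P.VLeft L (.inr j) i ↔ P.colAbs j < P.rowPeak i := by
  wlog hK : P.HBelow K (.inr i) j generalizing K K'
  · exact this (K := K') (K' := K) (by tauto) (by tauto)
  have hK' : ¬ P.HBelow K' (.inr i) j := by tauto
  obtain ⟨a₀, b₀, h₀⟩ := A.crossing j i (L (.inl j)) (K (.inr i))
  obtain ⟨a₁, b₁, h₁⟩ := A.crossing j i (L (.inl j)) (K' (.inr i))
  have e := P.colArc_colPeak j (L (.inl j))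
  have := h₀.lt_iff_of_between h₁ (p := P.colPeak j) (q := P.rowPeak i)
    (by rw [P.rowArc_rowPeak, P.rowArc_rowPeak]) (by rw [e]; exact hK)
    (by rw [e]; exact lt_of_le_of_ne (not_lt.1 hK') (P.hcurve_ne K' (.inr i) j).symm)
  rw [e, P.rowArc_rowPeak] at this
  exact this

theorem Peaks.hBelow_iff_of_vLeft_ne (P : Peaks A) {j : G.SingCol} {i : G.SingRow}
    {K K' : G.Resolution} (h : ¬ (P.VLeft K (.inr j) i ↔ P.VLeft K' (.inr j) i))
    (L : G.Resolution) : P.HBelow L (.inr i) j ↔ P.rowHgt i < P.colPeak j := by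
  wlog hK : P.VLeft K (.inr j) i generalizing K K'
  · exact this (K := K') (K' := K) (by tauto) (by tauto)
  have hK' : ¬ P.VLeft K' (.inr j) i := by tauto
  obtain ⟨a₀, b₀, h₀⟩ := A.crossing j i (K (.inl j)) (L (.inr i))
  obtain ⟨a₁, b₁, h₁⟩ := A.crossing j i (K' (.inl j)) (L (.inr i))
  have e := P.rowArc_rowPeak i (L (.inr i))
  have := h₀.symm.lt_iff_of_between h₁.symm (p := P.rowPeak i) (q := P.colPeak j)
    (by rw [P.colArc_colPeak, P.colArc_colPeak]) (by rw [e]; exact hK)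
    (by rw [e]; exact lt_of_le_of_ne (not_lt.1 hK') (P.vcurve_ne K' (.inr j) i).symm)
  rw [e, P.colArc_colPeak] at this
  exact this

theorem Peaks.colAbs_ne_rowPeak (P : Peaks A) {j : G.SingCol} {i : G.SingRow}
    {K K' : G.Resolution} (h : ¬ (P.HBelow K (.inr i) j ↔ P.HBelow K' (.inr i) j)) :
    P.colAbs j ≠ P.rowPeak i := by
  intro e
  apply h
  unfold Peaks.HBelow
  simp only [WindingArcs.hcurve, e, P.rowArc_rowPeak]

theorem Peaks.rowHgt_ne_colPeak (P : Peaks A) {j : G.SingCol} {i : G.SingRow}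
    {K K' : G.Resolution} (h : ¬ (P.VLeft K (.inr j) i ↔ P.VLeft K' (.inr j) i)) :
    P.rowHgt i ≠ P.colPeak j := by
  intro e
  apply h
  unfold Peaks.VLeft
  simp only [WindingArcs.vcurve, e, P.colArc_colPeak]

/-! ### Crossing numbers of the sides of a polygon -/

namespace Quad

/-- The resolution carrying the west side at height `t`; similarly for the other sides. -/
def resW (P : Peaks A) (π : G.Quad) (t : ℝ) : G.Resolution :=
  if t ≤ π.bend P .west then π.start.1 else π.finish.1

def resE (P : Peaks A) (π : G.Quad) (t : ℝ) : G.Resolution :=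
  if t ≤ π.bend P .east then π.finish.1 else π.start.1

def resS (P : Peaks A) (π : G.Quad) (s : ℝ) : G.Resolution :=
  if s ≤ π.bend P .south then π.start.1 else π.finish.1

def resN (P : Peaks A) (π : G.Quad) (s : ℝ) : G.Resolution :=
  if s ≤ π.bend P .north then π.finish.1 else π.start.1

/-- Horizontal translation of the east side. -/
def wrapH (π : G.Quad) : ℤ := if π.west.key < π.east.key then 0 else 1

/-- Vertical translation of the north side. -/
def wrapV (π : G.Quad) : ℤ := if π.south.key < π.north.key then 0 else 1

theorem westSide_eq (P : Peaks A) (π : G.Quad) (t : ℝ) :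
    π.westSide P t = A.vcurve (π.resW P t) π.west t := by
  unfold westSide resW; split_ifs <;> rfl

theorem eastSide_eq (P : Peaks A) (π : G.Quad) (t : ℝ) :
    π.eastSide P t = π.wrapH * G.cols + A.vcurve (π.resE P t) π.east t := by
  unfold eastSide resE wrapH; split_ifs <;> simp

theorem southSide_eq (P : Peaks A) (π : G.Quad) (s : ℝ) :
    π.southSide P s = A.hcurve (π.resS P s) π.south s := by
  unfold southSide resS; split_ifs <;> rfl

theorem northSide_eq (P : Peaks A) (π : G.Quad) (s : ℝ) :
    π.northSide P s = π.wrapV * G.rows + A.hcurve (π.resN P s) π.north s := by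
  unfold northSide resN wrapV; split_ifs <;> simp

theorem exists_lift_eq (base period p : ℝ) :
    ∃ k : ℤ, lift base period p = p + k * period := by
  unfold lift
  split_ifs
  · exact ⟨1, by simp⟩
  · exact ⟨0, by simp⟩

theorem vcurve_bend (P : Peaks A) (j : G.SingCol) (K : G.Resolution) (base : ℝ) :
    A.vcurve K (.inr j) (lift base G.rows (P.colPeak j)) = P.colAbs j := by
  obtain ⟨k, hk⟩ := exists_lift_eq base G.rows (P.colPeak j)
  rw [hk, A.vcurve_shift]
  exact P.colArc_colPeak j _

theorem hcurve_bend (P : Peaks A) (i : G.SingRow) (K : G.Resolution) (base : ℝ) :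
    A.hcurve K (.inr i) (lift base G.cols (P.rowPeak i)) = P.rowHgt i := by
  obtain ⟨k, hk⟩ := exists_lift_eq base G.cols (P.rowPeak i)
  rw [hk, A.hcurve_shift]
  exact P.rowArc_rowPeak i _

theorem hcurve_lift_iff (P : Peaks A) {s n : G.HLine} (hne : s ≠ n) (j : G.SingCol)
    (K L : G.Resolution) :
    (A.hcurve K s (P.colAbs j) < lift s.idx G.rows (P.colPeak j) ∧
      lift s.idx G.rows (P.colPeak j) <
        (if s.key < n.key then 0 else (G.rows : ℝ)) + A.hcurve L n (P.colAbs j)) ↔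
    ind (n.key < s.key) + ind (P.HBelow K s j) - ind (P.HBelow L n j) = 1 := by
  rw [HLine.idx_eq]
  exact lift_between_iff (A.hcurve_inStrip K s _) (A.hcurve_inStrip L n _)
    (fun e => hne (HLine.key_injective e)) (P.hcurve_ne K s j) (P.hcurve_ne L n j)
    (P.col_isPeak j).1 (P.col_isPeak j).2.1 s.idx_add_one_le n.idx_add_one_le

theorem vcurve_lift_iff (P : Peaks A) {w e : G.VLine} (hne : w ≠ e) (i : G.SingRow)
    (K L : G.Resolution) :
    (A.vcurve K w (P.rowHgt i) < lift w.idx G.cols (P.rowPeak i) ∧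
      lift w.idx G.cols (P.rowPeak i) <
        (if w.key < e.key then 0 else (G.cols : ℝ)) + A.vcurve L e (P.rowHgt i)) ↔
    ind (e.key < w.key) + ind (P.VLeft K w i) - ind (P.VLeft L e i) = 1 := by
  rw [VLine.idx_eq]
  exact lift_between_iff (A.vcurve_inStrip K w _) (A.vcurve_inStrip L e _)
    (fun e => hne (VLine.key_injective e)) (P.vcurve_ne K w i) (P.vcurve_ne L e i)
    (P.row_isPeak i).1 (P.row_isPeak i).2.1 w.idx_add_one_le e.idx_add_one_le

variable {P : Peaks A} {π : G.Quad}

theorem wrapV_cast : (π.wrapV : ℝ) * G.rows = if π.south.key < π.north.key then 0 else (G.rows : ℝ) := by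
  unfold wrapV; split_ifs <;> simp

theorem wrapH_cast : (π.wrapH : ℝ) * G.cols = if π.west.key < π.east.key then 0 else (G.cols : ℝ) := by
  unfold wrapH; split_ifs <;> simp

theorem south_ne_north (h : π.west ≠ π.east) : π.south ≠ π.north :=
  fun e => h (π.start.2.injective e)

theorem peakOnSide_west_iff (hne : π.west ≠ π.east) {j : G.SingCol} (hj : π.west = .inr j) :
    π.PeakOnSide P .west ↔ ind (π.north.key < π.south.key) +
      ind (P.HBelow (π.resS P (P.colAbs j)) π.south j) -
      ind (P.HBelow (π.resN P (P.colAbs j)) π.north j) = 1 := by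
  have hb : π.bend P .west = lift π.south.idx G.rows (P.colPeak j) := by
    simp only [bend, hj, Peaks.onV]
  have hw : π.westSide P (π.bend P .west) = P.colAbs j := by
    rw [westSide_eq, hj, hb, vcurve_bend]
  simp only [PeakOnSide]
  rw [hw, hb, southSide_eq, northSide_eq, wrapV_cast]
  exact hcurve_lift_iff P (south_ne_north hne) j _ _

theorem peakOnSide_east_iff (hne : π.west ≠ π.east) {j : G.SingCol} (hj : π.east = .inr j) :
    π.PeakOnSide P .east ↔ ind (π.north.key < π.south.key) +
      ind (P.HBelow (π.resS P (π.wrapH * G.cols + P.colAbs j)) π.south j) -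
      ind (P.HBelow (π.resN P (π.wrapH * G.cols + P.colAbs j)) π.north j) = 1 := by
  have hb : π.bend P .east = lift π.south.idx G.rows (P.colPeak j) := by
    simp only [bend, hj, Peaks.onV]
  have hw : π.eastSide P (π.bend P .east) = π.wrapH * G.cols + P.colAbs j := by
    rw [eastSide_eq, hj, hb, vcurve_bend]
  simp only [PeakOnSide]
  rw [hw, hb, southSide_eq, northSide_eq, wrapV_cast]
  have := fun K h => A.hcurve_shift K h (P.colAbs j) π.wrapH
  rw [add_comm _ (P.colAbs j)]
  rw [this, this]
  exact hcurve_lift_iff P (south_ne_north hne) j _ _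

theorem peakOnSide_south_iff (hne : π.west ≠ π.east) {i : G.SingRow} (hi : π.south = .inr i) :
    π.PeakOnSide P .south ↔ ind (π.east.key < π.west.key) +
      ind (P.VLeft (π.resW P (P.rowHgt i)) π.west i) -
      ind (P.VLeft (π.resE P (P.rowHgt i)) π.east i) = 1 := by
  have hb : π.bend P .south = lift π.west.idx G.cols (P.rowPeak i) := by
    simp only [bend, hi, Peaks.onH]
  have hw : π.southSide P (π.bend P .south) = P.rowHgt i := by
    rw [southSide_eq, hi, hb, hcurve_bend]
  simp only [PeakOnSide]
  rw [hw, hb, westSide_eq, eastSide_eq, wrapH_cast]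
  exact vcurve_lift_iff P hne i _ _

theorem peakOnSide_north_iff (hne : π.west ≠ π.east) {i : G.SingRow} (hi : π.north = .inr i) :
    π.PeakOnSide P .north ↔ ind (π.east.key < π.west.key) +
      ind (P.VLeft (π.resW P (π.wrapV * G.rows + P.rowHgt i)) π.west i) -
      ind (P.VLeft (π.resE P (π.wrapV * G.rows + P.rowHgt i)) π.east i) = 1 := by
  have hb : π.bend P .north = lift π.west.idx G.cols (P.rowPeak i) := by
    simp only [bend, hi, Peaks.onH]
  have hw : π.northSide P (π.bend P .north) = π.wrapV * G.rows + P.rowHgt i := by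
    rw [northSide_eq, hi, hb, hcurve_bend]
  simp only [PeakOnSide]
  rw [hw, hb, westSide_eq, eastSide_eq, wrapH_cast]
  have := fun K h => A.vcurve_shift K h (P.rowHgt i) π.wrapV
  rw [add_comm _ (P.rowHgt i)]
  rw [this, this]
  exact vcurve_lift_iff P hne i _ _

theorem colAbs_inStrip (P : Peaks A) (j : G.SingCol) :
    InStrip (VLine.key (.inr j : G.VLine)) (P.colAbs j) := by
  have := A.vcurve_inStrip (fun _ => 0) (.inr j) (P.colPeak j)
  exact this

theorem rowHgt_inStrip (P : Peaks A) (i : G.SingRow) :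
    InStrip (HLine.key (.inr i : G.HLine)) (P.rowHgt i) := by
  have := A.hcurve_inStrip (fun _ => 0) (.inr i) (P.rowPeak i)
  exact this

/-- If the peak of the column `j` lies between the two arcs of the row `i`, then along a horizontal
side on `i` it comes before the peak of `i` if `j` carries the west side … -/
theorem colAbs_le_lift {w e : G.VLine} (hne : w ≠ e) {i : G.SingRow} {j : G.SingCol}
    (hj : w = .inr j) {K K' : G.Resolution}
    (h : ¬ (P.HBelow K (.inr i) j ↔ P.HBelow K' (.inr i) j))
    (hS : ∃ L L', ind (e.key < w.key) + ind (P.VLeft L w i) - ind (P.VLeft L' e i) = 1) :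
    P.colAbs j ≤ lift w.idx G.cols (P.rowPeak i) := by
  obtain ⟨L, L', hL⟩ := hS
  have h1 := ((vcurve_lift_iff P hne i L L').2 hL).1
  have h2 := P.vLeft_iff_of_hBelow_ne h L
  subst hj
  unfold lift at h1 ⊢
  split_ifs at h1 ⊢ with hZ
  · have h3 := (colAbs_inStrip P j).lt
    have h4 := VLine.idx_add_one_le (.inr j : G.VLine)
    have h5 := (P.row_isPeak i).1
    linarith
  · exact (h2.1 h1).le

/-- … and after it if `j` carries the east side. -/
theorem lift_lt_colAbs {w e : G.VLine} (hne : w ≠ e) {i : G.SingRow} {j : G.SingCol}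
    (hj : e = .inr j) {K K' : G.Resolution}
    (h : ¬ (P.HBelow K (.inr i) j ↔ P.HBelow K' (.inr i) j))
    (hS : ∃ L L', ind (e.key < w.key) + ind (P.VLeft L w i) - ind (P.VLeft L' e i) = 1) :
    lift w.idx G.cols (P.rowPeak i) <
      (if w.key < e.key then 0 else (G.cols : ℝ)) + P.colAbs j := by
  obtain ⟨L, L', hL⟩ := hS
  have h1 := ((vcurve_lift_iff P hne i L L').2 hL).2
  have h2 := P.vLeft_iff_of_hBelow_ne h L'
  have h3 := P.colAbs_ne_rowPeak h
  subst hj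
  have h4 : P.rowPeak i < A.vcurve L' (.inr j) (P.rowHgt i) → P.rowPeak i < P.colAbs j := by
    intro h5
    refine lt_of_le_of_ne (not_lt.1 fun h6 => ?_) h3.symm
    exact absurd (h2.2 h6) (not_lt.2 h5.le)
  have h5 := (P.row_isPeak i).2.1
  have h6 := (colAbs_inStrip P j).le
  have h7 : (0 : ℝ) ≤ ((VLine.key (.inr j : G.VLine) / 2 : ℕ) : ℝ) := Nat.cast_nonneg _
  have h8 := A.vcurve_inStrip L' (.inr j) (P.rowHgt i)
  have h9 := VLine.idx_add_one_le (.inr j : G.VLine)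
  have h10 := h8.lt
  have h11 := (P.row_isPeak i).1
  unfold lift at h1 ⊢
  split_ifs at h1 ⊢ with hZ hW hW
  · linarith
  · linarith [h4 (by linarith)]
  · linarith [h4 (by linarith)]
  · linarith

theorem rowHgt_le_lift {s n : G.HLine} (hne : s ≠ n) {i : G.SingRow} {j : G.SingCol}
    (hi : s = .inr i) {K K' : G.Resolution}
    (h : ¬ (P.VLeft K (.inr j) i ↔ P.VLeft K' (.inr j) i))
    (hS : ∃ L L', ind (n.key < s.key) + ind (P.HBelow L s j) - ind (P.HBelow L' n j) = 1) :
    P.rowHgt i ≤ lift s.idx G.rows (P.colPeak j) := by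
  obtain ⟨L, L', hL⟩ := hS
  have h1 := ((hcurve_lift_iff P hne j L L').2 hL).1
  have h2 := P.hBelow_iff_of_vLeft_ne h L
  subst hi
  unfold lift at h1 ⊢
  split_ifs at h1 ⊢ with hZ
  · have h3 := (rowHgt_inStrip P i).lt
    have h4 := HLine.idx_add_one_le (.inr i : G.HLine)
    have h5 := (P.col_isPeak j).1
    linarith
  · exact (h2.1 h1).le

theorem lift_lt_rowHgt {s n : G.HLine} (hne : s ≠ n) {i : G.SingRow} {j : G.SingCol}
    (hi : n = .inr i) {K K' : G.Resolution}
    (h : ¬ (P.VLeft K (.inr j) i ↔ P.VLeft K' (.inr j) i))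
    (hS : ∃ L L', ind (n.key < s.key) + ind (P.HBelow L s j) - ind (P.HBelow L' n j) = 1) :
    lift s.idx G.rows (P.colPeak j) <
      (if s.key < n.key then 0 else (G.rows : ℝ)) + P.rowHgt i := by
  obtain ⟨L, L', hL⟩ := hS
  have h1 := ((hcurve_lift_iff P hne j L L').2 hL).2
  have h2 := P.hBelow_iff_of_vLeft_ne h L'
  have h3 := P.rowHgt_ne_colPeak h
  subst hi
  have h4 : P.colPeak j < A.hcurve L' (.inr i) (P.colAbs j) → P.colPeak j < P.rowHgt i := by
    intro h5
    refine lt_of_le_of_ne (not_lt.1 fun h6 => ?_) h3.symm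
    exact absurd (h2.2 h6) (not_lt.2 h5.le)
  have h5 := (P.col_isPeak j).2.1
  have h6 := (rowHgt_inStrip P i).le
  have h7 : (0 : ℝ) ≤ ((HLine.key (.inr i : G.HLine) / 2 : ℕ) : ℝ) := Nat.cast_nonneg _
  have h8 := A.hcurve_inStrip L' (.inr i) (P.colAbs j)
  have h9 := HLine.idx_add_one_le (.inr i : G.HLine)
  have h10 := h8.lt
  have h11 := (P.col_isPeak j).1
  unfold lift at h1 ⊢
  split_ifs at h1 ⊢ with hZ hW hW
  · linarith
  · linarith [h4 (by linarith)]
  · linarith [h4 (by linarith)]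
  · linarith

end Quad

/-- The line `h` passes below the peak on the line `v`, as a number; zero if `v` is straight. -/
def Peaks.hb (P : Peaks A) (K : G.Resolution) (h : G.HLine) : G.VLine → ℤ
  | .inl _ => 0
  | .inr j => ind (P.HBelow K h j)

/-- The line `v` passes to the left of the peak on the line `h`, as a number; zero if `h` is
straight. -/
def Peaks.vl (P : Peaks A) (K : G.Resolution) (v : G.VLine) : G.HLine → ℤ
  | .inl _ => 0
  | .inr i => ind (P.VLeft K v i)

namespace Quad

variable {P : Peaks A} {π : G.Quad}

/-- Crossing numbers of the sides with the peaks of their lines. At its corners in `start` a side is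
compared with the peak in the resolution of `start`, at its corners in `finish` in the resolution of
`finish`. -/
def cr (P : Peaks A) (π : G.Quad) : Compass → ℤ
  | .west => ind (π.north.key < π.south.key) + P.hb π.start.1 π.south π.west -
      P.hb π.finish.1 π.north π.west
  | .east => ind (π.north.key < π.south.key) + P.hb π.finish.1 π.south π.east -
      P.hb π.start.1 π.north π.east
  | .south => ind (π.east.key < π.west.key) + P.vl π.start.1 π.west π.south -
      P.vl π.finish.1 π.east π.south
  | .north => ind (π.east.key < π.west.key) + P.vl π.finish.1 π.west π.north -
      P.vl π.start.1 π.east π.north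

/-- The column `j`, at a vertical side, has its peak somewhere between the horizontal sides. -/
def OnV (P : Peaks A) (π : G.Quad) (j : G.SingCol) : Prop :=
  ∃ L L', ind (π.north.key < π.south.key) + ind (P.HBelow L π.south j) -
    ind (P.HBelow L' π.north j) = 1

/-- The row `i`, at a horizontal side, has its peak somewhere between the vertical sides. -/
def OnH (P : Peaks A) (π : G.Quad) (i : G.SingRow) : Prop :=
  ∃ L L', ind (π.east.key < π.west.key) + ind (P.VLeft L π.west i) -
    ind (P.VLeft L' π.east i) = 1

theorem mem_peakSides {d : Compass} :
    d ∈ π.peakSides ↔ ∃ e, π.sideRoC d = some e ∧ π.start.1 e ≠ π.finish.1 e := by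
  simp [peakSides]

theorem hBelow_resS {j : G.SingCol} {s : ℝ} {K : G.Resolution}
    (hK : K = π.start.1 ∨ K = π.finish.1)
    (h : ∀ i, π.south = .inr i → π.start.1 (.inr i) ≠ π.finish.1 (.inr i) →
      ¬ (P.HBelow π.start.1 (.inr i) j ↔ P.HBelow π.finish.1 (.inr i) j) → π.resS P s = K) :
    P.HBelow (π.resS P s) π.south j ↔ P.HBelow K π.south j := by
  have hres : π.resS P s = π.start.1 ∨ π.resS P s = π.finish.1 := by
    unfold resS; split_ifs <;> simp
  by_cases hw : P.HBelow π.start.1 π.south j ↔ P.HBelow π.finish.1 π.south j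
  · rcases hres with e | e <;> rcases hK with rfl | rfl <;> rw [e] <;> tauto
  · rcases hs : π.south with r | i
    · exact P.hBelow_congr j (by rintro e ⟨⟩)
    · rw [hs] at hw
      rw [h i hs (fun e => hw (P.hBelow_congr j (by rintro _ ⟨⟩; exact e))) hw]

theorem hBelow_resN {j : G.SingCol} {s : ℝ} {K : G.Resolution}
    (hK : K = π.start.1 ∨ K = π.finish.1)
    (h : ∀ i, π.north = .inr i → π.start.1 (.inr i) ≠ π.finish.1 (.inr i) →
      ¬ (P.HBelow π.start.1 (.inr i) j ↔ P.HBelow π.finish.1 (.inr i) j) → π.resN P s = K) :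
    P.HBelow (π.resN P s) π.north j ↔ P.HBelow K π.north j := by
  have hres : π.resN P s = π.start.1 ∨ π.resN P s = π.finish.1 := by
    unfold resN; split_ifs <;> simp
  by_cases hw : P.HBelow π.start.1 π.north j ↔ P.HBelow π.finish.1 π.north j
  · rcases hres with e | e <;> rcases hK with rfl | rfl <;> rw [e] <;> tauto
  · rcases hs : π.north with r | i
    · exact P.hBelow_congr j (by rintro e ⟨⟩)
    · rw [hs] at hw
      rw [h i hs (fun e => hw (P.hBelow_congr j (by rintro _ ⟨⟩; exact e))) hw]

theorem vLeft_resW {i : G.SingRow} {t : ℝ} {K : G.Resolution}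
    (hK : K = π.start.1 ∨ K = π.finish.1)
    (h : ∀ j, π.west = .inr j → π.start.1 (.inl j) ≠ π.finish.1 (.inl j) →
      ¬ (P.VLeft π.start.1 (.inr j) i ↔ P.VLeft π.finish.1 (.inr j) i) → π.resW P t = K) :
    P.VLeft (π.resW P t) π.west i ↔ P.VLeft K π.west i := by
  have hres : π.resW P t = π.start.1 ∨ π.resW P t = π.finish.1 := by
    unfold resW; split_ifs <;> simp
  by_cases hw : P.VLeft π.start.1 π.west i ↔ P.VLeft π.finish.1 π.west i
  · rcases hres with e | e <;> rcases hK with rfl | rfl <;> rw [e] <;> tauto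
  · rcases hs : π.west with r | j
    · exact P.vLeft_congr i (by rintro e ⟨⟩)
    · rw [hs] at hw
      rw [h j hs (fun e => hw (P.vLeft_congr i (by rintro _ ⟨⟩; exact e))) hw]

theorem vLeft_resE {i : G.SingRow} {t : ℝ} {K : G.Resolution}
    (hK : K = π.start.1 ∨ K = π.finish.1)
    (h : ∀ j, π.east = .inr j → π.start.1 (.inl j) ≠ π.finish.1 (.inl j) →
      ¬ (P.VLeft π.start.1 (.inr j) i ↔ P.VLeft π.finish.1 (.inr j) i) → π.resE P t = K) :
    P.VLeft (π.resE P t) π.east i ↔ P.VLeft K π.east i := by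
  have hres : π.resE P t = π.start.1 ∨ π.resE P t = π.finish.1 := by
    unfold resE; split_ifs <;> simp
  by_cases hw : P.VLeft π.start.1 π.east i ↔ P.VLeft π.finish.1 π.east i
  · rcases hres with e | e <;> rcases hK with rfl | rfl <;> rw [e] <;> tauto
  · rcases hs : π.east with r | j
    · exact P.vLeft_congr i (by rintro e ⟨⟩)
    · rw [hs] at hw
      rw [h j hs (fun e => hw (P.vLeft_congr i (by rintro _ ⟨⟩; exact e))) hw]

section

variable (hne : π.west ≠ π.east)
  (hS : ∀ i, π.south = .inr i → π.start.1 (.inr i) ≠ π.finish.1 (.inr i) → π.OnH P i)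
  (hN : ∀ i, π.north = .inr i → π.start.1 (.inr i) ≠ π.finish.1 (.inr i) → π.OnH P i)
  (hW : ∀ j, π.west = .inr j → π.start.1 (.inl j) ≠ π.finish.1 (.inl j) → π.OnV P j)
  (hE : ∀ j, π.east = .inr j → π.start.1 (.inl j) ≠ π.finish.1 (.inl j) → π.OnV P j)

include hne hS hN in
theorem peakOnSide_west_iff_cr {j : G.SingCol} (hj : π.west = .inr j) :
    π.PeakOnSide P .west ↔ π.cr P .west = 1 := by
  rw [peakOnSide_west_iff hne hj]
  have e1 : P.HBelow (π.resS P (P.colAbs j)) π.south j ↔ P.HBelow π.start.1 π.south j := by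
    refine hBelow_resS (Or.inl rfl) fun i hi hf hw => if_pos ?_
    have := colAbs_le_lift hne hj hw (hS i hi hf)
    simpa only [bend, hi, Peaks.onH] using this
  have e2 : P.HBelow (π.resN P (P.colAbs j)) π.north j ↔ P.HBelow π.finish.1 π.north j := by
    refine hBelow_resN (Or.inr rfl) fun i hi hf hw => if_pos ?_
    have := colAbs_le_lift hne hj hw (hN i hi hf)
    simpa only [bend, hi, Peaks.onH] using this
  rw [ind_congr e1, ind_congr e2]
  simp only [cr, hj, Peaks.hb]

include hne hS hN in
theorem peakOnSide_east_iff_cr {j : G.SingCol} (hj : π.east = .inr j) :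
    π.PeakOnSide P .east ↔ π.cr P .east = 1 := by
  rw [peakOnSide_east_iff hne hj]
  have e1 : P.HBelow (π.resS P (π.wrapH * G.cols + P.colAbs j)) π.south j ↔
      P.HBelow π.finish.1 π.south j := by
    refine hBelow_resS (Or.inr rfl) fun i hi hf hw => if_neg ?_
    have := lift_lt_colAbs hne hj hw (hS i hi hf)
    rw [not_le, wrapH_cast]
    simpa only [bend, hi, Peaks.onH] using this
  have e2 : P.HBelow (π.resN P (π.wrapH * G.cols + P.colAbs j)) π.north j ↔
      P.HBelow π.start.1 π.north j := by
    refine hBelow_resN (Or.inl rfl) fun i hi hf hw => if_neg ?_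
    have := lift_lt_colAbs hne hj hw (hN i hi hf)
    rw [not_le, wrapH_cast]
    simpa only [bend, hi, Peaks.onH] using this
  rw [ind_congr e1, ind_congr e2]
  simp only [cr, hj, Peaks.hb]

include hne hW hE in
theorem peakOnSide_south_iff_cr {i : G.SingRow} (hi : π.south = .inr i) :
    π.PeakOnSide P .south ↔ π.cr P .south = 1 := by
  rw [peakOnSide_south_iff hne hi]
  have e1 : P.VLeft (π.resW P (P.rowHgt i)) π.west i ↔ P.VLeft π.start.1 π.west i := by
    refine vLeft_resW (Or.inl rfl) fun j hj hf hw => if_pos ?_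
    have := rowHgt_le_lift (south_ne_north hne) hi hw (hW j hj hf)
    simpa only [bend, hj, Peaks.onV] using this
  have e2 : P.VLeft (π.resE P (P.rowHgt i)) π.east i ↔ P.VLeft π.finish.1 π.east i := by
    refine vLeft_resE (Or.inr rfl) fun j hj hf hw => if_pos ?_
    have := rowHgt_le_lift (south_ne_north hne) hi hw (hE j hj hf)
    simpa only [bend, hj, Peaks.onV] using this
  rw [ind_congr e1, ind_congr e2]
  simp only [cr, hi, Peaks.vl]

include hne hW hE in
theorem peakOnSide_north_iff_cr {i : G.SingRow} (hi : π.north = .inr i) :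
    π.PeakOnSide P .north ↔ π.cr P .north = 1 := by
  rw [peakOnSide_north_iff hne hi]
  have e1 : P.VLeft (π.resW P (π.wrapV * G.rows + P.rowHgt i)) π.west i ↔
      P.VLeft π.finish.1 π.west i := by
    refine vLeft_resW (Or.inr rfl) fun j hj hf hw => if_neg ?_
    have := lift_lt_rowHgt (south_ne_north hne) hi hw (hW j hj hf)
    rw [not_le, wrapV_cast]
    simpa only [bend, hj, Peaks.onV] using this
  have e2 : P.VLeft (π.resE P (π.wrapV * G.rows + P.rowHgt i)) π.east i ↔
      P.VLeft π.start.1 π.east i := by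
    refine vLeft_resE (Or.inl rfl) fun j hj hf hw => if_neg ?_
    have := lift_lt_rowHgt (south_ne_north hne) hi hw (hE j hj hf)
    rw [not_le, wrapV_cast]
    simpa only [bend, hj, Peaks.onV] using this
  rw [ind_congr e1, ind_congr e2]
  simp only [cr, hi, Peaks.vl]

end

/-- The peaks of a polygon lie on their sides precisely if all their crossing numbers are one. -/
theorem forall_peakOnSide_iff (hne : π.west ≠ π.east) :
    (∀ d ∈ π.peakSides, π.PeakOnSide P d) ↔ ∀ d ∈ π.peakSides, π.cr P d = 1 := by
  have mW : ∀ j, π.west = .inr j → π.start.1 (.inl j) ≠ π.finish.1 (.inl j) →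
      Compass.west ∈ π.peakSides := fun j hj hf =>
    mem_peakSides.2 ⟨.inl j, by simp [sideRoC, hj, VLine.roc], hf⟩
  have mE : ∀ j, π.east = .inr j → π.start.1 (.inl j) ≠ π.finish.1 (.inl j) →
      Compass.east ∈ π.peakSides := fun j hj hf =>
    mem_peakSides.2 ⟨.inl j, by simp [sideRoC, hj, VLine.roc], hf⟩
  have mS : ∀ i, π.south = .inr i → π.start.1 (.inr i) ≠ π.finish.1 (.inr i) →
      Compass.south ∈ π.peakSides := fun j hj hf =>
    mem_peakSides.2 ⟨.inr j, by simp [sideRoC, hj, HLine.roc], hf⟩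
  have mN : ∀ i, π.north = .inr i → π.start.1 (.inr i) ≠ π.finish.1 (.inr i) →
      Compass.north ∈ π.peakSides := fun j hj hf =>
    mem_peakSides.2 ⟨.inr j, by simp [sideRoC, hj, HLine.roc], hf⟩
  have key : ((∀ d ∈ π.peakSides, π.PeakOnSide P d) ∨ ∀ d ∈ π.peakSides, π.cr P d = 1) →
      ∀ d ∈ π.peakSides, (π.PeakOnSide P d ↔ π.cr P d = 1) := by
    intro h
    have hW : ∀ j, π.west = .inr j → π.start.1 (.inl j) ≠ π.finish.1 (.inl j) → π.OnV P j := by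
      intro j hj hf
      rcases h with h | h
      · exact ⟨_, _, (peakOnSide_west_iff hne hj).1 (h _ (mW j hj hf))⟩
      · have := h _ (mW j hj hf)
        simp only [cr, hj, Peaks.hb] at this
        exact ⟨_, _, this⟩
    have hE : ∀ j, π.east = .inr j → π.start.1 (.inl j) ≠ π.finish.1 (.inl j) → π.OnV P j := by
      intro j hj hf
      rcases h with h | h
      · exact ⟨_, _, (peakOnSide_east_iff hne hj).1 (h _ (mE j hj hf))⟩
      · have := h _ (mE j hj hf)
        simp only [cr, hj, Peaks.hb] at this
        exact ⟨_, _, this⟩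
    have hS : ∀ i, π.south = .inr i → π.start.1 (.inr i) ≠ π.finish.1 (.inr i) → π.OnH P i := by
      intro j hj hf
      rcases h with h | h
      · exact ⟨_, _, (peakOnSide_south_iff hne hj).1 (h _ (mS j hj hf))⟩
      · have := h _ (mS j hj hf)
        simp only [cr, hj, Peaks.vl] at this
        exact ⟨_, _, this⟩
    have hN : ∀ i, π.north = .inr i → π.start.1 (.inr i) ≠ π.finish.1 (.inr i) → π.OnH P i := by
      intro j hj hf
      rcases h with h | h
      · exact ⟨_, _, (peakOnSide_north_iff hne hj).1 (h _ (mN j hj hf))⟩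
      · have := h _ (mN j hj hf)
        simp only [cr, hj, Peaks.vl] at this
        exact ⟨_, _, this⟩
    intro d hd
    obtain ⟨e, he, -⟩ := mem_peakSides.1 hd
    rcases d
    · rcases hs : π.north with r | i
      · simp [sideRoC, hs, HLine.roc] at he
      · exact peakOnSide_north_iff_cr hne hW hE hs
    · rcases hs : π.south with r | i
      · simp [sideRoC, hs, HLine.roc] at he
      · exact peakOnSide_south_iff_cr hne hW hE hs
    · rcases hs : π.east with r | i
      · simp [sideRoC, hs, VLine.roc] at he
      · exact peakOnSide_east_iff_cr hne hS hN hs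
    · rcases hs : π.west with r | i
      · simp [sideRoC, hs, VLine.roc] at he
      · exact peakOnSide_west_iff_cr hne hS hN hs
  constructor
  · intro h d hd
    exact (key (Or.inl h) d hd).1 (h d hd)
  · intro h d hd
    exact (key (Or.inr h) d hd).2 (h d hd)

end Quad

end SingularGrid

/-! ### Empty grid polygons in terms of rectangles and crossing numbers -/

/-- A line between two others, on a circle of length `N`. -/
theorem shift_between {ka kb kc : ℕ} {a b c N : ℝ} (ha : InStrip ka a)
    (hb : InStrip kb b) (hc : InStrip kc c) (h : SingularGrid.CycBetween ka kb kc)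
    (hN : ((ka / 2 : ℕ) : ℝ) + 1 ≤ N) (hN' : ((kb / 2 : ℕ) : ℝ) + 1 ≤ N) :
    a < b + ((if ka < kb then 0 else 1 : ℤ) : ℝ) * N ∧
      b + ((if ka < kb then 0 else 1 : ℤ) : ℝ) * N < (if ka < kc then 0 else N) + c := by
  have hb0 : (0 : ℝ) ≤ ((kb / 2 : ℕ) : ℝ) := Nat.cast_nonneg _
  have hc0 : (0 : ℝ) ≤ ((kc / 2 : ℕ) : ℝ) := Nat.cast_nonneg _
  have := ha.lt
  have := hb.le
  have := hb.lt
  have := hc.le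
  unfold SingularGrid.CycBetween at h
  by_cases h1 : ka < kb
  · rw [if_pos h1, Int.cast_zero, zero_mul, add_zero]
    refine ⟨ha.lt_of_lt hb h1, ?_⟩
    split_ifs with h2
    · simpa using hb.lt_of_lt hc (by omega)
    · linarith
  · rw [if_neg h1, if_neg (by omega : ¬ ka < kc), Int.cast_one, one_mul]
    have := hb.lt_of_lt hc (by omega)
    exact ⟨by linarith, by linarith⟩

theorem exists_shift_between_iff {ka kb kc : ℕ} {a b c N : ℝ} (ha : InStrip ka a)
    (hb : InStrip kb b) (hc : InStrip kc c) (hab : ka ≠ kb) (hbc : kb ≠ kc) (hac : ka ≠ kc)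
    (hN : ((ka / 2 : ℕ) : ℝ) + 1 ≤ N) (hN' : ((kb / 2 : ℕ) : ℝ) + 1 ≤ N)
    (hN'' : ((kc / 2 : ℕ) : ℝ) + 1 ≤ N) :
    (∃ k : ℤ, a < b + k * N ∧ b + k * N < (if ka < kc then 0 else N) + c) ↔
      SingularGrid.CycBetween ka kb kc := by
  have ha0 : (0 : ℝ) ≤ ((ka / 2 : ℕ) : ℝ) := Nat.cast_nonneg _
  have hb0 : (0 : ℝ) ≤ ((kb / 2 : ℕ) : ℝ) := Nat.cast_nonneg _
  have hc0 : (0 : ℝ) ≤ ((kc / 2 : ℕ) : ℝ) := Nat.cast_nonneg _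
  have := ha.le
  have := ha.lt
  have := hb.le
  have := hb.lt
  have := hc.le
  have := hc.lt
  unfold SingularGrid.CycBetween
  constructor
  · rintro ⟨k, h1, h2⟩
    have hk0 : 0 ≤ k := by
      by_contra hk
      have : (k : ℝ) ≤ -1 := by exact_mod_cast (by omega : k ≤ -1)
      nlinarith
    have hk1 : k ≤ 1 := by
      by_contra hk
      have : (2 : ℝ) ≤ k := by exact_mod_cast (by omega : 2 ≤ k)
      have h3 : b + k * N < N + c := lt_of_lt_of_le h2 (by split_ifs <;> linarith)
      nlinarith
    obtain rfl | rfl : k = 0 ∨ k = 1 := by omega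
    · have h4 : a < b := by simpa using h1
      have h5 : ka < kb := by
        by_contra h
        exact absurd (hb.lt_of_lt ha (by omega)) (not_lt.2 h4.le)
      split_ifs at h2 with h6
      · have h7 : kb < kc := by
          by_contra h
          exact absurd (hc.lt_of_lt hb (by omega)) (by push Not; simp at h2; linarith)
        omega
      · omega
    · push_cast at h1 h2
      split_ifs at h2 with h6
      · exfalso; linarith
      · have h7 : kb < kc := by
          by_contra h
          exact absurd (hc.lt_of_lt hb (by omega)) (by push Not; linarith)
        omega
  · intro h
    exact ⟨_, shift_between ha hb hc h hN hN'⟩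

theorem shift_eq_zero_of_between {ka kc : ℕ} {a b c N : ℝ} {k : ℤ} (ha : InStrip ka a)
    (hb : InStrip ka b) (hc : InStrip kc c) (hac : ka ≠ kc)
    (hN : ((ka / 2 : ℕ) : ℝ) + 1 ≤ N) (hN'' : ((kc / 2 : ℕ) : ℝ) + 1 ≤ N)
    (h1 : a < b + k * N) (h2 : b + k * N < (if ka < kc then 0 else N) + c) : k = 0 := by
  have ha0 : (0 : ℝ) ≤ ((ka / 2 : ℕ) : ℝ) := Nat.cast_nonneg _
  have hc0 : (0 : ℝ) ≤ ((kc / 2 : ℕ) : ℝ) := Nat.cast_nonneg _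
  have := ha.le
  have := hb.le
  have := hb.lt
  have := hc.lt
  have hk0 : 0 ≤ k := by
    by_contra hk
    have : (k : ℝ) ≤ -1 := by exact_mod_cast (by omega : k ≤ -1)
    nlinarith
  by_contra hk
  have : (1 : ℝ) ≤ k := by exact_mod_cast (by omega : 1 ≤ k)
  split_ifs at h2 with h3
  · nlinarith
  · have := hc.lt_of_lt hb (by omega)
    nlinarith

theorem shift_eq_of_between {ka kc : ℕ} {a b c N : ℝ} {k : ℤ} (ha : InStrip ka a)
    (hb : InStrip kc b) (hc : InStrip kc c) (hac : ka ≠ kc)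
    (hN : ((ka / 2 : ℕ) : ℝ) + 1 ≤ N) (hN'' : ((kc / 2 : ℕ) : ℝ) + 1 ≤ N)
    (h1 : a < b + k * N) (h2 : b + k * N < (if ka < kc then 0 else N) + c) :
    k = if ka < kc then 0 else 1 := by
  have ha0 : (0 : ℝ) ≤ ((ka / 2 : ℕ) : ℝ) := Nat.cast_nonneg _
  have hc0 : (0 : ℝ) ≤ ((kc / 2 : ℕ) : ℝ) := Nat.cast_nonneg _
  have := ha.le
  have := ha.lt
  have := hb.le
  have := hb.lt
  have := hc.le
  have := hc.lt
  split_ifs at h2 ⊢ with h3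
  · have hk0 : 0 ≤ k := by
      by_contra hk
      have : (k : ℝ) ≤ -1 := by exact_mod_cast (by omega : k ≤ -1)
      nlinarith
    by_contra hk
    have : (1 : ℝ) ≤ k := by exact_mod_cast (by omega : 1 ≤ k)
    nlinarith
  · have h4 := hb.lt_of_lt ha (by omega)
    have hk0 : 1 ≤ k := by
      by_contra hk
      have : (k : ℝ) ≤ 0 := by exact_mod_cast (by omega : k ≤ 0)
      nlinarith
    by_contra hk
    have : (2 : ℝ) ≤ k := by exact_mod_cast (by omega : 2 ≤ k)
    nlinarith

namespace SingularGrid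

variable {G : SingularGrid} {A : G.WindingArcs}

/-- The dot of a generator on the line `v`. -/
theorem WindingArcs.exists_dot (A : G.WindingArcs) (I : G.Resolution) (v : G.VLine) (h : G.HLine) :
    ∃ s t : ℝ, s = A.vcurve I v t ∧ t = A.hcurve I h s := by
  rcases v with c | j
  · exact ⟨(c : ℕ), _, rfl, rfl⟩
  · rcases h with r | i
    · exact ⟨_, (r : ℕ), rfl, rfl⟩
    · obtain ⟨x, y, h⟩ := A.crossing j i (I (.inl j)) (I (.inr i))
      exact ⟨x, y, h.left_eq, h.right_eq⟩

/-- Crossing number of a vertical side on a singular column with its peak. -/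
theorem Peaks.crossV_eq (P : Peaks A) {s n : G.HLine} (hne : s ≠ n) (K L : G.Resolution)
    (j : G.SingCol) :
    ind (n.key < s.key) + ind (P.HBelow K s j) - ind (P.HBelow L n j) = 0 ∨
      ind (n.key < s.key) + ind (P.HBelow K s j) - ind (P.HBelow L n j) = 1 := by
  have hk : s.key ≠ n.key := fun e => hne (HLine.key_injective e)
  unfold Peaks.HBelow
  have hs := A.hcurve_inStrip K s (P.colAbs j)
  have hn := A.hcurve_inStrip L n (P.colAbs j)
  rcases Nat.lt_or_gt_of_ne hk with h | h
  · have := hs.lt_of_lt hn h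
    rw [ind_false (p := n.key < s.key) (by omega)]
    by_cases h1 : A.hcurve L n (P.colAbs j) < P.colPeak j
    · rw [ind_true h1, ind_true (this.trans h1)]; simp
    · rw [ind_false h1]
      rcases ind_eq_zero_or_one (A.hcurve K s (P.colAbs j) < P.colPeak j) with e | e <;> simp [e]
  · have := hn.lt_of_lt hs h
    rw [ind_true h]
    by_cases h1 : A.hcurve K s (P.colAbs j) < P.colPeak j
    · rw [ind_true h1, ind_true (this.trans h1)]; simp
    · rw [ind_false h1]
      rcases ind_eq_zero_or_one (A.hcurve L n (P.colAbs j) < P.colPeak j) with e | e <;> simp [e]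

theorem Peaks.crossH_eq (P : Peaks A) {w e : G.VLine} (hne : w ≠ e) (K L : G.Resolution)
    (i : G.SingRow) :
    ind (e.key < w.key) + ind (P.VLeft K w i) - ind (P.VLeft L e i) = 0 ∨
      ind (e.key < w.key) + ind (P.VLeft K w i) - ind (P.VLeft L e i) = 1 := by
  have hk : w.key ≠ e.key := fun e => hne (VLine.key_injective e)
  unfold Peaks.VLeft
  have hs := A.vcurve_inStrip K w (P.rowHgt i)
  have hn := A.vcurve_inStrip L e (P.rowHgt i)
  rcases Nat.lt_or_gt_of_ne hk with h | h
  · have := hs.lt_of_lt hn h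
    rw [ind_false (p := e.key < w.key) (by omega)]
    by_cases h1 : A.vcurve L e (P.rowHgt i) < P.rowPeak i
    · rw [ind_true h1, ind_true (this.trans h1)]; simp
    · rw [ind_false h1]
      rcases ind_eq_zero_or_one (A.vcurve K w (P.rowHgt i) < P.rowPeak i) with e | e <;> simp [e]
  · have := hn.lt_of_lt hs h
    rw [ind_true h]
    by_cases h1 : A.vcurve K w (P.rowHgt i) < P.rowPeak i
    · rw [ind_true h1, ind_true (this.trans h1)]; simp
    · rw [ind_false h1]
      rcases ind_eq_zero_or_one (A.vcurve L e (P.rowHgt i) < P.rowPeak i) with e | e <;> simp [e]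

/-- The number of times the oriented vertical (horizontal) sides of a rectangle on the line of a
singular column (row) cross the cut of the torus: positive on west and south sides. -/
def Rect.cutNumber (ρ : G.Rect) : G.SingRoC → ℤ
  | .inl j => ind ((ρ.start ρ.east).key < (ρ.start ρ.west).key) *
      (ind (ρ.west = .inr j) - ind (ρ.east = .inr j))
  | .inr i => ind (ρ.east.key < ρ.west.key) *
      (ind (ρ.start ρ.west = .inr i) - ind (ρ.start ρ.east = .inr i))

/-- Position of the dot of a generator on the arc of a singular RoC: one if it comes before the peak
and zero if it comes after the peak. -/
def Peaks.dotBefore (P : Peaks A) (x : G.Gen) : G.SingRoC → ℤ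
  | .inl j => P.hb x.1 (x.2 (.inr j)) (.inr j)
  | .inr i => P.vl x.1 (x.2.symm (.inr i)) (.inr i)

namespace Quad

variable {P : Peaks A} {π : G.Quad}

/-- The signed number of times the sides of a polygon on a singular RoC pass the peak. -/
def turn (P : Peaks A) (π : G.Quad) (e : G.SingRoC) : ℤ :=
  π.toRect.cutNumber e + P.dotBefore π.start e - P.dotBefore π.finish e

theorem cr_eq (hne : π.west ≠ π.east) {d : Compass} {e : G.SingRoC} (h : π.sideRoC d = some e) :
    π.cr P d = 0 ∨ π.cr P d = 1 := by
  rcases d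
  · rcases hs : π.north with r | i
    · simp [sideRoC, hs, HLine.roc] at h
    · simpa [cr, hs, Peaks.vl] using P.crossH_eq hne π.finish.1 π.start.1 i
  · rcases hs : π.south with r | i
    · simp [sideRoC, hs, HLine.roc] at h
    · simpa [cr, hs, Peaks.vl] using P.crossH_eq hne π.start.1 π.finish.1 i
  · rcases hs : π.east with r | j
    · simp [sideRoC, hs, VLine.roc] at h
    · simpa [cr, hs, Peaks.hb] using P.crossV_eq (south_ne_north hne) π.finish.1 π.start.1 j
  · rcases hs : π.west with r | j
    · simp [sideRoC, hs, VLine.roc] at h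
    · simpa [cr, hs, Peaks.hb] using P.crossV_eq (south_ne_north hne) π.start.1 π.finish.1 j

theorem finish_symm_apply (hf : π.finish.2 = (Equiv.swap π.west π.east).trans π.start.2)
    (h : G.HLine) : π.finish.2.symm h = Equiv.swap π.west π.east (π.start.2.symm h) := by
  rw [hf]; simp

/-- Sign of the contribution of a side to `turn`. -/
def orient : Compass → ℤ
  | .west => 1
  | .south => 1
  | .east => -1
  | .north => -1

theorem turn_eq (hne : π.west ≠ π.east)
    (hf : π.finish.2 = (Equiv.swap π.west π.east).trans π.start.2) {d : Compass} {e : G.SingRoC}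
    (h : π.sideRoC d = some e) : π.turn P e = orient d * π.cr P d := by
  have hsn := south_ne_north hne
  rcases d
  · rcases hs : π.north with r | i
    · simp [sideRoC, hs, HLine.roc] at h
    · simp only [sideRoC, hs, HLine.roc, Option.some.injEq] at h
      subst h
      have hs' : π.start.2 π.east = .inr i := hs
      have h1 : π.start.2 π.west ≠ .inr i := fun e => hsn (e.trans hs.symm)
      have h2 : π.start.2.symm (.inr i) = π.east := by rw [← hs']; simp
      simp only [turn, Rect.cutNumber, toRect, orient, cr, Peaks.dotBefore, finish_symm_apply hf, hs,
        ind_true hs', ind_false h1, h2, Equiv.swap_apply_right]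
      ring
  · rcases hs : π.south with r | i
    · simp [sideRoC, hs, HLine.roc] at h
    · simp only [sideRoC, hs, HLine.roc, Option.some.injEq] at h
      subst h
      have hs' : π.start.2 π.west = .inr i := hs
      have h1 : π.start.2 π.east ≠ .inr i := fun e => hsn (hs.trans e.symm)
      have h2 : π.start.2.symm (.inr i) = π.west := by rw [← hs']; simp
      simp only [turn, Rect.cutNumber, toRect, orient, cr, Peaks.dotBefore, finish_symm_apply hf, hs,
        ind_true hs', ind_false h1, h2, Equiv.swap_apply_left]
      ring
  · rcases hs : π.east with r | j
    · simp [sideRoC, hs, VLine.roc] at h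
    · simp only [sideRoC, hs, VLine.roc, Option.some.injEq] at h
      subst h
      have h1 : π.west ≠ .inr j := fun e => hne (e.trans hs.symm)
      have h2 : Equiv.swap π.west (.inr j) (.inr j : G.VLine) = π.west := Equiv.swap_apply_right _ _
      simp only [turn, Rect.cutNumber, toRect, orient, cr, Peaks.dotBefore, hf, hs,
        ind_false h1, Equiv.trans_apply, south, north, h2, ind_true True.intro]
      ring
  · rcases hs : π.west with r | j
    · simp [sideRoC, hs, VLine.roc] at h
    · simp only [sideRoC, hs, VLine.roc, Option.some.injEq] at h
      subst h
      have h1 : π.east ≠ .inr j := fun e => hne (hs.trans e.symm)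
      have h2 : Equiv.swap (.inr j) π.east (.inr j : G.VLine) = π.east := Equiv.swap_apply_left _ _
      simp only [turn, Rect.cutNumber, toRect, orient, cr, Peaks.dotBefore, hf, hs,
        ind_false h1, Equiv.trans_apply, south, north, h2, ind_true True.intro]
      ring

/-- RoCs whose resolution changes while the polygon passes their peak run along a side: away from the
sides, the dots on the arcs of two crossing RoCs cannot both jump over the peaks. -/
theorem exists_side_of_turn_ne_zero
    (hf : π.finish.2 = (Equiv.swap π.west π.east).trans π.start.2)
    (ht : ∀ e, π.start.1 e ≠ π.finish.1 e → π.turn P e ≠ 0) (e : G.SingRoC)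
    (he : π.start.1 e ≠ π.finish.1 e) : ∃ d, π.sideRoC d = some e := by
  by_contra! hd
  have key : ∀ (j : G.SingCol) (i : G.SingRow), π.west ≠ .inr j → π.east ≠ .inr j →
      π.start.2 (.inr j) = .inr i →
      (π.turn P (.inl j) = ind (P.HBelow π.start.1 (.inr i) j) -
        ind (P.HBelow π.finish.1 (.inr i) j)) ∧
      (π.turn P (.inr i) = ind (P.VLeft π.start.1 (.inr j) i) -
        ind (P.VLeft π.finish.1 (.inr j) i)) := by
    intro j i hw he' hji
    have h1 : π.start.2.symm (.inr i) = .inr j := by rw [← hji]; simp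
    have h2 : π.start.2 π.west ≠ .inr i := fun e => hw (π.start.2.injective (e.trans hji.symm))
    have h3 : π.start.2 π.east ≠ .inr i := fun e => he' (π.start.2.injective (e.trans hji.symm))
    have h4 := Equiv.swap_apply_of_ne_of_ne hw.symm he'.symm
    constructor
    · simp only [turn, Rect.cutNumber, toRect, Peaks.dotBefore, ind_false hw, ind_false he', hf,
        Equiv.trans_apply, h4, hji, Peaks.hb]
      ring
    · simp only [turn, Rect.cutNumber, toRect, Peaks.dotBefore, ind_false h2, ind_false h3,
        finish_symm_apply hf, h4, h1, Peaks.vl]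
      ring
  rcases e with j | i
  · have hw : π.west ≠ .inr j := fun e => hd .west (by simp [sideRoC, e, VLine.roc])
    have he' : π.east ≠ .inr j := fun e => hd .east (by simp [sideRoC, e, VLine.roc])
    have h4 := Equiv.swap_apply_of_ne_of_ne hw.symm he'.symm
    have h5 := ht _ he
    rcases hji : π.start.2 (.inr j) with r | i
    · apply h5
      simp only [turn, Rect.cutNumber, toRect, Peaks.dotBefore, ind_false hw, ind_false he', hf,
        Equiv.trans_apply, h4, hji, Peaks.hb, sub_self, mul_zero, zero_add]
      rw [ind_congr (P.hBelow_congr j (I := π.start.1) (J := π.finish.1) (by rintro _ ⟨⟩))]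
      simp
    · obtain ⟨k1, k2⟩ := key j i hw he' hji
      rw [k1] at h5
      have hne : ¬ (P.HBelow π.start.1 (.inr i) j ↔ P.HBelow π.finish.1 (.inr i) j) := fun h =>
        h5 (by rw [ind_congr h, sub_self])
      have hfi : π.start.1 (.inr i) ≠ π.finish.1 (.inr i) := fun h =>
        hne (P.hBelow_congr j (by rintro _ ⟨⟩; exact h))
      apply ht _ hfi
      rw [k2, ind_congr (P.vLeft_iff_of_hBelow_ne hne _), ind_congr (P.vLeft_iff_of_hBelow_ne hne _),
        sub_self]
  · have h5 := ht _ he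
    have h2 : π.start.2 π.west ≠ .inr i := fun e => hd .south (by simp [sideRoC, south, e, HLine.roc])
    have h3 : π.start.2 π.east ≠ .inr i := fun e => hd .north (by simp [sideRoC, north, e, HLine.roc])
    have hw : π.start.2.symm (.inr i) ≠ π.west := fun e => h2 (by rw [← e]; simp)
    have he' : π.start.2.symm (.inr i) ≠ π.east := fun e => h3 (by rw [← e]; simp)
    have h4 := Equiv.swap_apply_of_ne_of_ne hw he'
    rcases hji : π.start.2.symm (.inr i) with r | j
    · rw [hji] at h4
      apply h5
      simp only [turn, Rect.cutNumber, toRect, Peaks.dotBefore, ind_false h2, ind_false h3,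
        finish_symm_apply hf, h4, hji, Peaks.vl, sub_self, mul_zero, zero_add]
      rw [ind_congr (P.vLeft_congr i (I := π.start.1) (J := π.finish.1) (by rintro _ ⟨⟩))]
      simp
    · obtain ⟨k1, k2⟩ := key j i (fun e => hw (hji.trans e.symm)) (fun e => he' (hji.trans e.symm))
        (by rw [← hji]; simp)
      rw [k2] at h5
      have hne : ¬ (P.VLeft π.start.1 (.inr j) i ↔ P.VLeft π.finish.1 (.inr j) i) := fun h =>
        h5 (by rw [ind_congr h, sub_self])
      have hfi : π.start.1 (.inl j) ≠ π.finish.1 (.inl j) := fun h =>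
        hne (P.vLeft_congr i (by rintro _ ⟨⟩; exact h))
      apply ht _ hfi
      rw [k1, ind_congr (P.hBelow_iff_of_vLeft_ne hne _), ind_congr (P.hBelow_iff_of_vLeft_ne hne _),
        sub_self]

theorem westSide_inStrip (t : ℝ) : InStrip π.west.key (π.westSide P t) := by
  rw [westSide_eq]; exact A.vcurve_inStrip _ _ _

theorem southSide_inStrip (t : ℝ) : InStrip π.south.key (π.southSide P t) := by
  rw [southSide_eq]; exact A.hcurve_inStrip _ _ _

/-- The corners of a polygon in its initial generator are not in its interior: otherwise both sides at
this corner would turn at their peaks before reaching it. -/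
theorem corner_not_mem_interior (hπ : π.IsPolygon P) {v : G.VLine} (hv : v = π.west ∨ v = π.east)
    {z : ℝ × ℝ} {k l : ℤ} (h1 : z.1 = A.vcurve π.start.1 v z.2 + k * G.cols)
    (h2 : z.2 = A.hcurve π.start.1 (π.start.2 v) z.1 + l * G.rows) : z ∉ π.interior P := by
  rintro ⟨iw, ie, is, iN⟩
  have hne := hπ.west_ne_east
  have hsn := south_ne_north hne
  have kv : π.west.key ≠ π.east.key := fun e => hne (VLine.key_injective e)
  have kh : π.south.key ≠ π.north.key := fun e => hsn (HLine.key_injective e)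
  have hcr := (forall_peakOnSide_iff hne).1 hπ.peaks
  have sW := westSide_inStrip (P := P) (π := π) z.2
  have sS := southSide_inStrip (P := P) (π := π) z.1
  have sE := A.vcurve_inStrip (π.resE P z.2) π.east z.2
  have sN := A.hcurve_inStrip (π.resN P z.1) π.north z.1
  rcases hv with rfl | rfl
  · rw [h1, eastSide_eq, wrapH_cast] at ie
    have hk := shift_eq_zero_of_between sW (A.vcurve_inStrip π.start.1 π.west z.2) sE kv
      π.west.idx_add_one_le π.east.idx_add_one_le (by rw [← h1]; exact iw) ie
    rw [h2, northSide_eq, wrapV_cast] at iN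
    have hl := shift_eq_zero_of_between sS (A.hcurve_inStrip π.start.1 π.south z.1) sN kh
      π.south.idx_add_one_le π.north.idx_add_one_le (by
        have := is; rw [h2] at this; exact this) iN
    simp only [hk, hl, Int.cast_zero, zero_mul, add_zero] at h1 h2
    rw [h1] at iw
    have is' : π.southSide P z.1 < A.hcurve π.start.1 π.south z.1 := lt_of_lt_of_eq is h2
    unfold westSide at iw
    unfold southSide at is'
    split_ifs at iw with b1
    · exact lt_irrefl _ iw
    split_ifs at is' with b2
    · exact lt_irrefl _ is'
    rcases hw : π.west with c | j
    · rw [hw] at iw; exact lt_irrefl _ iw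
    rcases hs : π.south with r | i
    · rw [hs] at is'; exact lt_irrefl _ is'
    have hfl : π.start.1 (.inl j) ≠ π.finish.1 (.inl j) := by
      intro e
      rw [hw] at iw
      simp only [WindingArcs.vcurve, e] at iw
      exact lt_irrefl _ iw
    -- The peak of the west side is above the line of `start` on the south side, and the crossing of
    -- this line with the arc of `start` is the corner: the corner is below the peak.
    have h3 := hcr .west (mem_peakSides.2 ⟨.inl j, by simp [sideRoC, hw, VLine.roc], hfl⟩)
    simp only [cr, hw, Peaks.hb] at h3
    have h4 := ((hcurve_lift_iff P hsn j _ _).2 h3).1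
    obtain ⟨a, b, h⟩ := A.crossing j i (π.start.1 (.inl j)) (π.start.1 (.inr i))
    have h5 : z.1 = A.colArc j (π.start.1 (.inl j)) z.2 := by rw [hw] at h1; exact h1
    have h6 : z.2 = A.rowArc i (π.start.1 (.inr i)) z.1 := by
      have : π.start.2 π.west = .inr i := hs
      rw [this] at h2; exact h2
    have h7 := (h.unique _ _ h5 h6).2
    have h8 := vcurve_bend P j π.start.1 (π.south.idx : ℝ)
    simp only [WindingArcs.vcurve] at h8
    have h9 := (h.gt_iff (t := lift π.south.idx G.rows (P.colPeak j))).1 (by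
      rw [h8]
      have := h4
      rw [hs] at this ⊢
      exact this)
    apply b1
    rw [h7]
    have : π.bend P .west = lift π.south.idx G.rows (P.colPeak j) := by
      simp only [bend, hw, Peaks.onV]
    rw [this]
    exact h9.le
  · rw [h1, eastSide_eq, wrapH_cast] at ie
    have hk := shift_eq_of_between sW (A.vcurve_inStrip π.start.1 π.east z.2) sE kv
      π.west.idx_add_one_le π.east.idx_add_one_le (by rw [← h1]; exact iw) ie
    rw [h2, northSide_eq, wrapV_cast] at iN
    have hl := shift_eq_of_between sS (A.hcurve_inStrip π.start.1 π.north z.1) sN kh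
      π.south.idx_add_one_le π.north.idx_add_one_le (by
        have := is; rw [h2] at this; exact this) iN
    have hk' : (k : ℝ) * G.cols = if π.west.key < π.east.key then 0 else (G.cols : ℝ) := by
      rw [hk]; split_ifs <;> simp
    have hl' : (l : ℝ) * G.rows = if π.south.key < π.north.key then 0 else (G.rows : ℝ) := by
      rw [hl]; split_ifs <;> simp
    have hnn : π.start.2 π.east = π.north := rfl
    rw [hnn, hl', add_comm, add_lt_add_iff_left] at iN
    rw [hk', add_comm, add_lt_add_iff_left] at ie
    unfold resE at ie
    unfold resN at iN
    split_ifs at ie with b1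
    swap
    · exact lt_irrefl _ ie
    split_ifs at iN with b2
    swap
    · exact lt_irrefl _ iN
    rcases hw : π.east with c | j
    · rw [hw] at ie; exact lt_irrefl _ ie
    rcases hs : π.north with r | i
    · rw [hs] at iN; exact lt_irrefl _ iN
    have hfl : π.start.1 (.inl j) ≠ π.finish.1 (.inl j) := by
      intro e
      rw [hw] at ie
      simp only [WindingArcs.vcurve, e] at ie
      exact lt_irrefl _ ie
    have h3 := hcr .east (mem_peakSides.2 ⟨.inl j, by simp [sideRoC, hw, VLine.roc], hfl⟩)
    simp only [cr, hw, Peaks.hb] at h3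
    have h4 := ((hcurve_lift_iff P hsn j _ _).2 h3).2
    obtain ⟨a, b, h⟩ := A.crossing j i (π.start.1 (.inl j)) (π.start.1 (.inr i))
    have h5 : z.1 - k * G.cols = A.colArc j (π.start.1 (.inl j)) (z.2 - l * G.rows) := by
      have := A.vcurve_shift π.start.1 π.east z.2 (-l)
      rw [show z.2 - l * G.rows = z.2 + (-l : ℤ) * G.rows by push_cast; ring]
      rw [hw] at h1 this
      have h' : A.colArc j (π.start.1 (.inl j)) (z.2 + (-l : ℤ) * G.rows) =
        A.vcurve π.start.1 (.inr j) z.2 := this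
      rw [h']; linarith
    have h6 : z.2 - l * G.rows = A.rowArc i (π.start.1 (.inr i)) (z.1 - k * G.cols) := by
      have := A.hcurve_shift π.start.1 π.north z.1 (-k)
      rw [show z.1 - k * G.cols = z.1 + (-k : ℤ) * G.cols by push_cast; ring]
      rw [hnn, hs] at h2
      rw [hs] at this
      have h' : A.rowArc i (π.start.1 (.inr i)) (z.1 + (-k : ℤ) * G.cols) =
        A.hcurve π.start.1 (.inr i) z.1 := this
      rw [h']; linarith
    have h7 := (h.unique _ _ h5 h6).2
    have h8 := vcurve_bend P j π.start.1 (π.south.idx : ℝ)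
    have h8' := A.vcurve_shift π.start.1 (.inr j) (lift π.south.idx G.rows (P.colPeak j)) (-l)
    rw [h8] at h8'
    simp only [WindingArcs.vcurve] at h8'
    have h9 := (h.lt_iff
      (t := lift π.south.idx G.rows (P.colPeak j) + (-l : ℤ) * G.rows)).1 (by
      rw [h8']
      have := h4
      rw [← hl', hs] at this
      simp only [WindingArcs.hcurve] at this
      push_cast
      linarith)
    have : π.bend P .east = lift π.south.idx G.rows (P.colPeak j) := by
      simp only [bend, hw, Peaks.onV]
    rw [this] at b1
    push_cast at h9
    linarith

/-- Straightening a polygon does not move dots into it or out of it. -/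
theorem isEmpty_iff (hπ : π.IsPolygon P) : π.IsEmpty P ↔ π.toRect.IsEmpty := by
  have hne := hπ.west_ne_east
  have hsn := south_ne_north hne
  have kv : π.west.key ≠ π.east.key := fun e => hne (VLine.key_injective e)
  have kh : π.south.key ≠ π.north.key := fun e => hsn (HLine.key_injective e)
  have keyV : ∀ (v : G.VLine) (t : ℝ), v ≠ π.west → v ≠ π.east →
      ((∃ k : ℤ, π.westSide P t < A.vcurve π.start.1 v t + k * G.cols ∧
        A.vcurve π.start.1 v t + k * G.cols < π.eastSide P t) ↔
        CycBetween π.west.key v.key π.east.key) := by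
    intro v t h1 h2
    rw [eastSide_eq, wrapH_cast]
    exact exists_shift_between_iff (westSide_inStrip t) (A.vcurve_inStrip _ _ _)
      (A.vcurve_inStrip _ _ _) (fun e => h1 (VLine.key_injective e.symm))
      (fun e => h2 (VLine.key_injective e)) kv π.west.idx_add_one_le v.idx_add_one_le
      π.east.idx_add_one_le
  have keyH : ∀ (v : G.HLine) (t : ℝ), v ≠ π.south → v ≠ π.north →
      ((∃ k : ℤ, π.southSide P t < A.hcurve π.start.1 v t + k * G.rows ∧
        A.hcurve π.start.1 v t + k * G.rows < π.northSide P t) ↔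
        CycBetween π.south.key v.key π.north.key) := by
    intro v t h1 h2
    rw [northSide_eq, wrapV_cast]
    exact exists_shift_between_iff (southSide_inStrip t) (A.hcurve_inStrip _ _ _)
      (A.hcurve_inStrip _ _ _) (fun e => h1 (HLine.key_injective e.symm))
      (fun e => h2 (HLine.key_injective e)) kh π.south.idx_add_one_le v.idx_add_one_le
      π.north.idx_add_one_le
  constructor
  · intro h
    refine ⟨hne, fun v hv hv' => ?_⟩
    have h1 : v ≠ π.west := by
      rintro rfl; unfold CycBetween toRect at hv; dsimp only at hv; omega
    have h2 : v ≠ π.east := by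
      rintro rfl; unfold CycBetween toRect at hv; dsimp only at hv; omega
    have h3 : π.start.2 v ≠ π.south := fun e => h1 (π.start.2.injective e)
    have h4 : π.start.2 v ≠ π.north := fun e => h2 (π.start.2.injective e)
    obtain ⟨s, t, hs, ht⟩ := A.exists_dot π.start.1 v (π.start.2 v)
    -- by periodicity of the lines, the dot can be translated into the polygon
    have hK : ∃ k l : ℤ, (s + k * G.cols, t + l * G.rows) ∈ π.interior P := by
      refine ⟨if π.west.key < v.key then 0 else 1,
        if π.south.key < (π.start.2 v).key then 0 else 1, ?_⟩
      have eV := fun l : ℤ => A.vcurve_shift π.start.1 v t l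
      have eH := fun l : ℤ => A.hcurve_shift π.start.1 (π.start.2 v) s l
      have cV := fun t' => shift_between (westSide_inStrip (P := P) t')
        (A.vcurve_inStrip π.start.1 v t') (A.vcurve_inStrip (π.resE P t') π.east t') hv
        π.west.idx_add_one_le v.idx_add_one_le
      have cH := fun t' => shift_between (southSide_inStrip (P := P) t')
        (A.hcurve_inStrip π.start.1 (π.start.2 v) t') (A.hcurve_inStrip (π.resN P t') π.north t') hv'
        π.south.idx_add_one_le (π.start.2 v).idx_add_one_le
      simp only [← wrapH_cast, ← wrapV_cast, ← eastSide_eq, ← northSide_eq] at cV cH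
      refine ⟨?_, ?_, ?_, ?_⟩ <;> dsimp only
      · have := (cV (t + (if π.south.key < (π.start.2 v).key then 0 else 1 : ℤ) * G.rows)).1
        rwa [eV, ← hs] at this
      · have := (cV (t + (if π.south.key < (π.start.2 v).key then 0 else 1 : ℤ) * G.rows)).2
        rwa [eV, ← hs] at this
      · have := (cH (s + (if π.west.key < v.key then 0 else 1 : ℤ) * G.cols)).1
        rwa [eH, ← ht] at this
      · have := (cH (s + (if π.west.key < v.key then 0 else 1 : ℤ) * G.cols)).2
        rwa [eH, ← ht] at this
    obtain ⟨k, l, hkl⟩ := hK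
    refine h _ hkl ⟨v, k, l, ?_, ?_⟩
    · dsimp only; rw [A.vcurve_shift, ← hs]
    · dsimp only; rw [A.hcurve_shift, ← ht]
  · rintro ⟨-, h⟩ z hz ⟨v, k, l, h1, h2⟩
    by_cases hv : v = π.west ∨ v = π.east
    · exact corner_not_mem_interior hπ hv h1 h2 hz
    · push Not at hv
      have h3 : π.start.2 v ≠ π.south := fun e => hv.1 (π.start.2.injective e)
      have h4 : π.start.2 v ≠ π.north := fun e => hv.2 (π.start.2.injective e)
      obtain ⟨iw, ie, is, iN⟩ := hz
      refine h v ((keyV v z.2 hv.1 hv.2).1 ⟨k, ?_, ?_⟩) ((keyH _ z.1 h3 h4).1 ⟨l, ?_, ?_⟩)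
      · rw [← h1]; exact iw
      · rw [← h1]; exact ie
      · rw [← h2]; exact is
      · rw [← h2]; exact iN

/-- Empty grid polygons, in terms of their rectangle and of the resolutions of their ends. -/
theorem isPolygon_and_isEmpty_iff :
    π.IsPolygon P ∧ π.IsEmpty P ↔
      π.finish.2 = π.toRect.finish ∧ π.toRect.IsEmpty ∧
      ∀ e, π.start.1 e ≠ π.finish.1 e →
        π.start.1 e = 0 ∧ π.finish.1 e = 1 ∧ π.turn P e ≠ 0 := by
  constructor
  · rintro ⟨hπ, h⟩
    refine ⟨hπ.finish_eq, (isEmpty_iff hπ).1 h, fun e he => ?_⟩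
    obtain ⟨h0, h1, d, hd⟩ := hπ.resolutions e he
    refine ⟨h0, h1, ?_⟩
    have := (forall_peakOnSide_iff hπ.west_ne_east).1 hπ.peaks d (mem_peakSides.2 ⟨e, hd, he⟩)
    rw [turn_eq hπ.west_ne_east hπ.finish_eq hd, this]
    rcases d <;> simp [orient]
  · rintro ⟨hf, h, hr⟩
    have hne : π.west ≠ π.east := h.1
    have hπ : π.IsPolygon P := by
      refine ⟨hne, hf, fun e he => ⟨(hr e he).1, (hr e he).2.1, ?_⟩,
        (forall_peakOnSide_iff hne).2 fun d hd => ?_⟩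
      · exact exists_side_of_turn_ne_zero hf (fun e he => (hr e he).2.2) e he
      · obtain ⟨e, hd, he⟩ := mem_peakSides.1 hd
        have := (hr e he).2.2
        rw [turn_eq hne hf hd] at this
        exact (cr_eq hne hd).resolve_left fun h0 => this (by rw [h0, mul_zero])
    exact ⟨hπ, (isEmpty_iff hπ).2 h⟩

end Quad

end SingularGrid

/-! ### Decorations contained in a polygon: local formula -/

/-- A point between two lines, on a circle of length `N`. -/
theorem shift_between_lines_iff {ka kc : ℕ} {a c p N : ℝ} (ha : InStrip ka a) (hc : InStrip kc c)
    (hac : ka ≠ kc) (hN : ((ka / 2 : ℕ) : ℝ) + 1 ≤ N) (hN' : ((kc / 2 : ℕ) : ℝ) + 1 ≤ N)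
    (p0 : 0 < p) (pN : p < N) (hpa : p ≠ a) (k : ℤ) :
    (a < p + k * N ∧ p + k * N < (if ka < kc then 0 else N) + c) ↔
      (k = 0 ∧ ¬ p < a ∧ (kc < ka ∨ p < c)) ∨ (k = 1 ∧ kc < ka ∧ p < c) := by
  have ha0 : (0 : ℝ) ≤ ((ka / 2 : ℕ) : ℝ) := Nat.cast_nonneg _
  have hc0 : (0 : ℝ) ≤ ((kc / 2 : ℕ) : ℝ) := Nat.cast_nonneg _
  have := ha.le
  have := ha.lt
  have := hc.le
  have := hc.lt
  have hk : k < 0 ∨ k = 0 ∨ k = 1 ∨ 1 < k := by omega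
  rcases hk with hk | rfl | rfl | hk
  · have : (k : ℝ) ≤ -1 := by exact_mod_cast (by omega : k ≤ -1)
    constructor
    · rintro ⟨h, -⟩; nlinarith
    · rintro (⟨rfl, -⟩ | ⟨rfl, -⟩) <;> omega
  · simp only [Int.cast_zero, zero_mul, add_zero, true_and, zero_ne_one, false_and, or_false]
    rcases Nat.lt_or_gt_of_ne hac with h | h
    · rw [if_pos h, zero_add, not_lt]
      constructor
      · rintro ⟨h1, h2⟩; exact ⟨h1.le, Or.inr h2⟩
      · rintro ⟨h1, h2⟩; exact ⟨lt_of_le_of_ne h1 hpa.symm, h2.resolve_left (by omega)⟩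
    · rw [if_neg (by omega), not_lt]
      constructor
      · rintro ⟨h1, h2⟩; exact ⟨h1.le, Or.inl h⟩
      · rintro ⟨h1, h2⟩; exact ⟨lt_of_le_of_ne h1 hpa.symm, by linarith⟩
  · simp only [Int.cast_one, one_mul, one_ne_zero, false_and, true_and, false_or]
    rcases Nat.lt_or_gt_of_ne hac with h | h
    · rw [if_pos h, zero_add]
      constructor
      · rintro ⟨h1, h2⟩; exfalso; linarith
      · rintro ⟨h1, h2⟩; omega
    · rw [if_neg (by omega)]
      constructor
      · rintro ⟨h1, h2⟩; exact ⟨h, by linarith⟩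
      · rintro ⟨h1, h2⟩; exact ⟨by linarith, by linarith⟩
  · have : (2 : ℝ) ≤ k := by exact_mod_cast (by omega : 2 ≤ k)
    constructor
    · rintro ⟨-, h⟩
      have h3 : p + k * N < N + c := lt_of_lt_of_le h (by split_ifs <;> linarith)
      nlinarith
    · rintro (⟨rfl, -⟩ | ⟨rfl, -⟩) <;> omega

theorem exists_bool (p : Prop) : ∃ b : Bool, p = (b = true) := by
  by_cases h : p
  · exact ⟨true, by simp [h]⟩
  · exact ⟨false, by simp [h]⟩

theorem ind_eq_ite (p : Prop) [Decidable p] : ind p = if p then 1 else 0 := by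
  unfold ind; congr

/-- Four translates of a decoration between the sides of a polygon: `W k`, `E k`, `S k`, `N k` say that
the decoration is to the left of, respectively below, the corresponding side. -/
def Overlap (oH oV W0 W1 E0 E1 S0 S1 N0 N1 : Prop) : Prop :=
  (¬ W0 ∧ (oH ∨ E0) ∧ ¬ S0 ∧ (oV ∨ N0)) ∨ (¬ W1 ∧ (oH ∨ E1) ∧ oV ∧ N0) ∨
    (oH ∧ E0 ∧ ¬ S1 ∧ (oV ∨ N1)) ∨ (oH ∧ E1 ∧ oV ∧ N1)

theorem Overlap.transpose {oH oV W0 W1 E0 E1 S0 S1 N0 N1 : Prop} :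
    Overlap oH oV W0 W1 E0 E1 S0 S1 N0 N1 ↔ Overlap oV oH S0 S1 N0 N1 W0 W1 E0 E1 := by
  unfold Overlap
  constructor
  · rintro (⟨a, b, c, d⟩ | ⟨a, b, c, d⟩ | ⟨a, b, c, d⟩ | ⟨a, b, c, d⟩) <;> simp [*]
  · rintro (⟨a, b, c, d⟩ | ⟨a, b, c, d⟩ | ⟨a, b, c, d⟩ | ⟨a, b, c, d⟩) <;> simp [*]

theorem ind_overlap {oH oV W E S N : Prop} (h1 : ¬ oH → W → E) (h2 : oH → E → W)
    (h3 : ¬ oV → S → N) (h4 : oV → N → S) :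
    ind (Overlap oH oV W W E E S S N N) = ind W * ind S + ind E * ind N - ind W * ind N -
      ind E * ind S + ind oH * (ind N - ind S) + ind oV * (ind E - ind W) + ind oH * ind oV := by
  obtain ⟨oH, rfl⟩ := exists_bool oH
  obtain ⟨oV, rfl⟩ := exists_bool oV
  obtain ⟨W, rfl⟩ := exists_bool W
  obtain ⟨E, rfl⟩ := exists_bool E
  obtain ⟨S, rfl⟩ := exists_bool S
  obtain ⟨N, rfl⟩ := exists_bool N
  simp only [ind_eq_ite, Overlap]
  revert oH W E oV S N
  decide

/-- One peak, on the west side, on an arc running through the column of the decoration: `a` says that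
the decoration is to the left of the arc of the initial resolution, `p` that it is below the
peak, `s` and `n` that the south and north sides are below the peak. -/
theorem ind_overlap_west {oH oV p s n a S N : Prop} (h3 : ¬ oV → S → N) (h4 : oV → N → S)
    (hc : ind oV + ind s - ind n = 1)
    (c1 : S → s → p) (c2 : ¬ S → ¬ s → ¬ p) (c3 : N → n → p) (c4 : ¬ N → ¬ n → ¬ p) :
    ind (Overlap oH oV (p ∨ ¬ s ↔ a) (p ∧ ¬ s ↔ a) (¬ oH) (¬ oH) S S N N) =
      ind a * ind S + ind (¬ oH) * ind N - ind (¬ a) * ind N -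
      ind (¬ oH) * ind S + ind oH * (ind N - ind S) + ind oV * (ind (¬ oH) - ind a) +
      ind oH * ind oV + (ind (¬ a) - ind a) * (ind p - ind n) := by
  obtain ⟨oH, rfl⟩ := exists_bool oH
  obtain ⟨oV, rfl⟩ := exists_bool oV
  obtain ⟨p, rfl⟩ := exists_bool p
  obtain ⟨s, rfl⟩ := exists_bool s
  obtain ⟨n, rfl⟩ := exists_bool n
  obtain ⟨a, rfl⟩ := exists_bool a
  obtain ⟨S, rfl⟩ := exists_bool S
  obtain ⟨N, rfl⟩ := exists_bool N
  simp only [ind_eq_ite, Overlap] at hc ⊢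
  revert oV S N s n p oH a
  decide

theorem ind_overlap_east {oH oV p s n a S N : Prop} (h3 : ¬ oV → S → N) (h4 : oV → N → S)
    (hc : ind oV + ind s - ind n = 1)
    (c1 : S → s → p) (c2 : ¬ S → ¬ s → ¬ p) (c3 : N → n → p) (c4 : ¬ N → ¬ n → ¬ p) :
    ind (Overlap oH oV oH oH (p ∨ ¬ s ↔ ¬ a) (p ∧ ¬ s ↔ ¬ a) S S N N) =
      ind oH * ind S + ind a * ind N - ind oH * ind N -
      ind (¬ a) * ind S + ind oH * (ind N - ind S) + ind oV * (ind a - ind oH) +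
      ind oH * ind oV + (ind (¬ a) - ind a) * (ind p - ind s + 1) := by
  obtain ⟨oH, rfl⟩ := exists_bool oH
  obtain ⟨oV, rfl⟩ := exists_bool oV
  obtain ⟨p, rfl⟩ := exists_bool p
  obtain ⟨s, rfl⟩ := exists_bool s
  obtain ⟨n, rfl⟩ := exists_bool n
  obtain ⟨a, rfl⟩ := exists_bool a
  obtain ⟨S, rfl⟩ := exists_bool S
  obtain ⟨N, rfl⟩ := exists_bool N
  simp only [ind_eq_ite, Overlap] at hc ⊢
  revert oV S N s n p oH a
  decide

set_option synthInstance.maxSize 2000 in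
set_option synthInstance.maxHeartbeats 200000 in
set_option maxRecDepth 4000 in
/-- Two peaks, on the west and south sides, on arcs running through the square of the decoration. -/
theorem ind_overlap_west_south {oH oV p s n a p' w e b : Prop}
    (hc : ind oV + ind s - ind n = 1)
    (hc' : ind oH + ind w - ind e = 1)
    (c1 : b → s → p) (c2 : ¬ b → ¬ s → ¬ p) (c3 : ¬ oV → n → p) (c4 : oV → ¬ n → ¬ p)
    (d1 : a → w → p') (d2 : ¬ a → ¬ w → ¬ p') (d3 : ¬ oH → e → p') (d4 : oH → ¬ e → ¬ p')
    (hor : (s ↔ p) ∨ (w ↔ p')) :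
    ind (Overlap oH oV (p ∨ ¬ s ↔ a) (p ∧ ¬ s ↔ a) (¬ oH) (¬ oH)
        (p' ∨ ¬ w ↔ b) (p' ∧ ¬ w ↔ b) (¬ oV) (¬ oV)) =
      ind a * ind b + ind (¬ oH) * ind (¬ oV) - ind (¬ a) * ind (¬ oV) -
      ind (¬ oH) * ind (¬ b) + ind oH * (ind (¬ oV) - ind b) + ind oV * (ind (¬ oH) - ind a) +
      ind oH * ind oV + (ind (¬ a) - ind a) * (ind p - ind n) +
      (ind (¬ b) - ind b) * (ind p' - ind e) := by
  obtain ⟨oH, rfl⟩ := exists_bool oH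
  obtain ⟨oV, rfl⟩ := exists_bool oV
  obtain ⟨p, rfl⟩ := exists_bool p
  obtain ⟨s, rfl⟩ := exists_bool s
  obtain ⟨n, rfl⟩ := exists_bool n
  obtain ⟨a, rfl⟩ := exists_bool a
  obtain ⟨p', rfl⟩ := exists_bool p'
  obtain ⟨w, rfl⟩ := exists_bool w
  obtain ⟨e, rfl⟩ := exists_bool e
  obtain ⟨b, rfl⟩ := exists_bool b
  simp only [ind_eq_ite, Overlap] at hc hc' ⊢
  revert oV s n oH w e p p' a b
  decide


set_option synthInstance.maxSize 2000 in
set_option synthInstance.maxHeartbeats 200000 in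
set_option maxRecDepth 4000 in
/-- Two peaks, on the west and north sides. -/
theorem ind_overlap_west_north {oH oV p s n a p' w e b : Prop}
    (hc : ind oV + ind s - ind n = 1)
    (hc' : ind oH + ind w - ind e = 1)
    (c1 : oV → s → p) (c2 : ¬ oV → ¬ s → ¬ p) (c3 : ¬ b → n → p) (c4 : b → ¬ n → ¬ p)
    (d1 : ¬ a → w → p') (d2 : a → ¬ w → ¬ p') (d3 : ¬ oH → e → p') (d4 : oH → ¬ e → ¬ p')
    (hor : (n ↔ p) ∨ (w ↔ p')) :
    ind (Overlap oH oV (p ∨ ¬ s ↔ a) (p ∧ ¬ s ↔ a) (¬ oH) (¬ oH)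
        oV oV (p' ∨ ¬ w ↔ ¬ b) (p' ∧ ¬ w ↔ ¬ b)) =
      ind a * ind oV + ind (¬ oH) * ind b - ind (¬ a) * ind (¬ b) -
      ind (¬ oH) * ind oV + ind oH * (ind b - ind oV) + ind oV * (ind (¬ oH) - ind a) +
      ind oH * ind oV + (ind (¬ a) - ind a) * (ind p - ind n) +
      (ind (¬ b) - ind b) * (ind p' - ind w + 1) := by
  obtain ⟨oH, rfl⟩ := exists_bool oH
  obtain ⟨oV, rfl⟩ := exists_bool oV
  obtain ⟨p, rfl⟩ := exists_bool p
  obtain ⟨s, rfl⟩ := exists_bool s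
  obtain ⟨n, rfl⟩ := exists_bool n
  obtain ⟨a, rfl⟩ := exists_bool a
  obtain ⟨p', rfl⟩ := exists_bool p'
  obtain ⟨w, rfl⟩ := exists_bool w
  obtain ⟨e, rfl⟩ := exists_bool e
  obtain ⟨b, rfl⟩ := exists_bool b
  simp only [ind_eq_ite, Overlap] at hc hc' ⊢
  revert oV s n oH w e p p' a b
  decide


set_option synthInstance.maxSize 2000 in
set_option synthInstance.maxHeartbeats 200000 in
set_option maxRecDepth 4000 in
/-- Two peaks, on the east and north sides. -/
theorem ind_overlap_east_north {oH oV p s n a p' w e b : Prop}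
    (hc : ind oV + ind s - ind n = 1)
    (hc' : ind oH + ind w - ind e = 1)
    (c1 : oV → s → p) (c2 : ¬ oV → ¬ s → ¬ p) (c3 : b → n → p) (c4 : ¬ b → ¬ n → ¬ p)
    (d1 : oH → w → p') (d2 : ¬ oH → ¬ w → ¬ p') (d3 : a → e → p') (d4 : ¬ a → ¬ e → ¬ p')
    (hor : (n ↔ p) ∨ (e ↔ p')) :
    ind (Overlap oH oV oH oH (p ∨ ¬ s ↔ ¬ a) (p ∧ ¬ s ↔ ¬ a)
        oV oV (p' ∨ ¬ w ↔ ¬ b) (p' ∧ ¬ w ↔ ¬ b)) =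
      ind oH * ind oV + ind a * ind b - ind oH * ind (¬ b) -
      ind (¬ a) * ind oV + ind oH * (ind b - ind oV) + ind oV * (ind a - ind oH) +
      ind oH * ind oV + (ind (¬ a) - ind a) * (ind p - ind s + 1) +
      (ind (¬ b) - ind b) * (ind p' - ind w + 1) := by
  obtain ⟨oH, rfl⟩ := exists_bool oH
  obtain ⟨oV, rfl⟩ := exists_bool oV
  obtain ⟨p, rfl⟩ := exists_bool p
  obtain ⟨s, rfl⟩ := exists_bool s
  obtain ⟨n, rfl⟩ := exists_bool n
  obtain ⟨a, rfl⟩ := exists_bool a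
  obtain ⟨p', rfl⟩ := exists_bool p'
  obtain ⟨w, rfl⟩ := exists_bool w
  obtain ⟨e, rfl⟩ := exists_bool e
  obtain ⟨b, rfl⟩ := exists_bool b
  simp only [ind_eq_ite, Overlap] at hc hc' ⊢
  revert oV s n oH w e p p' a b
  decide


theorem le_lift_iff {base h t x M : ℝ} (hb : base ≤ h) (hx : x < M) (x0 : 0 < x) (hxt : x ≠ t)
    (tM : t < M) (t0 : 0 ≤ t) (hl : h < SingularGrid.Quad.lift base M t) :
    (x ≤ SingularGrid.Quad.lift base M t ↔ x < t ∨ ¬ h < t) ∧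
      (x + M ≤ SingularGrid.Quad.lift base M t ↔ x < t ∧ ¬ h < t) := by
  unfold SingularGrid.Quad.lift at *
  split_ifs at * with hZ
  · have h1 : ¬ h < t := by linarith
    simp only [h1, not_false_eq_true, or_true, iff_true, and_true, add_le_add_iff_right]
    exact ⟨by linarith, hxt.le_iff_lt⟩
  · simp only [hl, not_true_eq_false, or_false, and_false, iff_false, not_le]
    exact ⟨hxt.le_iff_lt, by linarith⟩

namespace SingularGrid

variable {G : SingularGrid} {A : G.WindingArcs}

/-- Two points of the bigons of a column, the decoration `q` and the peak, and a line across the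
column: if the line separates them, then it passes between them. -/
theorem Peaks.hBelow_consistent (P : Peaks A) {q : Fin G.cols × Fin G.rows}
    (hq : G.deco q.1 q.2 ≠ none) {j : G.SingCol} (hj : j.1 = q.1) (K : G.Resolution)
    (h : G.HLine) :
    (IsBelow K q h → P.HBelow K h j → (q.2 : ℝ) + 1 / 2 < P.colPeak j) ∧
      (¬ IsBelow K q h → ¬ P.HBelow K h j → ¬ (q.2 : ℝ) + 1 / 2 < P.colPeak j) := by
  obtain ⟨h1, h2⟩ := A.center_lt_hcurve_iff K hq h
  rw [← h1]
  have hq' : G.deco j.1 q.2 ≠ none := by rw [hj]; exact hq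
  have hne := (P.col_isPeak j).ne_center (A.col_winding j) hq'
  have hb := P.hcurve_ne K h j
  unfold Peaks.HBelow
  rcases h with r | i
  · simp only [WindingArcs.hcurve] at *
    constructor
    · intro h3 h4; linarith
    · intro h3 h4 h5
      have := lt_of_le_of_ne (not_lt.1 h4) hb.symm
      linarith
  · have hx : ∃ b b' : Fin 2, A.colArc j b ((q.2 : ℝ) + 1 / 2) < (q.1 : ℝ) + 1 / 2 ∧
        (q.1 : ℝ) + 1 / 2 < A.colArc j b' ((q.2 : ℝ) + 1 / 2) := by
      have k0 := A.col_winding j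
      rw [← hj]
      by_cases hs : RoC.OnFirstSide (G.deco j.1) 0 q.2
      · exact ⟨1, 0, k0.second_side 1 q.2 hq' (by rw [RoC.onFirstSide_one_iff]; simpa using hs),
          k0.first_side 0 q.2 hq' hs⟩
      · exact ⟨0, 1, k0.second_side 0 q.2 hq' hs,
          k0.first_side 1 q.2 hq' (by rw [RoC.onFirstSide_one_iff]; exact hs)⟩
    obtain ⟨b, b', hb1, hb2⟩ := hx
    obtain ⟨_, _, c1⟩ := A.crossing j i b (K (.inr i))
    obtain ⟨_, _, c2⟩ := A.crossing j i b' (K (.inr i))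
    have hp : A.colArc j b (P.colPeak j) = A.colArc j b' (P.colPeak j) := by
      rw [P.colArc_colPeak, P.colArc_colPeak]
    simp only [WindingArcs.hcurve] at *
    constructor
    · intro h3 h4
      by_contra h5
      have h6 := lt_of_le_of_ne (not_lt.1 h5) hne
      have := c1.gt_of_enclosed c2 hp hb1 hb2 h6 h3
      rw [P.colArc_colPeak] at this
      linarith
    · intro h3 h4 h5
      have h6 := lt_of_le_of_ne (not_lt.1 h3) h2.symm
      have := c1.lt_of_enclosed c2 hp hb1 hb2 h5 h6
      rw [P.colArc_colPeak] at this
      exact hb (le_antisymm this (not_lt.1 h4))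

theorem Peaks.vLeft_consistent (P : Peaks A) {q : Fin G.cols × Fin G.rows}
    (hq : G.deco q.1 q.2 ≠ none) {i : G.SingRow} (hi : i.1 = q.2) (K : G.Resolution)
    (v : G.VLine) :
    (IsLeft K q v → P.VLeft K v i → (q.1 : ℝ) + 1 / 2 < P.rowPeak i) ∧
      (¬ IsLeft K q v → ¬ P.VLeft K v i → ¬ (q.1 : ℝ) + 1 / 2 < P.rowPeak i) := by
  obtain ⟨h1, h2⟩ := A.center_lt_vcurve_iff K hq v
  rw [← h1]
  have hq' : G.deco q.1 i.1 ≠ none := by rw [hi]; exact hq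
  have hne := (P.row_isPeak i).ne_center (A.row_winding i) hq'
  have hb := P.vcurve_ne K v i
  unfold Peaks.VLeft
  rcases v with r | j
  · simp only [WindingArcs.vcurve] at *
    constructor
    · intro h3 h4; linarith
    · intro h3 h4 h5
      have := lt_of_le_of_ne (not_lt.1 h4) hb.symm
      linarith
  · have hx : ∃ b b' : Fin 2, A.rowArc i b ((q.1 : ℝ) + 1 / 2) < (q.2 : ℝ) + 1 / 2 ∧
        (q.2 : ℝ) + 1 / 2 < A.rowArc i b' ((q.1 : ℝ) + 1 / 2) := by
      have k0 := A.row_winding i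
      rw [← hi]
      by_cases hs : RoC.OnFirstSide (fun c => G.deco c i.1) 0 q.1
      · exact ⟨1, 0, k0.second_side 1 q.1 hq' (by rw [RoC.onFirstSide_one_iff]; simpa using hs),
          k0.first_side 0 q.1 hq' hs⟩
      · exact ⟨0, 1, k0.second_side 0 q.1 hq' hs,
          k0.first_side 1 q.1 hq' (by rw [RoC.onFirstSide_one_iff]; exact hs)⟩
    obtain ⟨b, b', hb1, hb2⟩ := hx
    obtain ⟨_, _, c1⟩ := A.crossing j i (K (.inl j)) b
    obtain ⟨_, _, c2⟩ := A.crossing j i (K (.inl j)) b'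
    have hp : A.rowArc i b (P.rowPeak i) = A.rowArc i b' (P.rowPeak i) := by
      rw [P.rowArc_rowPeak, P.rowArc_rowPeak]
    simp only [WindingArcs.vcurve] at *
    constructor
    · intro h3 h4
      by_contra h5
      have h6 := lt_of_le_of_ne (not_lt.1 h5) hne
      have := c1.symm.gt_of_enclosed c2.symm hp hb1 hb2 h6 h3
      rw [P.rowArc_rowPeak] at this
      linarith
    · intro h3 h4 h5
      have h6 := lt_of_le_of_ne (not_lt.1 h3) h2.symm
      have := c1.symm.lt_of_enclosed c2.symm hp hb1 hb2 h5 h6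
      rw [P.rowArc_rowPeak] at this
      exact hb (le_antisymm this (not_lt.1 h4))

theorem isLeft_inr_iff_not {I J : G.Resolution} {q : Fin G.cols × Fin G.rows} {j : G.SingCol}
    (h : j.1 = q.1) (hIJ : I (.inl j) ≠ J (.inl j)) :
    IsLeft I q (.inr j) ↔ ¬ IsLeft J q (.inr j) := by
  rw [isLeft_inr_iff h, isLeft_inr_iff h]
  obtain ⟨h1, h2⟩ | ⟨h1, h2⟩ : I (.inl j) = 0 ∧ J (.inl j) = 1 ∨ I (.inl j) = 1 ∧ J (.inl j) = 0 := by
    omega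
  · rw [h1, h2, RoC.onFirstSide_one_iff, not_not]
  · rw [h1, h2, RoC.onFirstSide_one_iff]

theorem isBelow_inr_iff_not {I J : G.Resolution} {q : Fin G.cols × Fin G.rows} {i : G.SingRow}
    (h : i.1 = q.2) (hIJ : I (.inr i) ≠ J (.inr i)) :
    IsBelow I q (.inr i) ↔ ¬ IsBelow J q (.inr i) := by
  rw [isBelow_inr_iff h, isBelow_inr_iff h]
  obtain ⟨h1, h2⟩ | ⟨h1, h2⟩ : I (.inr i) = 0 ∧ J (.inr i) = 1 ∨ I (.inr i) = 1 ∧ J (.inr i) = 0 := by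
    omega
  · rw [h1, h2, RoC.onFirstSide_one_iff, not_not]
  · rw [h1, h2, RoC.onFirstSide_one_iff]

/-- If two curves `H`, `H'` pass a decoration on different sides `B`, `B'`, and one of them separates it
from the peak, then they pass the peak on different sides. -/
theorem not_iff_of_separated {B B' H H' p : Prop} (h1 : B → H → p) (h2 : ¬ B → ¬ H → ¬ p)
    (h3 : B' → H' → p) (h4 : ¬ B' → ¬ H' → ¬ p) (hB : B ↔ ¬ B') (hp : ¬ (H ↔ p)) :
    ¬ (H ↔ H') := by
  by_cases B <;> by_cases p <;> by_cases H <;> simp_all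

/-- At a decorated square where two singular RoCs cross, at most one of the two peaks is separated from
its expected side of the decoration by the arcs of the other RoC. -/
theorem Peaks.hBelow_iff_or_vLeft_iff (P : Peaks A) {q : Fin G.cols × Fin G.rows}
    (hq : G.deco q.1 q.2 ≠ none) {j : G.SingCol} (hj : j.1 = q.1) {i : G.SingRow} (hi : i.1 = q.2)
    (K : G.Resolution) :
    (P.HBelow K (.inr i) j ↔ (q.2 : ℝ) + 1 / 2 < P.colPeak j) ∨
      (P.VLeft K (.inr j) i ↔ (q.1 : ℝ) + 1 / 2 < P.rowPeak i) := by
  by_contra hcon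
  obtain ⟨hc1, hc2⟩ := not_or.1 hcon
  set K' : G.Resolution := fun e => 1 - K e
  have hK : ∀ e, K e ≠ K' e := fun e => by simp only [K']; omega
  have a1 := P.hBelow_consistent hq hj K (.inr i)
  have a2 := P.hBelow_consistent hq hj K' (.inr i)
  have b1 := P.vLeft_consistent hq hi K (.inr j)
  have b2 := P.vLeft_consistent hq hi K' (.inr j)
  have c1 := isLeft_inr_iff_not hj (hK (.inl j))
  have c2 := isBelow_inr_iff_not hi (hK (.inr i))
  have w1 : ¬ (P.HBelow K (.inr i) j ↔ P.HBelow K' (.inr i) j) :=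
    not_iff_of_separated a1.1 a1.2 a2.1 a2.2 c2 hc1
  have w2 : ¬ (P.VLeft K (.inr j) i ↔ P.VLeft K' (.inr j) i) :=
    not_iff_of_separated b1.1 b1.2 b2.1 b2.2 c1 hc2
  exact w2 ((P.vLeft_iff_of_hBelow_ne w1 K).trans (P.vLeft_iff_of_hBelow_ne w1 K').symm)

namespace Quad

variable {P : Peaks A} {π : G.Quad}

/-- Translates of the decoration in the interior of a polygon, in terms of the position of the
decoration relative to the lines carrying the sides. -/
theorem contains_iff (hne : π.west ≠ π.east) {q : Fin G.cols × Fin G.rows}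
    (hq : G.deco q.1 q.2 ≠ none) :
    π.Contains P q ↔ ∃ k l : ℤ,
      ((k = 0 ∧ ¬ IsLeft (π.resW P ((q.2 : ℝ) + 1 / 2 + l * G.rows)) q π.west ∧
          (π.east.key < π.west.key ∨
            IsLeft (π.resE P ((q.2 : ℝ) + 1 / 2 + l * G.rows)) q π.east)) ∨
        (k = 1 ∧ π.east.key < π.west.key ∧
          IsLeft (π.resE P ((q.2 : ℝ) + 1 / 2 + l * G.rows)) q π.east)) ∧
      ((l = 0 ∧ ¬ IsBelow (π.resS P ((q.1 : ℝ) + 1 / 2 + k * G.cols)) q π.south ∧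
          (π.north.key < π.south.key ∨
            IsBelow (π.resN P ((q.1 : ℝ) + 1 / 2 + k * G.cols)) q π.north)) ∨
        (l = 1 ∧ π.north.key < π.south.key ∧
          IsBelow (π.resN P ((q.1 : ℝ) + 1 / 2 + k * G.cols)) q π.north)) := by
  have kv : π.west.key ≠ π.east.key := fun e => hne (VLine.key_injective e)
  have kh : π.south.key ≠ π.north.key := fun e => south_ne_north hne (HLine.key_injective e)
  have q1 : ((q.1 : ℕ) : ℝ) + 1 ≤ G.cols := by exact_mod_cast q.1.2
  have q2 : ((q.2 : ℕ) : ℝ) + 1 ≤ G.rows := by exact_mod_cast q.2.2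
  have q10 : (0 : ℝ) ≤ ((q.1 : ℕ) : ℝ) := Nat.cast_nonneg _
  have q20 : (0 : ℝ) ≤ ((q.2 : ℕ) : ℝ) := Nat.cast_nonneg _
  unfold Contains interior
  refine exists_congr fun k => exists_congr fun l => ?_
  rw [Set.mem_ofPred_eq]
  rw [westSide_eq, eastSide_eq, southSide_eq, northSide_eq, wrapH_cast, wrapV_cast,
    A.vcurve_shift, A.vcurve_shift, A.hcurve_shift, A.hcurve_shift, ← and_assoc]
  have cW := A.center_lt_vcurve_iff (π.resW P ((q.2 : ℝ) + 1 / 2 + l * G.rows)) hq π.west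
  have cE := A.center_lt_vcurve_iff (π.resE P ((q.2 : ℝ) + 1 / 2 + l * G.rows)) hq π.east
  have cS := A.center_lt_hcurve_iff (π.resS P ((q.1 : ℝ) + 1 / 2 + k * G.cols)) hq π.south
  have cN := A.center_lt_hcurve_iff (π.resN P ((q.1 : ℝ) + 1 / 2 + k * G.cols)) hq π.north
  rw [← cW.1, ← cE.1, ← cS.1, ← cN.1]
  exact and_congr
    (shift_between_lines_iff (A.vcurve_inStrip _ _ _) (A.vcurve_inStrip _ _ _) kv
      π.west.idx_add_one_le π.east.idx_add_one_le (by linarith) (by linarith) cW.2 k)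
    (shift_between_lines_iff (A.hcurve_inStrip _ _ _) (A.hcurve_inStrip _ _ _) kh
      π.south.idx_add_one_le π.north.idx_add_one_le (by linarith) (by linarith) cS.2 l)

end Quad

/-- How the side of the decoration `q` on the arcs of the singular RoC `e` changes from the
`0`-resolution to the `1`-resolution. -/
def shiftSign (q : Fin G.cols × Fin G.rows) : G.SingRoC → ℤ
  | .inl j => ind (IsLeft (fun _ => 1) q (.inr j)) - ind (IsLeft (fun _ => 0) q (.inr j))
  | .inr i => ind (IsBelow (fun _ => 1) q (.inr i)) - ind (IsBelow (fun _ => 0) q (.inr i))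

/-- The decoration `q` comes before the peak of the singular RoC `e`. -/
def Peaks.decoBefore (P : Peaks A) (q : Fin G.cols × Fin G.rows) : G.SingRoC → ℤ
  | .inl j => ind ((q.2 : ℝ) + 1 / 2 < P.colPeak j)
  | .inr i => ind ((q.1 : ℝ) + 1 / 2 < P.rowPeak i)

theorem isLeft_congr {I J : G.Resolution} {q : Fin G.cols × Fin G.rows} {v : G.VLine}
    (h : ∀ j, v = .inr j → j.1 = q.1 → I (.inl j) = J (.inl j)) :
    IsLeft I q v ↔ IsLeft J q v := by
  by_cases hv : ∃ j, v = .inr j ∧ j.1 = q.1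
  · obtain ⟨j, rfl, hj⟩ := hv
    rw [isLeft_inr_iff hj, isLeft_inr_iff hj, h j rfl hj]
  · push Not at hv
    rw [isLeft_iff_of_ne hv, isLeft_iff_of_ne hv]

theorem isBelow_congr {I J : G.Resolution} {q : Fin G.cols × Fin G.rows} {v : G.HLine}
    (h : ∀ i, v = .inr i → i.1 = q.2 → I (.inr i) = J (.inr i)) :
    IsBelow I q v ↔ IsBelow J q v := by
  by_cases hv : ∃ i, v = .inr i ∧ i.1 = q.2
  · obtain ⟨i, rfl, hi⟩ := hv
    rw [isBelow_inr_iff hi, isBelow_inr_iff hi, h i rfl hi]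
  · push Not at hv
    rw [isBelow_iff_of_ne hv, isBelow_iff_of_ne hv]

theorem shiftSign_inl_of_ne {q : Fin G.cols × Fin G.rows} {j : G.SingCol} (h : j.1 ≠ q.1) :
    shiftSign q (.inl j) = 0 := by
  unfold shiftSign
  simp only
  rw [ind_congr (isLeft_congr (I := fun _ => 1) (J := fun _ => 0)
    (by rintro _ ⟨⟩ hj; exact absurd hj h)), sub_self]

theorem shiftSign_inr_of_ne {q : Fin G.cols × Fin G.rows} {i : G.SingRow} (h : i.1 ≠ q.2) :
    shiftSign q (.inr i) = 0 := by
  unfold shiftSign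
  simp only
  rw [ind_congr (isBelow_congr (I := fun _ => 1) (J := fun _ => 0)
    (by rintro _ ⟨⟩ hj; exact absurd hj h)), sub_self]

theorem ind_isLeft_inr (I : G.Resolution) (q : Fin G.cols × Fin G.rows) (j : G.SingCol) :
    ind (IsLeft I q (.inr j)) =
      ind (IsLeft (fun _ => 0) q (.inr j)) + (I (.inl j) : ℕ) * shiftSign q (.inl j) := by
  obtain h | h : I (.inl j) = 0 ∨ I (.inl j) = 1 := by omega
  · rw [h, ind_congr (isLeft_congr (I := I) (J := fun _ => 0) (by rintro _ ⟨⟩ -; exact h))]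
    simp
  · rw [h, ind_congr (isLeft_congr (I := I) (J := fun _ => 1) (by rintro _ ⟨⟩ -; exact h))]
    simp [shiftSign]

theorem ind_isBelow_inr (I : G.Resolution) (q : Fin G.cols × Fin G.rows) (i : G.SingRow) :
    ind (IsBelow I q (.inr i)) =
      ind (IsBelow (fun _ => 0) q (.inr i)) + (I (.inr i) : ℕ) * shiftSign q (.inr i) := by
  obtain h | h : I (.inr i) = 0 ∨ I (.inr i) = 1 := by omega
  · rw [h, ind_congr (isBelow_congr (I := I) (J := fun _ => 0) (by rintro _ ⟨⟩ -; exact h))]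
    simp
  · rw [h, ind_congr (isBelow_congr (I := I) (J := fun _ => 1) (by rintro _ ⟨⟩ -; exact h))]
    simp [shiftSign]

theorem isLeft_mono {I : G.Resolution} {q : Fin G.cols × Fin G.rows} {v w : G.VLine}
    (h : v.key ≤ w.key) : IsLeft I q v → IsLeft I q w := fun hv => lt_of_lt_of_le hv h

theorem isBelow_mono {I : G.Resolution} {q : Fin G.cols × Fin G.rows} {v w : G.HLine}
    (h : v.key ≤ w.key) : IsBelow I q v → IsBelow I q w := fun hv => lt_of_lt_of_le hv h

/-- A line other than the arc of the column of `q` is on the same side of `q` as of the arc. -/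
theorem isLeft_iff_key_lt {q : Fin G.cols × Fin G.rows} {j : G.SingCol} (hj : j.1 = q.1)
    {v : G.VLine} (hv : v ≠ .inr j) (K : G.Resolution) :
    IsLeft K q v ↔ VLine.key (.inr j : G.VLine) < v.key := by
  rw [isLeft_iff_of_ne, VLine.key_inr, hj]
  rintro j' rfl e
  exact hv (by rw [Subtype.ext (e.trans hj.symm)])

theorem isBelow_iff_key_lt {q : Fin G.cols × Fin G.rows} {i : G.SingRow} (hi : i.1 = q.2)
    {v : G.HLine} (hv : v ≠ .inr i) (K : G.Resolution) :
    IsBelow K q v ↔ HLine.key (.inr i : G.HLine) < v.key := by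
  rw [isBelow_iff_of_ne, HLine.key_inr, hi]
  rintro j' rfl e
  exact hv (by rw [Subtype.ext (e.trans hi.symm)])

namespace Quad

variable {P : Peaks A} {π : G.Quad}

/-- Contribution of the peak of a polygon on `e` to its multiplicity at the decoration `q`. -/
def peakTerm (P : Peaks A) (π : G.Quad) (q : Fin G.cols × Fin G.rows) (e : G.SingRoC) : ℤ :=
  ind (π.start.1 e ≠ π.finish.1 e) *
    (shiftSign q e * (P.decoBefore q e - P.dotBefore π.finish e + ind (π.turn P e = -1)))

theorem peakTerm_inl_of_ne {q : Fin G.cols × Fin G.rows} {j : G.SingCol} (h : j.1 ≠ q.1) :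
    π.peakTerm P q (.inl j) = 0 := by
  unfold peakTerm; rw [shiftSign_inl_of_ne h]; ring

theorem peakTerm_inr_of_ne {q : Fin G.cols × Fin G.rows} {i : G.SingRow} (h : i.1 ≠ q.2) :
    π.peakTerm P q (.inr i) = 0 := by
  unfold peakTerm; rw [shiftSign_inr_of_ne h]; ring

theorem peakTerm_of_eq {q : Fin G.cols × Fin G.rows} {e : G.SingRoC}
    (h : π.start.1 e = π.finish.1 e) : π.peakTerm P q e = 0 := by
  unfold peakTerm; rw [ind_false (not_not.2 h)]; ring

theorem sum_peakTerm_inl {q : Fin G.cols × Fin G.rows} {j : G.SingCol} (hj : j.1 = q.1) :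
    ∑ j', π.peakTerm P q (.inl j') = π.peakTerm P q (.inl j) :=
  Finset.sum_eq_single j
    (fun _ _ h => peakTerm_inl_of_ne fun e => h (Subtype.ext (e.trans hj.symm)))
    (fun h => absurd (Finset.mem_univ _) h)

theorem sum_peakTerm_inr {q : Fin G.cols × Fin G.rows} {i : G.SingRow} (hi : i.1 = q.2) :
    ∑ i', π.peakTerm P q (.inr i') = π.peakTerm P q (.inr i) :=
  Finset.sum_eq_single i
    (fun _ _ h => peakTerm_inr_of_ne fun e => h (Subtype.ext (e.trans hi.symm)))
    (fun h => absurd (Finset.mem_univ _) h)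

/-- What a peak on the west side, on an arc through the column of the decoration, contributes. -/
structure WestPeak (P : Peaks A) (π : G.Quad) (q : Fin G.cols × Fin G.rows) (j : G.SingCol) :
    Prop where
  col : j.1 = q.1
  west : π.west = .inr j
  finish_west : IsLeft π.finish.1 q π.west ↔ ¬ IsLeft π.start.1 q π.west
  east_iff : ∀ K, IsLeft K q π.east ↔ ¬ π.east.key < π.west.key
  crossing : ind (π.north.key < π.south.key) + ind (P.HBelow π.start.1 π.south j) -
    ind (P.HBelow π.finish.1 π.north j) = 1
  west_zero : IsLeft (π.resW P ((q.2 : ℝ) + 1 / 2)) q π.west ↔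
    ((q.2 : ℝ) + 1 / 2 < P.colPeak j ∨ ¬ P.HBelow π.start.1 π.south j ↔ IsLeft π.start.1 q π.west)
  west_one : IsLeft (π.resW P ((q.2 : ℝ) + 1 / 2 + G.rows)) q π.west ↔
    ((q.2 : ℝ) + 1 / 2 < P.colPeak j ∧ ¬ P.HBelow π.start.1 π.south j ↔ IsLeft π.start.1 q π.west)
  term : π.peakTerm P q (.inl j) =
    (ind (¬ IsLeft π.start.1 q π.west) - ind (IsLeft π.start.1 q π.west)) *
      (ind ((q.2 : ℝ) + 1 / 2 < P.colPeak j) - ind (P.HBelow π.finish.1 π.north j))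

/-- What a peak on the east side, on an arc through the column of the decoration, contributes. -/
structure EastPeak (P : Peaks A) (π : G.Quad) (q : Fin G.cols × Fin G.rows) (j : G.SingCol) :
    Prop where
  col : j.1 = q.1
  east : π.east = .inr j
  finish_east : IsLeft π.finish.1 q π.east ↔ ¬ IsLeft π.start.1 q π.east
  west_iff : ∀ K, IsLeft K q π.west ↔ π.east.key < π.west.key
  crossing : ind (π.north.key < π.south.key) + ind (P.HBelow π.finish.1 π.south j) -
    ind (P.HBelow π.start.1 π.north j) = 1
  east_zero : IsLeft (π.resE P ((q.2 : ℝ) + 1 / 2)) q π.east ↔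
    ((q.2 : ℝ) + 1 / 2 < P.colPeak j ∨ ¬ P.HBelow π.finish.1 π.south j ↔
      ¬ IsLeft π.start.1 q π.east)
  east_one : IsLeft (π.resE P ((q.2 : ℝ) + 1 / 2 + G.rows)) q π.east ↔
    ((q.2 : ℝ) + 1 / 2 < P.colPeak j ∧ ¬ P.HBelow π.finish.1 π.south j ↔
      ¬ IsLeft π.start.1 q π.east)
  term : π.peakTerm P q (.inl j) =
    (ind (¬ IsLeft π.start.1 q π.east) - ind (IsLeft π.start.1 q π.east)) *
      (ind ((q.2 : ℝ) + 1 / 2 < P.colPeak j) - ind (P.HBelow π.finish.1 π.south j) + 1)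

/-- What a peak on the south side, on an arc through the row of the decoration, contributes. -/
structure SouthPeak (P : Peaks A) (π : G.Quad) (q : Fin G.cols × Fin G.rows) (i : G.SingRow) :
    Prop where
  row : i.1 = q.2
  south : π.south = .inr i
  finish_south : IsBelow π.finish.1 q π.south ↔ ¬ IsBelow π.start.1 q π.south
  north_iff : ∀ K, IsBelow K q π.north ↔ ¬ π.north.key < π.south.key
  crossing : ind (π.east.key < π.west.key) + ind (P.VLeft π.start.1 π.west i) -
    ind (P.VLeft π.finish.1 π.east i) = 1
  south_zero : IsBelow (π.resS P ((q.1 : ℝ) + 1 / 2)) q π.south ↔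
    ((q.1 : ℝ) + 1 / 2 < P.rowPeak i ∨ ¬ P.VLeft π.start.1 π.west i ↔ IsBelow π.start.1 q π.south)
  south_one : IsBelow (π.resS P ((q.1 : ℝ) + 1 / 2 + G.cols)) q π.south ↔
    ((q.1 : ℝ) + 1 / 2 < P.rowPeak i ∧ ¬ P.VLeft π.start.1 π.west i ↔ IsBelow π.start.1 q π.south)
  term : π.peakTerm P q (.inr i) =
    (ind (¬ IsBelow π.start.1 q π.south) - ind (IsBelow π.start.1 q π.south)) *
      (ind ((q.1 : ℝ) + 1 / 2 < P.rowPeak i) - ind (P.VLeft π.finish.1 π.east i))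

/-- What a peak on the north side, on an arc through the row of the decoration, contributes. -/
structure NorthPeak (P : Peaks A) (π : G.Quad) (q : Fin G.cols × Fin G.rows) (i : G.SingRow) :
    Prop where
  row : i.1 = q.2
  north : π.north = .inr i
  finish_north : IsBelow π.finish.1 q π.north ↔ ¬ IsBelow π.start.1 q π.north
  south_iff : ∀ K, IsBelow K q π.south ↔ π.north.key < π.south.key
  crossing : ind (π.east.key < π.west.key) + ind (P.VLeft π.finish.1 π.west i) -
    ind (P.VLeft π.start.1 π.east i) = 1
  north_zero : IsBelow (π.resN P ((q.1 : ℝ) + 1 / 2)) q π.north ↔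
    ((q.1 : ℝ) + 1 / 2 < P.rowPeak i ∨ ¬ P.VLeft π.finish.1 π.west i ↔
      ¬ IsBelow π.start.1 q π.north)
  north_one : IsBelow (π.resN P ((q.1 : ℝ) + 1 / 2 + G.cols)) q π.north ↔
    ((q.1 : ℝ) + 1 / 2 < P.rowPeak i ∧ ¬ P.VLeft π.finish.1 π.west i ↔
      ¬ IsBelow π.start.1 q π.north)
  term : π.peakTerm P q (.inr i) =
    (ind (¬ IsBelow π.start.1 q π.north) - ind (IsBelow π.start.1 q π.north)) *
      (ind ((q.1 : ℝ) + 1 / 2 < P.rowPeak i) - ind (P.VLeft π.finish.1 π.west i) + 1)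

theorem IsPolygon.cr_eq_one (hπ : π.IsPolygon P) {d : Compass} {e : G.SingRoC}
    (h : π.sideRoC d = some e) (he : π.start.1 e ≠ π.finish.1 e) : π.cr P d = 1 :=
  (forall_peakOnSide_iff hπ.west_ne_east).1 hπ.peaks d (mem_peakSides.2 ⟨e, h, he⟩)

theorem IsPolygon.shiftSign_eq (hπ : π.IsPolygon P) {q : Fin G.cols × Fin G.rows} {j : G.SingCol}
    (hj : j.1 = q.1) (hf : π.start.1 (.inl j) ≠ π.finish.1 (.inl j)) :
    shiftSign q (.inl j) =
      ind (¬ IsLeft π.start.1 q (.inr j)) - ind (IsLeft π.start.1 q (.inr j)) := by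
  obtain ⟨h0, h1, -⟩ := hπ.resolutions _ hf
  unfold shiftSign
  simp only
  rw [ind_congr (isLeft_congr (I := fun _ => 1) (J := π.finish.1) (by rintro _ ⟨⟩ -; exact h1.symm)),
    ind_congr (isLeft_inr_iff_not hj hf.symm),
    ind_congr (isLeft_congr (I := fun _ => 0) (J := π.start.1) (by rintro _ ⟨⟩ -; exact h0.symm))]

theorem IsPolygon.shiftSign_eq' (hπ : π.IsPolygon P) {q : Fin G.cols × Fin G.rows} {i : G.SingRow}
    (hi : i.1 = q.2) (hf : π.start.1 (.inr i) ≠ π.finish.1 (.inr i)) :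
    shiftSign q (.inr i) =
      ind (¬ IsBelow π.start.1 q (.inr i)) - ind (IsBelow π.start.1 q (.inr i)) := by
  obtain ⟨h0, h1, -⟩ := hπ.resolutions _ hf
  unfold shiftSign
  simp only
  rw [ind_congr (isBelow_congr (I := fun _ => 1) (J := π.finish.1) (by rintro _ ⟨⟩ -; exact h1.symm)),
    ind_congr (isBelow_inr_iff_not hi hf.symm),
    ind_congr (isBelow_congr (I := fun _ => 0) (J := π.start.1) (by rintro _ ⟨⟩ -; exact h0.symm))]

theorem q2_bounds (q : Fin G.cols × Fin G.rows) :
    (0 : ℝ) < (q.2 : ℝ) + 1 / 2 ∧ (q.2 : ℝ) + 1 / 2 < G.rows := by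
  have q2 : ((q.2 : ℕ) : ℝ) + 1 ≤ G.rows := by exact_mod_cast q.2.2
  have q20 : (0 : ℝ) ≤ ((q.2 : ℕ) : ℝ) := Nat.cast_nonneg _
  constructor <;> linarith

theorem q1_bounds (q : Fin G.cols × Fin G.rows) :
    (0 : ℝ) < (q.1 : ℝ) + 1 / 2 ∧ (q.1 : ℝ) + 1 / 2 < G.cols := by
  have q2 : ((q.1 : ℕ) : ℝ) + 1 ≤ G.cols := by exact_mod_cast q.1.2
  have q20 : (0 : ℝ) ≤ ((q.1 : ℕ) : ℝ) := Nat.cast_nonneg _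
  constructor <;> linarith

theorem isLeft_ite {c : Prop} [Decidable c] {a : Prop} {K L : G.Resolution}
    {q : Fin G.cols × Fin G.rows} {v : G.VLine} (hK : IsLeft K q v ↔ a) (hL : IsLeft L q v ↔ ¬ a) :
    IsLeft (if c then K else L) q v ↔ (c ↔ a) := by
  split_ifs with h <;> simp [h, hK, hL]

theorem isBelow_ite {c : Prop} [Decidable c] {a : Prop} {K L : G.Resolution}
    {q : Fin G.cols × Fin G.rows} {v : G.HLine} (hK : IsBelow K q v ↔ a) (hL : IsBelow L q v ↔ ¬ a) :
    IsBelow (if c then K else L) q v ↔ (c ↔ a) := by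
  split_ifs with h <;> simp [h, hK, hL]

theorem le_lift_col_iff {q : Fin G.cols × Fin G.rows} (hq : G.deco q.1 q.2 ≠ none)
    {s n : G.HLine} (hsn : s ≠ n) {j : G.SingCol} (hj : j.1 = q.1) {K L : G.Resolution}
    (hc : ind (n.key < s.key) + ind (P.HBelow K s j) - ind (P.HBelow L n j) = 1) :
    ((q.2 : ℝ) + 1 / 2 ≤ lift s.idx G.rows (P.colPeak j) ↔
      (q.2 : ℝ) + 1 / 2 < P.colPeak j ∨ ¬ P.HBelow K s j) ∧
    ((q.2 : ℝ) + 1 / 2 + G.rows ≤ lift s.idx G.rows (P.colPeak j) ↔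
      (q.2 : ℝ) + 1 / 2 < P.colPeak j ∧ ¬ P.HBelow K s j) := by
  have hq' : G.deco j.1 q.2 ≠ none := by rw [hj]; exact hq
  refine le_lift_iff ?_ (q2_bounds q).2 (q2_bounds q).1
    ((P.col_isPeak j).ne_center (A.col_winding j) hq').symm (P.col_isPeak j).2.1
    (P.col_isPeak j).1 ((hcurve_lift_iff P hsn j K L).2 hc).1
  rw [HLine.idx_eq]
  exact (A.hcurve_inStrip K s (P.colAbs j)).le

theorem le_lift_row_iff {q : Fin G.cols × Fin G.rows} (hq : G.deco q.1 q.2 ≠ none)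
    {w e : G.VLine} (hwe : w ≠ e) {i : G.SingRow} (hi : i.1 = q.2) {K L : G.Resolution}
    (hc : ind (e.key < w.key) + ind (P.VLeft K w i) - ind (P.VLeft L e i) = 1) :
    ((q.1 : ℝ) + 1 / 2 ≤ lift w.idx G.cols (P.rowPeak i) ↔
      (q.1 : ℝ) + 1 / 2 < P.rowPeak i ∨ ¬ P.VLeft K w i) ∧
    ((q.1 : ℝ) + 1 / 2 + G.cols ≤ lift w.idx G.cols (P.rowPeak i) ↔
      (q.1 : ℝ) + 1 / 2 < P.rowPeak i ∧ ¬ P.VLeft K w i) := by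
  have hq' : G.deco q.1 i.1 ≠ none := by rw [hi]; exact hq
  refine le_lift_iff ?_ (q1_bounds q).2 (q1_bounds q).1
    ((P.row_isPeak i).ne_center (A.row_winding i) hq').symm (P.row_isPeak i).2.1
    (P.row_isPeak i).1 ((vcurve_lift_iff P hwe i K L).2 hc).1
  rw [VLine.idx_eq]
  exact (A.vcurve_inStrip K w (P.rowHgt i)).le

theorem IsPolygon.westPeak (hπ : π.IsPolygon P) {q : Fin G.cols × Fin G.rows}
    (hq : G.deco q.1 q.2 ≠ none) {j : G.SingCol} (hj : j.1 = q.1) (hw : π.west = .inr j)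
    (hf : π.start.1 (.inl j) ≠ π.finish.1 (.inl j)) : π.WestPeak P q j := by
  have hne := hπ.west_ne_east
  have hd : π.sideRoC .west = some (.inl j) := by simp [sideRoC, hw, VLine.roc]
  have hcr := hπ.cr_eq_one hd hf
  have ht := turn_eq (P := P) hne hπ.finish_eq hd
  rw [hcr] at ht
  simp only [cr, hw, Peaks.hb] at hcr
  have hfw : IsLeft π.finish.1 q π.west ↔ ¬ IsLeft π.start.1 q π.west := by
    rw [hw]; exact isLeft_inr_iff_not hj hf.symm
  have hb : π.bend P .west = lift π.south.idx G.rows (P.colPeak j) := by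
    simp only [bend, hw, Peaks.onV]
  have hl := le_lift_col_iff hq (south_ne_north hne) hj hcr
  refine ⟨hj, hw, hfw, fun K => ?_, hcr, ?_, ?_, ?_⟩
  · rw [isLeft_iff_key_lt hj (fun e => hne (hw.trans e.symm)), ← hw]
    have : π.west.key ≠ π.east.key := fun e => hne (VLine.key_injective e)
    omega
  · unfold resW
    rw [isLeft_ite Iff.rfl hfw, hb, hl.1]
  · unfold resW
    rw [isLeft_ite Iff.rfl hfw, hb, hl.2]
  · have h2 : π.finish.2 (.inr j) = π.north := by
      rw [hπ.finish_eq, ← hw]; simp [north]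
    unfold peakTerm
    rw [ind_true hf, hπ.shiftSign_eq hj hf, ht, hw]
    simp [Peaks.decoBefore, Peaks.dotBefore, Peaks.hb, h2, orient]

theorem IsPolygon.eastPeak (hπ : π.IsPolygon P) {q : Fin G.cols × Fin G.rows}
    (hq : G.deco q.1 q.2 ≠ none) {j : G.SingCol} (hj : j.1 = q.1) (hw : π.east = .inr j)
    (hf : π.start.1 (.inl j) ≠ π.finish.1 (.inl j)) : π.EastPeak P q j := by
  have hne := hπ.west_ne_east
  have hd : π.sideRoC .east = some (.inl j) := by simp [sideRoC, hw, VLine.roc]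
  have hcr := hπ.cr_eq_one hd hf
  have ht := turn_eq (P := P) hne hπ.finish_eq hd
  rw [hcr] at ht
  simp only [cr, hw, Peaks.hb] at hcr
  have hfw : IsLeft π.finish.1 q π.east ↔ ¬ IsLeft π.start.1 q π.east := by
    rw [hw]; exact isLeft_inr_iff_not hj hf.symm
  have hb : π.bend P .east = lift π.south.idx G.rows (P.colPeak j) := by
    simp only [bend, hw, Peaks.onV]
  have hl := le_lift_col_iff hq (south_ne_north hne) hj hcr
  refine ⟨hj, hw, hfw, fun K => ?_, hcr, ?_, ?_, ?_⟩
  · rw [isLeft_iff_key_lt hj (fun e => hne (e.trans hw.symm)), ← hw]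
  · unfold resE
    rw [isLeft_ite hfw not_not.symm, hb, hl.1]
  · unfold resE
    rw [isLeft_ite hfw not_not.symm, hb, hl.2]
  · have h2 : π.finish.2 (.inr j) = π.south := by
      rw [hπ.finish_eq, ← hw]; simp [south]
    unfold peakTerm
    rw [ind_true hf, hπ.shiftSign_eq hj hf, ht, hw]
    simp [Peaks.decoBefore, Peaks.dotBefore, Peaks.hb, h2, orient]

theorem IsPolygon.southPeak (hπ : π.IsPolygon P) {q : Fin G.cols × Fin G.rows}
    (hq : G.deco q.1 q.2 ≠ none) {i : G.SingRow} (hi : i.1 = q.2) (hw : π.south = .inr i)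
    (hf : π.start.1 (.inr i) ≠ π.finish.1 (.inr i)) : π.SouthPeak P q i := by
  have hne := hπ.west_ne_east
  have hsn := south_ne_north hne
  have hd : π.sideRoC .south = some (.inr i) := by simp [sideRoC, hw, HLine.roc]
  have hcr := hπ.cr_eq_one hd hf
  have ht := turn_eq (P := P) hne hπ.finish_eq hd
  rw [hcr] at ht
  simp only [cr, hw, Peaks.vl] at hcr
  have hfw : IsBelow π.finish.1 q π.south ↔ ¬ IsBelow π.start.1 q π.south := by
    rw [hw]; exact isBelow_inr_iff_not hi hf.symm
  have hb : π.bend P .south = lift π.west.idx G.cols (P.rowPeak i) := by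
    simp only [bend, hw, Peaks.onH]
  have hl := le_lift_row_iff hq hne hi hcr
  refine ⟨hi, hw, hfw, fun K => ?_, hcr, ?_, ?_, ?_⟩
  · rw [isBelow_iff_key_lt hi (fun e => hsn (hw.trans e.symm)), ← hw]
    have : π.south.key ≠ π.north.key := fun e => hsn (HLine.key_injective e)
    omega
  · unfold resS
    rw [isBelow_ite Iff.rfl hfw, hb, hl.1]
  · unfold resS
    rw [isBelow_ite Iff.rfl hfw, hb, hl.2]
  · have h2 : π.finish.2.symm (.inr i) = π.east := by
      rw [finish_symm_apply hπ.finish_eq, ← hw]; simp [south]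
    unfold peakTerm
    rw [ind_true hf, hπ.shiftSign_eq' hi hf, ht, hw]
    simp [Peaks.decoBefore, Peaks.dotBefore, Peaks.vl, h2, orient]

theorem IsPolygon.northPeak (hπ : π.IsPolygon P) {q : Fin G.cols × Fin G.rows}
    (hq : G.deco q.1 q.2 ≠ none) {i : G.SingRow} (hi : i.1 = q.2) (hw : π.north = .inr i)
    (hf : π.start.1 (.inr i) ≠ π.finish.1 (.inr i)) : π.NorthPeak P q i := by
  have hne := hπ.west_ne_east
  have hsn := south_ne_north hne
  have hd : π.sideRoC .north = some (.inr i) := by simp [sideRoC, hw, HLine.roc]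
  have hcr := hπ.cr_eq_one hd hf
  have ht := turn_eq (P := P) hne hπ.finish_eq hd
  rw [hcr] at ht
  simp only [cr, hw, Peaks.vl] at hcr
  have hfw : IsBelow π.finish.1 q π.north ↔ ¬ IsBelow π.start.1 q π.north := by
    rw [hw]; exact isBelow_inr_iff_not hi hf.symm
  have hb : π.bend P .north = lift π.west.idx G.cols (P.rowPeak i) := by
    simp only [bend, hw, Peaks.onH]
  have hl := le_lift_row_iff hq hne hi hcr
  refine ⟨hi, hw, hfw, fun K => ?_, hcr, ?_, ?_, ?_⟩
  · rw [isBelow_iff_key_lt hi (fun e => hsn (e.trans hw.symm)), ← hw]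
  · unfold resN
    rw [isBelow_ite hfw not_not.symm, hb, hl.1]
  · unfold resN
    rw [isBelow_ite hfw not_not.symm, hb, hl.2]
  · have h2 : π.finish.2.symm (.inr i) = π.west := by
      rw [finish_symm_apply hπ.finish_eq, ← hw]; simp [north]
    unfold peakTerm
    rw [ind_true hf, hπ.shiftSign_eq' hi hf, ht, hw]
    simp [Peaks.decoBefore, Peaks.dotBefore, Peaks.vl, h2, orient]

end Quad

end SingularGrid

theorem exists_translate_iff_overlap {oH oV : Prop} {W E S N : ℤ → Prop} :
    (∃ k l : ℤ, ((k = 0 ∧ ¬ W l ∧ (oH ∨ E l)) ∨ (k = 1 ∧ oH ∧ E l)) ∧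
      ((l = 0 ∧ ¬ S k ∧ (oV ∨ N k)) ∨ (l = 1 ∧ oV ∧ N k))) ↔
    Overlap oH oV (W 0) (W 1) (E 0) (E 1) (S 0) (S 1) (N 0) (N 1) := by
  unfold Overlap
  constructor
  · rintro ⟨k, l, ⟨rfl, a, b⟩ | ⟨rfl, a, b⟩, ⟨rfl, c, d⟩ | ⟨rfl, c, d⟩⟩
    · exact Or.inl ⟨a, b, c, d⟩
    · exact Or.inr (Or.inl ⟨a, b, c, d⟩)
    · exact Or.inr (Or.inr (Or.inl ⟨a, b, c, d⟩))
    · exact Or.inr (Or.inr (Or.inr ⟨a, b, c, d⟩))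
  · rintro (⟨a, b, c, d⟩ | ⟨a, b, c, d⟩ | ⟨a, b, c, d⟩ | ⟨a, b, c, d⟩)
    · exact ⟨0, 0, Or.inl ⟨rfl, a, b⟩, Or.inl ⟨rfl, c, d⟩⟩
    · exact ⟨0, 1, Or.inl ⟨rfl, a, b⟩, Or.inr ⟨rfl, c, d⟩⟩
    · exact ⟨1, 0, Or.inr ⟨rfl, a, b⟩, Or.inl ⟨rfl, c, d⟩⟩
    · exact ⟨1, 1, Or.inr ⟨rfl, a, b⟩, Or.inr ⟨rfl, c, d⟩⟩

namespace SingularGrid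

variable {G : SingularGrid} {A : G.WindingArcs}

namespace Quad

variable {P : Peaks A} {π : G.Quad}

theorem contains_iff_overlap (hne : π.west ≠ π.east) {q : Fin G.cols × Fin G.rows}
    (hq : G.deco q.1 q.2 ≠ none) :
    π.Contains P q ↔ Overlap (π.east.key < π.west.key) (π.north.key < π.south.key)
      (IsLeft (π.resW P ((q.2 : ℝ) + 1 / 2)) q π.west)
      (IsLeft (π.resW P ((q.2 : ℝ) + 1 / 2 + G.rows)) q π.west)
      (IsLeft (π.resE P ((q.2 : ℝ) + 1 / 2)) q π.east)
      (IsLeft (π.resE P ((q.2 : ℝ) + 1 / 2 + G.rows)) q π.east)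
      (IsBelow (π.resS P ((q.1 : ℝ) + 1 / 2)) q π.south)
      (IsBelow (π.resS P ((q.1 : ℝ) + 1 / 2 + G.cols)) q π.south)
      (IsBelow (π.resN P ((q.1 : ℝ) + 1 / 2)) q π.north)
      (IsBelow (π.resN P ((q.1 : ℝ) + 1 / 2 + G.cols)) q π.north) := by
  rw [contains_iff hne hq, exists_translate_iff_overlap
    (W := fun l : ℤ => IsLeft (π.resW P ((q.2 : ℝ) + 1 / 2 + l * G.rows)) q π.west)
    (E := fun l : ℤ => IsLeft (π.resE P ((q.2 : ℝ) + 1 / 2 + l * G.rows)) q π.east)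
    (S := fun k : ℤ => IsBelow (π.resS P ((q.1 : ℝ) + 1 / 2 + k * G.cols)) q π.south)
    (N := fun k : ℤ => IsBelow (π.resN P ((q.1 : ℝ) + 1 / 2 + k * G.cols)) q π.north)]
  simp only [Int.cast_zero, zero_mul, add_zero, Int.cast_one, one_mul]

/-- No peak on an arc through the column of the decoration. -/
structure ColPlain (P : Peaks A) (π : G.Quad) (q : Fin G.cols × Fin G.rows) : Prop where
  finish_iff : ∀ v, IsLeft π.finish.1 q v ↔ IsLeft π.start.1 q v
  sum_eq : ∑ j, π.peakTerm P q (.inl j) = 0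

/-- No peak on an arc through the row of the decoration. -/
structure RowPlain (P : Peaks A) (π : G.Quad) (q : Fin G.cols × Fin G.rows) : Prop where
  finish_iff : ∀ v, IsBelow π.finish.1 q v ↔ IsBelow π.start.1 q v
  sum_eq : ∑ i, π.peakTerm P q (.inr i) = 0

theorem ColPlain.resW_iff {q : Fin G.cols × Fin G.rows} (h : π.ColPlain P q) (t : ℝ) :
    IsLeft (π.resW P t) q π.west ↔ IsLeft π.start.1 q π.west := by
  unfold resW; split_ifs
  · rfl
  · exact h.finish_iff _

theorem ColPlain.resE_iff {q : Fin G.cols × Fin G.rows} (h : π.ColPlain P q) (t : ℝ) :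
    IsLeft (π.resE P t) q π.east ↔ IsLeft π.start.1 q π.east := by
  unfold resE; split_ifs
  · exact h.finish_iff _
  · rfl

theorem RowPlain.resS_iff {q : Fin G.cols × Fin G.rows} (h : π.RowPlain P q) (t : ℝ) :
    IsBelow (π.resS P t) q π.south ↔ IsBelow π.start.1 q π.south := by
  unfold resS; split_ifs
  · rfl
  · exact h.finish_iff _

theorem RowPlain.resN_iff {q : Fin G.cols × Fin G.rows} (h : π.RowPlain P q) (t : ℝ) :
    IsBelow (π.resN P t) q π.north ↔ IsBelow π.start.1 q π.north := by
  unfold resN; split_ifs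
  · exact h.finish_iff _
  · rfl

theorem WestPeak.resE_iff {q : Fin G.cols × Fin G.rows} {j : G.SingCol} (h : π.WestPeak P q j)
    (t : ℝ) : IsLeft (π.resE P t) q π.east ↔ ¬ π.east.key < π.west.key := h.east_iff _

theorem EastPeak.resW_iff {q : Fin G.cols × Fin G.rows} {j : G.SingCol} (h : π.EastPeak P q j)
    (t : ℝ) : IsLeft (π.resW P t) q π.west ↔ π.east.key < π.west.key := h.west_iff _

theorem SouthPeak.resN_iff {q : Fin G.cols × Fin G.rows} {i : G.SingRow} (h : π.SouthPeak P q i)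
    (t : ℝ) : IsBelow (π.resN P t) q π.north ↔ ¬ π.north.key < π.south.key := h.north_iff _

theorem NorthPeak.resS_iff {q : Fin G.cols × Fin G.rows} {i : G.SingRow} (h : π.NorthPeak P q i)
    (t : ℝ) : IsBelow (π.resS P t) q π.south ↔ π.north.key < π.south.key := h.south_iff _

theorem IsPolygon.col_cases (hπ : π.IsPolygon P) {q : Fin G.cols × Fin G.rows}
    (hq : G.deco q.1 q.2 ≠ none) :
    π.ColPlain P q ∨ (∃ j, π.WestPeak P q j) ∨ ∃ j, π.EastPeak P q j := by
  by_cases h : ∃ j : G.SingCol, j.1 = q.1 ∧ π.start.1 (.inl j) ≠ π.finish.1 (.inl j)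
  · obtain ⟨j, hj, hf⟩ := h
    obtain ⟨-, -, d, hd⟩ := hπ.resolutions _ hf
    rcases d with _ | _ | _ | _
    · rcases hs : π.north with r | i <;> simp [sideRoC, hs, HLine.roc] at hd
    · rcases hs : π.south with r | i <;> simp [sideRoC, hs, HLine.roc] at hd
    · rcases hs : π.east with r | i <;> simp [sideRoC, hs, VLine.roc] at hd
      subst hd
      exact Or.inr (Or.inr ⟨_, hπ.eastPeak hq hj hs hf⟩)
    · rcases hs : π.west with r | i <;> simp [sideRoC, hs, VLine.roc] at hd
      subst hd
      exact Or.inr (Or.inl ⟨_, hπ.westPeak hq hj hs hf⟩)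
  · push Not at h
    refine Or.inl ⟨fun v => isLeft_congr fun j _ hj => (h j hj).symm,
      Finset.sum_eq_zero fun j _ => ?_⟩
    by_cases hj : j.1 = q.1
    · exact peakTerm_of_eq (h j hj)
    · exact peakTerm_inl_of_ne hj

theorem IsPolygon.row_cases (hπ : π.IsPolygon P) {q : Fin G.cols × Fin G.rows}
    (hq : G.deco q.1 q.2 ≠ none) :
    π.RowPlain P q ∨ (∃ i, π.SouthPeak P q i) ∨ ∃ i, π.NorthPeak P q i := by
  by_cases h : ∃ i : G.SingRow, i.1 = q.2 ∧ π.start.1 (.inr i) ≠ π.finish.1 (.inr i)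
  · obtain ⟨j, hj, hf⟩ := h
    obtain ⟨-, -, d, hd⟩ := hπ.resolutions _ hf
    rcases d with _ | _ | _ | _
    · rcases hs : π.north with r | i <;> simp [sideRoC, hs, HLine.roc] at hd
      subst hd
      exact Or.inr (Or.inr ⟨_, hπ.northPeak hq hj hs hf⟩)
    · rcases hs : π.south with r | i <;> simp [sideRoC, hs, HLine.roc] at hd
      subst hd
      exact Or.inr (Or.inl ⟨_, hπ.southPeak hq hj hs hf⟩)
    · rcases hs : π.east with r | i <;> simp [sideRoC, hs, VLine.roc] at hd
    · rcases hs : π.west with r | i <;> simp [sideRoC, hs, VLine.roc] at hd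
  · push Not at h
    refine Or.inl ⟨fun v => isBelow_congr fun j _ hj => (h j hj).symm,
      Finset.sum_eq_zero fun j _ => ?_⟩
    by_cases hj : j.1 = q.2
    · exact peakTerm_of_eq (h j hj)
    · exact peakTerm_inr_of_ne hj

/-- The multiplicity of a polygon at a decoration in terms of the relative position of the decoration
and the lines through the corners of the polygon, and of the peaks. -/
theorem IsPolygon.ind_contains (hπ : π.IsPolygon P) {q : Fin G.cols × Fin G.rows}
    (hq : G.deco q.1 q.2 ≠ none) :
    ind (π.Contains P q) =
      ind (IsLeft π.start.1 q π.west) * ind (IsBelow π.start.1 q π.south) +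
      ind (IsLeft π.start.1 q π.east) * ind (IsBelow π.start.1 q π.north) -
      ind (IsLeft π.finish.1 q π.west) * ind (IsBelow π.finish.1 q π.north) -
      ind (IsLeft π.finish.1 q π.east) * ind (IsBelow π.finish.1 q π.south) +
      ind (π.east.key < π.west.key) *
        (ind (IsBelow π.start.1 q π.north) - ind (IsBelow π.start.1 q π.south)) +
      ind (π.north.key < π.south.key) *
        (ind (IsLeft π.start.1 q π.east) - ind (IsLeft π.start.1 q π.west)) +
      ind (π.east.key < π.west.key) * ind (π.north.key < π.south.key) +
      ∑ e, π.peakTerm P q e := by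
  have hne := hπ.west_ne_east
  have kv : π.west.key ≠ π.east.key := fun e => hne (VLine.key_injective e)
  have kh : π.south.key ≠ π.north.key := fun e => south_ne_north hne (HLine.key_injective e)
  rw [ind_congr (contains_iff_overlap hne hq), Fintype.sum_sum_type]
  have hV : ¬ π.north.key < π.south.key →
      IsBelow π.start.1 q π.south → IsBelow π.start.1 q π.north :=
    fun h => isBelow_mono (by omega)
  have hV' : π.north.key < π.south.key →
      IsBelow π.start.1 q π.north → IsBelow π.start.1 q π.south :=
    fun h => isBelow_mono (by omega)
  have hH : ¬ π.east.key < π.west.key →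
      IsLeft π.start.1 q π.west → IsLeft π.start.1 q π.east :=
    fun h => isLeft_mono (by omega)
  have hH' : π.east.key < π.west.key →
      IsLeft π.start.1 q π.east → IsLeft π.start.1 q π.west :=
    fun h => isLeft_mono (by omega)
  -- At most one vertical and one horizontal side have a peak near the decoration. If there are two of
  -- them, the bits describing their arcs are related by `hBelow_iff_or_vLeft_iff`.
  rcases hπ.col_cases hq with hc | ⟨j, hc⟩ | ⟨j, hc⟩
  · simp only [propext (hc.resW_iff _), propext (hc.resE_iff _), propext (hc.finish_iff _), hc.sum_eq]
    rcases hπ.row_cases hq with hr | ⟨i, hr⟩ | ⟨i, hr⟩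
    · simp only [propext (hr.resS_iff _), propext (hr.resN_iff _), propext (hr.finish_iff _),
        hr.sum_eq]
      rw [ind_overlap hH hH' hV hV']
      ring
    · rw [propext Overlap.transpose, propext (hr.south_zero), propext (hr.south_one),
        propext (hr.resN_iff _), propext (hr.resN_iff _), propext hr.finish_south,
        sum_peakTerm_inr hr.row, hr.term, ind_congr (hr.north_iff π.start.1),
        ind_congr (hr.north_iff π.finish.1)]
      have c1 := P.vLeft_consistent hq hr.row π.start.1 π.west
      have c2 := P.vLeft_consistent hq hr.row π.finish.1 π.east
      rw [hc.finish_iff] at c2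
      rw [ind_overlap_west hH hH' hr.crossing c1.1 c1.2 c2.1 c2.2]
      ring
    · rw [propext Overlap.transpose, propext (hr.north_zero), propext (hr.north_one),
        propext (hr.resS_iff _), propext (hr.resS_iff _), propext hr.finish_north,
        sum_peakTerm_inr hr.row, hr.term, ind_congr (hr.south_iff π.start.1),
        ind_congr (hr.south_iff π.finish.1)]
      have c1 := P.vLeft_consistent hq hr.row π.finish.1 π.west
      have c2 := P.vLeft_consistent hq hr.row π.start.1 π.east
      rw [hc.finish_iff] at c1
      rw [ind_overlap_east hH hH' hr.crossing c1.1 c1.2 c2.1 c2.2]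
      ring
  · rw [propext hc.west_zero, propext hc.west_one, propext (hc.resE_iff _),
      propext (hc.resE_iff _), propext hc.finish_west, sum_peakTerm_inl hc.col, hc.term,
      ind_congr (hc.east_iff π.start.1), ind_congr (hc.east_iff π.finish.1)]
    have c1 := P.hBelow_consistent hq hc.col π.start.1 π.south
    have c2 := P.hBelow_consistent hq hc.col π.finish.1 π.north
    rcases hπ.row_cases hq with hr | ⟨i, hr⟩ | ⟨i, hr⟩
    · simp only [propext (hr.resS_iff _), propext (hr.resN_iff _), propext (hr.finish_iff _),
        hr.sum_eq] at c2 ⊢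
      rw [ind_overlap_west hV hV' hc.crossing c1.1 c1.2 c2.1 c2.2]
      ring
    · have d1 := P.vLeft_consistent hq hr.row π.start.1 π.west
      have d2 := P.vLeft_consistent hq hr.row π.finish.1 π.east
      have hor := P.hBelow_iff_or_vLeft_iff hq hc.col hr.row π.start.1
      rw [← hc.west, ← hr.south] at hor
      rw [hr.north_iff, not_not] at c2
      rw [hc.east_iff, not_not] at d2
      rw [propext (hr.south_zero), propext (hr.south_one),
        propext (hr.resN_iff _), propext (hr.resN_iff _), propext hr.finish_south,
        sum_peakTerm_inr hr.row, hr.term, ind_congr (hr.north_iff π.start.1),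
        ind_congr (hr.north_iff π.finish.1), ind_overlap_west_south hc.crossing hr.crossing
          c1.1 c1.2 c2.1 c2.2 d1.1 d1.2 d2.1 d2.2 hor]
      ring
    · have d1 := P.vLeft_consistent hq hr.row π.finish.1 π.west
      have d2 := P.vLeft_consistent hq hr.row π.start.1 π.east
      have hor := P.hBelow_iff_or_vLeft_iff hq hc.col hr.row π.finish.1
      rw [← hc.west, ← hr.north] at hor
      rw [hr.south_iff] at c1
      rw [hr.finish_north, not_not] at c2
      rw [hc.finish_west, not_not] at d1
      rw [hc.east_iff, not_not] at d2
      rw [propext (hr.north_zero), propext (hr.north_one),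
        propext (hr.resS_iff _), propext (hr.resS_iff _), propext hr.finish_north,
        sum_peakTerm_inr hr.row, hr.term, ind_congr (hr.south_iff π.start.1),
        ind_congr (hr.south_iff π.finish.1), ind_overlap_west_north hc.crossing hr.crossing
          c1.1 c1.2 c2.1 c2.2 d1.1 d1.2 d2.1 d2.2 hor]
      ring
  · rw [propext hc.east_zero, propext hc.east_one, propext (hc.resW_iff _),
      propext (hc.resW_iff _), propext hc.finish_east, sum_peakTerm_inl hc.col, hc.term,
      ind_congr (hc.west_iff π.start.1), ind_congr (hc.west_iff π.finish.1)]
    have c1 := P.hBelow_consistent hq hc.col π.finish.1 π.south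
    have c2 := P.hBelow_consistent hq hc.col π.start.1 π.north
    rcases hπ.row_cases hq with hr | ⟨i, hr⟩ | ⟨i, hr⟩
    · simp only [propext (hr.resS_iff _), propext (hr.resN_iff _), propext (hr.finish_iff _),
        hr.sum_eq] at c1 ⊢
      rw [ind_overlap_east hV hV' hc.crossing c1.1 c1.2 c2.1 c2.2]
      ring
    · have d1 := P.vLeft_consistent hq hr.row π.start.1 π.west
      have d2 := P.vLeft_consistent hq hr.row π.finish.1 π.east
      have hor := P.hBelow_iff_or_vLeft_iff hq hc.col hr.row π.finish.1
      rw [← hc.east, ← hr.south] at hor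
      rw [hr.finish_south, not_not] at c1
      rw [hr.north_iff, not_not] at c2
      rw [hc.west_iff] at d1
      rw [hc.finish_east, not_not] at d2
      rw [propext (hr.south_zero), propext (hr.south_one),
        propext (hr.resN_iff _), propext (hr.resN_iff _), propext hr.finish_south,
        sum_peakTerm_inr hr.row, hr.term, ind_congr (hr.north_iff π.start.1),
        ind_congr (hr.north_iff π.finish.1), propext Overlap.transpose,
        ind_overlap_west_north hr.crossing hc.crossing
          d1.1 d1.2 d2.1 d2.2 c1.1 c1.2 c2.1 c2.2 hor.symm]
      ring
    · have d1 := P.vLeft_consistent hq hr.row π.finish.1 π.west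
      have d2 := P.vLeft_consistent hq hr.row π.start.1 π.east
      have hor := P.hBelow_iff_or_vLeft_iff hq hc.col hr.row π.start.1
      rw [← hc.east, ← hr.north] at hor
      rw [hr.south_iff] at c1
      rw [hc.west_iff] at d1
      rw [propext (hr.north_zero), propext (hr.north_one),
        propext (hr.resS_iff _), propext (hr.resS_iff _), propext hr.finish_north,
        sum_peakTerm_inr hr.row, hr.term, ind_congr (hr.south_iff π.start.1),
        ind_congr (hr.south_iff π.finish.1), ind_overlap_east_north hc.crossing hr.crossing
          c1.1 c1.2 c2.1 c2.2 d1.1 d1.2 d2.1 d2.2 hor]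
      ring

end Quad

end SingularGrid

/-! ### Decorations contained in a polygon: exponents -/

namespace SingularGrid

variable {G : SingularGrid} {A : G.WindingArcs}

theorem ind_isLeft (I : G.Resolution) (q : Fin G.cols × Fin G.rows) (v : G.VLine) :
    ind (IsLeft I q v) = ind (IsLeft (fun _ => 0) q v) +
      ∑ j : G.SingCol, (I (.inl j) : ℕ) * shiftSign q (.inl j) * ind (v = .inr j) := by
  rcases v with c | j
  · rw [ind_congr (isLeft_congr (I := I) (J := fun _ => 0) (by rintro _ ⟨⟩))]
    simp
  · rw [ind_isLeft_inr, Finset.sum_eq_single j]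
    · simp
    · intro j' _ h
      rw [ind_false (by rintro ⟨⟩; exact h rfl), mul_zero]
    · simp

theorem ind_isBelow (I : G.Resolution) (q : Fin G.cols × Fin G.rows) (h : G.HLine) :
    ind (IsBelow I q h) = ind (IsBelow (fun _ => 0) q h) +
      ∑ i : G.SingRow, (I (.inr i) : ℕ) * shiftSign q (.inr i) * ind (h = .inr i) := by
  rcases h with c | j
  · rw [ind_congr (isBelow_congr (I := I) (J := fun _ => 0) (by rintro _ ⟨⟩))]
    simp
  · rw [ind_isBelow_inr, Finset.sum_eq_single j]
    · simp
    · intro j' _ h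
      rw [ind_false (by rintro ⟨⟩; exact h rfl), mul_zero]
    · simp

/-- The number of dots of a generator to the upper right of a decoration. -/
def dotsBeyond (K : G.Resolution) (x : G.Perm) (q : Fin G.cols × Fin G.rows) : ℤ :=
  ∑ v, ind (IsLeft K q v) * ind (IsBelow K q (x v))

/-- A potential for the multiplicities of polygons at the decoration `q`: the number of dots beyond
`q`, corrected by the position of the dots on the `β`-arcs relative to the peaks. -/
def Peaks.potential (P : Peaks A) (x : G.Gen) (q : Fin G.cols × Fin G.rows) : ℤ :=
  dotsBeyond x.1 x.2 q +
    ∑ e, (x.1 e : ℕ) * (shiftSign q e * (P.dotBefore x e - P.decoBefore q e))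

/-- The part of the multiplicity of a rectangle of `G_{0⋯0}` at `q` due to the sides crossing the cut of
the torus. -/
def Rect.cutTerm (ρ : G.Rect) (q : Fin G.cols × Fin G.rows) : ℤ :=
  ind (ρ.east.key < ρ.west.key) * (ind (IsBelow (fun _ => 0) q (ρ.start ρ.east)) -
      ind (IsBelow (fun _ => 0) q (ρ.start ρ.west))) +
    ind ((ρ.start ρ.east).key < (ρ.start ρ.west).key) *
      (ind (IsLeft (fun _ => 0) q ρ.east) - ind (IsLeft (fun _ => 0) q ρ.west)) +
    ind (ρ.east.key < ρ.west.key) * ind ((ρ.start ρ.east).key < (ρ.start ρ.west).key)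

/-- Contribution of a singular RoC to the multiplicity, apart from its sign `shiftSign`, in terms of
its resolutions at both ends and of the signed number of passages of the peak. -/
def turnTerm (a b : Fin 2) (n : ℤ) : ℤ := ind (a = 0 ∧ b = 1) * ind (n = -1) - (a : ℕ) * n

theorem Rect.cutTerm_resolution (ρ : G.Rect) (I : G.Resolution) (q : Fin G.cols × Fin G.rows) :
    ind (ρ.east.key < ρ.west.key) * (ind (IsBelow I q (ρ.start ρ.east)) -
      ind (IsBelow I q (ρ.start ρ.west))) +
    ind ((ρ.start ρ.east).key < (ρ.start ρ.west).key) *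
      (ind (IsLeft I q ρ.east) - ind (IsLeft I q ρ.west)) +
    ind (ρ.east.key < ρ.west.key) * ind ((ρ.start ρ.east).key < (ρ.start ρ.west).key) =
    ρ.cutTerm q - ∑ e, (I e : ℕ) * shiftSign q e * ρ.cutNumber e := by
  rw [ind_isBelow I, ind_isBelow I, ind_isLeft I, ind_isLeft I, Fintype.sum_sum_type]
  simp only [Rect.cutTerm, Rect.cutNumber]
  have e1 : ∑ j : G.SingCol, (I (.inl j) : ℕ) * shiftSign q (.inl j) *
      (ind ((ρ.start ρ.east).key < (ρ.start ρ.west).key) *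
        (ind (ρ.west = .inr j) - ind (ρ.east = .inr j))) =
      ind ((ρ.start ρ.east).key < (ρ.start ρ.west).key) *
      (∑ j : G.SingCol, (I (.inl j) : ℕ) * shiftSign q (.inl j) * ind (ρ.west = .inr j) -
        ∑ j : G.SingCol, (I (.inl j) : ℕ) * shiftSign q (.inl j) * ind (ρ.east = .inr j)) := by
    rw [← Finset.sum_sub_distrib, Finset.mul_sum]
    exact Finset.sum_congr rfl fun _ _ => by ring
  have e2 : ∑ i : G.SingRow, (I (.inr i) : ℕ) * shiftSign q (.inr i) *
      (ind (ρ.east.key < ρ.west.key) *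
        (ind (ρ.start ρ.west = .inr i) - ind (ρ.start ρ.east = .inr i))) =
      ind (ρ.east.key < ρ.west.key) *
      (∑ i : G.SingRow, (I (.inr i) : ℕ) * shiftSign q (.inr i) * ind (ρ.start ρ.west = .inr i) -
        ∑ i : G.SingRow, (I (.inr i) : ℕ) * shiftSign q (.inr i) *
          ind (ρ.start ρ.east = .inr i)) := by
    rw [← Finset.sum_sub_distrib, Finset.mul_sum]
    exact Finset.sum_congr rfl fun _ _ => by ring
  rw [e1, e2]
  ring

namespace Quad

variable {P : Peaks A} {π : G.Quad}

theorem IsPolygon.dotsBeyond_sub (hπ : π.IsPolygon P) (q : Fin G.cols × Fin G.rows) :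
    dotsBeyond π.start.1 π.start.2 q - dotsBeyond π.finish.1 π.finish.2 q =
      ind (IsLeft π.start.1 q π.west) * ind (IsBelow π.start.1 q π.south) +
      ind (IsLeft π.start.1 q π.east) * ind (IsBelow π.start.1 q π.north) -
      ind (IsLeft π.finish.1 q π.west) * ind (IsBelow π.finish.1 q π.north) -
      ind (IsLeft π.finish.1 q π.east) * ind (IsBelow π.finish.1 q π.south) := by
  unfold dotsBeyond
  rw [← Finset.sum_sub_distrib, Fintype.sum_eq_add _ _ hπ.west_ne_east]
  · rw [hπ.finish_eq]
    simp only [Equiv.trans_apply, Equiv.swap_apply_left, Equiv.swap_apply_right, south, north]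
    ring
  · rintro v ⟨hw, he⟩
    have hv : π.finish.2 v = π.start.2 v := by
      rw [hπ.finish_eq, Equiv.trans_apply, Equiv.swap_apply_of_ne_of_ne hw he]
    have h1 : IsLeft π.start.1 q v ↔ IsLeft π.finish.1 q v := by
      refine isLeft_congr fun j hj _ => ?_
      by_contra hf
      obtain ⟨-, -, d, hd⟩ := hπ.resolutions _ hf
      rcases d with _ | _ | _ | _
      · rcases hs : π.north with r | i <;> simp [sideRoC, hs, HLine.roc] at hd
      · rcases hs : π.south with r | i <;> simp [sideRoC, hs, HLine.roc] at hd
      · rcases hs : π.east with r | i <;> simp [sideRoC, hs, VLine.roc] at hd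
        exact he (by rw [hj, hs, hd])
      · rcases hs : π.west with r | i <;> simp [sideRoC, hs, VLine.roc] at hd
        exact hw (by rw [hj, hs, hd])
    have h2 : IsBelow π.start.1 q (π.start.2 v) ↔ IsBelow π.finish.1 q (π.start.2 v) := by
      refine isBelow_congr fun j hj _ => ?_
      by_contra hf
      obtain ⟨-, -, d, hd⟩ := hπ.resolutions _ hf
      rcases d with _ | _ | _ | _
      · rcases hs : π.north with r | i <;> simp [sideRoC, hs, HLine.roc] at hd
        exact he (π.start.2.injective (by rw [hj, ← hd, ← hs]; rfl))
      · rcases hs : π.south with r | i <;> simp [sideRoC, hs, HLine.roc] at hd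
        exact hw (π.start.2.injective (by rw [hj, ← hd, ← hs]; rfl))
      · rcases hs : π.east with r | i <;> simp [sideRoC, hs, VLine.roc] at hd
      · rcases hs : π.west with r | i <;> simp [sideRoC, hs, VLine.roc] at hd
    rw [hv, ind_congr h1, ind_congr h2, sub_self]

/-- The multiplicity of a polygon at a decoration: a difference of potentials, a term which depends on
the rectangle alone, and contributions of the singular RoCs. -/
theorem IsPolygon.ind_contains_eq (hπ : π.IsPolygon P) {q : Fin G.cols × Fin G.rows}
    (hq : G.deco q.1 q.2 ≠ none) :
    ind (π.Contains P q) = P.potential π.start q - P.potential π.finish q + π.toRect.cutTerm q +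
      ∑ e, shiftSign q e * turnTerm (π.start.1 e) (π.finish.1 e) (π.turn P e) := by
  have h1 := π.toRect.cutTerm_resolution π.start.1 q
  have h2 := hπ.dotsBeyond_sub q
  have h3 : ∑ e, (-((π.start.1 e : ℕ) * shiftSign q e * π.toRect.cutNumber e) +
        π.peakTerm P q e) =
      ∑ e, ((π.start.1 e : ℕ) * (shiftSign q e * (P.dotBefore π.start e - P.decoBefore q e)) -
        (π.finish.1 e : ℕ) * (shiftSign q e * (P.dotBefore π.finish e - P.decoBefore q e)) +
        shiftSign q e * turnTerm (π.start.1 e) (π.finish.1 e) (π.turn P e)) := by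
    refine Finset.sum_congr rfl fun e _ => ?_
    unfold peakTerm turnTerm
    by_cases hf : π.start.1 e = π.finish.1 e
    · rw [ind_false (not_not.2 hf), ind_false (p := π.start.1 e = 0 ∧ π.finish.1 e = 1) (by
        rintro ⟨h0, h1⟩; rw [h0, h1] at hf; exact absurd hf (by decide)), hf]
      unfold turn
      ring
    · obtain ⟨h0, h1, -⟩ := hπ.resolutions _ hf
      rw [ind_true hf, ind_true (p := π.start.1 e = 0 ∧ π.finish.1 e = 1) ⟨h0, h1⟩, h0, h1]
      simp only [Fin.isValue, Fin.val_zero, Fin.val_one]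
      push_cast
      ring
  rw [hπ.ind_contains hq]
  simp only [Finset.sum_add_distrib, Finset.sum_sub_distrib, Finset.sum_neg_distrib] at h3
  unfold Peaks.potential
  simp only [toRect] at *
  have e1 : π.start.2 π.east = π.north := rfl
  have e2 : π.start.2 π.west = π.south := rfl
  rw [e1, e2] at h1
  linarith

end Quad

end SingularGrid

/-! ### Juxtapositions of empty rectangles on the straightened grid -/

namespace SingularGrid

theorem CycBetween.rotations {a b c : ℕ} (hab : a ≠ b) (hbc : b ≠ c) (hac : a ≠ c) :
    (CycBetween b c a ↔ CycBetween a b c) ∧ (CycBetween c a b ↔ CycBetween a b c) ∧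
    (CycBetween a c b ↔ ¬ CycBetween a b c) ∧ (CycBetween b a c ↔ ¬ CycBetween a b c) ∧
    (CycBetween c b a ↔ ¬ CycBetween a b c) := by
  unfold CycBetween
  refine ⟨?_, ?_, ?_, ?_, ?_⟩ <;> omega

theorem CycBetween.split {a b c v : ℕ} (h : CycBetween a b c) (hv : v ≠ b) :
    CycBetween a v c ↔ CycBetween a v b ∨ CycBetween b v c := by
  unfold CycBetween at *; omega

theorem CycBetween.cross {a b c d : ℕ} (h1 : CycBetween c a d) (h2 : ¬ CycBetween c b d)
    (hb : b ≠ c) (hb' : b ≠ d) : CycBetween a d b := by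
  unfold CycBetween at *; omega

theorem CycBetween.cross' {a b c d : ℕ} (h1 : ¬ CycBetween c a d) (h2 : CycBetween c b d)
    (ha : a ≠ c) (ha' : a ≠ d) : CycBetween a c b := by
  unfold CycBetween at *; omega

theorem CycBetween.ne {a b c : ℕ} (h : CycBetween a b c) : a ≠ b ∧ b ≠ c ∧ a ≠ c := by
  unfold CycBetween at *; omega

/-- Number of times the arc from `a` to `b` of a circle covers the point after `k`. The circle is cut
before `0`; values of `k` beyond all marked points describe the arcs crossing the cut. -/
def cyc (a b k : ℕ) : ℤ := ind (a ≤ k) - ind (b ≤ k) + ind (b < a)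

theorem cyc_add {a b c : ℕ} (h : CycBetween a b c) (k : ℕ) :
    cyc a c k = cyc a b k + cyc b c k := by
  have : ind (c < a) = ind (b < a) + ind (c < b) := by
    unfold CycBetween at h
    rcases h with h | h | h
    · rw [ind_false (p := c < a) (by omega), ind_false (p := b < a) (by omega),
        ind_false (p := c < b) (by omega), add_zero]
    · rw [ind_true (p := c < a) (by omega), ind_true (p := b < a) (by omega),
        ind_false (p := c < b) (by omega), add_zero]
    · rw [ind_true (p := c < a) (by omega), ind_false (p := b < a) (by omega),
        ind_true (p := c < b) (by omega), zero_add]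
  unfold cyc
  rw [this]; ring

theorem cyc_add_swap {a b : ℕ} (h : a ≠ b) (k : ℕ) : cyc a b k + cyc b a k = 1 := by
  unfold cyc
  rcases Nat.lt_or_gt_of_ne h with h | h
  · rw [ind_true h, ind_false (p := b < a) (by omega)]; ring
  · rw [ind_true (p := b < a) h, ind_false (p := a < b) (by omega)]; ring

theorem cyc_eq_ind {a b : ℕ} (h : a ≠ b) (k : ℕ) : cyc a b k = ind (k = a ∨ CycBetween a k b) := by
  unfold cyc
  by_cases h1 : a ≤ k <;> by_cases h2 : b ≤ k <;> by_cases h3 : b < a <;>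
    simp only [h1, h2, h3, ind_true, ind_false, not_false_eq_true]
  · rw [ind_true (by unfold CycBetween; omega)]; norm_num
  · rw [ind_false (by unfold CycBetween; omega)]; norm_num
  · omega
  · rw [ind_true (by unfold CycBetween; omega)]; norm_num
  · rw [ind_false (by unfold CycBetween; omega)]; norm_num
  · omega
  · rw [ind_true (by unfold CycBetween; omega)]; norm_num
  · rw [ind_false (by unfold CycBetween; omega)]; norm_num

variable {G : SingularGrid}

/-- The multiplicities of a rectangle, as a function of the numbers of the lines at the left of and
below a square. -/
def Rect.dom (ρ : G.Rect) (k l : ℕ) : ℤ :=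
  cyc ρ.west.key ρ.east.key k * cyc (ρ.start ρ.west).key (ρ.start ρ.east).key l

theorem VLine.key_ne {v w : G.VLine} (h : v ≠ w) : v.key ≠ w.key :=
  fun e => h (VLine.key_injective e)

theorem HLine.key_ne {v w : G.HLine} (h : v ≠ w) : v.key ≠ w.key :=
  fun e => h (HLine.key_injective e)

theorem key_apply_ne (x : G.Perm) {v w : G.VLine} (h : v ≠ w) : (x v).key ≠ (x w).key :=
  HLine.key_ne fun e => h (x.injective e)

theorem Rect.mult_eq (ρ : G.Rect) (h : ρ.west ≠ ρ.east) (v : G.VLine) (l : G.HLine) :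
    (ρ.mult v l : ℤ) = ρ.dom v.key l.key := by
  unfold Rect.mult Rect.dom
  rw [cyc_eq_ind (VLine.key_ne h), cyc_eq_ind (key_apply_ne _ h)]
  simp only [VLine.key_injective.eq_iff, HLine.key_injective.eq_iff]
  by_cases h1 : v = ρ.west ∨ CycBetween ρ.west.key v.key ρ.east.key <;>
    by_cases h2 : l = ρ.start ρ.west ∨
      CycBetween (ρ.start ρ.west).key l.key (ρ.start ρ.east).key <;>
    simp [h1, h2]

theorem Rect.isEmpty_iff_of_ne {ρ : G.Rect} {f : G.VLine} :
    ρ.IsEmpty ↔ ρ.west ≠ ρ.east ∧ (CycBetween ρ.west.key f.key ρ.east.key →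
      ¬ CycBetween (ρ.start ρ.west).key (ρ.start f).key (ρ.start ρ.east).key) ∧
    ∀ v, v ≠ ρ.west → v ≠ ρ.east → v ≠ f → CycBetween ρ.west.key v.key ρ.east.key →
      ¬ CycBetween (ρ.start ρ.west).key (ρ.start v).key (ρ.start ρ.east).key := by
  constructor
  · rintro ⟨h1, h2⟩
    exact ⟨h1, h2 f, fun v _ _ _ => h2 v⟩
  · rintro ⟨h1, h2, h3⟩
    refine ⟨h1, fun v hv => ?_⟩
    by_cases e1 : v = f
    · rw [e1] at hv ⊢; exact h2 hv
    · exact h3 v (fun e => hv.ne.1 (by rw [e])) (fun e => hv.ne.2.1 (by rw [e])) e1 hv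

section Juxtapositions

variable {R : Type*} [CommRing R] (ε : G.SignAssignment) (F : G.Perm → (ℕ → ℕ → ℤ) → R)
  (x : G.Perm)

/-- The second rectangle of a juxtaposition. -/
def second (w e w' e' : G.VLine) : G.Rect := ⟨(⟨x, w, e⟩ : G.Rect).finish, w', e'⟩

open Classical in
/-- Contribution of a pair of rectangles to the square of a differential. -/
def juxtaposition (w e w' e' : G.VLine) : R :=
  if (⟨x, w, e⟩ : G.Rect).IsEmpty ∧ (second x w e w' e').IsEmpty then
    (((ε.sign ⟨x, w, e⟩ * ε.sign (second x w e w' e') : ℤˣ) : ℤ) : R) *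
      F (second x w e w' e').finish (fun k l => (⟨x, w, e⟩ : G.Rect).dom k l +
        (second x w e w' e').dom k l)
  else 0

variable {ε F x}

theorem swap_ne_swap {a b c d : G.VLine} (hab : a ≠ b) (h : ¬ (a = c ∧ b = d))
    (h' : ¬ (a = d ∧ b = c)) : Equiv.swap a b ≠ Equiv.swap c d := by
  intro e
  have h1 : Equiv.swap c d a = b := by rw [← e, Equiv.swap_apply_left]
  rcases eq_or_ne a c with rfl | hc
  · rw [Equiv.swap_apply_left] at h1
    exact h ⟨rfl, h1.symm⟩
  rcases eq_or_ne a d with rfl | hd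
  · rw [Equiv.swap_apply_right] at h1
    exact h' ⟨rfl, h1.symm⟩
  rw [Equiv.swap_apply_of_ne_of_ne hc hd] at h1
  exact hab h1

theorem finish_ne_self {ρ : G.Rect} (h : ρ.west ≠ ρ.east) : ρ.finish ≠ ρ.start := by
  intro e
  have h1 : ρ.finish ρ.west = ρ.start ρ.east := by simp [Rect.finish]
  rw [e] at h1
  exact h (ρ.start.injective h1)

/-- Two decompositions of the same domain cancel. -/
theorem juxtaposition_add {a b c d a' b' c' d' : G.VLine} {p p' : Prop} [Decidable p]
    [Decidable p']
    (hE : p ∧ (⟨x, a, b⟩ : G.Rect).IsEmpty ∧ (second x a b c d).IsEmpty ↔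
      p' ∧ (⟨x, a', b'⟩ : G.Rect).IsEmpty ∧ (second x a' b' c' d').IsEmpty)
    (h1 : ¬ (a = a' ∧ b = b')) (h2 : ¬ (a = b' ∧ b = a'))
    (hf : (second x a b c d).finish = (second x a' b' c' d').finish)
    (hD : p → p' → ∀ k l, (⟨x, a, b⟩ : G.Rect).dom k l + (second x a b c d).dom k l =
      (⟨x, a', b'⟩ : G.Rect).dom k l + (second x a' b' c' d').dom k l) :
    (if p then juxtaposition ε F x a b c d else 0) +
      (if p' then juxtaposition ε F x a' b' c' d' else 0) = 0 := by
  classical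
  unfold juxtaposition
  rw [← ite_and, ← ite_and]
  by_cases h : p ∧ (⟨x, a, b⟩ : G.Rect).IsEmpty ∧ (second x a b c d).IsEmpty
  · have h' := hE.1 h
    rw [if_pos h, if_pos h']
    obtain ⟨hp, he1, he2⟩ := h
    obtain ⟨hp', he1', he2'⟩ := h'
    have hD := hD hp hp'
    have hsw : (⟨x, a, b⟩ : G.Rect).finish ≠ (⟨x, a', b'⟩ : G.Rect).finish := by
      intro e
      refine swap_ne_swap he1.1 h1 h2 (Equiv.ext fun v => ?_)
      have := congrArg (fun f : G.Perm => f v) e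
      exact x.injective this
    have hs := ε.square ⟨x, a, b⟩ (second x a b c d) ⟨x, a', b'⟩ (second x a' b' c' d')
      he1 he2 he1' he2' rfl rfl rfl hf (by
        intro v h
        have := hD v.key h.key
        rw [← Rect.mult_eq _ he1.1, ← Rect.mult_eq _ he2.1, ← Rect.mult_eq _ he1'.1,
          ← Rect.mult_eq _ he2'.1] at this
        exact_mod_cast this) (by
        have n1 := finish_ne_self he1.1
        have n2 := finish_ne_self he1'.1
        simp only [List.nodup_cons, List.mem_cons, List.not_mem_nil, or_false, not_or,
          not_false_eq_true, List.nodup_nil, and_true]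
        refine ⟨⟨?_, ?_, ?_⟩, ⟨?_, ?_⟩, ?_⟩
        · intro e; exact n1 (congrArg Rect.start e).symm
        · intro e; exact h1 ⟨congrArg Rect.west e, congrArg Rect.east e⟩
        · intro e; exact n2 (congrArg Rect.start e).symm
        · intro e; exact n1 (congrArg Rect.start e)
        · intro e; exact hsw (congrArg Rect.start e)
        · intro e; exact n2 (congrArg Rect.start e).symm)
    rw [hs, hf, show (fun k l => (⟨x, a, b⟩ : G.Rect).dom k l + (second x a b c d).dom k l) =
      fun k l => (⟨x, a', b'⟩ : G.Rect).dom k l + (second x a' b' c' d').dom k l from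
        funext fun k => funext fun l => hD k l]
    push_cast
    ring
  · rw [if_neg h, if_neg (fun h' => h (hE.2 h')), add_zero]

theorem juxtaposition_disjoint {a b c d : G.VLine} (hab : a ≠ b) (hac : a ≠ c) (had : a ≠ d)
    (hbc : b ≠ c) (hbd : b ≠ d) (hcd : c ≠ d) :
    juxtaposition ε F x a b c d + juxtaposition ε F x c d a b = 0 := by
  have key : ∀ {a b c d : G.VLine}, a ≠ b → a ≠ c → a ≠ d → b ≠ c → b ≠ d → c ≠ d →
      (⟨x, a, b⟩ : G.Rect).IsEmpty ∧ (second x a b c d).IsEmpty →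
      (⟨x, c, d⟩ : G.Rect).IsEmpty ∧ (second x c d a b).IsEmpty := by
    rintro a b c d hab hac had hbc hbd hcd ⟨⟨-, h1⟩, -, h2⟩
    have kac := VLine.key_ne hac
    have kad := VLine.key_ne had
    have kbc := VLine.key_ne hbc
    have kbd := VLine.key_ne hbd
    have lac := key_apply_ne x hac
    have lad := key_apply_ne x had
    have lbc := key_apply_ne x hbc
    have lbd := key_apply_ne x hbd
    simp only [second, Rect.finish, Equiv.trans_apply] at h1 h2
    rw [Equiv.swap_apply_of_ne_of_ne hac.symm hbc.symm,
      Equiv.swap_apply_of_ne_of_ne had.symm hbd.symm] at h2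
    have h1c := h1 c
    have h1d := h1 d
    have h2a := h2 a
    have h2b := h2 b
    rw [Equiv.swap_apply_left] at h2a
    rw [Equiv.swap_apply_right] at h2b
    refine ⟨⟨hcd, fun v hv hv' => ?_⟩, hab, fun v hv hv' => ?_⟩
    · dsimp only at hv hv'
      rcases eq_or_ne v a with rfl | hva
      · have e1 : ¬ CycBetween c.key b.key d.key := fun h => h2b h hv'
        have e2 : ¬ CycBetween (x c).key (x b).key (x d).key := h2a hv
        exact h1d (hv.cross e1 kbc kbd) (hv'.cross e2 lbc lbd)
      rcases eq_or_ne v b with rfl | hvb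
      · have e1 : ¬ CycBetween c.key a.key d.key := fun h => h2a h hv'
        have e2 : ¬ CycBetween (x c).key (x a).key (x d).key := h2b hv
        exact h1c (CycBetween.cross' e1 hv kac kad) (CycBetween.cross' e2 hv' lac lad)
      · have := h2 v hv
        rw [Equiv.swap_apply_of_ne_of_ne hva hvb] at this
        exact this hv'
    · simp only [second, Rect.finish, Equiv.trans_apply] at hv hv'
      rw [Equiv.swap_apply_of_ne_of_ne hac had, Equiv.swap_apply_of_ne_of_ne hbc hbd] at hv'
      rcases eq_or_ne v c with rfl | hvc
      · rw [Equiv.swap_apply_left] at hv'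
        have e1 : ¬ CycBetween a.key d.key b.key := fun h => h1d h hv'
        have e2 : ¬ CycBetween (x a).key (x v).key (x b).key := h1c hv
        exact h2b (hv.cross e1 kad.symm kbd.symm) (CycBetween.cross' e2 hv' lac.symm lbc.symm)
      rcases eq_or_ne v d with rfl | hvd
      · rw [Equiv.swap_apply_right] at hv'
        have e1 : ¬ CycBetween a.key c.key b.key := fun h => h1c h hv'
        have e2 : ¬ CycBetween (x a).key (x v).key (x b).key := h1d hv
        exact h2a (CycBetween.cross' e1 hv kac.symm kbc.symm) (hv'.cross e2 lad.symm lbd.symm)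
      · rw [Equiv.swap_apply_of_ne_of_ne hvc hvd] at hv'
        exact h1 v hv hv'
  have := juxtaposition_add (ε := ε) (F := F) (x := x) (a := a) (b := b) (c := c) (d := d)
    (a' := c) (b' := d) (c' := a) (d' := b) (p := True) (p' := True)
    (by
      simp only [true_and]
      exact ⟨key hab hac had hbc hbd hcd, key hcd hac.symm hbc.symm had.symm hbd.symm hab⟩)
    (fun h => hac h.1) (fun h => had h.1)
    (by
      refine Equiv.ext fun v => ?_
      simp only [second, Rect.finish, Equiv.trans_apply]
      congr 1
      have : Equiv.swap a b * Equiv.swap c d = Equiv.swap c d * Equiv.swap a b := by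
        refine (Equiv.Perm.disjoint_swap_swap ?_).commute
        simp [*]
      exact congrArg (fun f : Equiv.Perm G.VLine => f v) this)
    (fun _ _ k l => by
      simp only [Rect.dom, second, Rect.finish, Equiv.trans_apply]
      rw [Equiv.swap_apply_of_ne_of_ne hac.symm hbc.symm,
        Equiv.swap_apply_of_ne_of_ne had.symm hbd.symm,
        Equiv.swap_apply_of_ne_of_ne hac had, Equiv.swap_apply_of_ne_of_ne hbc hbd]
      ring)
  simpa using this

theorem second_isEmpty_iff {w e p q f : G.VLine} (hpq : p ≠ q)
    (hσ : ∀ v, v ≠ p → v ≠ q → v ≠ f → Equiv.swap w e v = v) :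
    (second x w e p q).IsEmpty ↔ (CycBetween p.key f.key q.key →
      ¬ CycBetween (x (Equiv.swap w e p)).key (x (Equiv.swap w e f)).key
        (x (Equiv.swap w e q)).key) ∧
    ∀ v, v ≠ p → v ≠ q → v ≠ f → CycBetween p.key v.key q.key →
      ¬ CycBetween (x (Equiv.swap w e p)).key (x v).key (x (Equiv.swap w e q)).key := by
  rw [Rect.isEmpty_iff_of_ne (f := f)]
  simp only [second, Rect.finish, Equiv.trans_apply]
  refine ⟨fun h => ⟨h.2.1, fun v h1 h2 h3 => ?_⟩, fun h => ⟨hpq, h.1, fun v h1 h2 h3 => ?_⟩⟩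
  · have := h.2.2 v h1 h2 h3
    rwa [hσ v h1 h2 h3] at this
  · rw [hσ v h1 h2 h3]
    exact h.2 v h1 h2 h3

theorem first_isEmpty_iff {p q f : G.VLine} (hpq : p ≠ q) :
    (⟨x, p, q⟩ : G.Rect).IsEmpty ↔ (CycBetween p.key f.key q.key →
      ¬ CycBetween (x p).key (x f).key (x q).key) ∧
    ∀ v, v ≠ p → v ≠ q → v ≠ f → CycBetween p.key v.key q.key →
      ¬ CycBetween (x p).key (x v).key (x q).key := by
  rw [Rect.isEmpty_iff_of_ne (f := f)]
  simp [hpq]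

theorem swap_comp_swap (a b c d v : G.VLine) :
    Equiv.swap a b (Equiv.swap c d v) =
      Equiv.swap (Equiv.swap a b c) (Equiv.swap a b d) (Equiv.swap a b v) :=
  congrArg (fun f : Equiv.Perm G.VLine => f v) (Equiv.mul_swap_eq_swap_mul (Equiv.swap a b) c d)

open Classical in
/-- First of the four kinds of L-shaped domains, according to the position of the reentrant corner:
cutting along either of the two lines through this corner gives two rectangles. -/
theorem juxtaposition_corner₁ {a b c : G.VLine} (hab : a ≠ b) (hbc : b ≠ c) (hac : a ≠ c) :
    (if CycBetween a.key b.key c.key then juxtaposition ε F x a c a b else 0) +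
      (if CycBetween (x a).key (x c).key (x b).key then juxtaposition ε F x a b b c else 0) = 0 := by
  have rv := CycBetween.rotations (VLine.key_ne hab) (VLine.key_ne hbc) (VLine.key_ne hac)
  have rh := CycBetween.rotations (key_apply_ne x hab) (key_apply_ne x hbc) (key_apply_ne x hac)
  have sw1 : Equiv.swap a c b = b := Equiv.swap_apply_of_ne_of_ne hab.symm hbc
  have sw2 : Equiv.swap a b c = c := Equiv.swap_apply_of_ne_of_ne hac.symm hbc.symm
  refine juxtaposition_add ?_ ?_ ?_ ?_ ?_
  · rw [first_isEmpty_iff (f := b) hac, second_isEmpty_iff (f := c) hab, first_isEmpty_iff (f := c) hab,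
      second_isEmpty_iff (f := a) hbc]
    · simp only [Equiv.swap_apply_left, Equiv.swap_apply_right, sw1, sw2, rv, rh]
      have sv := fun (h : CycBetween a.key b.key c.key) (v : G.VLine) (hv : v ≠ b) =>
        h.split (VLine.key_ne hv)
      have sh := fun (h : ¬ CycBetween (x a).key (x b).key (x c).key) (v : G.VLine) (hv : v ≠ c) =>
        (rh.2.2.1.2 h).split (key_apply_ne x hv)
      grind
    · intro v h1 h2 h3; exact Equiv.swap_apply_of_ne_of_ne h3 h1
    · intro v h1 h2 h3; exact Equiv.swap_apply_of_ne_of_ne h1 h3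
  · exact fun h => hbc h.2.symm
  · exact fun h => hab h.1
  · refine Equiv.ext fun v => ?_
    simp only [second, Rect.finish, Equiv.trans_apply]
    rw [swap_comp_swap a b b c, Equiv.swap_apply_right, sw2]
  · intro h1 h2 k l
    simp only [Rect.dom, second, Rect.finish, Equiv.trans_apply, Equiv.swap_apply_left,
      Equiv.swap_apply_right, sw1, sw2]
    rw [cyc_add h1, cyc_add h2]
    ring

open Classical in
theorem juxtaposition_corner₂ {a b c : G.VLine} (hab : a ≠ b) (hbc : b ≠ c) (hac : a ≠ c) :
    (if CycBetween a.key b.key c.key then juxtaposition ε F x a b a c else 0) +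
      (if CycBetween (x a).key (x b).key (x c).key then juxtaposition ε F x b c a b else 0) = 0 := by
  have rv := CycBetween.rotations (VLine.key_ne hab) (VLine.key_ne hbc) (VLine.key_ne hac)
  have rh := CycBetween.rotations (key_apply_ne x hab) (key_apply_ne x hbc) (key_apply_ne x hac)
  have sw2 : Equiv.swap a b c = c := Equiv.swap_apply_of_ne_of_ne hac.symm hbc.symm
  have sw3 : Equiv.swap b c a = a := Equiv.swap_apply_of_ne_of_ne hab hac
  refine juxtaposition_add ?_ ?_ ?_ ?_ ?_
  · rw [first_isEmpty_iff (f := c) hab, second_isEmpty_iff (f := b) hac,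
      first_isEmpty_iff (f := a) hbc, second_isEmpty_iff (f := c) hab]
    · simp only [Equiv.swap_apply_left, Equiv.swap_apply_right, sw2, sw3, rv, rh]
      have sv := fun (h : CycBetween a.key b.key c.key) (v : G.VLine) (hv : v ≠ b) =>
        h.split (VLine.key_ne hv)
      have sh := fun (h : CycBetween (x a).key (x b).key (x c).key) (v : G.VLine)
        (hv : v ≠ b) => (h).split (key_apply_ne x hv)
      grind
    · intro v h1 h2 h3; exact Equiv.swap_apply_of_ne_of_ne (by assumption) (by assumption)
    · intro v h1 h2 h3; exact Equiv.swap_apply_of_ne_of_ne (by assumption) (by assumption)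
  · exact fun h => hab h.1
  · exact fun h => hac h.1
  · refine Equiv.ext fun v => ?_
    simp only [second, Rect.finish, Equiv.trans_apply]
    rw [swap_comp_swap a b a c, Equiv.swap_apply_left, sw2]
  · intro h1 h2 k l
    simp only [Rect.dom, second, Rect.finish, Equiv.trans_apply, Equiv.swap_apply_left,
      sw2, sw3]
    rw [cyc_add h1, cyc_add h2]
    ring

open Classical in
theorem juxtaposition_corner₃ {a b c : G.VLine} (hab : a ≠ b) (hbc : b ≠ c) (hac : a ≠ c) :
    (if CycBetween a.key b.key c.key then juxtaposition ε F x a c b c else 0) +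
      (if CycBetween (x b).key (x a).key (x c).key then juxtaposition ε F x b c a b else 0) = 0 := by
  have rv := CycBetween.rotations (VLine.key_ne hab) (VLine.key_ne hbc) (VLine.key_ne hac)
  have rh := CycBetween.rotations (key_apply_ne x hab) (key_apply_ne x hbc) (key_apply_ne x hac)
  have sw1 : Equiv.swap a c b = b := Equiv.swap_apply_of_ne_of_ne hab.symm hbc
  have sw3 : Equiv.swap b c a = a := Equiv.swap_apply_of_ne_of_ne hab hac
  refine juxtaposition_add ?_ ?_ ?_ ?_ ?_
  · rw [first_isEmpty_iff (f := b) hac, second_isEmpty_iff (f := a) hbc,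
      first_isEmpty_iff (f := a) hbc, second_isEmpty_iff (f := c) hab]
    · simp only [Equiv.swap_apply_left, Equiv.swap_apply_right, sw1, sw3, rv, rh]
      have sv := fun (h : CycBetween a.key b.key c.key) (v : G.VLine) (hv : v ≠ b) =>
        h.split (VLine.key_ne hv)
      have sh := fun (h : ¬ CycBetween (x a).key (x b).key (x c).key) (v : G.VLine)
        (hv : v ≠ a) => (rh.2.2.2.1.2 h).split (key_apply_ne x hv)
      grind
    · intro v h1 h2 h3; exact Equiv.swap_apply_of_ne_of_ne (by assumption) (by assumption)
    · intro v h1 h2 h3; exact Equiv.swap_apply_of_ne_of_ne (by assumption) (by assumption)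
  · exact fun h => hab h.1
  · exact fun h => hac h.1
  · refine Equiv.ext fun v => ?_
    simp only [second, Rect.finish, Equiv.trans_apply]
    rw [swap_comp_swap b c a b, Equiv.swap_apply_left, sw3]
  · intro h1 h2 k l
    simp only [Rect.dom, second, Rect.finish, Equiv.trans_apply, Equiv.swap_apply_left,
      Equiv.swap_apply_right, sw1, sw3]
    rw [cyc_add h1, cyc_add h2]
    ring

open Classical in
theorem juxtaposition_corner₄ {a b c : G.VLine} (hab : a ≠ b) (hbc : b ≠ c) (hac : a ≠ c) :
    (if CycBetween a.key b.key c.key then juxtaposition ε F x b c a c else 0) +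
      (if CycBetween (x a).key (x b).key (x c).key then juxtaposition ε F x a b b c else 0) = 0 := by
  have rv := CycBetween.rotations (VLine.key_ne hab) (VLine.key_ne hbc) (VLine.key_ne hac)
  have rh := CycBetween.rotations (key_apply_ne x hab) (key_apply_ne x hbc) (key_apply_ne x hac)
  have sw2 : Equiv.swap a b c = c := Equiv.swap_apply_of_ne_of_ne hac.symm hbc.symm
  have sw3 : Equiv.swap b c a = a := Equiv.swap_apply_of_ne_of_ne hab hac
  refine juxtaposition_add ?_ ?_ ?_ ?_ ?_
  · rw [first_isEmpty_iff (f := a) hbc, second_isEmpty_iff (f := b) hac,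
      first_isEmpty_iff (f := c) hab, second_isEmpty_iff (f := a) hbc]
    · simp only [Equiv.swap_apply_left, Equiv.swap_apply_right, sw2, sw3, rv, rh]
      have sv := fun (h : CycBetween a.key b.key c.key) (v : G.VLine) (hv : v ≠ b) =>
        h.split (VLine.key_ne hv)
      have sh := fun (h : CycBetween (x a).key (x b).key (x c).key) (v : G.VLine)
        (hv : v ≠ b) => (h).split (key_apply_ne x hv)
      grind
    · intro v h1 h2 h3; exact Equiv.swap_apply_of_ne_of_ne (by assumption) (by assumption)
    · intro v h1 h2 h3; exact Equiv.swap_apply_of_ne_of_ne (by assumption) (by assumption)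
  · exact fun h => hab h.1.symm
  · exact fun h => hac h.2.symm
  · refine Equiv.ext fun v => ?_
    simp only [second, Rect.finish, Equiv.trans_apply]
    rw [swap_comp_swap b c a c, Equiv.swap_apply_right, sw3]
  · intro h1 h2 k l
    simp only [Rect.dom, second, Rect.finish, Equiv.trans_apply,
      Equiv.swap_apply_right, sw2, sw3]
    rw [cyc_add h1, cyc_add h2]
    ring

/-- A vertical annulus: two empty rectangles with the same west and east sides. -/
theorem juxtaposition_vertical {a b : G.VLine} (hab : a ≠ b) :
    juxtaposition ε F x a b a b = - ind (∀ v : G.VLine, ¬ CycBetween a.key v.key b.key) *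
      F x (fun k _ => cyc a.key b.key k) := by
  have kl := key_apply_ne x hab
  have hE : (⟨x, a, b⟩ : G.Rect).IsEmpty ∧ (second x a b a b).IsEmpty ↔
      ∀ v : G.VLine, ¬ CycBetween a.key v.key b.key := by
    constructor
    · rintro ⟨⟨-, h1⟩, -, h2⟩ v hv
      have hva : v ≠ a := fun e => hv.ne.1 (by rw [e])
      have hvb : v ≠ b := fun e => hv.ne.2.1 (by rw [e])
      have := h2 v hv
      simp only [second, Rect.finish, Equiv.trans_apply, Equiv.swap_apply_left,
        Equiv.swap_apply_right, Equiv.swap_apply_of_ne_of_ne hva hvb] at this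
      have r := CycBetween.rotations (key_apply_ne x hva.symm) (key_apply_ne x hvb) kl
      exact h1 v hv (by tauto)
    · intro h
      exact ⟨⟨hab, fun v hv => absurd hv (h v)⟩, hab, fun v hv => absurd hv (h v)⟩
  unfold juxtaposition
  by_cases h : ∀ v : G.VLine, ¬ CycBetween a.key v.key b.key
  · have h' := hE.2 h
    rw [if_pos h', ind_true h, ε.vertical _ _ h'.1 h'.2 rfl rfl rfl]
    have hf : (second x a b a b).finish = x := by
      refine Equiv.ext fun v => ?_
      simp [second, Rect.finish]
    rw [hf]
    have : (fun k l => (⟨x, a, b⟩ : G.Rect).dom k l + (second x a b a b).dom k l) =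
        fun k _ => cyc a.key b.key k := by
      funext k l
      simp only [Rect.dom, second, Rect.finish, Equiv.trans_apply, Equiv.swap_apply_left,
        Equiv.swap_apply_right]
      rw [← mul_add, cyc_add_swap kl, mul_one]
    rw [this]
    simp
  · rw [if_neg (fun h' => h (hE.1 h')), ind_false h]
    simp

/-- A horizontal annulus. -/
theorem juxtaposition_horizontal {a b : G.VLine} (hab : a ≠ b) :
    juxtaposition ε F x a b b a = ind (∀ h : G.HLine, ¬ CycBetween (x a).key h.key (x b).key) *
      F x (fun _ l => cyc (x a).key (x b).key l) := by
  have kl := VLine.key_ne hab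
  have hE : (⟨x, a, b⟩ : G.Rect).IsEmpty ∧ (second x a b b a).IsEmpty ↔
      ∀ h : G.HLine, ¬ CycBetween (x a).key h.key (x b).key := by
    constructor
    · rintro ⟨⟨-, h1⟩, -, h2⟩ h hh
      obtain ⟨v, rfl⟩ := x.surjective h
      have hva : v ≠ a := fun e => hh.ne.1 (by rw [e])
      have hvb : v ≠ b := fun e => hh.ne.2.1 (by rw [e])
      have h3 := h2 v
      simp only [second, Rect.finish, Equiv.trans_apply, Equiv.swap_apply_left,
        Equiv.swap_apply_right, Equiv.swap_apply_of_ne_of_ne hva hvb] at h3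
      have r := CycBetween.rotations (VLine.key_ne hva.symm) (VLine.key_ne hvb) kl
      have := h1 v
      tauto
    · intro h
      refine ⟨⟨hab, fun v _ => h (x v)⟩, hab.symm, fun v _ => ?_⟩
      simp only [second, Rect.finish, Equiv.trans_apply, Equiv.swap_apply_left,
        Equiv.swap_apply_right]
      exact h _
  unfold juxtaposition
  by_cases h : ∀ h : G.HLine, ¬ CycBetween (x a).key h.key (x b).key
  · have h' := hE.2 h
    rw [if_pos h', ind_true h, ε.horizontal _ _ h'.1 h'.2 rfl rfl rfl]
    have hf : (second x a b b a).finish = x := by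
      refine Equiv.ext fun v => ?_
      simp [second, Rect.finish, Equiv.swap_comm b a]
    rw [hf]
    have : (fun k l => (⟨x, a, b⟩ : G.Rect).dom k l + (second x a b b a).dom k l) =
        fun _ l => cyc (x a).key (x b).key l := by
      funext k l
      simp only [Rect.dom, second, Rect.finish, Equiv.trans_apply, Equiv.swap_apply_left,
        Equiv.swap_apply_right]
      rw [← add_mul, cyc_add_swap kl, one_mul]
    rw [this]
    simp
  · rw [if_neg (fun h' => h (hE.1 h')), ind_false h]
    simp

theorem juxtaposition_eq_zero {a b c d : G.VLine} (h : a = b ∨ c = d) :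
    juxtaposition ε F x a b c d = 0 := by
  unfold juxtaposition
  refine if_neg ?_
  rintro ⟨⟨h1, -⟩, ⟨h2, -⟩⟩
  rcases h with h | h
  · exact h1 h
  · exact h2 h

theorem sum_sum_split {V M : Type*} [Fintype V] [DecidableEq V] [AddCommGroup M] {a b : V} (hab : a ≠ b)
    (u : V → V → M) (hu : ∀ c, u c c = 0) :
    ∑ c, ∑ d, u c d = u a b + u b a +
      ∑ f, (if a ≠ b ∧ b ≠ f ∧ a ≠ f then u a f + u f b + u b f + u f a else 0) +
      ∑ c, ∑ d, (if a ≠ c ∧ a ≠ d ∧ b ≠ c ∧ b ≠ d then u c d else 0) := by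
  have key : ∀ c d, u c d = (if c = a then if d = b then u c d else 0 else 0) +
      (if c = b then if d = a then u c d else 0 else 0) +
      ((if c = a then (if b ≠ d ∧ a ≠ d then u c d else 0) else 0) +
      (if d = b then (if b ≠ c ∧ a ≠ c then u c d else 0) else 0) +
      (if c = b then (if b ≠ d ∧ a ≠ d then u c d else 0) else 0) +
      (if d = a then (if b ≠ c ∧ a ≠ c then u c d else 0) else 0)) +
      (if a ≠ c ∧ a ≠ d ∧ b ≠ c ∧ b ≠ d then u c d else 0) := by
    intro c d
    by_cases h1 : c = a <;> by_cases h2 : c = b <;> by_cases h3 : d = a <;> by_cases h4 : d = b <;>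
      simp_all [eq_comm]
  rw [Finset.sum_congr rfl fun c _ => Finset.sum_congr rfl fun d _ => key c d]
  simp only [Finset.sum_add_distrib, Finset.sum_ite_eq', Finset.mem_univ, if_true,
    Finset.sum_ite_irrel, Finset.sum_const_zero]
  congr 2
  simp only [← Finset.sum_add_distrib]
  refine Finset.sum_congr rfl fun f _ => ?_
  by_cases h : b ≠ f ∧ a ≠ f <;> simp [h, hab]

open Classical in
theorem sum_corner :
    ∑ a : G.VLine, ∑ b : G.VLine, ∑ f : G.VLine, (if a ≠ b ∧ b ≠ f ∧ a ≠ f then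
      juxtaposition ε F x a b a f + juxtaposition ε F x a b f b +
      juxtaposition ε F x a b b f + juxtaposition ε F x a b f a else 0) = 0 := by
  let D : G.VLine → G.VLine → G.VLine → Prop := fun a b c => a ≠ b ∧ b ≠ c ∧ a ≠ c
  let S : (G.VLine → G.VLine → G.VLine → R) → R := fun g =>
    ∑ a, ∑ b, ∑ c, if D a b c then g a b c else 0
  have hadd : ∀ g h, S g + S h = S (fun a b c => g a b c + h a b c) := by
    intro g h
    simp only [S, ← Finset.sum_add_distrib]
    refine Finset.sum_congr rfl fun a _ => Finset.sum_congr rfl fun b _ =>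
      Finset.sum_congr rfl fun c _ => ?_
    split_ifs <;> simp
  have hcongr : ∀ {g h : G.VLine → G.VLine → G.VLine → R},
      (∀ a b c, a ≠ b → b ≠ c → a ≠ c → g a b c = h a b c) → S g = S h := by
    intro g h hgh
    refine Finset.sum_congr rfl fun a _ => Finset.sum_congr rfl fun b _ =>
      Finset.sum_congr rfl fun c _ => ?_
    split_ifs with hd
    · exact hgh a b c hd.1 hd.2.1 hd.2.2
    · rfl
  have hbc : ∀ g, S g = S (fun a b c => g a c b) := by
    intro g
    refine Finset.sum_congr rfl fun a _ => ?_
    rw [Finset.sum_comm]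
    refine Finset.sum_congr rfl fun b _ => Finset.sum_congr rfl fun c _ => ?_
    exact if_congr (by simp only [D]; tauto) rfl rfl
  have hab : ∀ g, S g = S (fun a b c => g b a c) := by
    intro g
    simp only [S]
    rw [Finset.sum_comm]
    refine Finset.sum_congr rfl fun a _ => Finset.sum_congr rfl fun b _ =>
      Finset.sum_congr rfl fun c _ => ?_
    exact if_congr (by simp only [D]; tauto) rfl rfl
  have hzero : ∀ {g : G.VLine → G.VLine → G.VLine → R},
      (∀ a b c, a ≠ b → b ≠ c → a ≠ c → g a b c = 0) → S g = 0 := by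
    intro g hg
    rw [hcongr hg]
    simp [S]
  -- The two rectangles share their west sides, their east sides, or the east side of one is the
  -- west side of the other. Sorting the pairs by the position of the reentrant corner matches them.
  have e1 : S (fun a b c => juxtaposition ε F x a b a c) =
      S (fun a b c => if CycBetween a.key b.key c.key then juxtaposition ε F x a b a c else 0) +
      S (fun a b c => if CycBetween a.key b.key c.key then juxtaposition ε F x a c a b else 0) := by
    rw [hbc fun a b c => if CycBetween a.key b.key c.key then juxtaposition ε F x a c a b else 0, hadd]
    refine hcongr fun a b c h1 h2 h3 => ?_
    have r := CycBetween.rotations (VLine.key_ne h1) (VLine.key_ne h2) (VLine.key_ne h3)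
    simp only [r.2.2.1]
    split_ifs <;> simp
  have e2 : S (fun a b c => juxtaposition ε F x a b c b) =
      S (fun a b c => if CycBetween a.key b.key c.key then juxtaposition ε F x a c b c else 0) +
      S (fun a b c => if CycBetween a.key b.key c.key then juxtaposition ε F x b c a c else 0) := by
    rw [hbc fun a b c => juxtaposition ε F x a b c b,
      hab fun a b c => if CycBetween a.key b.key c.key then juxtaposition ε F x b c a c else 0, hadd]
    refine hcongr fun a b c h1 h2 h3 => ?_
    have r := CycBetween.rotations (VLine.key_ne h1) (VLine.key_ne h2) (VLine.key_ne h3)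
    simp only [r.2.2.2.1]
    split_ifs <;> simp
  have e3 : S (fun a b c => juxtaposition ε F x a b b c) =
      S (fun a b c => if CycBetween (x a).key (x c).key (x b).key then
        juxtaposition ε F x a b b c else 0) +
      S (fun a b c => if CycBetween (x a).key (x b).key (x c).key then
        juxtaposition ε F x a b b c else 0) := by
    rw [hadd]
    refine hcongr fun a b c h1 h2 h3 => ?_
    have r := CycBetween.rotations (key_apply_ne x h1) (key_apply_ne x h2) (key_apply_ne x h3)
    simp only [r.2.2.1]
    split_ifs <;> simp
  have e4 : S (fun a b c => juxtaposition ε F x a b c a) =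
      S (fun a b c => if CycBetween (x a).key (x b).key (x c).key then
        juxtaposition ε F x b c a b else 0) +
      S (fun a b c => if CycBetween (x b).key (x a).key (x c).key then
        juxtaposition ε F x b c a b else 0) := by
    rw [hbc fun a b c => juxtaposition ε F x a b c a,
      hab fun a b c => juxtaposition ε F x a c b a, hadd]
    refine hcongr fun a b c h1 h2 h3 => ?_
    have r := CycBetween.rotations (key_apply_ne x h1) (key_apply_ne x h2) (key_apply_ne x h3)
    simp only [r.2.2.2.1]
    split_ifs <;> simp
  have z := hzero fun a b c h1 h2 h3 => juxtaposition_corner₁ (ε := ε) (F := F) (x := x) h1 h2 h3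
  have z2 := hzero fun a b c h1 h2 h3 => juxtaposition_corner₂ (ε := ε) (F := F) (x := x) h1 h2 h3
  have z3 := hzero fun a b c h1 h2 h3 => juxtaposition_corner₃ (ε := ε) (F := F) (x := x) h1 h2 h3
  have z4 := hzero fun a b c h1 h2 h3 => juxtaposition_corner₄ (ε := ε) (F := F) (x := x) h1 h2 h3
  rw [← hadd] at z z2 z3 z4
  change S (fun a b f => juxtaposition ε F x a b a f + juxtaposition ε F x a b f b +
      juxtaposition ε F x a b b f + juxtaposition ε F x a b f a) = 0
  rw [← hadd, ← hadd, ← hadd, e1, e2, e3, e4]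
  have e := congrArg₂ (· + ·) (congrArg₂ (· + ·) z z2) (congrArg₂ (· + ·) z3 z4)
  simp only [add_zero] at e
  refine Eq.trans ?_ e
  abel

open Classical in
/-- Pairs of empty rectangles with the same domain and the same ends cancel, except for annuli. -/
theorem sum_juxtaposition [IsDomain R] [CharZero R] :
    ∑ a : G.VLine, ∑ b : G.VLine, ∑ c : G.VLine, ∑ d : G.VLine, juxtaposition ε F x a b c d =
      ∑ a : G.VLine, ∑ b : G.VLine, (if a ≠ b then
        ind (∀ h : G.HLine, ¬ CycBetween (x a).key h.key (x b).key) *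
          F x (fun _ l => cyc (x a).key (x b).key l) else 0) -
      ∑ a : G.VLine, ∑ b : G.VLine, (if a ≠ b then
        ind (∀ v : G.VLine, ¬ CycBetween a.key v.key b.key) *
          F x (fun k _ => cyc a.key b.key k) else 0) := by
  have h1 : ∀ a b : G.VLine, ∑ c : G.VLine, ∑ d : G.VLine, juxtaposition ε F x a b c d =
      (if a ≠ b then ind (∀ h : G.HLine, ¬ CycBetween (x a).key h.key (x b).key) *
          F x (fun _ l => cyc (x a).key (x b).key l) else 0) -
      (if a ≠ b then ind (∀ v : G.VLine, ¬ CycBetween a.key v.key b.key) *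
          F x (fun k _ => cyc a.key b.key k) else 0) +
      ∑ f : G.VLine, (if a ≠ b ∧ b ≠ f ∧ a ≠ f then
        juxtaposition ε F x a b a f + juxtaposition ε F x a b f b +
        juxtaposition ε F x a b b f + juxtaposition ε F x a b f a else 0) +
      ∑ c : G.VLine, ∑ d : G.VLine, (if a ≠ c ∧ a ≠ d ∧ b ≠ c ∧ b ≠ d then
        juxtaposition ε F x a b c d else 0) := by
    intro a b
    by_cases hab : a = b
    · subst hab
      simp [juxtaposition_eq_zero (ε := ε) (F := F) (x := x) (Or.inl (rfl : a = a))]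
    · rw [sum_sum_split hab _ fun c => juxtaposition_eq_zero (Or.inr rfl),
        juxtaposition_vertical hab, juxtaposition_horizontal hab, if_pos hab, if_pos hab]
      ring
  have h2 : ∑ a : G.VLine, ∑ b : G.VLine, ∑ c : G.VLine, ∑ d : G.VLine,
      (if a ≠ c ∧ a ≠ d ∧ b ≠ c ∧ b ≠ d then juxtaposition ε F x a b c d else 0) = 0 := by
    set s := ∑ a : G.VLine, ∑ b : G.VLine, ∑ c : G.VLine, ∑ d : G.VLine,
      (if a ≠ c ∧ a ≠ d ∧ b ≠ c ∧ b ≠ d then juxtaposition ε F x a b c d else 0) with hs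
    have : s = ∑ a : G.VLine, ∑ b : G.VLine, ∑ c : G.VLine, ∑ d : G.VLine,
        (if a ≠ c ∧ a ≠ d ∧ b ≠ c ∧ b ≠ d then juxtaposition ε F x c d a b else 0) := by
      have hcomm := Finset.sum_comm (s := Finset.univ) (t := Finset.univ)
        (f := fun p q : G.VLine × G.VLine => if p.1 ≠ q.1 ∧ p.1 ≠ q.2 ∧ p.2 ≠ q.1 ∧ p.2 ≠ q.2 then
          juxtaposition ε F x p.1 p.2 q.1 q.2 else 0)
      simp only [Fintype.sum_prod_type] at hcomm
      rw [hs, hcomm]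
      refine Finset.sum_congr rfl fun a _ => Finset.sum_congr rfl fun b _ =>
        Finset.sum_congr rfl fun c _ => Finset.sum_congr rfl fun d _ => ?_
      exact if_congr (by simp only [ne_comm]; tauto) rfl rfl
    have h3 : s + s = 0 := by
      nth_rewrite 2 [this]
      rw [hs]
      simp only [← Finset.sum_add_distrib]
      refine Finset.sum_eq_zero fun a _ => Finset.sum_eq_zero fun b _ =>
        Finset.sum_eq_zero fun c _ => Finset.sum_eq_zero fun d _ => ?_
      split_ifs with h
      · by_cases hab : a = b
        · rw [juxtaposition_eq_zero (Or.inl hab), juxtaposition_eq_zero (Or.inr hab), add_zero]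
        by_cases hcd : c = d
        · rw [juxtaposition_eq_zero (Or.inr hcd), juxtaposition_eq_zero (Or.inl hcd), add_zero]
        exact juxtaposition_disjoint hab h.1 h.2.1 h.2.2.1 h.2.2.2 hcd
      · simp
    exact add_self_eq_zero.1 h3
  simp only [h1, Finset.sum_add_distrib, Finset.sum_sub_distrib]
  rw [h2, sum_corner, add_zero, add_zero]

end Juxtapositions

end SingularGrid

/-! ### Transfer matrices of the singular RoCs -/

section Transfer

variable {K : Type*} [Field K]

/-- Contribution of a singular RoC to the coefficient of a polygon which passes its peak `n` times,
between resolutions `a` and `b` of the RoC. The parameter `c` is a sign and `H` the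
quotient of the variables of the two `O`s of the RoC. -/
def transfer (c H : K) (n : ℤ) (a b : Fin 2) : K :=
  if a = 0 then if b = 0 then 1 else c * ((1 - H ^ (-n)) / (1 - H⁻¹))
  else if b = 0 then 0 else H ^ (-n)

variable {c H : K}

/-- The transfer matrices form a one-parameter group. This is why polygons with peaks behave like
rectangles. -/
theorem sum_transfer_mul_transfer (hH : H ≠ 0) (m n : ℤ) (a b : Fin 2) :
    ∑ d, transfer c H m a d * transfer c H n d b = transfer c H (m + n) a b := by
  have h : H ^ (-(m + n)) = H ^ (-m) * H ^ (-n) := by rw [← zpow_add₀ hH]; congr 1; ring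
  rw [Fin.sum_univ_two]
  unfold transfer
  rw [h]
  generalize H ^ (-m) = x
  generalize H ^ (-n) = y
  fin_cases a <;> fin_cases b <;> simp
  ring

@[simp] theorem transfer_zero_self (a : Fin 2) : transfer c H 0 a a = 1 := by
  fin_cases a <;> simp [transfer]

@[simp] theorem transfer_zero_flip : transfer c H 0 0 1 = 0 := by simp [transfer]

theorem transfer_one_zero (n : ℤ) : transfer c H n 1 0 = 0 := by simp [transfer]

theorem transfer_zero_zero (n : ℤ) : transfer c H n 0 0 = 1 := by simp [transfer]

theorem transfer_one_one (n : ℤ) : transfer c H n 1 1 = H ^ (-n) := by simp [transfer]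

theorem transfer_one_flip (h1 : H ≠ 1) : transfer c H 1 0 1 = c := by
  have : (1 : K) - H⁻¹ ≠ 0 := sub_ne_zero.2 fun e => h1 (inv_eq_one.1 e.symm)
  simp [transfer, div_self this]

theorem transfer_neg_one_flip (hH : H ≠ 0) (h1 : H ≠ 1) :
    transfer c H (-1) 0 1 = - (c * H) := by
  have : (1 : K) - H⁻¹ ≠ 0 := sub_ne_zero.2 fun e => h1 (inv_eq_one.1 e.symm)
  have h2 : (1 : K) - H = - H * (1 - H⁻¹) := by field_simp; ring
  simp only [transfer, neg_neg, zpow_one]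
  rw [h2, mul_div_assoc, div_self this]
  simp

end Transfer

/-- A sum of products in which the factors with index in `Act` depend, apart from their own variable,
only on variables with index outside `Act`, and the other factors only on their own variable. -/
theorem sum_prod_of_triangular {ι β L R : Type*} [Fintype ι] [DecidableEq ι] [Fintype β]
    [Nonempty β] [CommSemiring R] {f : ι → L → β → R} {g : ι → R}
    (hf : ∀ e l, ∑ b, f e l b = g e) {l : (ι → β) → ι → L} (Act : ι → Prop)
    (h1 : ∀ e, ¬ Act e → ∀ J J', l J e = l J' e)
    (h2 : ∀ e, Act e → ∀ J J', (∀ e', ¬ Act e' → J e' = J' e') → l J e = l J' e) :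
    ∑ J : ι → β, ∏ e, f e (l J e) (J e) = ∏ e, g e := by
  classical
  have key : ∀ (p : ι → Prop) [DecidablePred p] (h : ι → β → R), ∑ J : {e // p e} → β, ∏ e, h e.1 (J e) =
      ∏ e : {e // p e}, ∑ b, h e.1 b := fun p _ h =>
    (Fintype.prod_sum (fun (e : {e // p e}) b => h e.1 b)).symm
  let E := Equiv.piEquivPiSubtypeProd Act (fun _ => β)
  let b₀ : β := Classical.arbitrary β
  let u : ({e // ¬ Act e} → β) → ι → β := fun J e => if h : Act e then b₀ else J ⟨e, h⟩
  have hE : ∀ (J₁ : {e // Act e} → β) (J₂ : {e // ¬ Act e} → β),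
      ∏ e, f e (l (E.symm (J₁, J₂)) e) (E.symm (J₁, J₂) e) =
      (∏ e : {e // Act e}, f e.1 (l (u J₂) e) (J₁ e)) *
        ∏ e : {e // ¬ Act e}, f e.1 (l (fun _ => b₀) e) (J₂ e) := by
    intro J₁ J₂
    rw [← Fintype.prod_subtype_mul_prod_subtype Act]
    congr 1
    · refine Finset.prod_congr rfl fun e _ => ?_
      have e1 : E.symm (J₁, J₂) e.1 = J₁ e := by simp [E, e.2]
      rw [e1, h2 e.1 e.2 _ (u J₂) fun e' he' => by simp [E, u, he']]
    · refine Finset.prod_congr rfl fun e _ => ?_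
      have e1 : E.symm (J₁, J₂) e.1 = J₂ e := by simp [E, e.2]
      rw [e1, h1 e.1 e.2 _ (fun _ => b₀)]
  rw [← E.symm.sum_comp, Fintype.sum_prod_type, Finset.sum_comm]
  simp only [hE]
  have h3 : ∀ J₂ : {e // ¬ Act e} → β, ∑ J₁ : {e // Act e} → β,
      (∏ e : {e // Act e}, f e.1 (l (u J₂) e) (J₁ e)) *
        ∏ e : {e // ¬ Act e}, f e.1 (l (fun _ => b₀) e) (J₂ e) =
      (∏ e : {e // Act e}, g e) * ∏ e : {e // ¬ Act e}, f e.1 (l (fun _ => b₀) e) (J₂ e) := by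
    intro J₂
    rw [← Finset.sum_mul, key Act (fun e b => f e (l (u J₂) e) b)]
    simp only [hf]
  simp only [h3]
  have h4 : ∑ J : {e // ¬ Act e} → β, ∏ e, f e.1 (l (fun _ => b₀) e.1) (J e) =
      ∏ e : {e // ¬ Act e}, g e.1 := by
    simpa only [hf] using key (fun e => ¬ Act e) (fun e b => f e (l (fun _ => b₀) e) b)
  rw [← Finset.mul_sum, h4]
  exact Fintype.prod_subtype_mul_prod_subtype Act g

/-! ### Sums over the thin annuli of one direction -/

section Lines

variable {m : ℕ} {S : Fin m → Prop} [Fintype {c // S c}] {M : Type*}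

theorem sum_lines_congr [AddCommMonoid M] {f g : Fin m ⊕ {c // S c} → M}
    (h1 : ∀ c, ¬ S c → f (.inl c) = g (.inl c))
    (h2 : ∀ j : {c // S c}, f (.inl j.1) + f (.inr j) = g (.inl j.1) + g (.inr j)) :
    ∑ v, f v = ∑ v, g v := by
  classical
  obtain rfl : ‹Fintype {c // S c}› = Subtype.fintype S := Subsingleton.elim _ _
  have key : ∀ f : Fin m ⊕ {c // S c} → M, ∑ v, f v =
      ∑ j : {c // S c}, (f (.inl j.1) + f (.inr j)) + ∑ c : {c // ¬ S c}, f (.inl c.1) := by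
    intro f
    rw [Fintype.sum_sum_type, ← Fintype.sum_subtype_add_sum_subtype S (fun c => f (.inl c)),
      Finset.sum_add_distrib]
    abel
  rw [key, key]
  exact congrArg₂ (· + ·) (Finset.sum_congr rfl fun j _ => h2 j)
    (Finset.sum_congr rfl fun c _ => h1 c.1 c.2)

variable {K ι : Type*} [Field K] [Fintype ι] [DecidableEq ι] {emb : {c // S c} → ι}
  {W : Fin m ⊕ {c // S c} → K} {c H : ι → K} {n : Fin m ⊕ {c // S c} → ι → ℤ} {δ : ι → ℤ}
  {I J : ι → Fin 2}

open SingularGrid in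
/-- Annuli from a generator to itself: the coefficients are those of the regular grid. -/
theorem sum_transfer_self (hW : ∀ v, W v ≠ 0)
    (hH : ∀ j, H (emb j) = W (.inr j) / W (.inl j.1))
    (hn : ∀ v j, n v (emb j) = ind (v = .inr j) - ind (v = .inl j.1))
    (hn' : ∀ v e, (∀ j, emb j ≠ e) → n v e = 0) :
    ∑ v, W v * ∏ e, transfer (c e) (H e) (n v e) (I e) (I e) = ∑ v, W v := by
  have hz : ∀ v e, (∀ j, emb j = e → v ≠ .inr j ∧ v ≠ .inl j.1) → n v e = 0 := by
    intro v e h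
    by_cases he : ∃ j, emb j = e
    · obtain ⟨j, rfl⟩ := he
      rw [hn, ind_false (h j rfl).1, ind_false (h j rfl).2, sub_zero]
    · exact hn' v e fun j hj => he ⟨j, hj⟩
  refine sum_lines_congr (fun a ha => ?_) fun j => ?_
  · rw [Finset.prod_eq_one, mul_one]
    intro e _
    rw [hz, transfer_zero_self]
    rintro j -
    refine ⟨by simp, ?_⟩
    rintro ⟨⟩
    exact ha j.2
  · have hp : ∀ v : Fin m ⊕ {c // S c}, v = .inl j.1 ∨ v = .inr j →
        ∏ e, transfer (c e) (H e) (n v e) (I e) (I e) =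
          transfer (c (emb j)) (H (emb j)) (n v (emb j)) (I (emb j)) (I (emb j)) := by
      intro v hv
      refine Finset.prod_eq_single _ (fun e _ he => ?_) (by simp)
      rw [hz, transfer_zero_self]
      rintro j' rfl
      have : j' ≠ j := fun h => he (by rw [h])
      constructor
      · rintro rfl
        simp [this] at hv
      · rintro rfl
        simp at hv
        exact this (Subtype.ext hv)
    rw [hp _ (Or.inl rfl), hp _ (Or.inr rfl), hn, hn]
    have h1 := hW (.inl j.1)
    have h2 := hW (.inr j)
    obtain h | h : I (emb j) = 0 ∨ I (emb j) = 1 := by omega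
    · simp only [h, transfer_zero_zero, mul_one]
    · simp only [h, transfer_one_one, hH]
      simp
      field_simp
      ring

open SingularGrid in
/-- Annuli which change the resolution of a RoC in their direction: the two annuli adjacent to its
arcs cancel. -/
theorem sum_transfer_eq_zero (hW : ∀ v, W v ≠ 0)
    (hH : ∀ j, H (emb j) = W (.inr j) / W (.inl j.1)) (hH1 : ∀ j, H (emb j) ≠ 1)
    (hn : ∀ v j, n v (emb j) = ind (v = .inr j) - ind (v = .inl j.1))
    (hn' : ∀ v e, (∀ j, emb j ≠ e) → n v e = 0) {j₀ : {c // S c}} (hI : I (emb j₀) = 0)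
    (hJ : J (emb j₀) = 1) (hδ : δ (emb j₀) = 0) :
    ∑ v, W v * ∏ e, transfer (c e) (H e) (n v e + δ e) (I e) (J e) = 0 := by
  have hz : ∀ v e, (∀ j, emb j = e → v ≠ .inr j ∧ v ≠ .inl j.1) → n v e = 0 := by
    intro v e h
    by_cases he : ∃ j, emb j = e
    · obtain ⟨j, rfl⟩ := he
      rw [hn, ind_false (h j rfl).1, ind_false (h j rfl).2, sub_zero]
    · exact hn' v e fun j hj => he ⟨j, hj⟩
  have h0 : ∀ v, v ≠ .inl j₀.1 → v ≠ .inr j₀ →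
      W v * ∏ e, transfer (c e) (H e) (n v e + δ e) (I e) (J e) = 0 := by
    intro v h1 h2
    rw [Finset.prod_eq_zero (Finset.mem_univ (emb j₀)), mul_zero]
    rw [hn, ind_false h1, ind_false h2, hδ, hI, hJ]
    simp
  have : ∑ v, W v * ∏ e, transfer (c e) (H e) (n v e + δ e) (I e) (J e) =
      ∑ _v : Fin m ⊕ {c // S c}, (0 : K) := by
    refine sum_lines_congr (fun a ha => h0 _ ?_ (by simp)) fun j => ?_
    · rintro ⟨⟩
      exact ha j₀.2
    by_cases hj : j = j₀
    · subst hj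
      have hp : ∀ v : Fin m ⊕ {c // S c}, v = .inl j.1 ∨ v = .inr j →
          ∏ e, transfer (c e) (H e) (n v e + δ e) (I e) (J e) =
            transfer (c (emb j)) (H (emb j)) (n v (emb j)) 0 1 *
            ∏ e ∈ Finset.univ.erase (emb j), transfer (c e) (H e) (δ e) (I e) (J e) := by
        intro v hv
        rw [← Finset.mul_prod_erase _ _ (Finset.mem_univ (emb j)), hδ, hI, hJ, add_zero]
        congr 1
        refine Finset.prod_congr rfl fun e he => ?_
        rw [hz, zero_add]
        rintro j' rfl
        have : j' ≠ j := fun h => Finset.ne_of_mem_erase he (by rw [h])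
        constructor
        · rintro rfl
          simp [this] at hv
        · rintro rfl
          simp at hv
          exact this (Subtype.ext hv)
      have h1 := hW (.inl j.1)
      have h2 := hW (.inr j)
      have hH0 : H (emb j) ≠ 0 := by rw [hH]; exact div_ne_zero h2 h1
      have e1 : n (.inl j.1) (emb j) = -1 := by simp [hn]
      have e2 : n (.inr j) (emb j) = 1 := by simp [hn]
      rw [hp _ (Or.inl rfl), hp _ (Or.inr rfl), e1, e2, transfer_one_flip (hH1 j),
        transfer_neg_one_flip hH0 (hH1 j), hH]
      field_simp
      ring
    · rw [h0 _ (fun h => hj (Subtype.ext (by simpa using h))) (by simp),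
        h0 _ (by simp) (by simpa using hj)]
  rw [this]
  simp

open SingularGrid in
/-- The thin annuli along the lines of one direction contribute as on the regular grid if the
resolutions at both ends agree, and cancel otherwise. -/
theorem sum_transfer (hW : ∀ v, W v ≠ 0)
    (hH : ∀ j, H (emb j) = W (.inr j) / W (.inl j.1)) (hH1 : ∀ j, H (emb j) ≠ 1)
    (hn : ∀ v j, n v (emb j) = ind (v = .inr j) - ind (v = .inl j.1))
    (hn' : ∀ v e, (∀ j, emb j ≠ e) → n v e = 0) (h0 : I = J → ∀ e, δ e = 0)
    (h1 : I ≠ J → ∃ e, I e = 1 ∧ J e = 0 ∨ I e = 0 ∧ J e = 1 ∧ δ e = 0) :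
    ∑ v, W v * ∏ e, transfer (c e) (H e) (n v e + δ e) (I e) (J e) =
      if I = J then ∑ v, W v else 0 := by
  split_ifs with h
  · subst h
    simp only [h0 rfl, add_zero]
    exact sum_transfer_self hW hH hn hn'
  · obtain ⟨e, ⟨he1, he2⟩ | ⟨he1, he2, he3⟩⟩ := h1 h
    · refine Finset.sum_eq_zero fun v _ => ?_
      rw [Finset.prod_eq_zero (Finset.mem_univ e), mul_zero]
      rw [he1, he2, transfer_one_zero]
    · by_cases he : ∃ j, emb j = e
      · obtain ⟨j, rfl⟩ := he
        exact sum_transfer_eq_zero hW hH hH1 hn hn' he1 he2 he3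
      · refine Finset.sum_eq_zero fun v _ => ?_
        rw [Finset.prod_eq_zero (Finset.mem_univ e), mul_zero]
        rw [he1, he2, he3, hn' v e fun j hj => he ⟨j, hj⟩, add_zero, transfer_zero_flip]

open SingularGrid in
/-- The next line in the cyclic order. -/
theorem exists_next {L : Type*} [Finite L] {key : L → ℕ} (hkey : Function.Injective key)
    (h : Nontrivial L) (a : L) : ∃ b, b ≠ a ∧
      ∀ b', b' ≠ a ∧ (∀ v, ¬ CycBetween (key a) (key v) (key b')) ↔ b' = b := by
  classical
  -- Order the other lines by their distance from `a` in the cyclic order.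
  let N := ∑ᶠ v, (key v + 1)
  have hN : ∀ v, key v < N := by
    intro v
    have := Fintype.ofFinite L
    simp only [N, finsum_eq_sum_of_fintype]
    exact lt_of_lt_of_le (Nat.lt_succ_self _)
      (Finset.single_le_sum (f := fun v => key v + 1) (fun _ _ => Nat.zero_le _) (Finset.mem_univ v))
  let d : L → ℕ := fun v => if key a < key v then key v - key a else key v + N - key a
  obtain ⟨v₀, hv₀⟩ := exists_ne a
  obtain ⟨b, hb, hmin⟩ := (Set.toFinite {v : L | v ≠ a}).exists_minimalFor d _ ⟨v₀, hv₀⟩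
  have hb' : b ≠ a := hb
  have hmin' : ∀ v, v ≠ a → d b ≤ d v := by
    intro v hv
    rcases le_total (d b) (d v) with h | h
    · exact h
    · exact hmin hv h
  refine ⟨b, hb', fun b' => ⟨fun ⟨h1, h2⟩ => ?_, ?_⟩⟩
  · by_contra hne
    have k1 : key b' ≠ key a := fun e => h1 (hkey e)
    have k2 : key b ≠ key a := fun e => hb' (hkey e)
    have k3 : key b' ≠ key b := fun e => hne (hkey e)
    have h3 := hmin' b' h1
    have h4 := h2 b
    have := hN a
    have := hN b
    have := hN b'
    simp only [d] at h3
    unfold CycBetween at h4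
    split_ifs at h3 <;> omega
  · rintro rfl
    refine ⟨hb', fun v hv => ?_⟩
    have k1 : v ≠ a := fun e => hv.ne.1 (by rw [e])
    have h3 := hmin' v k1
    have := hN a
    have := hN b'
    have := hN v
    simp only [d] at h3
    unfold CycBetween at hv
    split_ifs at h3 <;> omega

open SingularGrid in
/-- The thin annuli correspond to the lines at their start. -/
theorem sum_sum_annuli {L R : Type*} [Fintype L] [DecidableEq L] [CommRing R] {key : L → ℕ}
    (hkey : Function.Injective key) (h : Nontrivial L) {Φ : L → L → R} {f : L → R}
    (hΦ : ∀ a b, (∀ v, cyc (key a) (key b) (key v) = ind (v = a)) → Φ a b = f a) :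
    ∑ a, ∑ b, (if a ≠ b then ((ind (∀ v, ¬ CycBetween (key a) (key v) (key b)) : ℤ) : R) * Φ a b
      else 0) = ∑ a, f a := by
  refine Finset.sum_congr rfl fun a _ => ?_
  obtain ⟨b, hba, hb⟩ := exists_next hkey h a
  rw [Finset.sum_eq_single b]
  · have h1 := ((hb b).2 rfl).2
    rw [if_pos hba.symm, ind_true h1, Int.cast_one, one_mul]
    refine hΦ a b fun v => ?_
    rw [cyc_eq_ind (fun e => hba (hkey e).symm)]
    refine ind_congr ⟨?_, fun e => Or.inl (by rw [e])⟩
    rintro (h2 | h2)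
    · exact hkey h2
    · exact absurd h2 (h1 v)
  · intro b' _ hne
    by_cases hab : a ≠ b'
    · rw [if_pos hab, ind_false fun h => hne ((hb b').1 ⟨hab.symm, h⟩)]
      simp
    · rw [if_neg hab]
  · simp

end Lines

/-! ### Coefficients of the differential -/

namespace SingularGrid

variable {G : SingularGrid} {A : G.WindingArcs}

/-- Each column of the grid `G_I` contains one decoration of each kind. -/
theorem existsUnique_resolvedCol (I : G.Resolution) (k : Mark) (v : G.VLine) :
    ∃! q : G.Decor k, G.resolvedCol I q.1 = v := by
  classical
  have key : ∀ (c : Fin G.cols) (p : Fin G.rows → Prop), (∃! r, G.deco c r = some k ∧ p r) →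
      (∀ r, G.resolvedCol I (c, r) = v ↔ p r) → v.key / 2 = c →
      ∃! q : G.Decor k, G.resolvedCol I q.1 = v := by
    rintro c p ⟨r, ⟨h1, h2⟩, h3⟩ h4 h5
    refine ⟨⟨(c, r), h1⟩, (h4 r).2 h2, ?_⟩
    rintro ⟨⟨c', r'⟩, hq⟩ hq'
    have h6 := idx_resolvedCol I (c', r')
    have h7 : G.resolvedCol I (c', r') = v := hq'
    rw [h7, h5] at h6
    obtain rfl : c = c' := Fin.ext h6
    obtain rfl := h3 r' ⟨hq, (h4 r').1 h7⟩
    rfl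
  rcases v with c | j
  · by_cases hs : RoC.IsSingular (G.deco c)
    · refine key c _ (RoC.existsUnique_side hs (G.col_admissible c) k (I (.inl ⟨c, hs⟩)) True)
        (fun r => ?_) (by simp)
      rw [resolvedCol_of_singular (q := (c, r)) hs]
      split_ifs with h <;> simp [h]
    · refine key c (fun _ => True) ?_ (fun r => ?_) (by simp)
      · simpa using RoC.existsUnique_of_not_isSingular hs (G.col_admissible c) k
      · rw [resolvedCol_of_not_singular (q := (c, r)) hs]; simp
  · refine key j.1 _ (RoC.existsUnique_side j.2 (G.col_admissible j.1) k (I (.inl j)) False)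
      (fun r => ?_) (by simp; omega)
    rw [resolvedCol_of_singular (q := (j.1, r)) j.2]
    split_ifs with h <;> simp [h]

/-- Each row of the grid `G_I` contains one decoration of each kind. -/
theorem existsUnique_resolvedRow (I : G.Resolution) (k : Mark) (v : G.HLine) :
    ∃! q : G.Decor k, G.resolvedRow I q.1 = v := by
  classical
  have key : ∀ (c : Fin G.rows) (p : Fin G.cols → Prop), (∃! r, G.deco r c = some k ∧ p r) →
      (∀ r, G.resolvedRow I (r, c) = v ↔ p r) → v.key / 2 = c →
      ∃! q : G.Decor k, G.resolvedRow I q.1 = v := by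
    rintro c p ⟨r, ⟨h1, h2⟩, h3⟩ h4 h5
    refine ⟨⟨(r, c), h1⟩, (h4 r).2 h2, ?_⟩
    rintro ⟨⟨r', c'⟩, hq⟩ hq'
    have h6 := idx_resolvedRow I (r', c')
    have h7 : G.resolvedRow I (r', c') = v := hq'
    rw [h7, h5] at h6
    obtain rfl : c = c' := Fin.ext h6
    obtain rfl := h3 r' ⟨hq, (h4 r').1 h7⟩
    rfl
  rcases v with c | j
  · by_cases hs : RoC.IsSingular (fun r => G.deco r c)
    · refine key c _ (RoC.existsUnique_side hs (G.row_admissible c) k (I (.inr ⟨c, hs⟩)) True)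
        (fun r => ?_) (by simp)
      rw [resolvedRow_of_singular (q := (r, c)) hs]
      split_ifs with h <;> simp [h]
    · refine key c (fun _ => True) ?_ (fun r => ?_) (by simp)
      · simpa using RoC.existsUnique_of_not_isSingular hs (G.row_admissible c) k
      · rw [resolvedRow_of_not_singular (q := (r, c)) hs]; simp
  · refine key j.1 _ (RoC.existsUnique_side j.2 (G.row_admissible j.1) k (I (.inr j)) False)
      (fun r => ?_) (by simp; omega)
    rw [resolvedRow_of_singular (q := (r, j.1)) j.2]
    split_ifs with h <;> simp [h]

theorem shiftSign_inl_eq (q : Fin G.cols × Fin G.rows) (j : G.SingCol) :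
    shiftSign q (.inl j) = ind (G.resolvedCol (fun _ => 0) q = .inr j) -
      ind (G.resolvedCol (fun _ => 0) q = .inl j.1) := by
  classical
  by_cases h : j.1 = q.1
  · obtain ⟨c, hc⟩ := j
    obtain ⟨q1, q2⟩ := q
    dsimp only at h
    subst h
    rw [shiftSign, ind_congr (isLeft_inr_iff_not (I := fun _ => 1) (J := fun _ => 0) rfl (by simp)),
      ind_congr (isLeft_inr_iff (I := fun _ => 0) rfl), ind_congr (not_congr (isLeft_inr_iff
        (q := (c, q2)) (I := fun _ => 0) rfl)), resolvedCol_of_singular (q := (c, q2)) hc]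
    split_ifs with h <;> simp [h]
  · have h1 := idx_resolvedCol (fun _ => 0) q
    rw [shiftSign_inl_of_ne h, ind_false, ind_false, sub_self]
    · intro e
      rw [e] at h1
      simp at h1
      exact h (Fin.ext h1)
    · intro e
      rw [e] at h1
      simp at h1
      exact h (Fin.ext (by omega))

theorem shiftSign_inr_eq (q : Fin G.cols × Fin G.rows) (i : G.SingRow) :
    shiftSign q (.inr i) = ind (G.resolvedRow (fun _ => 0) q = .inr i) -
      ind (G.resolvedRow (fun _ => 0) q = .inl i.1) := by
  classical
  by_cases h : i.1 = q.2
  · obtain ⟨c, hc⟩ := i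
    obtain ⟨q1, q2⟩ := q
    dsimp only at h
    subst h
    rw [shiftSign, ind_congr (isBelow_inr_iff_not (I := fun _ => 1) (J := fun _ => 0) rfl (by simp)),
      ind_congr (isBelow_inr_iff (I := fun _ => 0) rfl), ind_congr (not_congr (isBelow_inr_iff
        (q := (q1, c)) (I := fun _ => 0) rfl)), resolvedRow_of_singular (q := (q1, c)) hc]
    split_ifs with h <;> simp [h]
  · have h1 := idx_resolvedRow (fun _ => 0) q
    rw [shiftSign_inr_of_ne h, ind_false, ind_false, sub_self]
    · intro e
      rw [e] at h1
      simp at h1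
      exact h (Fin.ext h1)
    · intro e
      rw [e] at h1
      simp at h1
      exact h (Fin.ext (by omega))

/-- The Laurent monomial in the variables `U_O` with given exponents. -/
def laurent (f : G.Decor .O → ℤ) : FractionRing G.Coeff :=
  ∏ o, algebraMap G.Coeff (FractionRing G.Coeff) (MvPolynomial.X o) ^ f o

theorem algebraMap_X_ne_zero (o : G.Decor .O) :
    algebraMap G.Coeff (FractionRing G.Coeff) (MvPolynomial.X o) ≠ 0 := by
  rw [Ne, FaithfulSMul.algebraMap_eq_zero_iff]
  exact MvPolynomial.X_ne_zero o

theorem laurent_ne_zero (f : G.Decor .O → ℤ) : laurent f ≠ 0 :=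
  Finset.prod_ne_zero_iff.2 fun o _ => zpow_ne_zero _ (algebraMap_X_ne_zero o)

theorem laurent_add (f g : G.Decor .O → ℤ) :
    laurent (fun o => f o + g o) = laurent f * laurent g := by
  unfold laurent
  rw [← Finset.prod_mul_distrib]
  exact Finset.prod_congr rfl fun o _ => zpow_add₀ (algebraMap_X_ne_zero o) _ _

theorem laurent_sub (f g : G.Decor .O → ℤ) :
    laurent (fun o => f o - g o) = laurent f / laurent g := by
  rw [eq_div_iff (laurent_ne_zero g), ← laurent_add]
  simp

theorem laurent_sum_mul {ι : Type*} [Fintype ι] (s : G.Decor .O → ι → ℤ) (t : ι → ℤ) :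
    laurent (fun o => ∑ e, s o e * t e) = ∏ e, laurent (fun o => s o e) ^ t e := by
  unfold laurent
  simp only [← Finset.prod_zpow, ← zpow_mul]
  rw [Finset.prod_comm]
  refine Finset.prod_congr rfl fun o _ => ?_
  classical
  induction (Finset.univ : Finset ι) using Finset.induction_on with
  | empty => simp
  | insert a u ha ih =>
    rw [Finset.sum_insert ha, Finset.prod_insert ha, zpow_add₀ (algebraMap_X_ne_zero o), ih]

theorem laurent_ind {p : G.Decor .O → Prop} {o : G.Decor .O} (h : ∀ o', p o' ↔ o' = o) :
    laurent (fun o' => ind (p o')) = algebraMap G.Coeff _ (MvPolynomial.X o) := by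
  unfold laurent
  rw [Finset.prod_eq_single o]
  · simp only [ind_true ((h o).2 rfl), zpow_one]
  · intro o' _ ho'
    simp only [ind_false fun e => ho' ((h o').1 e), zpow_zero]
  · simp

/-- The variable of the `O` in a column of `G_{0⋯0}`. -/
def colVar (v : G.VLine) : FractionRing G.Coeff :=
  laurent (fun o => ind (G.resolvedCol (fun _ => 0) o.1 = v))

/-- The variable of the `O` in a row of `G_{0⋯0}`. -/
def rowVar (h : G.HLine) : FractionRing G.Coeff :=
  laurent (fun o => ind (G.resolvedRow (fun _ => 0) o.1 = h))

/-- The quotient of the variables of the two `O`s of a singular RoC. -/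
def ratio (e : G.SingRoC) : FractionRing G.Coeff := laurent (fun o => shiftSign o.1 e)

theorem ratio_ne_zero (e : G.SingRoC) : ratio e ≠ 0 := laurent_ne_zero _

theorem ratio_inl (j : G.SingCol) : ratio (.inl j) = colVar (.inr j) / colVar (.inl j.1) := by
  unfold ratio colVar
  rw [← laurent_sub]
  simp only [shiftSign_inl_eq]

theorem ratio_inr (i : G.SingRow) : ratio (.inr i) = rowVar (.inr i) / rowVar (.inl i.1) := by
  unfold ratio rowVar
  rw [← laurent_sub]
  simp only [shiftSign_inr_eq]

theorem exists_colVar_eq (v : G.VLine) : ∃ o : G.Decor .O, G.resolvedCol (fun _ => 0) o.1 = v ∧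
    colVar v = algebraMap G.Coeff _ (MvPolynomial.X o) := by
  obtain ⟨o, h1, h2⟩ := existsUnique_resolvedCol (fun _ => 0) .O v
  exact ⟨o, h1, laurent_ind fun o' => ⟨fun h => h2 o' h, fun h => h ▸ h1⟩⟩

theorem exists_rowVar_eq (h : G.HLine) : ∃ o : G.Decor .O, G.resolvedRow (fun _ => 0) o.1 = h ∧
    rowVar h = algebraMap G.Coeff _ (MvPolynomial.X o) := by
  obtain ⟨o, h1, h2⟩ := existsUnique_resolvedRow (fun _ => 0) .O h
  exact ⟨o, h1, laurent_ind fun o' => ⟨fun h => h2 o' h, fun h => h ▸ h1⟩⟩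

theorem algebraMap_X_injective : Function.Injective fun o : G.Decor .O =>
    algebraMap G.Coeff (FractionRing G.Coeff) (MvPolynomial.X o) := fun _ _ h =>
  MvPolynomial.X_injective (FaithfulSMul.algebraMap_injective _ _ h)

theorem ratio_ne_one (e : G.SingRoC) : ratio e ≠ 1 := by
  rcases e with j | i
  · obtain ⟨o, h1, h2⟩ := exists_colVar_eq (.inr j : G.VLine)
    obtain ⟨o', h1', h2'⟩ := exists_colVar_eq (.inl j.1 : G.VLine)
    rw [ratio_inl, h2, h2', Ne, div_eq_one_iff_eq (algebraMap_X_ne_zero _)]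
    intro h
    rw [algebraMap_X_injective h, h1'] at h1
    cases h1
  · obtain ⟨o, h1, h2⟩ := exists_rowVar_eq (.inr i : G.HLine)
    obtain ⟨o', h1', h2'⟩ := exists_rowVar_eq (.inl i.1 : G.HLine)
    rw [ratio_inr, h2, h2', Ne, div_eq_one_iff_eq (algebraMap_X_ne_zero _)]
    intro h
    rw [algebraMap_X_injective h, h1'] at h1
    cases h1

theorem sum_colVar : ∑ v : G.VLine, colVar v =
    ∑ o : G.Decor .O, algebraMap G.Coeff (FractionRing G.Coeff) (MvPolynomial.X o) := by
  choose f h1 h2 using exists_colVar_eq (G := G)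
  refine Fintype.sum_bijective f ⟨fun v w h => by rw [← h1 v, ← h1 w, h], fun o => ?_⟩ _ _ h2
  exact ⟨_, (existsUnique_resolvedCol (fun _ => 0) .O _).unique (h1 _) rfl⟩

theorem sum_rowVar : ∑ v : G.HLine, rowVar v =
    ∑ o : G.Decor .O, algebraMap G.Coeff (FractionRing G.Coeff) (MvPolynomial.X o) := by
  choose f h1 h2 using exists_rowVar_eq (G := G)
  refine Fintype.sum_bijective f ⟨fun v w h => by rw [← h1 v, ← h1 w, h], fun o => ?_⟩ _ _ h2
  exact ⟨_, (existsUnique_resolvedRow (fun _ => 0) .O _).unique (h1 _) rfl⟩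

theorem VLine.eq_of_roc_eq_some {v w : G.VLine} {e : G.SingRoC} (h : v.roc = some e)
    (h' : w.roc = some e) : v = w := by
  rcases v with _ | j <;> rcases w with _ | j' <;> simp [VLine.roc] at h h'
  rw [← h'] at h
  rw [Sum.inl.inj h]

theorem HLine.eq_of_roc_eq_some {v w : G.HLine} {e : G.SingRoC} (h : v.roc = some e)
    (h' : w.roc = some e) : v = w := by
  rcases v with _ | j <;> rcases w with _ | j' <;> simp [HLine.roc] at h h'
  rw [← h'] at h
  rw [Sum.inr.inj h]

theorem VLine.roc_ne_roc {v : G.VLine} {w : G.HLine} {e : G.SingRoC} (h : v.roc = some e) :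
    w.roc ≠ some e := by
  intro h'
  rcases v with _ | j <;> rcases w with _ | j' <;> simp [VLine.roc, HLine.roc] at h h'
  rw [← h'] at h
  cases h

/-- The sign of a polygon through the peak of `e`, entering it from the west or the south. -/
def CompassConvention.sign (C : G.CompassConvention) (e : G.SingRoC) : ℤ :=
  - Quad.orient (C.dir e)

namespace Quad

variable {P : Peaks A} {π : G.Quad}

theorem sideRoC_injective (hne : π.west ≠ π.east) {d d' : Compass} {e : G.SingRoC}
    (h : π.sideRoC d = some e) (h' : π.sideRoC d' = some e) : d = d' := by
  have hsn := south_ne_north hne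
  rcases d <;> rcases d' <;> simp only [sideRoC] at h h' <;> first
    | rfl
    | exact absurd h' (VLine.roc_ne_roc h)
    | exact absurd h (VLine.roc_ne_roc h')
    | exact absurd (VLine.eq_of_roc_eq_some h h') hne
    | exact absurd (VLine.eq_of_roc_eq_some h' h) hne
    | exact absurd (HLine.eq_of_roc_eq_some h h') hsn
    | exact absurd (HLine.eq_of_roc_eq_some h' h) hsn

open Classical in
theorem IsPolygon.neg_one_pow_numConventional (C : G.CompassConvention) (hπ : π.IsPolygon P) :
    (-1 : ℤ) ^ π.numConventional C =
      ∏ e, if π.start.1 e ≠ π.finish.1 e then C.sign e * π.turn P e else 1 := by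
  have hne := hπ.west_ne_east
  have h1 : (-1 : ℤ) ^ π.numConventional C =
      ∏ d ∈ π.peakSides, if ∃ e, π.sideRoC d = some e ∧ C.dir e = d then -1 else 1 := by
    rw [Finset.prod_ite, Finset.prod_const, Finset.prod_const_one, mul_one]
    rfl
  have h2 : ∀ d ∈ π.peakSides, ∃ e, π.sideRoC d = some e ∧ π.start.1 e ≠ π.finish.1 e :=
    fun d hd => mem_peakSides.1 hd
  choose f hf hf' using h2
  rw [h1, ← Finset.prod_filter (fun e => π.start.1 e ≠ π.finish.1 e)]
  refine Finset.prod_bij f (fun d hd => by simp [hf' d hd]) (fun d hd d' hd' h =>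
    sideRoC_injective hne (hf d hd) (by rw [h]; exact hf d' hd')) (fun e he => ?_) fun d hd => ?_
  · have he : π.start.1 e ≠ π.finish.1 e := by simpa using he
    obtain ⟨-, -, d, hd⟩ := hπ.resolutions e he
    have hd' : d ∈ π.peakSides := mem_peakSides.2 ⟨e, hd, he⟩
    refine ⟨d, hd', ?_⟩
    have := hf d hd'
    rw [hd] at this
    exact (Option.some.inj this).symm
  · have e1 := turn_eq (P := P) hne hπ.finish_eq (hf d hd)
    rw [hπ.cr_eq_one (hf d hd) (hf' d hd), mul_one] at e1
    rw [e1]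
    have e2 : (∃ e, π.sideRoC d = some e ∧ C.dir e = d) ↔ C.dir (f d hd) = d := by
      rw [hf d hd]
      exact ⟨fun ⟨e, h, h'⟩ => by rw [Option.some.inj h]; exact h', fun h => ⟨_, rfl, h⟩⟩
    have e3 := hf d hd
    simp only [e2, CompassConvention.sign]
    rcases he : f d hd with j | i <;> rw [he] at e3
    · rcases d
      · rcases hs : π.north with _ | _ <;> simp [sideRoC, hs, HLine.roc] at e3
      · rcases hs : π.south with _ | _ <;> simp [sideRoC, hs, HLine.roc] at e3
      all_goals rcases C.col_dir j with h | h <;> simp [h, orient]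
    · rcases d
      on_goal 3 => rcases hs : π.east with _ | _ <;> simp [sideRoC, hs, VLine.roc] at e3
      on_goal 3 => rcases hs : π.west with _ | _ <;> simp [sideRoC, hs, VLine.roc] at e3
      all_goals rcases C.row_dir i with h | h <;> simp [h, orient]

theorem algebraMap_weight : algebraMap G.Coeff (FractionRing G.Coeff) (π.weight P) =
    laurent (fun o => ind (π.Contains P o.1)) := by
  unfold weight laurent
  rw [map_prod]
  refine Finset.prod_congr rfl fun o _ => ?_
  by_cases h : π.Contains P o.1 <;> simp [h]

open Classical in
/-- The coefficient of the differential due to a polygon, zero if `π` is not an empty polygon. -/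
def coefficient (P : Peaks A) (C : G.CompassConvention) (ε : G.SignAssignment) (π : G.Quad) :
    G.Coeff :=
  if π.IsPolygon P ∧ π.IsEmpty P then (((π.sign C ε : ℤˣ) : ℤ) : G.Coeff) * π.weight P else 0

open Classical in
theorem coefficient_eq_zero {C : G.CompassConvention} {ε : G.SignAssignment}
    (h : ¬ (π.finish.2 = π.toRect.finish ∧ π.toRect.IsEmpty)) : π.coefficient P C ε = 0 := by
  refine if_neg fun h' => h ?_
  have := isPolygon_and_isEmpty_iff.1 h'
  exact ⟨this.1, this.2.1⟩

/-- The coefficients of the differential factor: they are the coefficients of the regular grid, up to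
a change of basis, times a transfer matrix for each singular RoC. -/
theorem algebraMap_coefficient (C : G.CompassConvention) (ε : G.SignAssignment)
    (hf : π.finish.2 = π.toRect.finish) (hE : π.toRect.IsEmpty) :
    algebraMap G.Coeff (FractionRing G.Coeff) (π.coefficient P C ε) =
      (((ε.sign π.toRect : ℤˣ) : ℤ) : FractionRing G.Coeff) *
      (laurent (fun o => P.potential π.start o.1) / laurent (fun o => P.potential π.finish o.1)) *
      laurent (fun o => π.toRect.cutTerm o.1) *
      ∏ e, transfer (C.sign e : FractionRing G.Coeff) (ratio e) (π.turn P e)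
        (π.start.1 e) (π.finish.1 e) := by
  classical
  by_cases h : ∀ e, π.start.1 e ≠ π.finish.1 e →
      π.start.1 e = 0 ∧ π.finish.1 e = 1 ∧ π.turn P e ≠ 0
  · have hP := isPolygon_and_isEmpty_iff.2 ⟨hf, hE, h⟩
    have hπ := hP.1
    have hne := hπ.west_ne_east
    have e1 : laurent (fun o => ind (π.Contains P o.1)) =
        laurent (fun o => P.potential π.start o.1) / laurent (fun o => P.potential π.finish o.1) *
        laurent (fun o => π.toRect.cutTerm o.1) *
        ∏ e, ratio e ^ turnTerm (π.start.1 e) (π.finish.1 e) (π.turn P e) := by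
      rw [← laurent_sub, ← laurent_add]
      unfold ratio
      rw [← laurent_sum_mul, ← laurent_add]
      congr 1
      funext o
      exact hπ.ind_contains_eq (by rw [o.2]; simp)
    have e2 : ∀ e, ((if π.start.1 e ≠ π.finish.1 e then C.sign e * π.turn P e else 1 : ℤ) :
        FractionRing G.Coeff) * ratio e ^ turnTerm (π.start.1 e) (π.finish.1 e) (π.turn P e) =
        transfer (C.sign e : FractionRing G.Coeff) (ratio e) (π.turn P e)
          (π.start.1 e) (π.finish.1 e) := by
      intro e
      by_cases he : π.start.1 e = π.finish.1 e
      · rw [if_neg (not_not.2 he), he]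
        obtain h0 | h0 : π.finish.1 e = 0 ∨ π.finish.1 e = 1 := by omega
        · simp [h0, turnTerm, transfer_zero_zero]
        · simp [h0, turnTerm, transfer_one_one]
      · obtain ⟨h0, h1, h2⟩ := h e he
        obtain ⟨-, -, d, hd⟩ := hπ.resolutions e he
        have ht := turn_eq (P := P) hne hf hd
        rw [hπ.cr_eq_one hd he, mul_one] at ht
        rw [if_pos he, h0, h1]
        have ht' : π.turn P e = 1 ∨ π.turn P e = -1 := by
          rw [ht]; cases d <;> simp [orient]
        rcases ht' with h3 | h3
        · rw [h3, transfer_one_flip (ratio_ne_one e)]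
          simp [turnTerm]
        · rw [h3, transfer_neg_one_flip (ratio_ne_zero e) (ratio_ne_one e)]
          simp [turnTerm]
    have e3 : (((-1 : ℤˣ) ^ π.numConventional C : ℤˣ) : ℤ) = (-1) ^ π.numConventional C := by
      simp
    rw [coefficient, if_pos hP, map_mul, algebraMap_weight, e1, ← Finset.prod_congr rfl fun e _ => e2 e,
      Finset.prod_mul_distrib, ← Int.cast_prod, ← hπ.neg_one_pow_numConventional C, sign,
      Units.val_mul, e3, map_intCast]
    push_cast
    ring
  · rw [coefficient, if_neg fun h' => h (isPolygon_and_isEmpty_iff.1 h').2.2, map_zero]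
    push Not at h
    obtain ⟨e, he, h⟩ := h
    rw [Finset.prod_eq_zero (Finset.mem_univ e), mul_zero]
    obtain ⟨h1, h2⟩ | ⟨h1, h2⟩ : π.start.1 e = 0 ∧ π.finish.1 e = 1 ∨
        π.start.1 e = 1 ∧ π.finish.1 e = 0 := by omega
    · rw [h h1 h2, h1, h2, transfer_zero_flip]
    · rw [h1, h2, transfer_one_zero]

end Quad

end SingularGrid

/-! ### The square of the differential -/

namespace SingularGrid

variable {G : SingularGrid} {A : G.WindingArcs}

/-- If the position of the dot on the arcs of a RoC relative to its peak changes with the resolution,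
then this dot lies on another RoC whose resolution changes, and whose own peak is not affected. -/
theorem Peaks.exists_of_dotBefore_ne (P : Peaks A) {y : G.Perm} {J J' : G.Resolution} {e : G.SingRoC}
    (h : P.dotBefore (J, y) e ≠ P.dotBefore (J', y) e) :
    ∃ e', J e' ≠ J' e' ∧ ∀ L L', P.dotBefore (L, y) e' = P.dotBefore (L', y) e' := by
  rcases e with j | i
  · simp only [dotBefore, hb] at h
    rcases hy : y (.inr j) with r | i
    · exact absurd (ind_congr (P.hBelow_congr j (by simp [hy, HLine.roc]))) h
    · rw [hy] at h
      refine ⟨.inr i, fun hi => h (ind_congr (P.hBelow_congr j ?_)), fun L L' => ?_⟩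
      · rintro e ⟨⟩; exact hi
      · have h' : ¬ (P.HBelow J (.inr i) j ↔ P.HBelow J' (.inr i) j) := fun e => h (ind_congr e)
        have hy' : y.symm (.inr i) = .inr j := by rw [← hy, Equiv.symm_apply_apply]
        simp only [dotBefore, vl, hy']
        exact ind_congr ((P.vLeft_iff_of_hBelow_ne h' L).trans (P.vLeft_iff_of_hBelow_ne h' L').symm)
  · simp only [dotBefore, vl] at h
    rcases hy : y.symm (.inr i) with r | j
    · exact absurd (ind_congr (P.vLeft_congr i (by simp [hy, VLine.roc]))) h
    · rw [hy] at h
      refine ⟨.inl j, fun hi => h (ind_congr (P.vLeft_congr i ?_)), fun L L' => ?_⟩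
      · rintro e ⟨⟩; exact hi
      · have h' : ¬ (P.VLeft J (.inr j) i ↔ P.VLeft J' (.inr j) i) := fun e => h (ind_congr e)
        have hy' : y (.inr j) = .inr i := by rw [← hy, Equiv.apply_symm_apply]
        simp only [dotBefore, hb, hy']
        exact ind_congr ((P.hBelow_iff_of_vLeft_ne h' L).trans (P.hBelow_iff_of_vLeft_ne h' L').symm)

theorem nontrivial_vLine (v : G.VLine) : Nontrivial G.VLine := by
  obtain ⟨⟨q, hq⟩, -, -⟩ := existsUnique_resolvedCol (fun _ => 0) .O v
  obtain ⟨⟨q', hq'⟩, h, -⟩ :=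
    existsUnique_resolvedRow (fun _ => 0) .X (G.resolvedRow (fun _ => 0) q)
  have h1 := idx_resolvedRow (fun _ => 0) q
  have h2 := idx_resolvedRow (fun _ => 0) q'
  dsimp only at h
  rw [h, h1] at h2
  refine ⟨.inl q.1, .inl q'.1, fun e => ?_⟩
  rw [Sum.inl.inj e, Fin.ext h2, hq'] at hq
  cases hq

namespace Rect

theorem dotsBeyond_sub {ρ : G.Rect} (hne : ρ.west ≠ ρ.east) (I : G.Resolution)
    (q : Fin G.cols × Fin G.rows) :
    dotsBeyond I ρ.start q - dotsBeyond I ρ.finish q =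
      (ind (IsLeft I q ρ.west) - ind (IsLeft I q ρ.east)) *
      (ind (IsBelow I q (ρ.start ρ.west)) - ind (IsBelow I q (ρ.start ρ.east))) := by
  unfold dotsBeyond
  rw [← Finset.sum_sub_distrib, Fintype.sum_eq_add _ _ hne]
  · simp only [finish, Equiv.trans_apply, Equiv.swap_apply_left, Equiv.swap_apply_right]
    ring
  · rintro v ⟨hw, he⟩
    simp only [finish, Equiv.trans_apply, Equiv.swap_apply_of_ne_of_ne hw he, sub_self]

theorem cyc_eq_ind_isLeft (I : G.Resolution) (q : Fin G.cols × Fin G.rows) (v w : G.VLine) :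
    cyc v.key w.key (G.resolvedCol I q).key =
      ind (IsLeft I q w) - ind (IsLeft I q v) + ind (w.key < v.key) := by
  have key : ∀ v : G.VLine, ind (v.key ≤ (G.resolvedCol I q).key) = 1 - ind (IsLeft I q v) := by
    intro v
    by_cases h : IsLeft I q v
    · rw [ind_true h, ind_false (not_le.2 h), sub_self]
    · rw [ind_false h, ind_true (not_lt.1 h), sub_zero]
  rw [cyc, key, key]; ring

theorem cyc_eq_ind_isBelow (I : G.Resolution) (q : Fin G.cols × Fin G.rows) (v w : G.HLine) :
    cyc v.key w.key (G.resolvedRow I q).key =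
      ind (IsBelow I q w) - ind (IsBelow I q v) + ind (w.key < v.key) := by
  have key : ∀ v : G.HLine, ind (v.key ≤ (G.resolvedRow I q).key) = 1 - ind (IsBelow I q v) := by
    intro v
    by_cases h : IsBelow I q v
    · rw [ind_true h, ind_false (not_le.2 h), sub_self]
    · rw [ind_false h, ind_true (not_lt.1 h), sub_zero]
  rw [cyc, key, key]; ring

/-- The multiplicity of a rectangle at a decoration of `G_{0⋯0}`. -/
theorem dom_resolved {ρ : G.Rect} (hne : ρ.west ≠ ρ.east) (q : Fin G.cols × Fin G.rows) :
    ρ.dom (G.resolvedCol (fun _ => 0) q).key (G.resolvedRow (fun _ => 0) q).key =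
      ρ.cutTerm q + dotsBeyond (fun _ => 0) ρ.start q - dotsBeyond (fun _ => 0) ρ.finish q := by
  have := dotsBeyond_sub hne (fun _ => 0) q
  rw [dom, cyc_eq_ind_isLeft, cyc_eq_ind_isBelow, cutTerm]
  linear_combination -this

end Rect

/-- The signed number of passages of the winding arcs of a RoC across the cut of the torus, on the
boundary of a domain with given multiplicities. -/
def cutCount (D : ℕ → ℕ → ℤ) : G.SingRoC → ℤ
  | .inl j => D (2 * j.1 + 1) (2 * G.rows) - D (2 * j.1) (2 * G.rows)
  | .inr i => D (2 * G.cols) (2 * i.1 + 1) - D (2 * G.cols) (2 * i.1)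

theorem cutCount_add (D D' : ℕ → ℕ → ℤ) (e : G.SingRoC) :
    cutCount (fun k l => D k l + D' k l) e = cutCount D e + cutCount D' e := by
  rcases e with j | i <;> simp only [cutCount] <;> ring

theorem ind_le_succ_sub (a k : ℕ) : ind (a ≤ k + 1) - ind (a ≤ k) = ind (a = k + 1) := by
  rcases lt_trichotomy a (k + 1) with h | h | h
  · rw [ind_true (by omega), ind_true (by omega), ind_false (by omega)]; rfl
  · rw [ind_true (by omega), ind_false (by omega), ind_true (by omega)]; rfl
  · rw [ind_false (by omega), ind_false (by omega), ind_false (by omega)]; rfl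

theorem cyc_succ_sub (a b k : ℕ) :
    cyc a b (k + 1) - cyc a b k = ind (a = k + 1) - ind (b = k + 1) := by
  unfold cyc
  have h1 := ind_le_succ_sub a k
  have h2 := ind_le_succ_sub b k
  linear_combination h1 - h2

theorem VLine.key_lt (v : G.VLine) : v.key < 2 * G.cols := by
  have := v.idx_lt
  rw [v.idx_eq] at this
  omega

theorem HLine.key_lt (v : G.HLine) : v.key < 2 * G.rows := by
  have := v.idx_lt
  rw [v.idx_eq] at this
  omega

theorem cyc_of_le {a b k : ℕ} (ha : a ≤ k) (hb : b ≤ k) : cyc a b k = ind (b < a) := by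
  rw [cyc, ind_true ha, ind_true hb, sub_self, zero_add]

theorem Rect.cutNumber_eq (ρ : G.Rect) (e : G.SingRoC) : ρ.cutNumber e = cutCount ρ.dom e := by
  rcases e with j | i
  · simp only [cutCount, dom, cutNumber]
    have h1 : ∀ v : G.VLine, v = .inr j ↔ v.key = 2 * j.1 + 1 := fun v =>
      ⟨fun h => by rw [h]; rfl, fun h => VLine.key_injective h⟩
    rw [← sub_mul, cyc_succ_sub, cyc_of_le (HLine.key_lt _).le (HLine.key_lt _).le,
      ind_congr (h1 _), ind_congr (h1 _)]
    ring
  · simp only [cutCount, dom, cutNumber]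
    have h1 : ∀ v : G.HLine, v = .inr i ↔ v.key = 2 * i.1 + 1 := fun v =>
      ⟨fun h => by rw [h]; rfl, fun h => HLine.key_injective h⟩
    rw [← mul_sub, cyc_succ_sub, cyc_of_le (VLine.key_lt _).le (VLine.key_lt _).le,
      ind_congr (h1 _), ind_congr (h1 _)]

open Classical in
/-- The coefficient of the square of the differential due to pairs of polygons from `x` to `z` whose
rectangles compose to a domain with multiplicities `D` ending in `w`, apart from signs. -/
def composite (P : Peaks A) (C : G.CompassConvention) (x z : G.Gen) (w : G.Perm)
    (D : ℕ → ℕ → ℤ) : FractionRing G.Coeff :=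
  if w = z.2 then
    laurent (fun o => P.potential x o.1) / laurent (fun o => P.potential z o.1) *
    laurent (fun o => D (G.resolvedCol (fun _ => 0) o.1).key (G.resolvedRow (fun _ => 0) o.1).key -
      dotsBeyond (fun _ => 0) x.2 o.1 + dotsBeyond (fun _ => 0) w o.1) *
    ∏ e, transfer (C.sign e : FractionRing G.Coeff) (ratio e)
      (cutCount D e + (P.dotBefore x e - P.dotBefore z e)) (x.1 e) (z.1 e)
  else 0

/-- Summing over the resolutions of the intermediate generator. -/
theorem sum_coefficient_mul_coefficient (P : Peaks A) (C : G.CompassConvention)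
    (ε : G.SignAssignment) (x z : G.Gen) (a b c d : G.VLine) :
    ∑ J : G.Resolution, algebraMap G.Coeff (FractionRing G.Coeff)
      (Quad.coefficient P C ε ⟨x, (J, (⟨x.2, a, b⟩ : G.Rect).finish), a, b⟩ *
        Quad.coefficient P C ε ⟨(J, (⟨x.2, a, b⟩ : G.Rect).finish), z, c, d⟩) =
      juxtaposition ε (composite P C x z) x.2 a b c d := by
  classical
  set ρ : G.Rect := ⟨x.2, a, b⟩ with hρ
  by_cases h : ρ.IsEmpty ∧ (second x.2 a b c d).IsEmpty ∧ (second x.2 a b c d).finish = z.2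
  · obtain ⟨h1, h2, h3⟩ := h
    rw [juxtaposition, if_pos ⟨h1, h2⟩, composite, if_pos h3]
    have key : ∀ J : G.Resolution, algebraMap G.Coeff (FractionRing G.Coeff)
        (Quad.coefficient P C ε ⟨x, (J, ρ.finish), a, b⟩ *
          Quad.coefficient P C ε ⟨(J, ρ.finish), z, c, d⟩) =
        (((ε.sign ρ * ε.sign (second x.2 a b c d) : ℤˣ) : ℤ) : FractionRing G.Coeff) *
        (laurent (fun o => P.potential x o.1) / laurent (fun o => P.potential z o.1) *
        laurent (fun o => ρ.cutTerm o.1 + (second x.2 a b c d).cutTerm o.1)) *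
        ∏ e, (transfer (C.sign e : FractionRing G.Coeff) (ratio e)
          (ρ.cutNumber e + P.dotBefore x e - P.dotBefore (J, ρ.finish) e) (x.1 e) (J e) *
          transfer (C.sign e : FractionRing G.Coeff) (ratio e)
          ((second x.2 a b c d).cutNumber e + P.dotBefore (J, ρ.finish) e - P.dotBefore z e)
            (J e) (z.1 e)) := by
      intro J
      rw [map_mul, Quad.algebraMap_coefficient, Quad.algebraMap_coefficient, Finset.prod_mul_distrib,
        laurent_add]
      · have hl := laurent_ne_zero fun o : G.Decor .O => P.potential (J, ρ.finish) o.1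
        have hl' := laurent_ne_zero fun o : G.Decor .O => P.potential z o.1
        simp only [Quad.toRect, Quad.turn, Units.val_mul, Int.cast_mul, second, ← hρ]
        generalize laurent (fun o : G.Decor .O => P.potential (J, ρ.finish) o.1) = X at *
        field_simp
      · exact h3.symm
      · exact h2
      · rfl
      · exact h1
    simp only [key]
    rw [← Finset.mul_sum, mul_assoc]
    congr 1
    congr 1
    · congr 1
      congr 1
      funext o
      rw [Rect.dom_resolved h1.1, Rect.dom_resolved h2.1]
      have : (second x.2 a b c d).start = ρ.finish := rfl
      rw [this]
      ring
    · -- The turns of the two polygons depend on the resolution `J` through the position `l` of the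
      -- intermediate dots, which cancels in the sum of the turns.
      have := sum_prod_of_triangular (ι := G.SingRoC) (β := Fin 2)
        (f := fun e (l : ℤ) d' => transfer (C.sign e : FractionRing G.Coeff) (ratio e)
          (ρ.cutNumber e + P.dotBefore x e - l) (x.1 e) d' *
          transfer (C.sign e : FractionRing G.Coeff) (ratio e)
          ((second x.2 a b c d).cutNumber e + l - P.dotBefore z e) d' (z.1 e))
        (g := fun e => transfer (C.sign e : FractionRing G.Coeff) (ratio e)
          (ρ.cutNumber e + (second x.2 a b c d).cutNumber e + (P.dotBefore x e - P.dotBefore z e))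
            (x.1 e) (z.1 e))
        (by
          intro e l
          rw [sum_transfer_mul_transfer (ratio_ne_zero e)]
          congr 1
          ring)
        (l := fun J e => P.dotBefore (J, ρ.finish) e)
        (fun e => ∃ J J', P.dotBefore (J, ρ.finish) e ≠ P.dotBefore (J', ρ.finish) e)
        (by
          intro e he J J'
          by_contra h
          exact he ⟨J, J', h⟩)
        (by
          intro e _ J J' hJ
          by_contra h
          obtain ⟨e', h1, h2⟩ := P.exists_of_dotBefore_ne h
          exact h1 (hJ e' fun ⟨L, L', hL⟩ => hL (h2 L L')))
      rw [this]
      refine Finset.prod_congr rfl fun e _ => ?_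
      rw [cutCount_add, Rect.cutNumber_eq, Rect.cutNumber_eq]
  · have h0 : ∀ J : G.Resolution, Quad.coefficient P C ε ⟨x, (J, ρ.finish), a, b⟩ *
        Quad.coefficient P C ε ⟨(J, ρ.finish), z, c, d⟩ = 0 := by
      intro J
      by_cases h1 : ρ.IsEmpty
      · rw [Quad.coefficient_eq_zero (π := ⟨(J, ρ.finish), z, c, d⟩), mul_zero]
        rintro ⟨h2, h3⟩
        exact h ⟨h1, h3, h2.symm⟩
      · rw [Quad.coefficient_eq_zero (π := ⟨x, (J, ρ.finish), a, b⟩), zero_mul]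
        rintro ⟨-, h2⟩
        exact h1 h2
    simp only [h0, map_zero, Finset.sum_const_zero]
    unfold juxtaposition composite
    split_ifs with h1 h2
    · exact absurd ⟨h1.1, h1.2, h2⟩ h
    · rw [mul_zero]
    · rfl

/-- Between different resolutions of the same generator, some RoC flips while its dot remains on the
same side of its peak. -/
theorem exists_flip {P : Peaks A} {x z : G.Gen} (hxz : x.2 = z.2) (h : x.1 ≠ z.1) :
    ∃ e, x.1 e = 1 ∧ z.1 e = 0 ∨
      x.1 e = 0 ∧ z.1 e = 1 ∧ P.dotBefore x e - P.dotBefore z e = 0 := by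
  obtain ⟨I, x⟩ := x
  obtain ⟨J, z⟩ := z
  obtain rfl : x = z := hxz
  have key : ∀ e, I e ≠ J e → P.dotBefore (I, x) e - P.dotBefore (J, x) e = 0 →
      ∃ e, I e = 1 ∧ J e = 0 ∨
        I e = 0 ∧ J e = 1 ∧ P.dotBefore (I, x) e - P.dotBefore (J, x) e = 0 := by
    intro e he h0
    refine ⟨e, ?_⟩
    simp only [h0, and_true]
    omega
  obtain ⟨e, he⟩ := Function.ne_iff.1 h
  by_cases h0 : P.dotBefore (I, x) e = P.dotBefore (J, x) e
  · exact key e he (sub_eq_zero.2 h0)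
  · obtain ⟨e', h1, h2⟩ := P.exists_of_dotBefore_ne h0
    exact key e' h1 (sub_eq_zero.2 (h2 _ _))

/-- The thin vertical annuli contribute the sum of the variables to the diagonal, apart from signs. -/
theorem sum_composite_vertical (P : Peaks A) (C : G.CompassConvention) {x z : G.Gen}
    (hxz : x.2 = z.2) (h : Nontrivial G.VLine) :
    ∑ a : G.VLine, ∑ b : G.VLine, (if a ≠ b then
      ((ind (∀ v : G.VLine, ¬ CycBetween a.key v.key b.key) : ℤ) : FractionRing G.Coeff) *
        composite P C x z x.2 (fun k _ => cyc a.key b.key k) else 0) =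
      laurent (fun o => P.potential x o.1) / laurent (fun o => P.potential z o.1) *
        if x.1 = z.1 then
          ∑ o : G.Decor .O, algebraMap G.Coeff (FractionRing G.Coeff) (MvPolynomial.X o) else 0 := by
  classical
  let n : G.VLine → G.SingRoC → ℤ := fun v e => match e with
    | .inl j => ind (v = .inr j) - ind (v = .inl j.1)
    | .inr _ => 0
  have key := sum_transfer (W := colVar (G := G)) (c := fun e => (C.sign e : FractionRing G.Coeff))
    (H := ratio) (emb := (Sum.inl : G.SingCol → G.SingRoC)) (n := n)
    (δ := fun e => P.dotBefore x e - P.dotBefore z e) (I := x.1) (J := z.1)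
    (fun _ => laurent_ne_zero _) ratio_inl (fun _ => ratio_ne_one _) (fun _ _ => rfl)
    (by
      rintro v (j | i) he
      · exact absurd rfl (he j)
      · rfl)
    (fun hI e => by rw [Prod.ext hI hxz, sub_self]) (exists_flip hxz)
  rw [sum_sum_annuli (key := VLine.key) VLine.key_injective h
    (f := fun a => laurent (fun o => P.potential x o.1) / laurent (fun o => P.potential z o.1) *
      (colVar a * ∏ e, transfer (C.sign e : FractionRing G.Coeff) (ratio e)
        (n a e + (P.dotBefore x e - P.dotBefore z e)) (x.1 e) (z.1 e))), ← Finset.mul_sum, key,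
    sum_colVar]
  intro a b hab
  rw [composite, if_pos hxz, mul_assoc]
  congr 1
  congr 1
  · unfold colVar
    congr 1
    funext o
    rw [hab, sub_add_cancel]
  · refine Finset.prod_congr rfl fun e _ => ?_
    congr 2
    rcases e with j | i
    · have h1 := hab (.inr j)
      have h2 := hab (.inl j.1)
      simp only [VLine.key_inr, VLine.key_inl] at h1 h2
      simp only [cutCount, n]
      rw [h1, h2, ind_congr eq_comm, ind_congr (eq_comm (b := a))]
    · simp [cutCount, n]

/-- The thin horizontal annuli contribute the sum of the variables to the diagonal, apart from
signs. -/
theorem sum_composite_horizontal (P : Peaks A) (C : G.CompassConvention) {x z : G.Gen}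
    (hxz : x.2 = z.2) (h : Nontrivial G.HLine) :
    ∑ a : G.HLine, ∑ b : G.HLine, (if a ≠ b then
      ((ind (∀ v : G.HLine, ¬ CycBetween a.key v.key b.key) : ℤ) : FractionRing G.Coeff) *
        composite P C x z x.2 (fun _ l => cyc a.key b.key l) else 0) =
      laurent (fun o => P.potential x o.1) / laurent (fun o => P.potential z o.1) *
        if x.1 = z.1 then
          ∑ o : G.Decor .O, algebraMap G.Coeff (FractionRing G.Coeff) (MvPolynomial.X o) else 0 := by
  classical
  let n : G.HLine → G.SingRoC → ℤ := fun v e => match e with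
    | .inl _ => 0
    | .inr j => ind (v = .inr j) - ind (v = .inl j.1)
  have key := sum_transfer (W := rowVar (G := G)) (c := fun e => (C.sign e : FractionRing G.Coeff))
    (H := ratio) (emb := (Sum.inr : G.SingRow → G.SingRoC)) (n := n)
    (δ := fun e => P.dotBefore x e - P.dotBefore z e) (I := x.1) (J := z.1)
    (fun _ => laurent_ne_zero _) ratio_inr (fun _ => ratio_ne_one _) (fun _ _ => rfl)
    (by
      rintro v (j | i) he
      · rfl
      · exact absurd rfl (he i))
    (fun hI e => by rw [Prod.ext hI hxz, sub_self]) (exists_flip hxz)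
  rw [sum_sum_annuli (key := HLine.key) HLine.key_injective h
    (f := fun a => laurent (fun o => P.potential x o.1) / laurent (fun o => P.potential z o.1) *
      (rowVar a * ∏ e, transfer (C.sign e : FractionRing G.Coeff) (ratio e)
        (n a e + (P.dotBefore x e - P.dotBefore z e)) (x.1 e) (z.1 e))), ← Finset.mul_sum, key,
    sum_rowVar]
  intro a b hab
  rw [composite, if_pos hxz, mul_assoc]
  congr 1
  congr 1
  · unfold rowVar
    congr 1
    funext o
    rw [hab, sub_add_cancel]
  · refine Finset.prod_congr rfl fun e _ => ?_
    congr 2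
    rcases e with j | i
    · simp [cutCount, n]
    · have h1 := hab (.inr i)
      have h2 := hab (.inl i.1)
      simp only [HLine.key_inr, HLine.key_inl] at h1 h2
      simp only [cutCount, n]
      rw [h1, h2, ind_congr eq_comm, ind_congr (eq_comm (b := a))]

instance : CharZero (FractionRing G.Coeff) :=
  charZero_of_injective_algebraMap (FaithfulSMul.algebraMap_injective G.Coeff _)

/-- The coefficients of the square of the differential vanish: the thin vertical annuli cancel the thin
horizontal ones, and all other pairs of rectangles cancel on the regular grid. -/
theorem sum_coefficient_eq_zero (P : Peaks A) (C : G.CompassConvention) (ε : G.SignAssignment)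
    (x z : G.Gen) : ∑ y : G.Gen, ∑ p : G.VLine × G.VLine, ∑ q : G.VLine × G.VLine,
      Quad.coefficient P C ε ⟨x, y, p.1, p.2⟩ * Quad.coefficient P C ε ⟨y, z, q.1, q.2⟩ = 0 := by
  classical
  have e1 : ∀ (J : G.Resolution) (p q : G.VLine × G.VLine), ∑ y : G.Perm,
      Quad.coefficient P C ε ⟨x, (J, y), p.1, p.2⟩ * Quad.coefficient P C ε ⟨(J, y), z, q.1, q.2⟩ =
      Quad.coefficient P C ε ⟨x, (J, (⟨x.2, p.1, p.2⟩ : G.Rect).finish), p.1, p.2⟩ *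
        Quad.coefficient P C ε ⟨(J, (⟨x.2, p.1, p.2⟩ : G.Rect).finish), z, q.1, q.2⟩ := by
    intro J p q
    refine Finset.sum_eq_single _ (fun y _ hy => ?_) (by simp)
    rw [Quad.coefficient_eq_zero (π := ⟨x, (J, y), p.1, p.2⟩) fun h => hy h.1, zero_mul]
  have e2 : ∑ y : G.Gen, ∑ p : G.VLine × G.VLine, ∑ q : G.VLine × G.VLine,
      Quad.coefficient P C ε ⟨x, y, p.1, p.2⟩ * Quad.coefficient P C ε ⟨y, z, q.1, q.2⟩ =
      ∑ p : G.VLine × G.VLine, ∑ q : G.VLine × G.VLine, ∑ J : G.Resolution,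
      Quad.coefficient P C ε ⟨x, (J, (⟨x.2, p.1, p.2⟩ : G.Rect).finish), p.1, p.2⟩ *
        Quad.coefficient P C ε ⟨(J, (⟨x.2, p.1, p.2⟩ : G.Rect).finish), z, q.1, q.2⟩ := by
    rw [Finset.sum_comm]
    refine Finset.sum_congr rfl fun p _ => ?_
    rw [Finset.sum_comm]
    refine Finset.sum_congr rfl fun q _ => ?_
    rw [Fintype.sum_prod_type]
    exact Finset.sum_congr rfl fun J _ => e1 J p q
  rw [e2]
  -- The transfer matrices have entries in the field of fractions.
  apply FaithfulSMul.algebraMap_injective G.Coeff (FractionRing G.Coeff)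
  rw [map_zero]
  simp only [map_sum, sum_coefficient_mul_coefficient, Fintype.sum_prod_type]
  rw [sum_juxtaposition]
  by_cases hxz : x.2 = z.2
  swap
  · simp [composite, hxz]
  rcases isEmpty_or_nonempty G.VLine with hV | ⟨⟨v⟩⟩
  · simp
  have hV := nontrivial_vLine v
  have hH : Nontrivial G.HLine := x.2.symm.nontrivial
  rw [sum_composite_vertical P C hxz hV, ← sum_composite_horizontal P C hxz hH, sub_eq_zero]
  rw [← x.2.sum_comp]
  refine Finset.sum_congr rfl fun a _ => ?_
  rw [← x.2.sum_comp]
  refine Finset.sum_congr rfl fun b _ => ?_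
  simp only [Ne, x.2.injective.eq_iff]

theorem differential_gen (P : Peaks A) (C : G.CompassConvention) (ε : G.SignAssignment) (x : G.Gen) :
    differential P C ε (G.gen x) =
      ∑ y : G.Gen, (∑ p : G.VLine × G.VLine, Quad.coefficient P C ε ⟨x, y, p.1, p.2⟩) • G.gen y := by
  classical
  unfold differential gen
  rw [DirectSum.toModule_lof, Finsupp.linearCombination_single, one_smul]
  unfold differentialGen polygons
  refine Finset.sum_congr rfl fun y _ => ?_
  rw [Finset.sum_filter, Finset.sum_smul]
  refine Finset.sum_congr rfl fun p _ => ?_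
  unfold Quad.coefficient
  rw [ite_smul, zero_smul]
  rfl

theorem ext_gen {M : Type*} [AddCommGroup M] [Module G.Coeff M] {f g : G.CV →ₗ[G.Coeff] M}
    (h : ∀ x, f (G.gen x) = g (G.gen x)) : f = g := by
  refine DirectSum.linearMap_ext _ fun I => Finsupp.lhom_ext' fun x => LinearMap.ext_ring ?_
  exact h (I, x)

theorem differential_comp_differential (P : Peaks A) (C : G.CompassConvention)
    (ε : G.SignAssignment) : differential P C ε ∘ₗ differential P C ε = 0 := by
  refine ext_gen (M := G.CV) fun x => ?_
  rw [LinearMap.comp_apply, differential_gen, map_sum, LinearMap.zero_apply]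
  simp only [map_smul, differential_gen, Finset.smul_sum, smul_smul]
  rw [Finset.sum_comm]
  refine Finset.sum_eq_zero fun z _ => ?_
  rw [← Finset.sum_smul]
  have := sum_coefficient_eq_zero P C ε x z
  simp only [← Finset.mul_sum, ← Finset.sum_mul] at this
  rw [this, zero_smul]

end SingularGrid

/-! ### Integral formulas for the gradings -/

namespace SingularGrid

variable {G : SingularGrid} {A : G.WindingArcs}

theorem pairing_image {ι κ : Type*} [Fintype ι] [Fintype κ] {f : ι → ℚ × ℚ} {g : κ → ℚ × ℚ}
    (hf : Function.Injective f) (hg : Function.Injective g) :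
    pairing (Finset.univ.image f) (Finset.univ.image g) =
      ((∑ i, ∑ j, ind (0 < ((g j).1 - (f i).1) * ((g j).2 - (f i).2)) : ℤ) : ℚ) / 2 := by
  classical
  unfold pairing
  rw [Finset.card_filter, Finset.sum_product, Finset.sum_image fun _ _ _ _ h => hf h]
  simp only [Finset.sum_image fun _ _ _ _ h => hg h, ind_eq_ite]
  push_cast
  rfl

theorem sum_sum_ind_pos {ι : Type*} [Fintype ι] (α β : ι → ℕ) (c : ℚ) :
    ∑ i, ∑ j, ind (0 < ((α j + c) - (α i + c)) * ((β j + c) - (β i + c))) =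
      2 * ∑ i, ∑ j, ind (α i < α j) * ind (β i < β j) := by
  have key : ∀ i j, ind (0 < ((α j + c) - (α i + c)) * ((β j + c) - (β i + c))) =
      ind (α i < α j) * ind (β i < β j) + ind (α j < α i) * ind (β j < β i) := by
    intro i j
    rw [add_sub_add_right_eq_sub, add_sub_add_right_eq_sub, ind_congr mul_pos_iff]
    simp only [sub_pos, sub_neg, Nat.cast_lt]
    by_cases h1 : α i < α j <;> by_cases h2 : β i < β j <;> by_cases h3 : α j < α i <;>
      by_cases h4 : β j < β i <;> first | omega | simp [h1, h2, h3, h4]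
  simp only [key, Finset.sum_add_distrib]
  rw [Finset.sum_comm (f := fun i j => ind (α j < α i) * ind (β j < β i))]
  ring

/-- The number of pairs of dots in south-west/north-east position. -/
def ascents (x : G.Perm) : ℤ := ∑ v, ∑ w, ind (v.key < w.key) * ind ((x v).key < (x w).key)

/-- The decorations of a given kind correspond to the columns of `G_I`. -/
def colEquiv (I : G.Resolution) (k : Mark) : G.Decor k ≃ G.VLine :=
  Equiv.ofBijective (fun q => G.resolvedCol I q.1)
    (Function.bijective_iff_existsUnique _ |>.2 (existsUnique_resolvedCol I k))

/-- The decorations of a given kind correspond to the rows of `G_I`. -/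
def rowEquiv (I : G.Resolution) (k : Mark) : G.Decor k ≃ G.HLine :=
  Equiv.ofBijective (fun q => G.resolvedRow I q.1)
    (Function.bijective_iff_existsUnique _ |>.2 (existsUnique_resolvedRow I k))

/-- The decorations of a given kind in `G_I`, as a correspondence between columns and rows. -/
def decoPerm (I : G.Resolution) (k : Mark) : G.Perm := (colEquiv I k).symm.trans (rowEquiv I k)

theorem ascents_decoPerm (I : G.Resolution) (k : Mark) :
    ascents (decoPerm I k) = ∑ q : G.Decor k, ∑ q' : G.Decor k,
      ind ((G.resolvedCol I q.1).key < (G.resolvedCol I q'.1).key) *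
        ind ((G.resolvedRow I q.1).key < (G.resolvedRow I q'.1).key) := by
  unfold ascents
  rw [← (colEquiv I k).sum_comp]
  refine Finset.sum_congr rfl fun q _ => ?_
  rw [← (colEquiv I k).sum_comp]
  refine Finset.sum_congr rfl fun q' _ => ?_
  simp [decoPerm, colEquiv, rowEquiv]

variable (G) in
/-- Part of the Maslov grading which does not depend on the generator. -/
def maslovConst : ℤ :=
  1 - ∑ v : G.VLine, ∑ w : G.VLine, (1 - ind (w.key < v.key)) +
    ∑ h : G.HLine, ∑ h' : G.HLine, ind (h'.key < h.key)

/-- The integer `M_k(x)` in the grid `G_I`, where `k` is one of the two kinds of decorations. -/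
def markMaslov (k : Mark) (x : G.Gen) : ℤ :=
  ascents x.2 + ascents (decoPerm x.1 k) - 2 * ∑ q : G.Decor k, dotsBeyond x.1 x.2 q.1 +
    maslovConst G

theorem relMaslov_eq (k : Mark) (x : G.Gen) :
    relMaslov (G.dotPoints x.2) (G.decorPoints x.1 k) = (markMaslov k x : ℚ) := by
  obtain ⟨I, x⟩ := x
  have h1 : Function.Injective fun v : G.VLine => ((v.key : ℚ), ((x v).key : ℚ)) := by
    intro v w h
    exact VLine.key_injective (Nat.cast_injective (R := ℚ) (congrArg Prod.fst h))
  have h2 : Function.Injective fun q : G.Decor k => (((G.resolvedCol I q.1).key : ℚ) + 1 / 2,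
      ((G.resolvedRow I q.1).key : ℚ) + 1 / 2) := by
    intro v w h
    have := VLine.key_injective (Nat.cast_injective (R := ℚ) (add_right_cancel (congrArg Prod.fst h)))
    exact (colEquiv I k).injective this
  have e1 := sum_sum_ind_pos (fun v : G.VLine => v.key) (fun v => (x v).key) 0
  simp only [add_zero] at e1
  have e2 := sum_sum_ind_pos (fun q : G.Decor k => (G.resolvedCol I q.1).key)
    (fun q => (G.resolvedRow I q.1).key) (1 / 2)
  have key : ∀ (v : G.VLine) (q : G.Decor k),
      ind (0 < ((G.resolvedCol I q.1).key + 1 / 2 - (v.key : ℚ)) *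
        ((G.resolvedRow I q.1).key + 1 / 2 - ((x v).key : ℚ))) =
      2 * (ind (IsLeft I q.1 v) * ind (IsBelow I q.1 (x v))) +
        (1 - ind (IsLeft I q.1 v)) - ind (IsBelow I q.1 (x v)) := by
    intro v q
    have hlt : ∀ a b : ℕ, (0 < (a : ℚ) + 1 / 2 - b ↔ ¬ a < b) ∧ ((a : ℚ) + 1 / 2 - b < 0 ↔ a < b) := by
      intro a b
      rcases Nat.lt_or_ge a b with h | h
      · have : (a : ℚ) + 1 ≤ b := by exact_mod_cast h
        exact ⟨⟨fun _ => by linarith, fun h' => absurd h h'⟩, fun _ => h, fun _ => by linarith⟩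
      · have : (b : ℚ) ≤ a := by exact_mod_cast h
        exact ⟨⟨fun _ => by omega, fun _ => by linarith⟩, fun _ => by linarith, fun h' => by omega⟩
    rw [ind_congr mul_pos_iff]
    simp only [(hlt _ _).1, (hlt _ _).2]
    change ind ((¬ IsLeft I q.1 v ∧ ¬ IsBelow I q.1 (x v)) ∨ (IsLeft I q.1 v ∧ IsBelow I q.1 (x v))) = _
    by_cases h1 : IsLeft I q.1 v <;> by_cases h2 : IsBelow I q.1 (x v) <;> simp [h1, h2]
  have e3 : ∑ v : G.VLine, ∑ q : G.Decor k,
      ind (0 < ((G.resolvedCol I q.1).key + 1 / 2 - (v.key : ℚ)) *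
        ((G.resolvedRow I q.1).key + 1 / 2 - ((x v).key : ℚ))) =
      2 * ∑ q : G.Decor k, dotsBeyond I x q.1 + (1 - maslovConst G) := by
    simp only [key, Finset.sum_add_distrib, Finset.sum_sub_distrib, ← Finset.mul_sum]
    have e4 : ∑ v : G.VLine, ∑ q : G.Decor k, ind (IsLeft I q.1 v) =
        ∑ v : G.VLine, ∑ w : G.VLine, ind (w.key < v.key) :=
      Finset.sum_congr rfl fun v _ =>
        (colEquiv I k).sum_comp (fun w => ind (w.key < v.key))
    have e5 : ∑ v : G.VLine, ∑ q : G.Decor k, ind (IsBelow I q.1 (x v)) =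
        ∑ v : G.HLine, ∑ w : G.HLine, ind (w.key < v.key) := by
      rw [← x.sum_comp]
      exact Finset.sum_congr rfl fun v _ =>
        (rowEquiv I k).sum_comp (fun w => ind (w.key < (x v).key))
    have e6 : ∑ v : G.VLine, ∑ q : G.Decor k, (1 : ℤ) = ∑ v : G.VLine, ∑ w : G.VLine, 1 :=
      Finset.sum_congr rfl fun v _ => (colEquiv I k).sum_comp (fun _ => (1 : ℤ))
    rw [e4, e5, e6, Finset.sum_comm (γ := G.VLine), maslovConst]
    simp only [dotsBeyond, Finset.sum_sub_distrib]
    ring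
  unfold relMaslov dotPoints decorPoints
  rw [pairing_image h1 h1, pairing_image h1 h2, pairing_image h2 h2]
  dsimp only
  rw [e1, e2, e3, markMaslov, ascents_decoPerm]
  unfold ascents
  push_cast
  ring

/-- Change of the number of ascents in a transposition of two columns. -/
theorem ascents_sub {ρ : G.Rect} (hne : ρ.west ≠ ρ.east) :
    ascents ρ.start - ascents ρ.finish =
      (1 - 2 * ind (ρ.east.key < ρ.west.key)) *
        (1 - 2 * ind ((ρ.start ρ.east).key < (ρ.start ρ.west).key)) +
      2 * ∑ f, if ρ.west ≠ ρ.east ∧ ρ.east ≠ f ∧ ρ.west ≠ f then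
        (ind (ρ.west.key < f.key) - ind (ρ.east.key < f.key)) *
        (ind ((ρ.start ρ.west).key < (ρ.start f).key) -
          ind ((ρ.start ρ.east).key < (ρ.start f).key)) else 0 := by
  classical
  obtain ⟨x, w, e⟩ := ρ
  dsimp only at hne ⊢
  have e1 : ascents (⟨x, w, e⟩ : G.Rect).finish = ∑ u, ∑ v,
      ind ((Equiv.swap w e u).key < (Equiv.swap w e v).key) * ind ((x u).key < (x v).key) := by
    unfold ascents
    rw [← Equiv.sum_comp (Equiv.swap w e)]
    refine Finset.sum_congr rfl fun u _ => ?_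
    rw [← Equiv.sum_comp (Equiv.swap w e)]
    simp [Rect.finish]
  rw [e1, ascents]
  simp only [← Finset.sum_sub_distrib, ← sub_mul]
  rw [sum_sum_split hne _ fun c => by simp]
  have hflip : ∀ {a b : ℕ}, a ≠ b → ind (a < b) = 1 - ind (b < a) := by
    intro a b h
    rcases lt_or_gt_of_ne h with h | h
    · rw [ind_true h, ind_false (by omega), sub_zero]
    · rw [ind_false (by omega), ind_true h, sub_self]
  have hfour : ∑ c, ∑ d, (if w ≠ c ∧ w ≠ d ∧ e ≠ c ∧ e ≠ d then
      (ind (c.key < d.key) - ind ((Equiv.swap w e c).key < (Equiv.swap w e d).key)) *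
        ind ((x c).key < (x d).key) else 0) = 0 := by
    refine Finset.sum_eq_zero fun c _ => Finset.sum_eq_zero fun d _ => ?_
    split_ifs with h
    · rw [Equiv.swap_apply_of_ne_of_ne h.1.symm h.2.2.1.symm,
        Equiv.swap_apply_of_ne_of_ne h.2.1.symm h.2.2.2.symm, sub_self, zero_mul]
    · rfl
  rw [hfour, add_zero, Finset.mul_sum]
  congr 1
  · rw [Equiv.swap_apply_left, Equiv.swap_apply_right, hflip (VLine.key_ne hne),
      hflip (key_apply_ne x hne)]
    ring
  · refine Finset.sum_congr rfl fun f _ => ?_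
    split_ifs with h
    · rw [Equiv.swap_apply_left, Equiv.swap_apply_right,
        Equiv.swap_apply_of_ne_of_ne h.2.2.symm h.2.1.symm,
        hflip (VLine.key_ne h.2.1).symm, hflip (VLine.key_ne h.2.2).symm,
        hflip (key_apply_ne x h.2.1).symm, hflip (key_apply_ne x h.2.2).symm]
      ring
    · simp

/-- An empty rectangle lowers the Maslov grading on the regular grid by one, apart from the
contribution of the decorations which it contains. -/
theorem Rect.sum_cutTerm {ρ : G.Rect} (h : ρ.IsEmpty) (k : Mark) :
    ascents ρ.start - ascents ρ.finish + 2 * ∑ q : G.Decor k, ρ.cutTerm q.1 = 1 := by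
  classical
  have hne := h.1
  have hk := VLine.key_ne hne
  have hl := key_apply_ne ρ.start hne
  have e1 : ∑ q : G.Decor k, ρ.cutTerm q.1 =
      ind (ρ.east.key < ρ.west.key) *
        ∑ f : G.VLine, cyc (ρ.start ρ.west).key (ρ.start ρ.east).key (ρ.start f).key +
      ind ((ρ.start ρ.east).key < (ρ.start ρ.west).key) *
        ∑ f : G.VLine, cyc ρ.west.key ρ.east.key f.key -
      ∑ f : G.VLine,
        ind (ρ.east.key < ρ.west.key) * ind ((ρ.start ρ.east).key < (ρ.start ρ.west).key) := by
    rw [ρ.start.sum_comp (fun h => cyc (ρ.start ρ.west).key (ρ.start ρ.east).key h.key),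
      ← (rowEquiv (fun _ => 0) k).sum_comp, ← (colEquiv (fun _ => 0) k).sum_comp,
      ← (colEquiv (fun _ => 0) k).sum_comp, Finset.mul_sum, Finset.mul_sum,
      ← Finset.sum_add_distrib, ← Finset.sum_sub_distrib]
    refine Finset.sum_congr rfl fun q _ => ?_
    simp only [rowEquiv, colEquiv, Equiv.ofBijective_apply]
    rw [cyc_eq_ind_isLeft, cyc_eq_ind_isBelow, cutTerm]
    ring
  have key : ∀ f : G.VLine, (if ρ.west ≠ ρ.east ∧ ρ.east ≠ f ∧ ρ.west ≠ f then
        (ind (ρ.west.key < f.key) - ind (ρ.east.key < f.key)) *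
        (ind ((ρ.start ρ.west).key < (ρ.start f).key) -
          ind ((ρ.start ρ.east).key < (ρ.start f).key)) else 0) =
      -(ind (ρ.east.key < ρ.west.key) *
        cyc (ρ.start ρ.west).key (ρ.start ρ.east).key (ρ.start f).key) -
      ind ((ρ.start ρ.east).key < (ρ.start ρ.west).key) * cyc ρ.west.key ρ.east.key f.key +
      ind (ρ.east.key < ρ.west.key) * ind ((ρ.start ρ.east).key < (ρ.start ρ.west).key) +
      (if f = ρ.west then ind (ρ.east.key < ρ.west.key) +
        ind ((ρ.start ρ.east).key < (ρ.start ρ.west).key) -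
        ind (ρ.east.key < ρ.west.key) * ind ((ρ.start ρ.east).key < (ρ.start ρ.west).key) else 0) +
      (if f = ρ.east then
        -(ind (ρ.east.key < ρ.west.key) * ind ((ρ.start ρ.east).key < (ρ.start ρ.west).key))
        else 0) := by
    intro f
    by_cases h1 : f = ρ.west
    · subst h1
      rw [if_neg (by simp), if_pos rfl, if_neg hne, cyc_eq_ind hk, cyc_eq_ind hl,
        ind_true (Or.inl rfl), ind_true (Or.inl rfl)]
      ring
    by_cases h2 : f = ρ.east
    · subst h2
      have z : ∀ {a b : ℕ}, a ≠ b → cyc a b b = 0 := fun hab => by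
        rw [cyc_eq_ind hab]
        exact ind_false fun h => h.elim hab.symm fun h' => h'.ne.2.1 rfl
      rw [if_neg (by simp), if_neg hne.symm, if_pos rfl, z hk, z hl]
      ring
    rw [if_pos ⟨hne, Ne.symm h2, Ne.symm h1⟩, if_neg h1, if_neg h2]
    have h3 : cyc ρ.west.key ρ.east.key f.key *
        cyc (ρ.start ρ.west).key (ρ.start ρ.east).key (ρ.start f).key = 0 := by
      have n1 := VLine.key_ne h1
      have n2 := key_apply_ne ρ.start h1
      rw [cyc_eq_ind hk, cyc_eq_ind hl]
      by_cases h4 : CycBetween ρ.west.key f.key ρ.east.key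
      · have := h.2 f h4
        rw [ind_false (p := (ρ.start f).key = _ ∨ _) (by tauto), mul_zero]
      · rw [ind_false (p := f.key = _ ∨ _) (by tauto), zero_mul]
    have hle : ∀ {a b : ℕ}, a ≠ b → ind (b < a) = ind (b ≤ a) := fun h =>
      ind_congr ⟨le_of_lt, fun h' => lt_of_le_of_ne h' (Ne.symm h)⟩
    rw [hle (VLine.key_ne h1), hle (VLine.key_ne h2), hle (key_apply_ne _ h1),
      hle (key_apply_ne _ h2)]
    unfold cyc at h3 ⊢
    linear_combination h3
  rw [ascents_sub hne, e1, Finset.sum_congr rfl fun f _ => key f]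
  simp only [Finset.sum_add_distrib, Finset.sum_sub_distrib, Finset.sum_neg_distrib,
    Finset.sum_ite_eq', Finset.mem_univ, if_true, ← Finset.mul_sum]
  ring

end SingularGrid

/-! ### Change of the Maslov gradings along a polygon -/

namespace SingularGrid

variable {G : SingularGrid} {A : G.WindingArcs}

/-- The two decorations of a given kind in a singular column. -/
theorem exists_shiftSign_inl (j : G.SingCol) (k : Mark) : ∃ p m : G.Decor k,
    (∀ q : G.Decor k, G.resolvedCol (fun _ => 0) q.1 = .inr j ↔ q = p) ∧
    (∀ q : G.Decor k, G.resolvedCol (fun _ => 0) q.1 = .inl j.1 ↔ q = m) ∧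
    ∀ q : G.Decor k, shiftSign q.1 (.inl j) = ind (q = p) - ind (q = m) := by
  have h : ∀ v : G.VLine, ∃ p : G.Decor k, ∀ q : G.Decor k,
      G.resolvedCol (fun _ => 0) q.1 = v ↔ q = p := fun v => by
    obtain ⟨p, h1, h2⟩ := existsUnique_resolvedCol (fun _ => 0) k v
    exact ⟨p, fun q => ⟨h2 q, fun h => h ▸ h1⟩⟩
  obtain ⟨p, hp⟩ := h (.inr j)
  obtain ⟨m, hm⟩ := h (.inl j.1)
  exact ⟨p, m, hp, hm, fun q => by rw [shiftSign_inl_eq, ind_congr (hp q), ind_congr (hm q)]⟩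

/-- The two decorations of a given kind in a singular row. -/
theorem exists_shiftSign_inr (i : G.SingRow) (k : Mark) : ∃ p m : G.Decor k,
    (∀ q : G.Decor k, G.resolvedRow (fun _ => 0) q.1 = .inr i ↔ q = p) ∧
    (∀ q : G.Decor k, G.resolvedRow (fun _ => 0) q.1 = .inl i.1 ↔ q = m) ∧
    ∀ q : G.Decor k, shiftSign q.1 (.inr i) = ind (q = p) - ind (q = m) := by
  have h : ∀ v : G.HLine, ∃ p : G.Decor k, ∀ q : G.Decor k,
      G.resolvedRow (fun _ => 0) q.1 = v ↔ q = p := fun v => by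
    obtain ⟨p, h1, h2⟩ := existsUnique_resolvedRow (fun _ => 0) k v
    exact ⟨p, fun q => ⟨h2 q, fun h => h ▸ h1⟩⟩
  obtain ⟨p, hp⟩ := h (.inr i)
  obtain ⟨m, hm⟩ := h (.inl i.1)
  exact ⟨p, m, hp, hm, fun q => by rw [shiftSign_inr_eq, ind_congr (hp q), ind_congr (hm q)]⟩

theorem sum_ind_eq_mul {ι : Type*} [Fintype ι] (p : ι) (f : ι → ℤ) :
    ∑ q, ind (q = p) * f q = f p := by
  rw [Fintype.sum_eq_single p fun q hq => by rw [ind_false hq, zero_mul], ind_true rfl, one_mul]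

theorem sum_shiftSign (e : G.SingRoC) (k : Mark) : ∑ q : G.Decor k, shiftSign q.1 e = 0 := by
  have h : ∃ p m : G.Decor k, ∀ q : G.Decor k, shiftSign q.1 e = ind (q = p) - ind (q = m) := by
    rcases e with j | i
    · obtain ⟨p, m, -, -, h⟩ := exists_shiftSign_inl j k
      exact ⟨p, m, h⟩
    · obtain ⟨p, m, -, -, h⟩ := exists_shiftSign_inr i k
      exact ⟨p, m, h⟩
  obtain ⟨p, m, h⟩ := h
  have h1 := sum_ind_eq_mul p fun _ => 1
  have h2 := sum_ind_eq_mul m fun _ => 1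
  simp only [mul_one] at h1 h2
  simp only [h, Finset.sum_sub_distrib, h1, h2, sub_self]

/-- Effect of the resolution on the order of the columns of two decorations. -/
theorem ind_resolvedCol_lt (I : G.Resolution) (q q' : Fin G.cols × Fin G.rows) :
    ind ((G.resolvedCol I q).key < (G.resolvedCol I q').key) =
      ind ((G.resolvedCol (fun _ => 0) q).key < (G.resolvedCol (fun _ => 0) q').key) +
      ∑ j : G.SingCol, (I (.inl j) : ℕ) *
        (ind (G.resolvedCol (fun _ => 0) q = .inr j ∧ G.resolvedCol (fun _ => 0) q' = .inl j.1) -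
          ind (G.resolvedCol (fun _ => 0) q' = .inr j ∧
            G.resolvedCol (fun _ => 0) q = .inl j.1)) := by
  classical
  obtain ⟨c, r⟩ := q
  obtain ⟨c', r'⟩ := q'
  have hidx : ∀ (c : Fin G.cols) (r : Fin G.rows) (j : G.SingCol), c ≠ j.1 →
      G.resolvedCol (fun _ => 0) (c, r) ≠ .inr j := by
    intro c r j hne h
    have := idx_resolvedCol (fun _ => 0) (c, r)
    rw [h] at this
    simp at this
    exact hne (Fin.ext (by omega))
  have hidx' : ∀ (c : Fin G.cols) (r : Fin G.rows) (j : G.SingCol), c ≠ j.1 →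
      G.resolvedCol (fun _ => 0) (c, r) ≠ .inl j.1 := by
    intro c r j hne h
    have := idx_resolvedCol (fun _ => 0) (c, r)
    rw [h] at this
    simp at this
    exact hne (Fin.ext (by omega))
  by_cases hc : c = c'
  · subst hc
    by_cases hs : RoC.IsSingular (G.deco c)
    · rw [Finset.sum_eq_single ⟨c, hs⟩]
      · obtain h | h : I (.inl ⟨c, hs⟩) = 0 ∨ I (.inl ⟨c, hs⟩) = 1 := by omega
        · simp only [resolvedCol_of_singular (q := (c, r)) hs,
            resolvedCol_of_singular (q := (c, r')) hs, h]
          simp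
        · simp only [resolvedCol_of_singular (q := (c, r)) hs,
            resolvedCol_of_singular (q := (c, r')) hs, h, RoC.onFirstSide_one_iff]
          by_cases h1 : RoC.OnFirstSide (G.deco c) 0 r <;>
            by_cases h2 : RoC.OnFirstSide (G.deco c) 0 r' <;> simp [h1, h2]
      · intro j _ hj
        have hne : c ≠ j.1 := fun h => hj (Subtype.ext h.symm)
        rw [ind_false fun h => hidx _ _ _ hne h.1, ind_false fun h => hidx _ _ _ hne h.1, sub_self,
          mul_zero]
      · simp
    · have h0 : ∀ I r, G.resolvedCol I (c, r) = .inl c := fun I r =>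
        resolvedCol_of_not_singular (q := (c, r)) hs
      simp [h0]
  · rw [Finset.sum_eq_zero, add_zero]
    · have hc' : (c : ℕ) ≠ c' := fun h => hc (Fin.ext h)
      have h1 := idx_resolvedCol I (c, r)
      have h2 := idx_resolvedCol I (c', r')
      have h3 := idx_resolvedCol (fun _ => 0) (c, r)
      have h4 := idx_resolvedCol (fun _ => 0) (c', r')
      dsimp only at h1 h2 h3 h4
      exact ind_congr (by omega)
    · intro j _
      by_cases hj : c = j.1
      · have hne : c' ≠ j.1 := fun h => hc (hj.trans h.symm)
        rw [ind_false fun h => hidx' _ _ _ hne h.2, ind_false fun h => hidx _ _ _ hne h.1, sub_self,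
          mul_zero]
      · rw [ind_false fun h => hidx _ _ _ hj h.1, ind_false fun h => hidx' _ _ _ hj h.2, sub_self,
          mul_zero]

/-- Effect of the resolution on the order of the rows of two decorations. -/
theorem ind_resolvedRow_lt (I : G.Resolution) (q q' : Fin G.cols × Fin G.rows) :
    ind ((G.resolvedRow I q).key < (G.resolvedRow I q').key) =
      ind ((G.resolvedRow (fun _ => 0) q).key < (G.resolvedRow (fun _ => 0) q').key) +
      ∑ i : G.SingRow, (I (.inr i) : ℕ) *
        (ind (G.resolvedRow (fun _ => 0) q = .inr i ∧ G.resolvedRow (fun _ => 0) q' = .inl i.1) -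
          ind (G.resolvedRow (fun _ => 0) q' = .inr i ∧
            G.resolvedRow (fun _ => 0) q = .inl i.1)) := by
  -- The statement is the mirror image in the diagonal of the preceding one.
  let G' : SingularGrid := ⟨G.rows, G.cols, fun r c => G.deco c r, G.row_admissible, G.col_admissible⟩
  have hk : ∀ v : G'.VLine, v.key = HLine.key (G := G) v := by rintro (_ | _) <;> rfl
  have hr : ∀ (I : G.Resolution) (q : Fin G.cols × Fin G.rows),
      G'.resolvedCol (fun e => I e.swap) q.swap = G.resolvedRow I q := fun _ _ => rfl
  have h := ind_resolvedCol_lt (G := G') (fun e => I e.swap) q.swap q'.swap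
  have h0 := hr (fun _ => 0)
  simp only [hk, hr, h0] at h
  exact h

theorem onFirstSide_of_resolvedCol {q : Fin G.cols × Fin G.rows} {j : G.SingCol} :
    (G.resolvedCol (fun _ => 0) q = .inr j → q.1 = j.1 ∧ ¬ RoC.OnFirstSide (G.deco j.1) 0 q.2) ∧
    (G.resolvedCol (fun _ => 0) q = .inl j.1 → q.1 = j.1 ∧ RoC.OnFirstSide (G.deco j.1) 0 q.2) := by
  classical
  obtain ⟨c, r⟩ := q
  have h1 := idx_resolvedCol (fun _ => 0) (c, r)
  obtain ⟨c', hs⟩ := j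
  have key : ∀ v : G.VLine, v.key / 2 = c' → G.resolvedCol (fun _ => 0) (c, r) = v → c = c' :=
    fun v hv h => Fin.ext (by rw [← hv, ← h, h1])
  constructor <;> intro h <;> obtain rfl := key _ (by simp; try omega) h <;>
    rw [resolvedCol_of_singular (q := (c, r)) hs] at h <;> refine ⟨rfl, ?_⟩ <;>
    split_ifs at h <;> assumption

theorem onFirstSide_of_resolvedRow {q : Fin G.cols × Fin G.rows} {i : G.SingRow} :
    (G.resolvedRow (fun _ => 0) q = .inr i →
      q.2 = i.1 ∧ ¬ RoC.OnFirstSide (fun c => G.deco c i.1) 0 q.1) ∧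
    (G.resolvedRow (fun _ => 0) q = .inl i.1 →
      q.2 = i.1 ∧ RoC.OnFirstSide (fun c => G.deco c i.1) 0 q.1) :=
  onFirstSide_of_resolvedCol
    (G := ⟨G.rows, G.cols, fun r c => G.deco c r, G.row_admissible, G.col_admissible⟩)
    (q := q.swap) (j := i)

/-- The order of two decorations of the same kind in a singular column, in terms of the peak. -/
theorem Peaks.ind_resolvedRow_sub (P : Peaks A) {j : G.SingCol} {k : Mark} {p m : G.Decor k}
    (hp : G.resolvedCol (fun _ => 0) p.1 = .inr j) (hm : G.resolvedCol (fun _ => 0) m.1 = .inl j.1) :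
    ind ((G.resolvedRow (fun _ => 0) p.1).key < (G.resolvedRow (fun _ => 0) m.1).key) -
      ind ((G.resolvedRow (fun _ => 0) m.1).key < (G.resolvedRow (fun _ => 0) p.1).key) =
      1 + 2 * (P.decoBefore p.1 (.inl j) - P.decoBefore m.1 (.inl j)) := by
  obtain ⟨⟨⟨pc, pr⟩, hpk⟩, ⟨⟨mc, mr⟩, hmk⟩⟩ := p, m
  obtain ⟨rfl, h1⟩ := onFirstSide_of_resolvedCol.1 hp
  obtain ⟨rfl, h2⟩ := onFirstSide_of_resolvedCol.2 hm
  have h3 := idx_resolvedRow (fun _ => 0) (j.1, pr)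
  have h4 := idx_resolvedRow (fun _ => 0) (j.1, mr)
  simp only [decoBefore] at h3 h4 ⊢
  dsimp only at hpk hmk
  rcases RoC.IsPeak.between_of_onFirstSide (A.col_winding j) (P.col_isPeak j) j.2
    (G.col_admissible j.1) (p := mr) (q := pr) (by rw [hmk]; simp) (by rw [hmk, hpk]) h2 h1 with
    ⟨h5, h6, h7⟩ | ⟨h5, h6⟩
  · have h5 : (mr : ℕ) < pr := h5
    rw [ind_false (by omega), ind_true (by omega), ind_false (by linarith), ind_true h6]
    norm_num
  · have h5 : (pr : ℕ) < mr := h5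
    rw [ind_true (by omega), ind_false (by omega)]
    rcases h6 with ⟨h6, h7⟩ | ⟨h6, h7⟩
    · rw [ind_true h6, ind_true h7]; norm_num
    · rw [ind_false (by linarith), ind_false (by linarith)]; norm_num

/-- The order of two decorations of the same kind in a singular row, in terms of the peak. -/
theorem Peaks.ind_resolvedCol_sub (P : Peaks A) {i : G.SingRow} {k : Mark} {p m : G.Decor k}
    (hp : G.resolvedRow (fun _ => 0) p.1 = .inr i) (hm : G.resolvedRow (fun _ => 0) m.1 = .inl i.1) :
    ind ((G.resolvedCol (fun _ => 0) p.1).key < (G.resolvedCol (fun _ => 0) m.1).key) -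
      ind ((G.resolvedCol (fun _ => 0) m.1).key < (G.resolvedCol (fun _ => 0) p.1).key) =
      1 + 2 * (P.decoBefore p.1 (.inr i) - P.decoBefore m.1 (.inr i)) := by
  obtain ⟨⟨⟨pr, pc⟩, hpk⟩, ⟨⟨mr, mc⟩, hmk⟩⟩ := p, m
  obtain ⟨rfl, h1⟩ := onFirstSide_of_resolvedRow.1 hp
  obtain ⟨rfl, h2⟩ := onFirstSide_of_resolvedRow.2 hm
  have h3 := idx_resolvedCol (fun _ => 0) (pr, i.1)
  have h4 := idx_resolvedCol (fun _ => 0) (mr, i.1)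
  simp only [decoBefore] at h3 h4 ⊢
  dsimp only at hpk hmk
  rcases RoC.IsPeak.between_of_onFirstSide (A.row_winding i) (P.row_isPeak i) i.2
    (G.row_admissible i.1) (p := mr) (q := pr) (by rw [hmk]; simp) (by rw [hmk, hpk]) h2 h1 with
    ⟨h5, h6, h7⟩ | ⟨h5, h6⟩
  · have h5 : (mr : ℕ) < pr := h5
    rw [ind_false (by omega), ind_true (by omega), ind_false (by linarith), ind_true h6]
    norm_num
  · have h5 : (pr : ℕ) < mr := h5
    rw [ind_true (by omega), ind_false (by omega)]
    rcases h6 with ⟨h6, h7⟩ | ⟨h6, h7⟩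
    · rw [ind_true h6, ind_true h7]; norm_num
    · rw [ind_false (by linarith), ind_false (by linarith)]; norm_num

/-- Position of the decorations of kind `k` of a singular RoC relative to its peak: `-1` if the peak
separates them and `0` otherwise. -/
def Peaks.separation (P : Peaks A) (k : Mark) (e : G.SingRoC) : ℤ :=
  ∑ q : G.Decor k, shiftSign q.1 e * P.decoBefore q.1 e

theorem sum_sum_ind_eq {ι : Type*} [Fintype ι] (p m : ι) (f : ι → ι → ℤ) :
    ∑ q, ∑ q', (ind (q = p ∧ q' = m) - ind (q' = p ∧ q = m)) * f q q' = f p m - f m p := by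
  have h : ∀ a b : Prop, ind (a ∧ b) = ind a * ind b := by
    intro a b; by_cases a <;> by_cases b <;> simp [*]
  have h1 : ∀ q q', (ind (q = p ∧ q' = m) - ind (q' = p ∧ q = m)) * f q q' =
      ind (q = p) * (ind (q' = m) * f q q') - ind (q = m) * (ind (q' = p) * f q q') := by
    intro q q'; rw [h, h]; ring
  simp only [h1, Finset.sum_sub_distrib, ← Finset.mul_sum, sum_ind_eq_mul]

/-- Changing a resolution exchanges the two columns (rows) of a singular RoC, and the order of its
decorations if they are on different sides of the peak. -/
theorem Peaks.ascents_decoPerm_eq (P : Peaks A) (k : Mark) (I : G.Resolution) :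
    ascents (decoPerm I k) = ascents (decoPerm (G := G) (fun _ => 0) k) +
      ∑ e, (I e : ℕ) * (1 + 2 * P.separation k e) := by
  have hcol : ∀ j : G.SingCol, 1 + 2 * P.separation k (.inl j) =
      ∑ q : G.Decor k, ∑ q' : G.Decor k,
        (ind (G.resolvedCol (fun _ => 0) q.1 = .inr j ∧
            G.resolvedCol (fun _ => 0) q'.1 = .inl j.1) -
          ind (G.resolvedCol (fun _ => 0) q'.1 = .inr j ∧
            G.resolvedCol (fun _ => 0) q.1 = .inl j.1)) *
        ind ((G.resolvedRow (fun _ => 0) q.1).key < (G.resolvedRow (fun _ => 0) q'.1).key) := by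
    intro j
    obtain ⟨p, m, hp, hm, hs⟩ := exists_shiftSign_inl j k
    simp only [hp, hm]
    rw [sum_sum_ind_eq p m fun q q' : G.Decor k =>
      ind ((G.resolvedRow (fun _ => 0) q.1).key < (G.resolvedRow (fun _ => 0) q'.1).key)]
    simp only [separation, hs, sub_mul, Finset.sum_sub_distrib]
    rw [sum_ind_eq_mul p fun q => P.decoBefore q.1 (.inl j), sum_ind_eq_mul m fun q => P.decoBefore q.1 (.inl j)]
    exact (P.ind_resolvedRow_sub ((hp p).2 rfl) ((hm m).2 rfl)).symm
  have hrow : ∀ i : G.SingRow, 1 + 2 * P.separation k (.inr i) =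
      ∑ q : G.Decor k, ∑ q' : G.Decor k,
        (ind (G.resolvedRow (fun _ => 0) q.1 = .inr i ∧
            G.resolvedRow (fun _ => 0) q'.1 = .inl i.1) -
          ind (G.resolvedRow (fun _ => 0) q'.1 = .inr i ∧
            G.resolvedRow (fun _ => 0) q.1 = .inl i.1)) *
        ind ((G.resolvedCol (fun _ => 0) q.1).key < (G.resolvedCol (fun _ => 0) q'.1).key) := by
    intro i
    obtain ⟨p, m, hp, hm, hs⟩ := exists_shiftSign_inr i k
    simp only [hp, hm]
    rw [sum_sum_ind_eq p m fun q q' : G.Decor k =>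
      ind ((G.resolvedCol (fun _ => 0) q.1).key < (G.resolvedCol (fun _ => 0) q'.1).key)]
    simp only [separation, hs, sub_mul, Finset.sum_sub_distrib]
    rw [sum_ind_eq_mul p fun q => P.decoBefore q.1 (.inr i), sum_ind_eq_mul m fun q => P.decoBefore q.1 (.inr i)]
    exact (P.ind_resolvedCol_sub ((hp p).2 rfl) ((hm m).2 rfl)).symm
  rw [ascents_decoPerm, ascents_decoPerm, Fintype.sum_sum_type]
  simp only [hcol, hrow, Finset.mul_sum]
  rw [Finset.sum_comm (γ := G.SingCol), Finset.sum_comm (γ := G.SingRow)]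
  simp only [← Finset.sum_add_distrib]
  refine Finset.sum_congr rfl fun q _ => ?_
  rw [Finset.sum_comm (γ := G.SingCol), Finset.sum_comm (γ := G.SingRow)]
  simp only [← Finset.sum_add_distrib]
  refine Finset.sum_congr rfl fun q' _ => ?_
  rw [ind_resolvedCol_lt I, ind_resolvedRow_lt I]
  simp only [← mul_assoc, ← Finset.sum_mul]
  -- Two decorations do not share both their columns and their rows.
  have hzero : (∑ j : G.SingCol, (I (.inl j) : ℕ) *
        (ind (G.resolvedCol (fun _ => 0) q.1 = .inr j ∧ G.resolvedCol (fun _ => 0) q'.1 = .inl j.1) -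
          ind (G.resolvedCol (fun _ => 0) q'.1 = .inr j ∧
            G.resolvedCol (fun _ => 0) q.1 = .inl j.1)) : ℤ) *
      (∑ i : G.SingRow, (I (.inr i) : ℕ) *
        (ind (G.resolvedRow (fun _ => 0) q.1 = .inr i ∧ G.resolvedRow (fun _ => 0) q'.1 = .inl i.1) -
          ind (G.resolvedRow (fun _ => 0) q'.1 = .inr i ∧
            G.resolvedRow (fun _ => 0) q.1 = .inl i.1))) = 0 := by
    by_cases h1 : q.1.1 = q'.1.1
    · by_cases h2 : q.1.2 = q'.1.2
      · have : q = q' := Subtype.ext (Prod.ext h1 h2)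
        simp [this]
      · rw [Finset.sum_eq_zero (s := (Finset.univ : Finset G.SingRow)), mul_zero]
        intro i _
        rw [ind_false, ind_false, sub_self, mul_zero]
        · rintro ⟨h, h'⟩
          exact h2 ((onFirstSide_of_resolvedRow.2 h').1.trans (onFirstSide_of_resolvedRow.1 h).1.symm)
        · rintro ⟨h, h'⟩
          exact h2 ((onFirstSide_of_resolvedRow.1 h).1.trans (onFirstSide_of_resolvedRow.2 h').1.symm)
    · rw [Finset.sum_eq_zero (s := (Finset.univ : Finset G.SingCol)), zero_mul]
      intro j _
      rw [ind_false, ind_false, sub_self, mul_zero]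
      · rintro ⟨h, h'⟩
        exact h1 ((onFirstSide_of_resolvedCol.2 h').1.trans (onFirstSide_of_resolvedCol.1 h).1.symm)
      · rintro ⟨h, h'⟩
        exact h1 ((onFirstSide_of_resolvedCol.1 h).1.trans (onFirstSide_of_resolvedCol.2 h').1.symm)
  linear_combination hzero

theorem Peaks.sum_potential (P : Peaks A) (k : Mark) (x : G.Gen) :
    ∑ q : G.Decor k, P.potential x q.1 =
      ∑ q : G.Decor k, dotsBeyond x.1 x.2 q.1 - ∑ e, (x.1 e : ℕ) * P.separation k e := by
  simp only [potential, Finset.sum_add_distrib]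
  rw [Finset.sum_comm, sub_eq_add_neg, ← Finset.sum_neg_distrib]
  congr 1
  refine Finset.sum_congr rfl fun e _ => ?_
  have := sum_shiftSign e k
  simp only [mul_sub, Finset.sum_sub_distrib, ← Finset.mul_sum, separation, ← Finset.sum_mul, this]
  ring

theorem numOnes_eq (I : G.Resolution) : (G.numOnes I : ℤ) = ∑ e, ((I e : ℕ) : ℤ) := by
  unfold numOnes
  rw [Finset.card_filter]
  push_cast
  refine Finset.sum_congr rfl fun e _ => ?_
  obtain h | h : I e = 0 ∨ I e = 1 := by omega
  all_goals simp [h]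

/-- An empty polygon lowers the Maslov grading of either kind by one, apart from the contribution of
the decorations which it contains. -/
theorem Quad.IsPolygon.markMaslov_eq {P : Peaks A} {π : G.Quad} (hπ : π.IsPolygon P)
    (hE : π.toRect.IsEmpty) (k : Mark) :
    markMaslov k π.finish - G.numOnes π.finish.1 = markMaslov k π.start - G.numOnes π.start.1 - 1 +
      2 * ∑ q : G.Decor k, ind (π.Contains P q.1) := by
  have h1 : ∑ q : G.Decor k, ind (π.Contains P q.1) =
      ∑ q : G.Decor k, P.potential π.start q.1 - ∑ q : G.Decor k, P.potential π.finish q.1 +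
        ∑ q : G.Decor k, π.toRect.cutTerm q.1 := by
    rw [Finset.sum_congr rfl fun q _ => hπ.ind_contains_eq (q := q.1) (by rw [q.2]; simp)]
    rw [Finset.sum_add_distrib, Finset.sum_comm]
    simp only [← Finset.sum_mul, sum_shiftSign, zero_mul, Finset.sum_const_zero, add_zero,
      Finset.sum_add_distrib, Finset.sum_sub_distrib]
  have h2 := Rect.sum_cutTerm hE k
  have h3 : π.toRect.finish = π.finish.2 := hπ.finish_eq.symm
  have h4 : π.toRect.start = π.start.2 := rfl
  rw [h3, h4] at h2
  rw [h1, P.sum_potential, P.sum_potential, numOnes_eq, numOnes_eq, markMaslov, markMaslov,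
    P.ascents_decoPerm_eq k π.start.1, P.ascents_decoPerm_eq k π.finish.1]
  simp only [mul_add, mul_one, Finset.sum_add_distrib]
  have h5 : ∀ I : G.Resolution, ∑ e, ((I e : ℕ) : ℤ) * (2 * P.separation k e) =
      2 * ∑ e, ((I e : ℕ) : ℤ) * P.separation k e := by
    intro I
    rw [Finset.mul_sum]
    exact Finset.sum_congr rfl fun _ _ => by ring
  rw [h5, h5]
  linear_combination -h2

end SingularGrid

/-! ### The number of components of the link and integrality of the gradings -/

/-- The sign of a permutation in terms of the number of its cycles, fixed points included. The map `f`
identifies the points of each cycle. -/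
theorem Equiv.Perm.sign_eq_of_surjective {α β : Type*} [Fintype α] [DecidableEq α]
    (σ : Equiv.Perm α) {f : α → β} (hf : Function.Surjective f)
    (h : ∀ v w, f v = f w ↔ σ.SameCycle v w) :
    Equiv.Perm.sign σ = (-1) ^ (Fintype.card α + Nat.card β) := by
  let g : α → {c // c ∈ σ.cycleFactorsFinset} ⊕ Function.fixedPoints σ := fun v =>
    if hv : σ v = v then .inr ⟨v, hv⟩
    else .inl ⟨σ.cycleOf v, Equiv.Perm.cycleOf_mem_cycleFactorsFinset_iff.2
      (Equiv.Perm.mem_support.2 hv)⟩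
  have hg : Function.Surjective g := by
    rintro (⟨c, hc⟩ | ⟨v, hv⟩)
    · have hcyc := (Equiv.Perm.mem_cycleFactorsFinset_iff.1 hc).1
      obtain ⟨v, hv⟩ := Equiv.Perm.IsCycle.nonempty_support hcyc
      have hv' := Equiv.Perm.mem_cycleFactorsFinset_support_le hc hv
      refine ⟨v, ?_⟩
      simp only [g, dif_neg (Equiv.Perm.mem_support.1 hv')]
      congr 2
      exact (Equiv.Perm.cycle_is_cycleOf hv hc).symm
    · refine ⟨v, ?_⟩
      have hv : σ v = v := hv
      simp [g, hv]
  have hgk : ∀ v w, g v = g w ↔ σ.SameCycle v w := by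
    intro v w
    by_cases hv : σ v = v
    · have h1 : σ.SameCycle v w ↔ v = w :=
        ⟨fun ⟨i, hi⟩ => by rw [← hi, Equiv.Perm.zpow_apply_eq_self_of_apply_eq_self hv],
          fun h => h ▸ Equiv.Perm.SameCycle.refl _ _⟩
      rw [h1]
      by_cases hw : σ w = w
      · simp only [g, hv, hw, dite_true, Sum.inr.injEq]
        exact Subtype.mk_eq_mk
      · simp only [g, hv, hw, dite_true, dite_false]
        simp
        rintro rfl
        exact hw hv
    · by_cases hw : σ w = w
      · have h1 : σ.SameCycle v w ↔ v = w :=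
          ⟨fun h => by
            obtain ⟨i, hi⟩ := h.symm
            rw [← hi, Equiv.Perm.zpow_apply_eq_self_of_apply_eq_self hw],
            fun h => h ▸ Equiv.Perm.SameCycle.refl _ _⟩
        rw [h1]
        simp only [g, hv, hw, dite_true, dite_false]
        simp
        rintro rfl
        exact hv hw
      · simp only [g, hv, hw, dite_false, Sum.inl.injEq, Subtype.mk.injEq]
        exact (Equiv.Perm.sameCycle_iff_cycleOf_eq_of_mem_support (Equiv.Perm.mem_support.2 hv)
          (Equiv.Perm.mem_support.2 hw)).symm
  have hker : Setoid.ker f = Setoid.ker g := by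
    ext v w
    rw [Setoid.ker_def, Setoid.ker_def, h, hgk]
  have hcard : Nat.card β = σ.cycleType.card + Fintype.card (Function.fixedPoints σ) := by
    rw [← Nat.card_congr (Setoid.quotientKerEquivOfSurjective f hf), hker,
      Nat.card_congr (Setoid.quotientKerEquivOfSurjective g hg), Nat.card_eq_fintype_card,
      Fintype.card_sum, Equiv.Perm.cycleType_def]
    simp
  have hs := Equiv.Perm.card_fixedPoints σ
  have hle := Finset.card_le_univ σ.support
  rw [Equiv.Perm.sign_of_cycleType, hcard]
  have : Fintype.card α = σ.cycleType.sum + Fintype.card (Function.fixedPoints σ) := by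
    rw [hs, Equiv.Perm.sum_cycleType] at *
    omega
  rw [this, show σ.cycleType.sum + Fintype.card (Function.fixedPoints σ) + (σ.cycleType.card +
    Fintype.card (Function.fixedPoints σ)) = σ.cycleType.sum + σ.cycleType.card +
    2 * Fintype.card (Function.fixedPoints σ) by ring, pow_add _ _ (2 * _), pow_mul]
  simp

namespace SingularGrid

variable {G : SingularGrid} {A : G.WindingArcs}

/-- A transposition changes the number of ascents by an odd number. -/
theorem negOnePow_ascents (τ : Equiv.Perm G.VLine) (x : G.Perm) :
    (ascents (τ.trans x)).negOnePow = Equiv.Perm.sign τ * (ascents x).negOnePow := by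
  classical
  induction τ using Equiv.Perm.swap_induction_on generalizing x with
  | one => simp [Equiv.Perm.one_def]
  | swap_mul f a b hab ih =>
    have h1 : (Equiv.swap a b * f).trans x = f.trans ((Equiv.swap a b).trans x) := rfl
    have h2 := ascents_sub (ρ := ⟨x, a, b⟩) hab
    have h3 : Odd (ascents x - ascents ((Equiv.swap a b).trans x)) := by
      have hodd : ∀ c : ℤ, Odd (1 - 2 * c) := fun c => ⟨-c, by ring⟩
      rw [show (Equiv.swap a b).trans x = (⟨x, a, b⟩ : G.Rect).finish from rfl]
      rw [h2]
      exact ((hodd _).mul (hodd _)).add_even (even_two_mul _)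
    have h4 := Int.negOnePow_odd _ h3
    rw [Int.negOnePow_sub] at h4
    rw [h1, ih, Equiv.Perm.sign_mul, Equiv.Perm.sign_swap hab]
    have h5 : (ascents ((Equiv.swap a b).trans x)).negOnePow = -(ascents x).negOnePow := by
      rcases Int.units_eq_one_or (ascents x).negOnePow with h | h <;>
        rcases Int.units_eq_one_or (ascents ((Equiv.swap a b).trans x)).negOnePow with h' | h' <;>
        rw [h, h'] at h4 ⊢ <;> simp at h4 ⊢
    rw [h5]
    simp

variable (G) in
theorem card_vLine_eq_size : Fintype.card G.VLine = G.size :=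
  (Fintype.card_congr (colEquiv (fun _ => 0) .O)).symm

theorem decoPerm_resolvedCol (I : G.Resolution) {k : Mark} (q : G.Decor k) :
    decoPerm I k (G.resolvedCol I q.1) = G.resolvedRow I q.1 := by
  have h : G.resolvedCol I q.1 = colEquiv I k q := rfl
  rw [h, decoPerm, Equiv.trans_apply, Equiv.symm_apply_apply]
  rfl

/-- The components of the link of `G_I` are the cycles of the permutation of the columns which
follows the link from the `O` of a column to the `X` of its row. -/
theorem sign_decoPerm (I : G.Resolution) :
    Equiv.Perm.sign ((decoPerm I .O).trans (decoPerm I .X).symm) =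
      (-1) ^ (G.size + G.numComponents I) := by
  set σ : Equiv.Perm G.VLine := (decoPerm I .O).trans (decoPerm I .X).symm with hσ
  let mkDecor : ∀ {k : Mark}, G.Decor k → {q : Fin G.cols × Fin G.rows // G.deco q.1 q.2 ≠ none} :=
    fun q => ⟨q.1, by rw [q.2]; simp⟩
  let f := fun v : G.VLine =>
    Quot.mk (fun q q' : {q : Fin G.cols × Fin G.rows // G.deco q.1 q.2 ≠ none} =>
      G.resolvedCol I q.1 = G.resolvedCol I q'.1 ∨ G.resolvedRow I q.1 = G.resolvedRow I q'.1)
      (mkDecor ((colEquiv I .O).symm v))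
  have hcol : ∀ (k : Mark) (v : G.VLine), G.resolvedCol I ((colEquiv I k).symm v).1 = v :=
    fun k v => (colEquiv I k).apply_symm_apply v
  have hrow : ∀ (k : Mark) (v : G.VLine),
      G.resolvedRow I ((colEquiv I k).symm v).1 = decoPerm I k v := fun k v => rfl
  -- The column of each decoration is in the cycle of the column of the `O` in the same row.
  have hcycle : ∀ q : {q : Fin G.cols × Fin G.rows // G.deco q.1 q.2 ≠ none},
      σ.SameCycle ((decoPerm I .O).symm (G.resolvedRow I q.1)) (G.resolvedCol I q.1) := by
    rintro ⟨q, hq⟩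
    cases hk : G.deco q.1 q.2 with
    | none => exact absurd hk hq
    | some k =>
      have h1 := decoPerm_resolvedCol I (⟨q, hk⟩ : G.Decor k)
      dsimp only at h1 ⊢
      rw [← h1]
      cases k with
      | O => rw [Equiv.symm_apply_apply]
      | X =>
        refine ⟨1, ?_⟩
        simp [hσ]
  have hstep : ∀ v, f (σ v) = f v := by
    intro v
    have h1 : f (σ v) = Quot.mk _ (mkDecor ((colEquiv I .X).symm (σ v))) :=
      Quot.sound (.inl (by simp only [mkDecor, hcol]))
    rw [h1]
    refine Quot.sound (.inr ?_)
    simp only [mkDecor, hrow]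
    simp [hσ]
  have hstep' : ∀ (i : ℤ) v, f ((σ ^ i) v) = f v := by
    intro i
    induction i using Int.induction_on with
    | zero => simp
    | succ i ih => intro v; rw [zpow_add_one, Equiv.Perm.mul_apply, ih, hstep]
    | pred i ih =>
      intro v
      rw [zpow_sub_one, Equiv.Perm.mul_apply, ih, ← hstep]
      exact congrArg f (σ.apply_symm_apply v)
  rw [← card_vLine_eq_size]
  refine Equiv.Perm.sign_eq_of_surjective σ (f := f) ?_ ?_
  · rintro ⟨q⟩
    refine ⟨G.resolvedCol I q.1, Quot.sound (.inl ?_)⟩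
    simp only [mkDecor, hcol]
  · refine fun v w => ⟨fun h => ?_, ?_⟩
    · let t : {q : Fin G.cols × Fin G.rows // G.deco q.1 q.2 ≠ none} →
          Quotient (Equiv.Perm.SameCycle.setoid σ) := fun q => Quotient.mk _ (G.resolvedCol I q.1)
      have ht : ∀ q q' : {q : Fin G.cols × Fin G.rows // G.deco q.1 q.2 ≠ none},
          (G.resolvedCol I q.1 = G.resolvedCol I q'.1 ∨
            G.resolvedRow I q.1 = G.resolvedRow I q'.1) → t q = t q' := by
        rintro q q' (h | h)
        · simp only [t, h]
        · have h1 := hcycle q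
          rw [h] at h1
          exact Quotient.sound (h1.symm.trans (hcycle q'))
      have h1 := congrArg (Quot.lift t ht) h
      simp only [f, t, mkDecor, hcol] at h1
      exact Quotient.exact h1
    · rintro ⟨i, rfl⟩
      exact (hstep' i v).symm

/-- The Alexander grading is an integer: by `sign_decoPerm` the `O`s and the `X`s, as permutations,
have ascents whose numbers differ by `n - ℓ` modulo two. -/
theorem exists_alexander_eq (x : G.Gen) : ∃ a : ℤ, G.alexander x = a := by
  have h1 := negOnePow_ascents ((decoPerm x.1 .O).trans (decoPerm x.1 .X).symm) (decoPerm x.1 .X)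
  have h2 : ((decoPerm x.1 .O).trans (decoPerm x.1 .X).symm).trans (decoPerm x.1 .X) =
      decoPerm x.1 .O := by
    ext v; simp
  rw [h2, sign_decoPerm] at h1
  have h3 : (ascents (decoPerm x.1 .O) - ascents (decoPerm x.1 .X) - G.size +
      G.numComponents x.1).negOnePow = 1 := by
    have h4 : ((-1 : ℤˣ) ^ (G.size + G.numComponents x.1)) =
        ((G.size : ℤ) + G.numComponents x.1).negOnePow := by
      rw [← Nat.cast_add, Int.negOnePow_def, zpow_natCast]
    rw [Int.negOnePow_add, Int.negOnePow_sub, Int.negOnePow_sub, h1, h4, Int.negOnePow_add]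
    generalize (G.size : ℤ).negOnePow = a
    generalize (G.numComponents x.1 : ℤ).negOnePow = b
    generalize (ascents (decoPerm x.1 .X)).negOnePow = c
    rcases Int.units_eq_one_or a with rfl | rfl <;> rcases Int.units_eq_one_or b with rfl | rfl <;>
      rcases Int.units_eq_one_or c with rfl | rfl <;> rfl
  obtain ⟨a, ha⟩ := Int.negOnePow_eq_one_iff _ |>.1 h3
  refine ⟨a - (∑ q : G.Decor .O, dotsBeyond x.1 x.2 q.1 - ∑ q : G.Decor .X, dotsBeyond x.1 x.2 q.1),
    ?_⟩
  have ha' : ((ascents (decoPerm x.1 .O) - ascents (decoPerm x.1 .X) - G.size +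
      G.numComponents x.1 : ℤ) : ℚ) = ((a + a : ℤ) : ℚ) := by rw [ha]
  rw [alexander, gridAlexander, relMaslov_eq, relMaslov_eq, markMaslov, markMaslov]
  push_cast at ha' ⊢
  linear_combination ha' / 2

theorem maslov_eq (x : G.Gen) : G.maslov x = ((markMaslov .O x - G.numOnes x.1 : ℤ) : ℚ) := by
  rw [maslov, gridMaslov, relMaslov_eq]
  push_cast
  rfl

/-- Decorations share a column or a row in one resolution if and only if they do in any other. -/
theorem numComponents_eq (I J : G.Resolution) : G.numComponents I = G.numComponents J := by
  classical
  have hcol : ∀ (I : G.Resolution) (q q' : Fin G.cols × Fin G.rows),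
      G.resolvedCol I q = G.resolvedCol I q' ↔
        G.resolvedCol (fun _ => 0) q = G.resolvedCol (fun _ => 0) q' := by
    rintro I ⟨c, r⟩ ⟨c', r'⟩
    have h1 := idx_resolvedCol I (c, r)
    have h2 := idx_resolvedCol I (c', r')
    have h3 := idx_resolvedCol (fun _ => 0) (c, r)
    have h4 := idx_resolvedCol (fun _ => 0) (c', r')
    dsimp only at h1 h2 h3 h4
    by_cases hc : c = c'
    · subst hc
      by_cases hs : RoC.IsSingular (G.deco c)
      · rw [resolvedCol_of_singular (q := (c, r)) hs, resolvedCol_of_singular (q := (c, r')) hs,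
          resolvedCol_of_singular (q := (c, r)) hs, resolvedCol_of_singular (q := (c, r')) hs]
        dsimp only
        obtain h | h : I (.inl ⟨c, hs⟩) = 0 ∨ I (.inl ⟨c, hs⟩) = 1 := by omega
        · rw [h]
        · rw [h, RoC.onFirstSide_one_iff, RoC.onFirstSide_one_iff]
          by_cases h1 : RoC.OnFirstSide (G.deco c) 0 r <;>
            by_cases h2 : RoC.OnFirstSide (G.deco c) 0 r' <;> simp [h1, h2]
      · rw [resolvedCol_of_not_singular (q := (c, r)) hs,
          resolvedCol_of_not_singular (q := (c, r')) hs,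
          resolvedCol_of_not_singular (q := (c, r)) hs,
          resolvedCol_of_not_singular (q := (c, r')) hs]
    · refine ⟨fun h => absurd (Fin.ext ?_) hc, fun h => absurd (Fin.ext ?_) hc⟩
      · rw [← h1, h, h2]
      · rw [← h3, h, h4]
  have hrow : ∀ (I : G.Resolution) (q q' : Fin G.cols × Fin G.rows),
      G.resolvedRow I q = G.resolvedRow I q' ↔
        G.resolvedRow (fun _ => 0) q = G.resolvedRow (fun _ => 0) q' := by
    rintro I ⟨c, r⟩ ⟨c', r'⟩
    have h1 := idx_resolvedRow I (c, r)
    have h2 := idx_resolvedRow I (c', r')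
    have h3 := idx_resolvedRow (fun _ => 0) (c, r)
    have h4 := idx_resolvedRow (fun _ => 0) (c', r')
    dsimp only at h1 h2 h3 h4
    by_cases hc : r = r'
    · subst hc
      by_cases hs : RoC.IsSingular (fun c => G.deco c r)
      · rw [resolvedRow_of_singular (q := (c, r)) hs, resolvedRow_of_singular (q := (c', r)) hs,
          resolvedRow_of_singular (q := (c, r)) hs, resolvedRow_of_singular (q := (c', r)) hs]
        dsimp only
        obtain h | h : I (.inr ⟨r, hs⟩) = 0 ∨ I (.inr ⟨r, hs⟩) = 1 := by omega
        · rw [h]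
        · rw [h, RoC.onFirstSide_one_iff, RoC.onFirstSide_one_iff]
          by_cases h1 : RoC.OnFirstSide (fun c => G.deco c r) 0 c <;>
            by_cases h2 : RoC.OnFirstSide (fun c => G.deco c r) 0 c' <;> simp [h1, h2]
      · rw [resolvedRow_of_not_singular (q := (c, r)) hs,
          resolvedRow_of_not_singular (q := (c', r)) hs,
          resolvedRow_of_not_singular (q := (c, r)) hs,
          resolvedRow_of_not_singular (q := (c', r)) hs]
    · refine ⟨fun h => absurd (Fin.ext ?_) hc, fun h => absurd (Fin.ext ?_) hc⟩
      · rw [← h1, h, h2]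
      · rw [← h3, h, h4]
  unfold numComponents
  simp only [hcol I, hrow I, hcol J, hrow J]

namespace Quad.IsPolygon

variable {P : Peaks A} {π : G.Quad}

theorem maslov_finish (hπ : π.IsPolygon P) (hE : π.toRect.IsEmpty) :
    G.maslov π.finish =
      G.maslov π.start - 1 + 2 * ((∑ q : G.Decor .O, ind (π.Contains P q.1) : ℤ) : ℚ) := by
  rw [maslov_eq, maslov_eq, hπ.markMaslov_eq hE .O]
  push_cast
  ring

theorem alexander_finish (hπ : π.IsPolygon P) (hE : π.toRect.IsEmpty) :
    G.alexander π.finish = G.alexander π.start +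
      ((∑ q : G.Decor .O, ind (π.Contains P q.1) : ℤ) : ℚ) -
      ((∑ q : G.Decor .X, ind (π.Contains P q.1) : ℤ) : ℚ) := by
  have hO := congrArg (Int.cast (R := ℚ)) (hπ.markMaslov_eq hE .O)
  have hX := congrArg (Int.cast (R := ℚ)) (hπ.markMaslov_eq hE .X)
  rw [alexander, gridAlexander, relMaslov_eq, relMaslov_eq, alexander, gridAlexander, relMaslov_eq,
    relMaslov_eq, numComponents_eq π.finish.1 π.start.1]
  push_cast at hO hX ⊢
  linear_combination hO / 2 - hX / 2

end Quad.IsPolygon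

end SingularGrid

/-! ### The bigraded module and the filtration -/

namespace SingularGrid

variable {G : SingularGrid} {A : G.WindingArcs}

/-- Variant of `DirectSum.isInternal_submodule_of_iSupIndep_of_iSup_eq_top` which does not ask the
structure of a commutative monoid to come from a given structure of a group. -/
theorem isInternal_of_iSupIndep_of_iSup_eq_top {R M ι : Type*} [Ring R] [AddCommMonoid M]
    [Module R M] [DecidableEq ι] {p : ι → Submodule R M} (h : iSupIndep p) (h' : iSup p = ⊤) :
    DirectSum.IsInternal p := by
  let := Module.addCommMonoidToAddCommGroup R (M := M)
  exact DirectSum.isInternal_submodule_of_iSupIndep_of_iSup_eq_top h h'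

/-- The coefficient of the product of a generator and a monomial in an element of `CV⁻(G)`. -/
def monomialCoeff (x : G.Gen) (e : G.Decor .O →₀ ℕ) : G.CV →ₗ[ℤ] ℤ where
  toFun z := MvPolynomial.coeff e ((z x.1 : G.CMinus x.1) x.2)
  map_add' z w := by
    rw [DirectSum.add_apply, Finsupp.add_apply, MvPolynomial.coeff_add]
  map_smul' c z := by
    rw [DirectSum.smul_apply, Finsupp.smul_apply, MvPolynomial.coeff_smul]
    rfl

theorem eq_zero_of_monomialCoeff {z : G.CV} (h : ∀ x e, monomialCoeff x e z = 0) : z = 0 := by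
  refine DFinsupp.ext fun I => Finsupp.ext fun x => MvPolynomial.ext _ _ fun e => ?_
  exact (h (I, x) e).trans (MvPolynomial.coeff_zero e).symm

theorem monomialCoeff_eq_zero_of_ne {x y : G.Gen} {e e' : G.Decor .O →₀ ℕ}
    (h : ¬ (x = y ∧ e = e')) :
    monomialCoeff x e ((MvPolynomial.monomial e' (1 : ℤ) : G.Coeff) • G.gen y) = 0 := by
  classical
  obtain ⟨I, x⟩ := x
  obtain ⟨J, y⟩ := y
  change MvPolynomial.coeff e ((((MvPolynomial.monomial e' (1 : ℤ) : G.Coeff) •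
    G.gen (J, y)) I : G.CMinus I) x) = 0
  rw [DirectSum.smul_apply, Finsupp.smul_apply, gen, smul_eq_mul]
  dsimp only
  by_cases hI : J = I
  · subst hI
    rw [DirectSum.lof_apply, Finsupp.single_apply]
    split_ifs with hx
    · subst hx
      rw [mul_one, MvPolynomial.coeff_monomial, if_neg]
      exact fun he => h ⟨rfl, he.symm⟩
    · rw [mul_zero, MvPolynomial.coeff_zero]
  · rw [DirectSum.lof_eq_of, DirectSum.of_eq_of_ne _ _ _ (Ne.symm hI), Finsupp.zero_apply, mul_zero,
      MvPolynomial.coeff_zero]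

theorem monomialCoeff_eq_zero {d : ℤ × ℤ} {z : G.CV} (hz : z ∈ G.bigradedPart d) {x : G.Gen}
    {e : G.Decor .O →₀ ℕ}
    (h : ¬ (G.maslov x - 2 * (e.degree : ℚ) = d.1 ∧ G.alexander x - (e.degree : ℚ) = d.2)) :
    monomialCoeff x e z = 0 := by
  induction hz using Submodule.span_induction with
  | mem z hz =>
    obtain ⟨y, e', rfl, hy⟩ := hz
    refine monomialCoeff_eq_zero_of_ne ?_
    rintro ⟨rfl, rfl⟩
    exact h hy
  | zero => exact map_zero _
  | add z w _ _ hz hw => rw [map_add, hz, hw, add_zero]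
  | smul c z _ hz => rw [map_smul, hz, smul_zero]

theorem monomial_smul_gen_mem {x : G.Gen} {e : G.Decor .O →₀ ℕ} {m a : ℤ}
    (hm : G.maslov x - 2 * (e.degree : ℚ) = m) (ha : G.alexander x - (e.degree : ℚ) = a) :
    (MvPolynomial.monomial e (1 : ℤ) : G.Coeff) • G.gen x ∈ G.bigradedPart (m, a) :=
  Submodule.subset_span ⟨x, e, rfl, hm, ha⟩

variable (G) in
theorem iSupIndep_bigradedPart : iSupIndep G.bigradedPart := by
  intro d
  rw [Submodule.disjoint_def]
  intro z hz hz'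
  refine eq_zero_of_monomialCoeff fun x e => ?_
  by_cases h : G.maslov x - 2 * (e.degree : ℚ) = d.1 ∧ G.alexander x - (e.degree : ℚ) = d.2
  · have : (⨆ (j : ℤ × ℤ) (_ : j ≠ d), G.bigradedPart j) ≤ LinearMap.ker (monomialCoeff x e) := by
      refine iSup₂_le fun j hj w hw => monomialCoeff_eq_zero hw fun h' => hj (Prod.ext ?_ ?_)
      · exact_mod_cast h'.1.symm.trans h.1
      · exact_mod_cast h'.2.symm.trans h.2
    exact this hz'
  · exact monomialCoeff_eq_zero hz h

variable (G) in
theorem iSup_bigradedPart : (⨆ d, G.bigradedPart d) = ⊤ := by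
  classical
  refine (Submodule.eq_top_iff').2 fun z => ?_
  induction z using DirectSum.induction_on with
  | zero => exact Submodule.zero_mem _
  | add z w hz hw => exact Submodule.add_mem _ hz hw
  | of I f =>
    induction f using Finsupp.induction_linear with
    | zero => rw [map_zero]; exact Submodule.zero_mem _
    | add f g hf hg => rw [map_add]; exact Submodule.add_mem _ hf hg
    | single x p =>
      have h1 : DirectSum.of G.CMinus I (Finsupp.single x p) = p • G.gen (I, x) := by
        rw [gen, ← map_smul, Finsupp.smul_single, smul_eq_mul, mul_one]
        rfl
      rw [h1]
      clear h1
      induction p using MvPolynomial.induction_on' with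
      | add p q hp hq =>
        rw [add_smul]
        exact Submodule.add_mem _ hp hq
      | monomial e c =>
        obtain ⟨a, ha⟩ := exists_alexander_eq (I, x)
        have h2 : (MvPolynomial.monomial e c : G.Coeff) • G.gen (I, x) =
            c • ((MvPolynomial.monomial e (1 : ℤ) : G.Coeff) • G.gen (I, x)) := by
          rw [← smul_assoc, MvPolynomial.smul_monomial, smul_eq_mul, mul_one]
        rw [h2]
        refine Submodule.smul_mem _ _ (Submodule.mem_iSup_of_mem
          (markMaslov .O (I, x) - G.numOnes I - 2 * (e.degree : ℤ), a - (e.degree : ℤ))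
          (monomial_smul_gen_mem ?_ ?_))
        · rw [maslov_eq]; push_cast; ring
        · rw [ha]; push_cast; ring

variable (G) in
theorem isInternal_bigradedPart : DirectSum.IsInternal G.bigradedPart :=
  isInternal_of_iSupIndep_of_iSup_eq_top (iSupIndep_bigradedPart G) (iSup_bigradedPart G)

theorem X_smul_mem (o : G.Decor .O) {m a : ℤ} {z : G.CV} (hz : z ∈ G.bigradedPart (m, a)) :
    (MvPolynomial.X o : G.Coeff) • z ∈ G.bigradedPart (m - 2, a - 1) := by
  induction hz using Submodule.span_induction with
  | mem z hz =>
    obtain ⟨x, e, rfl, hm, ha⟩ := hz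
    rw [smul_smul, MvPolynomial.X, MvPolynomial.monomial_mul, one_mul]
    refine monomial_smul_gen_mem ?_ ?_
    · rw [map_add, Finsupp.degree_single]; push_cast; linear_combination hm
    · rw [map_add, Finsupp.degree_single]; push_cast; linear_combination ha
  | zero => rw [smul_zero]; exact Submodule.zero_mem _
  | add z w _ _ hz hw => rw [smul_add]; exact Submodule.add_mem _ hz hw
  | smul c z _ hz => rw [smul_comm]; exact Submodule.smul_mem _ _ hz

/-- The weight of a polygon is a monomial whose degree is the number of `O`s which it contains. -/
theorem Quad.exists_weight_eq (P : Peaks A) (π : G.Quad) : ∃ E : G.Decor .O →₀ ℕ,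
    π.weight P = MvPolynomial.monomial E 1 ∧
      (E.degree : ℤ) = ∑ q : G.Decor .O, ind (π.Contains P q.1) := by
  classical
  refine ⟨∑ o, if π.Contains P o.1 then Finsupp.single o 1 else 0, ?_, ?_⟩
  · rw [MvPolynomial.monomial_sum_one]
    refine Finset.prod_congr rfl fun o _ => ?_
    split_ifs
    · rfl
    · exact MvPolynomial.C_1.symm
  · rw [map_sum]
    push_cast
    refine Finset.sum_congr rfl fun o _ => ?_
    by_cases h : π.Contains P o.1 <;> simp [h]

theorem ind_nonneg (p : Prop) : 0 ≤ ind p := by by_cases h : p <;> simp [h]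

/-- The differential lowers the Maslov grading by one and does not raise the Alexander grading. -/
theorem differential_mem (P : Peaks A) (C : G.CompassConvention) (ε : G.SignAssignment) {m a : ℤ}
    {z : G.CV} (hz : z ∈ G.bigradedPart (m, a)) :
    differential P C ε z ∈ ⨆ (a' : ℤ) (_ : a' ≤ a), G.bigradedPart (m - 1, a') := by
  induction hz using Submodule.span_induction with
  | mem z hz =>
    obtain ⟨x, e, rfl, hm, ha⟩ := hz
    rw [map_smul, differential_gen, Finset.smul_sum]
    refine Submodule.sum_mem _ fun y _ => ?_
    rw [smul_smul, Finset.mul_sum, Finset.sum_smul]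
    refine Submodule.sum_mem _ fun p _ => ?_
    unfold Quad.coefficient
    split_ifs with h
    · obtain ⟨hπ, hE⟩ := h
      have hE := (Quad.isEmpty_iff hπ).1 hE
      have h1 := hπ.maslov_finish hE
      have h2 := hπ.alexander_finish hE
      obtain ⟨E, hw, hd⟩ := Quad.exists_weight_eq P ⟨x, y, p.1, p.2⟩
      have hX : 0 ≤ ∑ q : G.Decor .X, ind (Quad.Contains P ⟨x, y, p.1, p.2⟩ q.1) :=
        Finset.sum_nonneg fun q _ => ind_nonneg _
      rw [← hd] at h1 h2
      generalize ∑ q : G.Decor .X, ind (Quad.Contains P ⟨x, y, p.1, p.2⟩ q.1) = N at h2 hX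
      dsimp only at h1 h2
      have h3 : (((MvPolynomial.monomial e (1 : ℤ)) *
          ((((Quad.sign C ε ⟨x, y, p.1, p.2⟩ : ℤˣ) : ℤ) : G.Coeff) *
            Quad.weight P ⟨x, y, p.1, p.2⟩)) • G.gen y : G.CV) =
          ((Quad.sign C ε ⟨x, y, p.1, p.2⟩ : ℤˣ) : ℤ) •
            ((MvPolynomial.monomial (e + E) (1 : ℤ) : G.Coeff) • G.gen y) := by
        rw [hw, mul_left_comm, MvPolynomial.monomial_mul, one_mul, mul_smul, ← Int.smul_one_eq_cast,
          smul_assoc, one_smul]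
      rw [h3]
      refine Submodule.smul_mem _ _ (Submodule.mem_iSup_of_mem (a - N) (Submodule.mem_iSup_of_mem
        (by omega) (monomial_smul_gen_mem ?_ ?_)))
      · rw [h1, map_add]; push_cast; linear_combination hm
      · rw [h2, map_add]; push_cast; linear_combination ha
    · rw [mul_zero, zero_smul]
      exact Submodule.zero_mem _
  | zero => rw [map_zero]; exact Submodule.zero_mem _
  | add z w _ _ hz hw => rw [map_add]; exact Submodule.add_mem _ hz hw
  | smul c z _ hz =>
    rw [LinearMap.map_smul_of_tower]
    exact Submodule.smul_mem _ _ hz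

theorem differential_mem_maslovPart (P : Peaks A) (C : G.CompassConvention) (ε : G.SignAssignment)
    {m : ℤ} {z : G.CV} (hz : z ∈ G.maslovPart m) :
    differential P C ε z ∈ G.maslovPart (m - 1) := by
  have h : G.maslovPart m ≤ (G.maslovPart (m - 1)).comap
      ((differential P C ε).restrictScalars ℤ) := by
    refine iSup_le fun a w hw => ?_
    have h1 : (⨆ (a' : ℤ) (_ : a' ≤ a), G.bigradedPart (m - 1, a')) ≤ G.maslovPart (m - 1) :=
      iSup₂_le fun a' _ => le_iSup (fun a => G.bigradedPart (m - 1, a)) a'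
    exact h1 (differential_mem P C ε hw)
  exact h hz

theorem differential_mem_alexanderFiltration (P : Peaks A) (C : G.CompassConvention)
    (ε : G.SignAssignment) {a : ℤ} {z : G.CV} (hz : z ∈ G.alexanderFiltration a) :
    differential P C ε z ∈ G.alexanderFiltration a := by
  have h : G.alexanderFiltration a ≤ (G.alexanderFiltration a).comap
      ((differential P C ε).restrictScalars ℤ) := by
    refine iSup_le fun m => iSup₂_le fun a' ha' w hw => ?_
    have h1 : (⨆ (b : ℤ) (_ : b ≤ a'), G.bigradedPart (m - 1, b)) ≤ G.alexanderFiltration a :=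
      iSup₂_le fun b hb => le_iSup_of_le (m - 1) (le_iSup₂_of_le b (hb.trans ha') le_rfl)
    exact h1 (differential_mem P C ε hw)
  exact h hz

end SingularGrid

end

theorem mainTheorem4 (G : SingularGrid) (A : G.WindingArcs) (P : SingularGrid.Peaks A)
    (C : G.CompassConvention) (ε : G.SignAssignment) :
    DirectSum.IsInternal G.bigradedPart ∧
    (∀ (o : G.Decor Mark.O) (m a : ℤ), ∀ z ∈ G.bigradedPart (m, a),
      (MvPolynomial.X o : G.Coeff) • z ∈ G.bigradedPart (m - 2, a - 1)) ∧
    SingularGrid.differential P C ε ∘ₗ SingularGrid.differential P C ε = 0 ∧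
    (∀ m : ℤ, ∀ z ∈ G.maslovPart m, SingularGrid.differential P C ε z ∈ G.maslovPart (m - 1)) ∧
    (∀ a : ℤ, ∀ z ∈ G.alexanderFiltration a,
      SingularGrid.differential P C ε z ∈ G.alexanderFiltration a) := by
  exact ⟨SingularGrid.isInternal_bigradedPart G, fun o _ _ _ hz => SingularGrid.X_smul_mem o hz,
    SingularGrid.differential_comp_differential P C ε,
    fun _ _ hz => SingularGrid.differential_mem_maslovPart P C ε hz,
    fun _ _ hz => SingularGrid.differential_mem_alexanderFiltration P C ε hz⟩
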